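/- **Conventions.** $\kappa$ is the security parameter. A function $\varepsilon(\kappa)$ is negligible if $\kappa^n\varepsilon(\kappa)\to 0$ for every $n$. Adversaries are non-uniform probabilistic polynomial-time oracle algorithms, i.e. families of polynomial-size Boolean circuits with coin flips and oracle gates. A family $F=(F_\kappa)$, $F_\kappa:\{0,1\}^{l_k}\times\{0,1\}^{l_d}\to\{0,1\}^{l_r}$, is a *PRF family* if it is computed by polynomial-size circuits and no adversary distinguishes oracle access to $F_\kappa(k,\cdot)$, $k$ uniform, from oracle access to a uniformly random function $\{0,1\}^{l_d}\to\{0,1\}^{l_r}$ with non-negligible advantage. **The system $\mathit{MA}=(R,\mathcal T,\mathsf{Setup},\pi)$.** Let $l,l_k,l_d,l_p,l_v,l_r,l_u$ be polynomially bounded functions of $\kappa$ with $l_r+l_p=l_d=l_u+l_r+l_v$, and let $pad\in\{0,1\}^{l_p}$ be fixed for each $\kappa$. There are one reader $R$ and tags $T_1,\dots,T_l$. Tag $T_i$ holds a uniform key $k_i\in\{0,1\}^{l_k}$ and a counter $ctr_i\in\{0,1\}^{l_r}$, initially $1$ (counters are incremented modulo $2^{l_r}$). $R$'s database holds for each $i$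 the record $(I_i,k_i,ctr_i,ID_i)$, where initially $I_i=F_{k_i}(ctr_i\|pad)$. A session of $\pi$ is: 1. $R$ sends a uniform $c_1=r_R\in\{0,1\}^{l_u}$. 2. $T_i$ chooses a uniform $r_T\in\{0,1\}^{l_v}$, sends $\alpha_1=(\alpha_{11},\alpha_{12},\alpha_{13})$ with $\alpha_{11}=F_{k_i}(ctr_i\|pad)$, $\alpha_{12}=r_T$, $\alpha_{13}=F_{k_i}(c_1\|\alpha_{11}\|\alpha_{12})\oplus ctr_i$, and increments $ctr_i$. 3. $R$ looks for the first record with $I=\alpha_{11}$ and $ctr=F_k(r_R\|\alpha_{11}\|\alpha_{12})\oplus\alpha_{13}$ and, if there is none, for the first record with $\alpha_{11}=F_k(ctr'\|pad)$, where $ctr'=F_k(r_R\|\alpha_{11}\|\alpha_{12})\oplus\alpha_{13}$. If no record is found, $R$ outputs $o_R=0$. Otherwise $R$ identifies the tag of this record, replaces its counter by $ctr+1$ (resp. $ctr'+1$) and its index by $I=F_k(ctr\|pad)$ for the new counter $ctr$, sends $c_2=F_k(r_R\|ctr\|\alpha_{12})$, and outputs $o_R=1$. 4. $T_i$ outputs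 $o_{T_i}=1$ if $c_2=F_{k_i}(c_1\|ctr_i\|r_T)$, and $o_{T_i}=0$ otherwise. **Attacks.** After $\mathsf{Setup}$ the adversary, which knows all public parameters, may adaptively: open sessions of $R$ (receiving $c_1$); send $c_1$ to a tag (receiving $\alpha_1$; a session the tag was still running is abandoned); send $\alpha_1$ to an open session of $R$ (receiving $o_R$, and $c_2$ if $o_R=1$); send $c_2$ to a tag that is waiting for it (receiving $o_{T_i}$); corrupt a tag (receiving its complete internal state). Sessions of $R$ may run concurrently; each tag runs its sessions one after another. * *Adaptive completeness*: for every adversary that attacks the system and then names a tag, the probability that this tag is uncorrupted but $o_R=o_{T_i}=1$ fails in a subsequent undisturbed session between it and $R$ is negligible. * *Mutual authentication*: for every adversary, the probabilities of the following two events are negligible. (1) $R$ accepts ($o_R=1$) and identifies a tag $T_i$ that is uncorrupted at that moment, but $T_i$ has had no session with the same $(c_1,\alpha_1)$. (2) A tag $T_i$ that is uncorrupted at that moment accepts ($o_{T_i}=1$), but $R$ has had no session with the same $(c_1,\alpha_1,c_2)$ in which it accepted and identified $T_i$. * *unp$^\#$-privacy*: an adversary $A_1$ attacks the system and names a challenge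 tag $T_c$; if $T_c$ does not exist or is corrupted, the result is $0$. Then $A_2$ continues from the final state of $A_1$, may not corrupt $T_c$, and outputs a bit, which is the result. If $b=1$, $A_2$ faces the real system. If $b=0$, the record of $T_c$ is deleted from the database and: every $\alpha_1$ sent by $T_c$ is a uniformly random string; when $R$, in a session begun with $c_1$, receives an $\alpha_1$ such that $T_c$ has ever had a session with the same $(c_1,\alpha_1)$, it outputs $o_R=1$ as acceptance of $T_c$ and sends a uniformly random $c_2$; $T_c$ outputs $1$ on $c_2$ if and only if $R$ has had a session with the same $(c_1,\alpha_1,c_2)$ in which it accepted $T_c$; everything else is as in the real system. For all $(A_1,A_2)$, the probabilities of result $1$ for $b=1$ and for $b=0$ differ by a negligible amount. **Theorem.** Suppose that $2^{-l_r}$, $2^{-l_u}$ and $2^{-l_v}$ are negligible in $\kappa$. If $F$ is a PRF family, then the RFID system $\mathit{MA}=(R,\mathcal T,\mathsf{Setup},\pi)$ satisfies adaptive completeness, mutual authentication, and unp$^\#$-privacy. -/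

import Mathlib

noncomputable section

namespace RFID

/-! Asymptotics -/

/-- A sequence of naturals that is bounded by a polynomial in the security parameter. -/
def PolyBounded (f : ℕ → ℕ) : Prop :=
  ∃ p : Polynomial ℕ, ∀ κ, f κ ≤ p.eval κ

/-- Negligible: smaller than every inverse polynomial in the security parameter. -/
def Negligible (ε : ℕ → ℝ) : Prop :=
  Asymptotics.SuperpolynomialDecay Filter.atTop (fun κ : ℕ => (κ : ℝ)) ε

/-! The computation model: Boolean circuits over a memory of one-bit registers, with coin flips and
oracle gates. A family of polynomial-size circuits, one for each security parameter, is a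
non-uniform probabilistic polynomial-time oracle algorithm. -/

/-- One-bit registers, named by natural numbers. -/
abbrev Memory := ℕ → Bool

/-- A NAND gate that reads the registers `a`, `b` and writes the register `dst`. -/
structure Gate where
  dst : ℕ
  a : ℕ
  b : ℕ

def Gate.eval (g : Gate) (mem : Memory) : Memory :=
  Function.update mem g.dst (!(mem g.a && mem g.b))

/-- A set of oracles; a call to the oracle `p` sends one bit for each element of `In p` and
receives one bit for each element of `Out p`. -/
structure Interface where
  Port : Type
  In : Port → Type
  Out : Port → Type
  [fintypeIn : ∀ p, Fintype (In p)]
  [fintypeOut : ∀ p, Fintype (Out p)]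

attribute [instance] Interface.fintypeIn Interface.fintypeOut

inductive Instr (I : Interface) where
  | gate (g : Gate)
  | flip (dst : ℕ)
  | query (p : I.Port) (inp : I.In p → ℕ) (out : I.Out p ↪ ℕ)

/-- The cost of an instruction; an oracle call pays for every bit sent and received. -/
def Instr.cost {I : Interface} : Instr I → ℕ
  | .gate _ => 1
  | .flip _ => 1
  | .query p _ _ => 1 + Fintype.card (I.In p) + Fintype.card (I.Out p)

/-- A straight-line program, that is, a probabilistic oracle circuit. -/
abbrev Circuit (I : Interface) := List (Instr I)

def Circuit.size {I : Interface} (C : Circuit I) : ℕ := (C.map Instr.cost).sum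

/-- Stateful, probabilistic oracles with state space `σ`. -/
abbrev Oracle (I : Interface) (σ : Type) :=
  (p : I.Port) → (I.In p → Bool) → σ → PMF ((I.Out p → Bool) × σ)

def Instr.exec {I : Interface} {σ : Type} (O : Oracle I σ) :
    Instr I → Memory × σ → PMF (Memory × σ)
  | .gate g, (mem, s) => pure (g.eval mem, s)
  | .flip dst, (mem, s) => do
      let b ← PMF.uniformOfFintype Bool
      pure (Function.update mem dst b, s)
  | .query p inp out, (mem, s) => do
      let (ans, s') ← O p (fun i => mem (inp i)) s
      pure (Function.extend out ans mem, s')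

def Circuit.run {I : Interface} {σ : Type} (O : Oracle I σ) :
    Circuit I → Memory × σ → PMF (Memory × σ)
  | [], x => pure x
  | i :: C, x => do
      let y ← i.exec O x
      Circuit.run O C y

/-- All registers are initially zero. -/
def blank : Memory := fun _ => false

/-- The element addressed by a one-hot (more generally: by a first-one) selector. -/
def select {n : ℕ} (f : Fin n → Bool) : Option (Fin n) := (List.finRange n).find? f

/-- The bit string carried by a bundle of wires (least significant bit first). -/
def ofWires {n : ℕ} (f : Fin n → Bool) : BitVec n := BitVec.ofFnLE f

/-- The uniform distribution on bit strings of length `n`. -/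
def uniformBits (n : ℕ) : PMF (BitVec n) :=
  (PMF.uniformOfFintype (Fin n → Bool)).map ofWires

/-! Pseudorandom functions -/

/-- The memory that holds a key in the registers `0, …, lk - 1` and an argument in the `ld`
registers after them. -/
def loadArgs {lk ld : ℕ} (k : BitVec lk) (x : BitVec ld) : Memory := fun r =>
  if r < lk then k.getLsbD r else x.getLsbD (r - lk)

/-- The family `F` is computed by polynomial-size (deterministic, oracle-free) Boolean circuits. -/
def EfficientlyComputable (lk ld lr : ℕ → ℕ)
    (F : ∀ κ, BitVec (lk κ) → BitVec (ld κ) → BitVec (lr κ)) : Prop :=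
  ∃ (C : ℕ → List Gate) (out : ∀ κ, Fin (lr κ) → ℕ),
    PolyBounded (fun κ => (C κ).length) ∧
    ∀ κ k x, ofWires (fun j =>
      ((C κ).foldl (fun mem g => g.eval mem) (loadArgs k x)) (out κ j)) = F κ k x

/-- Access to one function from `ld`-bit strings to `lr`-bit strings. -/
def funInterface (ld lr : ℕ) : Interface where
  Port := Unit
  In _ := Fin ld
  Out _ := Fin lr

def funOracle {ld lr : ℕ} (f : BitVec ld → BitVec lr) : Oracle (funInterface ld lr) Unit :=
  fun _ x s => pure ((fun j => (f (ofWires x)).getLsb j), s)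

/-- The distinguisher's output (register `0`) when it is given oracle access to `f`. -/
def distinguish {ld lr : ℕ} (D : Circuit (funInterface ld lr)) (f : BitVec ld → BitVec lr) :
    PMF Bool := do
  let (mem, _) ← D.run (funOracle f) (blank, ())
  pure (mem 0)

/-- Oracle `F_k` for a uniformly random key `k`. -/
def prfReal {lk ld lr : ℕ} (F : BitVec lk → BitVec ld → BitVec lr)
    (D : Circuit (funInterface ld lr)) : PMF Bool := do
  let k ← uniformBits lk
  distinguish D (F k)

/-- Oracle `f` for a uniformly random function `f`, given by the table of its values. -/
def prfIdeal {ld lr : ℕ} (D : Circuit (funInterface ld lr)) : PMF Bool := do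
  let table ← PMF.uniformOfFintype ((Fin ld → Bool) → (Fin lr → Bool))
  distinguish D (fun x => ofWires (table (fun i => x.getLsb i)))

/-- `F` is a PRF family. -/
def IsPRF (lk ld lr : ℕ → ℕ)
    (F : ∀ κ, BitVec (lk κ) → BitVec (ld κ) → BitVec (lr κ)) : Prop :=
  EfficientlyComputable lk ld lr F ∧
  ∀ D : ∀ κ, Circuit (funInterface (ld κ) (lr κ)), PolyBounded (fun κ => (D κ).size) →
    Negligible (fun κ =>
      |(prfReal (F κ) (D κ) true).toReal - (prfIdeal (D κ) true).toReal|)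

/-! RFID systems with three-round protocols -/

/-- An RFID system `(R, T, Setup, π)` at a fixed value of the security parameter, with one reader,
`numTags` tags and a protocol of the form `c₁` (reader to tag), `α₁` (tag to reader), `c₂` (reader
to tag). The reader's database holds at most one record for each tag. -/
structure RFIDSystem where
  numTags : ℕ
  lenC1 : ℕ
  lenA : ℕ
  lenC2 : ℕ
  lenState : ℕ
  TagState : Type
  Rec : Type
  /-- Initial database and initial states of the tags. -/
  setup : PMF ((Fin numTags → Option Rec) × (Fin numTags → TagState))
  /-- The first message `c₁`. -/
  readerStart : PMF (BitVec lenC1)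
  /-- The tag receives `c₁` and sends `α₁`. -/
  tagRespond : TagState → BitVec lenC1 → PMF (BitVec lenA × TagState)
  /-- The reader receives `α₁` in a session that it began with `c₁`. `none` means that it outputs
  `0`; `some (i, c₂)` means that it identifies tag `i`, sends `c₂` and outputs `1`. -/
  readerRespond : (Fin numTags → Option Rec) → BitVec lenC1 → BitVec lenA →
    PMF ((Fin numTags → Option Rec) × Option (Fin numTags × BitVec lenC2))
  /-- The tag receives `c₂` and outputs a bit. -/
  tagFinish : TagState → BitVec lenC2 → Bool × TagState
  /-- The encoding in which the state of a tag is handed to whoever corrupts the tag. -/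
  leak : TagState → BitVec lenState

/-- A session of the reader. -/
inductive ReaderSession (S : RFIDSystem) where
  | idle
  | waiting (c1 : BitVec S.lenC1)
  | rejected
  | accepted (c1 : BitVec S.lenC1) (α : BitVec S.lenA) (i : Fin S.numTags) (c2 : BitVec S.lenC2)

/-- The global state of an attack on `S` in which the reader runs at most `m` sessions.
`pending i` is the transcript of the session that tag `i` is currently running, `tagLog i` the list
of all transcripts `(c₁, α₁)` of its sessions, complete or not. The last two components record
violations of mutual authentication. -/
structure Game (S : RFIDSystem) (m : ℕ) where
  db : Fin S.numTags → Option S.Rec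
  tag : Fin S.numTags → S.TagState
  corrupted : Fin S.numTags → Bool
  pending : Fin S.numTags → Option (BitVec S.lenC1 × BitVec S.lenA)
  tagLog : Fin S.numTags → List (BitVec S.lenC1 × BitVec S.lenA)
  reader : Fin m → ReaderSession S
  tagImpersonated : Bool
  readerImpersonated : Bool

variable {S : RFIDSystem} {m : ℕ}

/-- Run `Setup`. -/
def Game.init (S : RFIDSystem) (m : ℕ) : PMF (Game S m) := do
  let (db, tag) ← S.setup
  pure { db := db, tag := tag, corrupted := fun _ => false, pending := fun _ => none,
         tagLog := fun _ => [], reader := fun _ => .idle,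
         tagImpersonated := false, readerImpersonated := false }

/-- The reader has a session with transcript `(c₁, α₁, c₂)` in which it accepted tag `i`. -/
def Game.ReaderMatches (g : Game S m) (i : Fin S.numTags)
    (c1 : BitVec S.lenC1) (α : BitVec S.lenA) (c2 : BitVec S.lenC2) : Prop :=
  ∃ s, g.reader s = .accepted c1 α i c2

/-- The oracles of the adversary. -/
inductive AttackPort where
  | initReader
  | startTag
  | sendReader
  | finishTag
  | corrupt

/-- Reader sessions and tags are addressed by selectors. An answer of the reader to `α₁` consists of
`c₂` and its output bit, and the answer of a tag to `c₂` is its output bit. -/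
def attackInterface (S : RFIDSystem) (m : ℕ) : Interface where
  Port := AttackPort
  In
    | .initReader => Fin m
    | .startTag => Fin S.numTags ⊕ Fin S.lenC1
    | .sendReader => Fin m ⊕ Fin S.lenA
    | .finishTag => Fin S.numTags ⊕ Fin S.lenC2
    | .corrupt => Fin S.numTags
  Out
    | .initReader => Fin S.lenC1
    | .startTag => Fin S.lenA
    | .sendReader => Fin S.lenC2 ⊕ Unit
    | .finishTag => Unit
    | .corrupt => Fin S.lenState
  fintypeIn p := by cases p <;> infer_instance
  fintypeOut p := by cases p <;> infer_instance

/-- Open the reader session `s`; nothing happens if it has been opened before. -/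
def Game.initReader (s : Fin m) (g : Game S m) : PMF (BitVec S.lenC1 × Game S m) :=
  match g.reader s with
  | .idle => do
      let c1 ← S.readerStart
      pure (c1, { g with reader := Function.update g.reader s (.waiting c1) })
  | _ => pure (0, g)

/-- Record that tag `i` has begun a session with transcript `(c₁, α₁)`; a session that it was
running is abandoned. -/
def Game.beginTag (i : Fin S.numTags) (c1 : BitVec S.lenC1) (α : BitVec S.lenA)
    (g : Game S m) : Game S m :=
  { g with pending := Function.update g.pending i (some (c1, α))
           tagLog := Function.update g.tagLog i ((c1, α) :: g.tagLog i) }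

/-- Send `c₁` to tag `i`. -/
def Game.startTag (i : Fin S.numTags) (c1 : BitVec S.lenC1) (g : Game S m) :
    PMF (BitVec S.lenA × Game S m) := do
  let (α, st) ← S.tagRespond (g.tag i) c1
  pure (α, { g.beginTag i c1 α with tag := Function.update g.tag i st })

open Classical in
/-- Send `α₁` to the reader session `s`; only a session that is waiting for it reacts. The reader is
fooled if it accepts an uncorrupted tag that has no session with the same transcript. -/
def Game.sendReader (s : Fin m) (α : BitVec S.lenA) (g : Game S m) :
    PMF ((BitVec S.lenC2 × Bool) × Game S m) :=
  match g.reader s with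
  | .waiting c1 => do
      let (db, res) ← S.readerRespond g.db c1 α
      match res with
      | none => pure ((0, false), { g with
          db := db, reader := Function.update g.reader s .rejected })
      | some (i, c2) => pure ((c2, true), { g with
          db := db
          reader := Function.update g.reader s (.accepted c1 α i c2)
          tagImpersonated := g.tagImpersonated ||
            decide (g.corrupted i = false ∧ (c1, α) ∉ g.tagLog i) })
  | _ => pure ((0, false), g)

open Classical in
/-- Send `c₂` to tag `i`; only a tag that is waiting for it reacts. An uncorrupted tag is fooled if
it accepts while the reader has no session with the same transcript in which it accepted this
tag. -/
def Game.finishTag (i : Fin S.numTags) (c2 : BitVec S.lenC2) (g : Game S m) :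
    PMF (Bool × Game S m) :=
  match g.pending i with
  | some (c1, α) =>
      let (o, st) := S.tagFinish (g.tag i) c2
      pure (o, { g with
        tag := Function.update g.tag i st
        pending := Function.update g.pending i none
        readerImpersonated := g.readerImpersonated ||
          decide (o = true ∧ g.corrupted i = false ∧ ¬ g.ReaderMatches i c1 α c2) })
  | none => pure (false, g)

/-- Corrupt tag `i`: its complete state is revealed. -/
def Game.corrupt (i : Fin S.numTags) (g : Game S m) : PMF (BitVec S.lenState × Game S m) :=
  pure (S.leak (g.tag i), { g with corrupted := Function.update g.corrupted i true })

/-- The behaviour of the five oracles on decoded calls. -/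
structure Handlers (S : RFIDSystem) (m : ℕ) where
  initReader : Fin m → Game S m → PMF (BitVec S.lenC1 × Game S m)
  startTag : Fin S.numTags → BitVec S.lenC1 → Game S m → PMF (BitVec S.lenA × Game S m)
  sendReader : Fin m → BitVec S.lenA → Game S m → PMF ((BitVec S.lenC2 × Bool) × Game S m)
  finishTag : Fin S.numTags → BitVec S.lenC2 → Game S m → PMF (Bool × Game S m)
  corrupt : Fin S.numTags → Game S m → PMF (BitVec S.lenState × Game S m)

/-- Decode calls and encode answers. A call that addresses nothing is answered by zeros. -/
def Handlers.oracle (H : Handlers S m) : Oracle (attackInterface S m) (Game S m)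
  | .initReader, x, g =>
      match select x with
      | some s => do
          let (c1, g') ← H.initReader s g
          pure ((fun j => c1.getLsb j), g')
      | none => pure ((fun _ => false), g)
  | .startTag, x, g =>
      match select (fun i => x (.inl i)) with
      | some i => do
          let (α, g') ← H.startTag i (ofWires (fun j => x (.inr j))) g
          pure ((fun j => α.getLsb j), g')
      | none => pure ((fun _ => false), g)
  | .sendReader, x, g =>
      match select (fun i => x (.inl i)) with
      | some s => do
          let ((c2, o), g') ← H.sendReader s (ofWires (fun j => x (.inr j))) g
          pure (Sum.elim (fun j => c2.getLsb j) (fun _ => o), g')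
      | none => pure ((fun _ => false), g)
  | .finishTag, x, g =>
      match select (fun i => x (.inl i)) with
      | some i => do
          let (o, g') ← H.finishTag i (ofWires (fun j => x (.inr j))) g
          pure ((fun _ => o), g')
      | none => pure ((fun _ => false), g)
  | .corrupt, x, g =>
      match select x with
      | some i => do
          let (st, g') ← H.corrupt i g
          pure ((fun j => st.getLsb j), g')
      | none => pure ((fun _ => false), g)

/-- The real system. -/
def realHandlers (S : RFIDSystem) (m : ℕ) : Handlers S m where
  initReader := Game.initReader
  startTag := Game.startTag
  sendReader := Game.sendReader
  finishTag := Game.finishTag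
  corrupt := Game.corrupt

/-- The adversary's circuit, attacking the real system. -/
abbrev Attack (S : RFIDSystem) (m : ℕ) := Circuit (attackInterface S m)

/-- The tag named by the registers `0, …, numTags - 1` at the end of a run. -/
def chosenTag (S : RFIDSystem) (mem : Memory) : Option (Fin S.numTags) :=
  select (fun i => mem i)

/-! Adaptive completeness -/

/-- An undisturbed session between the reader and tag `i`; the result is `true` if both output
`1`. -/
def Game.honestRun (g : Game S m) (i : Fin S.numTags) : PMF Bool := do
  let c1 ← S.readerStart
  let (α, st) ← S.tagRespond (g.tag i) c1
  let (_, res) ← S.readerRespond g.db c1 α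
  match res with
  | none => pure false
  | some (_, c2) => pure (S.tagFinish st c2).1

/-- The adversary attacks the system and then names a tag. The result is `true` if this tag is
uncorrupted and fails to complete an undisturbed session with the reader. -/
def completenessExp (S : RFIDSystem) (m : ℕ) (A : Attack S m) : PMF Bool := do
  let g₀ ← Game.init S m
  let (mem, g) ← A.run (realHandlers S m).oracle (blank, g₀)
  match chosenTag S mem with
  | none => pure false
  | some i => do
      let ok ← g.honestRun i
      pure (!g.corrupted i && !ok)

def AdaptivelyComplete (S : ℕ → RFIDSystem) : Prop :=
  ∀ (m : ℕ → ℕ) (A : ∀ κ, Attack (S κ) (m κ)),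
    PolyBounded m → PolyBounded (fun κ => (A κ).size) →
    Negligible (fun κ => (completenessExp (S κ) (m κ) (A κ) true).toReal)

/-! Mutual authentication -/

/-- The result is a pair of bits: whether the reader, respectively a tag, was fooled. -/
def authExp (S : RFIDSystem) (m : ℕ) (A : Attack S m) : PMF (Bool × Bool) := do
  let g₀ ← Game.init S m
  let (_, g) ← A.run (realHandlers S m).oracle (blank, g₀)
  pure (g.tagImpersonated, g.readerImpersonated)

/-- Neither tags nor the reader can be impersonated. -/
def MutuallyAuthenticating (S : ℕ → RFIDSystem) : Prop :=
  ∀ (m : ℕ → ℕ) (A : ∀ κ, Attack (S κ) (m κ)),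
    PolyBounded m → PolyBounded (fun κ => (A κ).size) →
    Negligible (fun κ => (((authExp (S κ) (m κ) (A κ)).map Prod.fst) true).toReal) ∧
    Negligible (fun κ => (((authExp (S κ) (m κ) (A κ)).map Prod.snd) true).toReal)

/-! Privacy -/

/-- The challenge tag can no longer be corrupted. -/
def corruptExcept (c : Fin S.numTags) (i : Fin S.numTags) (g : Game S m) :
    PMF (BitVec S.lenState × Game S m) :=
  if i = c then pure (0, g) else g.corrupt i

/-- The real world of the guessing stage with challenge tag `c`. -/
def realChallenge (S : RFIDSystem) (m : ℕ) (c : Fin S.numTags) : Handlers S m :=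
  { realHandlers S m with corrupt := corruptExcept c }

open Classical in
/-- The random world of the guessing stage with challenge tag `c`. Messages of `c` are uniformly
random. The reader accepts a message in the name of `c` exactly if it has the same transcript as a
session of `c`, and answers it by a uniformly random `c₂`. Tag `c` accepts `c₂` exactly if the reader
has a session with the same transcript in which it accepted `c`. Everything else is as in the
real world. -/
def randomChallenge (S : RFIDSystem) (m : ℕ) (c : Fin S.numTags) : Handlers S m where
  initReader := Game.initReader
  startTag i c1 g :=
    if i = c then do
      let α ← uniformBits S.lenA
      pure (α, g.beginTag c c1 α)
    else g.startTag i c1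
  sendReader s α g :=
    match g.reader s with
    | .waiting c1 =>
        if (c1, α) ∈ g.tagLog c then do
          let c2 ← uniformBits S.lenC2
          pure ((c2, true),
            { g with reader := Function.update g.reader s (.accepted c1 α c c2) })
        else g.sendReader s α
    | _ => pure ((0, false), g)
  finishTag i c2 g :=
    if i = c then
      match g.pending c with
      | some (c1, α) =>
          pure (decide (g.ReaderMatches c c1 α c2),
            { g with pending := Function.update g.pending c none })
      | none => pure (false, g)
    else g.finishTag i c2
  corrupt := corruptExcept c

/-- Delete the record of tag `c` from the database. -/
def Game.forget (g : Game S m) (c : Fin S.numTags) : Game S m :=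
  { g with db := Function.update g.db c none }

/-- The privacy experiment with hidden bit `b`. In the learning stage `A₁` attacks the real system
and names a challenge tag. In the guessing stage `A₂`, continuing with the memory of `A₁`, faces the
real world if `b = 1` and the random world, where the secrets of the challenge tag are no longer
used, if `b = 0`. The result is the guess of `A₂` (register `0`), or `0` if no uncorrupted tag was
named. -/
def unpExp (S : RFIDSystem) (m : ℕ) (A₁ A₂ : Attack S m) (b : Bool) : PMF Bool := do
  let g₀ ← Game.init S m
  let (mem, g) ← A₁.run (realHandlers S m).oracle (blank, g₀)
  match chosenTag S mem with
  | none => pure false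
  | some c =>
      if g.corrupted c then pure false
      else do
        let (mem', _) ← if b
          then A₂.run (realChallenge S m c).oracle (mem, g)
          else A₂.run (randomChallenge S m c).oracle (mem, g.forget c)
        pure (mem' 0)

/-- Unp#-privacy. -/
def UnpSharpPrivate (S : ℕ → RFIDSystem) : Prop :=
  ∀ (m : ℕ → ℕ) (A₁ A₂ : ∀ κ, Attack (S κ) (m κ)),
    PolyBounded m → PolyBounded (fun κ => (A₁ κ).size) → PolyBounded (fun κ => (A₂ κ).size) →
    Negligible (fun κ =>
      |(unpExp (S κ) (m κ) (A₁ κ) (A₂ κ) true true).toReal -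
        (unpExp (S κ) (m κ) (A₁ κ) (A₂ κ) false true).toReal|)

/-! The refined mutual authentication system -/

/-- The state of a tag: secret key, counter, and the values `c₁`, `r_T` of its latest session. -/
structure MATag (lk lv lr lu : ℕ) where
  key : BitVec lk
  ctr : BitVec lr
  c1 : BitVec lu
  rT : BitVec lv

/-- The reader's record of a tag; the identity of the tag is the position of the record. -/
structure MARec (lk lr : ℕ) where
  index : BitVec lr
  key : BitVec lk
  ctr : BitVec lr

/-- The system `MA` for a function `F` with key length `lk`, input length `ld = lr + lp =
lu + lr + lv` and output length `lr`. Counters are incremented modulo `2 ^ lr`, and a search of the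
database returns the first hit. -/
def MA (l lk ld lp lv lr lu : ℕ) (hp : lr + lp = ld) (hm : lu + lr + lv = ld)
    (pad : BitVec lp) (F : BitVec lk → BitVec ld → BitVec lr) : RFIDSystem :=
  let index (k : BitVec lk) (ctr : BitVec lr) : BitVec lr := F k ((ctr ++ pad).cast hp)
  let mac (k : BitVec lk) (c1 : BitVec lu) (x : BitVec lr) (r : BitVec lv) : BitVec lr :=
    F k ((c1 ++ x ++ r).cast hm)
  { numTags := l
    lenC1 := lu
    lenA := lr + lv + lr
    lenC2 := lr
    lenState := lk + lr + lu + lv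
    TagState := MATag lk lv lr lu
    Rec := MARec lk lr
    setup := do
      let keys ← PMF.uniformOfFintype (Fin l → Fin lk → Bool)
      let key (i : Fin l) : BitVec lk := ofWires (keys i)
      let ctr : BitVec lr := BitVec.ofNat lr 1
      pure (fun i => some { index := index (key i) ctr, key := key i, ctr := ctr },
            fun i => { key := key i, ctr := ctr, c1 := 0, rT := 0 })
    readerStart := uniformBits lu
    tagRespond := fun st c1 => do
      let rT ← uniformBits lv
      let α11 := index st.key st.ctr
      let α13 := mac st.key c1 α11 rT ^^^ st.ctr
      pure (α11 ++ rT ++ α13,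
        { key := st.key, ctr := st.ctr + BitVec.ofNat lr 1, c1 := c1, rT := rT })
    readerRespond := fun db rR α =>
      let α11 : BitVec lr := α.extractLsb' (lv + lr) lr
      let α12 : BitVec lv := α.extractLsb' lr lv
      let α13 : BitVec lr := α.extractLsb' 0 lr
      let received (rcd : MARec lk lr) : BitVec lr := mac rcd.key rR α11 α12 ^^^ α13
      let step1 (i : Fin l) : Option (Fin l × MARec lk lr) :=
        (db i).bind fun rcd =>
          if rcd.index = α11 ∧ rcd.ctr = received rcd then some (i, rcd) else none
      let step2 (i : Fin l) : Option (Fin l × MARec lk lr) :=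
        (db i).bind fun rcd =>
          if index rcd.key (received rcd) = α11 then some (i, rcd) else none
      -- In both steps the new counter is the successor of the received one, which equals the
      -- stored one in the first step.
      match ((List.finRange l).findSome? step1).or ((List.finRange l).findSome? step2) with
      | none => pure (db, none)
      | some (i, rcd) =>
          let ctr := received rcd + BitVec.ofNat lr 1
          pure (Function.update db i
              (some { index := index rcd.key ctr, key := rcd.key, ctr := ctr }),
            some (i, mac rcd.key rR ctr α12))
    tagFinish := fun st c2 => (decide (c2 = mac st.key st.c1 st.ctr st.rT), st)
    leak := fun st => st.key ++ st.ctr ++ st.c1 ++ st.rT }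

/-- The system `MA` as a family indexed by the security parameter. -/
def MAFamily (l lk ld lp lv lr lu : ℕ → ℕ)
    (hp : ∀ κ, lr κ + lp κ = ld κ) (hm : ∀ κ, lu κ + lr κ + lv κ = ld κ)
    (pad : ∀ κ, BitVec (lp κ))
    (F : ∀ κ, BitVec (lk κ) → BitVec (ld κ) → BitVec (lr κ)) (κ : ℕ) : RFIDSystem :=
  MA (l κ) (lk κ) (ld κ) (lp κ) (lv κ) (lr κ) (lu κ) (hp κ) (hm κ) (pad κ) (F κ)

end RFID

end

/-! Fix one tag `c` and replace `F_{k_c}` by a uniformly random function `f`. Consider `f` lazily: a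
value is drawn when it is first used. As long as the counter does not wrap, the nonces do not repeat
and none of them imitates the format of an index argument, each session of `c` evaluates `f` at two
new arguments. Hence `α₁ = (f(ctr‖pad), r_T, mask xor ctr)` is a uniform string, the mask acting as
a one-time pad. The answer `c₂` to such a session is another new value. Conversely, a message that
is not a transcript of `c` is attributed to `c` only if an unrevealed value of `f` is guessed, and
`c` accepts a `c₂` that the reader did not send only if another one is guessed. So, up to an error
polynomial in the number of calls times `2^{-l_r} + 2^{-l_u} + 2^{-l_v}`, the tag can be replaced by
an ideal one, which sends random messages and for which acceptance is decided by comparing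
transcripts. `near_run` is this statement for whole circuits. Its invariant `InvAt` lists the
revealed values; the single calls are treated in `near_initReader`, `near_startTag`,
`near_sendReader` and `near_finishTag`.

One point needs care: the other tags keep their functions `F_{k_j}`, about which nothing is assumed
in this step. That a message of `c` is not attributed to another tag therefore rests on the
randomness of its index alone (`expect_confusing`).

Mutual authentication: the frauds are counted for each tag separately. An ideal tag is never
involved in a fraud (`answer_ideal_clean`), so the probability of a fraud is at most the distance
between the two games (`fraud_le`). Privacy: the experiment is the sum over `c` of the experiments
in which `c` is chosen (`unpExp_eq`), and in each summand both values of `b` are compared with the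
game in which `c` is ideal in both stages (`near_tagExp`). Since a tag that has been corrupted no
longer counts, its corruption may be answered by zeros (`run_hidden`), and then its key is used only
through `F_{k_c}`.

The passage from `F_{k_c}` to `f` is a reduction to the PRF property. As algorithms are circuits, it
must be shown that the game can be run by a polynomial-size circuit with one oracle for the function
of `c`: its state is stored in registers, every bit of the next state is a small Boolean formula,
and the functions of the other tags are computed by the circuits for `F`. The result is
`exists_distinguisher`.

Adaptive completeness follows from privacy. Let the guessing stage be an undisturbed session with
the challenge tag, with failure as the guess. In the random world this session never fails, so the
advantage equals the probability that completeness is violated (`exists_unpExp`). -/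

noncomputable section

namespace RFID

open scoped ENNReal

/-! ### Expectations -/

/-- The expectation of a nonnegative function. -/
def expect {α : Type} (μ : PMF α) (g : α → ℝ≥0∞) : ℝ≥0∞ := ∑' a, μ a * g a

section Expect

variable {α β : Type}

theorem expect_pure (a : α) (g : α → ℝ≥0∞) : expect (pure a : PMF α) g = g a := by
  classical
  change ∑' b, PMF.pure a b * g b = g a
  rw [tsum_eq_single a]
  · simp
  · intro b hb
    simp [PMF.pure_apply, hb]

theorem expect_bind (μ : PMF α) (k : α → PMF β) (g : β → ℝ≥0∞) :
    expect (μ >>= k) g = expect μ (fun a => expect (k a) g) := by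
  change ∑' b, (μ.bind k) b * g b = ∑' a, μ a * ∑' b, k a b * g b
  simp only [PMF.bind_apply, ← ENNReal.tsum_mul_right, ← ENNReal.tsum_mul_left]
  rw [ENNReal.tsum_comm]
  simp only [mul_assoc]

theorem expect_map (f : α → β) (μ : PMF α) (g : β → ℝ≥0∞) :
    expect (μ.map f) g = expect μ (fun a => g (f a)) := by
  have h : μ.map f = (μ >>= fun a => (pure (f a) : PMF β)) := rfl
  rw [h, expect_bind]
  simp only [expect_pure]

theorem expect_congr (μ : PMF α) {g h : α → ℝ≥0∞} (H : ∀ a ∈ μ.support, g a = h a) :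
    expect μ g = expect μ h := by
  refine tsum_congr fun a => ?_
  by_cases ha : μ a = 0
  · simp [ha]
  · rw [H a ((PMF.mem_support_iff _ _).2 ha)]

theorem expect_mono_support (μ : PMF α) {g h : α → ℝ≥0∞} (H : ∀ a ∈ μ.support, g a ≤ h a) :
    expect μ g ≤ expect μ h := by
  refine ENNReal.tsum_le_tsum fun a => ?_
  by_cases ha : μ a = 0
  · simp [ha]
  · gcongr
    exact H a ((PMF.mem_support_iff _ _).2 ha)

theorem expect_mono (μ : PMF α) {g h : α → ℝ≥0∞} (H : ∀ a, g a ≤ h a) :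
    expect μ g ≤ expect μ h :=
  expect_mono_support μ fun a _ => H a

theorem expect_const (μ : PMF α) (c : ℝ≥0∞) : expect μ (fun _ => c) = c := by
  simp [expect, ENNReal.tsum_mul_right, μ.tsum_coe]

theorem expect_add (μ : PMF α) (g h : α → ℝ≥0∞) :
    expect μ (fun a => g a + h a) = expect μ g + expect μ h := by
  simp only [expect, mul_add, ENNReal.tsum_add]

theorem expect_finset_sum {ι : Type} (μ : PMF α) (s : Finset ι) (g : ι → α → ℝ≥0∞) :
    expect μ (fun a => ∑ i ∈ s, g i a) = ∑ i ∈ s, expect μ (g i) := by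
  classical
  induction s using Finset.induction_on with
  | empty => simp [expect_const]
  | insert i s hi ih => simp only [Finset.sum_insert hi, expect_add, ih]

theorem expect_le_one (μ : PMF α) {g : α → ℝ≥0∞} (H : ∀ a, g a ≤ 1) : expect μ g ≤ 1 :=
  (expect_mono μ H).trans (expect_const μ 1).le

theorem expect_comm (μ : PMF α) (ν : PMF β) (g : α → β → ℝ≥0∞) :
    expect μ (fun a => expect ν (g a)) = expect ν (fun b => expect μ (fun a => g a b)) := by
  simp only [expect, ← ENNReal.tsum_mul_left]
  rw [ENNReal.tsum_comm]
  simp only [mul_left_comm]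

/-- The indicator of truth. -/
def ind (b : Bool) : ℝ≥0∞ := if b then 1 else 0

@[simp] theorem ind_true : ind true = 1 := rfl
@[simp] theorem ind_false : ind false = 0 := rfl

theorem ind_le_one (b : Bool) : ind b ≤ 1 := by cases b <;> simp

theorem apply_true (μ : PMF Bool) : μ true = expect μ ind := by
  simp [expect]

theorem expect_uniform [Fintype α] [Nonempty α] (g : α → ℝ≥0∞) :
    expect (PMF.uniformOfFintype α) g = (Fintype.card α : ℝ≥0∞)⁻¹ * ∑ a, g a := by
  simp [expect, tsum_fintype, Finset.mul_sum]

theorem expect_uniform_equiv [Fintype α] [Nonempty α] [Fintype β] [Nonempty β] (e : α ≃ β)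
    (g : β → ℝ≥0∞) :
    expect (PMF.uniformOfFintype α) (fun a => g (e a)) = expect (PMF.uniformOfFintype β) g := by
  rw [expect_uniform, expect_uniform, Fintype.card_congr e, e.sum_comp]

theorem expect_uniform_prod [Fintype α] [Nonempty α] [Fintype β] [Nonempty β]
    (g : α × β → ℝ≥0∞) :
    expect (PMF.uniformOfFintype (α × β)) g =
      expect (PMF.uniformOfFintype α) (fun a =>
        expect (PMF.uniformOfFintype β) (fun b => g (a, b))) := by
  simp only [expect_uniform, Fintype.card_prod, Fintype.sum_prod_type, Nat.cast_mul]
  rw [← Finset.mul_sum, ← mul_assoc, ENNReal.mul_inv]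
  · simp
  · simp

/-- A uniform function stays uniform when one of its values is resampled. -/
theorem expect_uniform_update [Fintype α] [DecidableEq α] [Fintype β] [Nonempty β] (u : α)
    (g : (α → β) → ℝ≥0∞) :
    expect (PMF.uniformOfFintype (α → β)) g =
      expect (PMF.uniformOfFintype β) (fun b =>
        expect (PMF.uniformOfFintype (α → β)) (fun f => g (Function.update f u b))) := by
  have e := Equiv.funSplitAt u β
  have key : ∀ g : (α → β) → ℝ≥0∞, expect (PMF.uniformOfFintype (α → β)) g =
      expect (PMF.uniformOfFintype β) (fun b =>
        expect (PMF.uniformOfFintype ({a // a ≠ u} → β)) (fun f =>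
          g ((Equiv.funSplitAt u β).symm (b, f)))) := by
    intro g
    rw [← expect_uniform_equiv (Equiv.funSplitAt u β).symm, expect_uniform_prod]
  rw [key]
  congr 1
  funext b
  -- The value `b'` that the function had at `u` is overwritten, so the left side is averaged over
  -- it as a constant.
  rw [key, ← expect_const (PMF.uniformOfFintype β) (expect _ _)]
  congr 1
  funext b'
  congr 1
  funext f
  congr 1
  funext a
  by_cases h : a = u
  · subst h; simp
  · simp [h]

/-- The restriction of a uniform function along an injection is uniform. -/
theorem expect_uniform_comp {κ : Type} [Fintype α] [DecidableEq α] [Fintype κ] [DecidableEq κ] [Fintype β] [Nonempty β]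
    (e : κ → α) (he : Function.Injective e) (g : (κ → β) → ℝ≥0∞) :
    expect (PMF.uniformOfFintype (α → β)) (fun f => g (fun i => f (e i))) =
      expect (PMF.uniformOfFintype (κ → β)) g := by
  classical
  -- A function on `α` is the pair of its restrictions to the range of `e` and to the complement,
  -- and the integrand ignores the second.
  rw [← expect_uniform_equiv
    (Equiv.piEquivPiSubtypeProd (fun a => a ∈ Set.range e) (fun _ => β)).symm,
    expect_uniform_prod, ← expect_uniform_equiv (Equiv.arrowCongr (Equiv.ofInjective e he)
      (Equiv.refl β)).symm]
  congr 1
  funext f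
  rw [← expect_const (PMF.uniformOfFintype ({a // ¬ a ∈ Set.range e} → β)) (g _)]
  congr 1
  funext f'
  congr 1
  funext i
  simp [Equiv.piEquivPiSubtypeProd, Equiv.arrowCongr]

theorem ofWires_getLsb {n : ℕ} (x : BitVec n) : ofWires (fun j => x.getLsb j) = x := by
  apply BitVec.eq_of_getLsbD_eq
  intro i hi
  simp [ofWires, hi]

theorem getLsb_ofWires {n : ℕ} (f : Fin n → Bool) (j : Fin n) : (ofWires f).getLsb j = f j := by
  simp [ofWires]

/-- Bit strings as functions. -/
def wiresEquiv (n : ℕ) : (Fin n → Bool) ≃ BitVec n where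
  toFun := ofWires
  invFun x j := x.getLsb j
  left_inv f := by funext j; exact getLsb_ofWires f j
  right_inv := ofWires_getLsb

theorem expect_uniformBits (n : ℕ) (g : BitVec n → ℝ≥0∞) :
    expect (uniformBits n) g = expect (PMF.uniformOfFintype (BitVec n)) g := by
  rw [uniformBits, expect_map]
  exact expect_uniform_equiv (wiresEquiv n) g

theorem card_bitVec (n : ℕ) : Fintype.card (BitVec n) = 2 ^ n := by
  rw [← Fintype.card_congr (wiresEquiv n)]
  simp

end Expect

/-! ### Couplings -/

/-- The distributions `μ` and `ν` can be coupled along the relation `R`. -/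
def Coupled {α β : Type} (R : α → β → Prop) (μ : PMF α) (ν : PMF β) : Prop :=
  ∀ (Φ : α → ℝ≥0∞) (Ψ : β → ℝ≥0∞),
    ((∀ x y, R x y → Φ x ≤ Ψ y) → expect μ Φ ≤ expect ν Ψ) ∧
    ((∀ x y, R x y → Ψ y ≤ Φ x) → expect ν Ψ ≤ expect μ Φ)

namespace Coupled

variable {α β α' β' : Type} {R : α → β → Prop} {R' : α' → β' → Prop}

theorem pure {x : α} {y : β} (h : R x y) : Coupled R (pure x : PMF α) (pure y : PMF β) := by
  intro Φ Ψ
  simp only [expect_pure]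
  exact ⟨fun H => H _ _ h, fun H => H _ _ h⟩

/-- Since coupling is expressed by expectations of test functions, no joint distribution has to be
built: the expectations over the second experiments are themselves a pair of test functions for the
first ones. -/
theorem bind {μ : PMF α} {ν : PMF β} {k : α → PMF α'} {k' : β → PMF β'} (h : Coupled R μ ν)
    (hk : ∀ x y, R x y → Coupled R' (k x) (k' y)) : Coupled R' (μ >>= k) (ν >>= k') := by
  intro Φ Ψ
  simp only [expect_bind]
  exact ⟨fun H => (h _ _).1 fun x y hxy => (hk x y hxy Φ Ψ).1 H,
    fun H => (h _ _).2 fun x y hxy => (hk x y hxy Φ Ψ).2 H⟩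

theorem refl (μ : PMF α) : Coupled (fun x y => x = y) μ μ := by
  intro Φ Ψ
  exact ⟨fun H => expect_mono μ fun a => H a a rfl, fun H => expect_mono μ fun a => H a a rfl⟩

theorem bind_same {μ : PMF α} {k : α → PMF α'} {k' : α → PMF β'}
    (hk : ∀ x, Coupled R' (k x) (k' x)) : Coupled R' (μ >>= k) (μ >>= k') :=
  (refl μ).bind fun x y hxy => by subst hxy; exact hk x

theorem mono {S : α → β → Prop} {μ : PMF α} {ν : PMF β} (h : Coupled R μ ν)
    (hRS : ∀ x y, R x y → S x y) : Coupled S μ ν := by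
  intro Φ Ψ
  exact ⟨fun H => (h Φ Ψ).1 fun x y hxy => H x y (hRS x y hxy),
    fun H => (h Φ Ψ).2 fun x y hxy => H x y (hRS x y hxy)⟩

theorem expect_eq {μ : PMF α} {ν : PMF β} (h : Coupled R μ ν) {Φ : α → ℝ≥0∞} {Ψ : β → ℝ≥0∞}
    (H : ∀ x y, R x y → Φ x = Ψ y) : expect μ Φ = expect ν Ψ :=
  le_antisymm ((h Φ Ψ).1 fun x y hxy => (H x y hxy).le)
    ((h Φ Ψ).2 fun x y hxy => (H x y hxy).ge)

theorem map {μ : PMF α} {ν : PMF β} (h : Coupled R μ ν) {f : α → α'} {f' : β → β'}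
    (H : ∀ x y, R x y → R' (f x) (f' y)) : Coupled R' (μ.map f) (ν.map f') :=
  h.bind fun x y hxy => Coupled.pure (H x y hxy)

/-- Distributions whose supports are related pointwise. -/
theorem of_support {μ : PMF α} {ν : PMF β} (h : ∀ x ∈ μ.support, ∀ y ∈ ν.support, R x y) :
    Coupled R μ ν := by
  intro Φ Ψ
  constructor
  · intro H
    calc expect μ Φ = expect ν (fun _ => expect μ Φ) := (expect_const _ _).symm
      _ ≤ expect ν Ψ := expect_mono_support ν fun y hy =>
        (expect_mono_support μ (h := fun _ => Ψ y) fun x hx => H x y (h x hx y hy)).trans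
          (expect_const _ _).le
  · intro H
    calc expect ν Ψ = expect μ (fun _ => expect ν Ψ) := (expect_const _ _).symm
      _ ≤ expect μ Φ := expect_mono_support μ fun x hx =>
        (expect_mono_support ν (h := fun _ => Φ x) fun y hy => H x y (h x hx y hy)).trans
          (expect_const _ _).le

theorem of_map {f : β → α} {μ : PMF α} {ν : PMF β} (h : μ = ν.map f)
    (H : ∀ y, R (f y) y) : Coupled R μ ν := by
  intro Φ Ψ
  subst h
  simp only [expect_map]
  exact ⟨fun G => expect_mono ν fun y => G _ _ (H y), fun G => expect_mono ν fun y => G _ _ (H y)⟩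

end Coupled

/-! ### Running circuits -/

section Run

variable {I : Interface} {σ τ : Type}

theorem run_append (O : Oracle I σ) (C C' : Circuit I) (x : Memory × σ) :
    Circuit.run O (C ++ C') x = (Circuit.run O C x >>= Circuit.run O C') := by
  induction C generalizing x with
  | nil => exact (PMF.pure_bind _ _).symm
  | cons i C ih =>
    change (Instr.exec O i x >>= fun y => Circuit.run O (C ++ C') y) = _
    simp only [ih]
    exact (PMF.bind_bind _ _ _).symm

theorem run_gates (O : Oracle I σ) (gs : List Gate) (mem : Memory) (s : σ) :
    Circuit.run O (gs.map Instr.gate) (mem, s) =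
      pure (gs.foldl (fun mem g => g.eval mem) mem, s) := by
  induction gs generalizing mem with
  | nil => rfl
  | cons g gs ih =>
    change (pure (g.eval mem, s) >>= fun y => Circuit.run O (gs.map Instr.gate) y) = _
    refine (PMF.pure_bind _ _).trans ?_
    rw [ih]
    rfl

/-- A relation between the states of two oracles that is preserved by all calls and by all gates
and coin flips is preserved by every circuit. -/
theorem run_coupled {O : Oracle I σ} {O' : Oracle I τ} {R : Memory × σ → Memory × τ → Prop}
    (C : Circuit I)
    (step : ∀ i ∈ C, ∀ x y, R x y → Coupled R (Instr.exec O i x) (Instr.exec O' i y))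
    {x : Memory × σ} {y : Memory × τ} (h : R x y) :
    Coupled R (Circuit.run O C x) (Circuit.run O' C y) := by
  induction C generalizing x y with
  | nil => exact Coupled.pure h
  | cons i C ih =>
    exact (step i (by simp) x y h).bind fun x' y' h' =>
      ih (fun j hj => step j (by simp [hj])) h'

/-- An oracle that is the image of another one. -/
theorem run_map {O : Oracle I σ} {O' : Oracle I τ} {f : τ → σ}
    (h : ∀ p x t, O p x (f t) = (O' p x t).map (fun y => (y.1, f y.2)))
    (C : Circuit I) (mem : Memory) (t : τ) :
    Coupled (fun x y => x = (y.1, f y.2)) (Circuit.run O C (mem, f t))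
      (Circuit.run O' C (mem, t)) := by
  refine run_coupled C ?_ rfl
  rintro i - ⟨_, _⟩ ⟨mem, t⟩ hxy
  obtain ⟨rfl, rfl⟩ := Prod.mk.injEq .. ▸ hxy
  cases i with
  | gate g => exact Coupled.pure rfl
  | flip d => exact Coupled.bind_same fun b => Coupled.pure rfl
  | query p inp out =>
    refine (Coupled.of_map (R := fun x y => x = (y.1, f y.2)) (h _ _ _) fun y => rfl).bind ?_
    rintro x ⟨a, t'⟩ rfl
    exact Coupled.pure rfl

end Run

end RFID

end

noncomputable section

namespace RFID

open scoped ENNReal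

/-! ### A normal form of the attack game -/

/-- The dimensions of the system `MA` and the number of reader sessions. -/
structure Dims where
  l : ℕ
  lk : ℕ
  ld : ℕ
  lp : ℕ
  lv : ℕ
  lr : ℕ
  lu : ℕ
  m : ℕ
  hp : lr + lp = ld
  hm : lu + lr + lv = ld
  pad : BitVec lp

namespace Dims

variable (D : Dims)

/-- The length of `α₁`. -/
abbrev lA : ℕ := D.lr + D.lv + D.lr

/-- A function with the input and output lengths of `F_k`. -/
abbrev Fn : Type := BitVec D.ld → BitVec D.lr

/-- The type of `F`. -/
abbrev Family : Type := BitVec D.lk → D.Fn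

/-- The system `MA` with these dimensions. -/
abbrev sys (F : D.Family) : RFIDSystem :=
  MA D.l D.lk D.ld D.lp D.lv D.lr D.lu D.hp D.hm D.pad F

abbrev Ifc (F : D.Family) : Interface := attackInterface (D.sys F) D.m

/-- The argument of `F_k` that gives the index for the counter `k`. -/
def idx (k : BitVec D.lr) : BitVec D.ld := (k ++ D.pad).cast D.hp

/-- The argument of `F_k` that authenticates `x` in a session with nonces `c1` and `r`. -/
def mac (c1 : BitVec D.lu) (x : BitVec D.lr) (r : BitVec D.lv) : BitVec D.ld :=
  (c1 ++ x ++ r).cast D.hm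

/-- The coins for one call: keys, a nonce of the reader, a nonce of a tag, a random `α₁` and a
random `c₂`. -/
abbrev Coin : Type :=
  (Fin D.l × Fin D.lk) ⊕ (Fin D.lu ⊕ (Fin D.lv ⊕ (Fin D.lA ⊕ Fin D.lr)))

end Dims

variable {D : Dims}

abbrev Coins (D : Dims) : Type := D.Coin → Bool

namespace Coins

def key (r : Coins D) (j : Fin D.l) : BitVec D.lk := ofWires fun b => r (.inl (j, b))
def c1 (r : Coins D) : BitVec D.lu := ofWires fun b => r (.inr (.inl b))
def rT (r : Coins D) : BitVec D.lv := ofWires fun b => r (.inr (.inr (.inl b)))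
def α (r : Coins D) : BitVec D.lA := ofWires fun b => r (.inr (.inr (.inr (.inl b))))
def c2 (r : Coins D) : BitVec D.lr := ofWires fun b => r (.inr (.inr (.inr (.inr b))))

end Coins

/-- Uniform coins. -/
def coins (D : Dims) : PMF (Coins D) := PMF.uniformOfFintype (Coins D)

/-- The normal form draws all coins that a call could need at once, so that an answer is a
deterministic function of the state, the coins and the values of the functions. Each part of the
system reads one block of these coins, and the marginal of that block is uniform. -/
theorem expect_coins_c1 (g : BitVec D.lu → ℝ≥0∞) :
    expect (coins D) (fun r => g r.c1) = expect (uniformBits D.lu) g := by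
  rw [uniformBits, expect_map]
  exact expect_uniform_comp (fun b => Sum.inr (Sum.inl b))
    (fun _ _ h => by simpa using h) (fun f => g (ofWires f))

theorem expect_coins_rT (g : BitVec D.lv → ℝ≥0∞) :
    expect (coins D) (fun r => g r.rT) = expect (uniformBits D.lv) g := by
  rw [uniformBits, expect_map]
  exact expect_uniform_comp (fun b => Sum.inr (Sum.inr (Sum.inl b)))
    (fun _ _ h => by simpa using h) (fun f => g (ofWires f))

theorem expect_coins_α (g : BitVec D.lA → ℝ≥0∞) :
    expect (coins D) (fun r => g r.α) = expect (uniformBits D.lA) g := by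
  rw [uniformBits, expect_map]
  exact expect_uniform_comp (fun b => Sum.inr (Sum.inr (Sum.inr (Sum.inl b))))
    (fun _ _ h => by simpa using h) (fun f => g (ofWires f))

theorem expect_coins_c2 (g : BitVec D.lr → ℝ≥0∞) :
    expect (coins D) (fun r => g r.c2) = expect (uniformBits D.lr) g := by
  rw [uniformBits, expect_map]
  exact expect_uniform_comp (fun b => Sum.inr (Sum.inr (Sum.inr (Sum.inr b))))
    (fun _ _ h => by simpa using h) (fun f => g (ofWires f))

theorem expect_coins_key (g : (Fin D.l → BitVec D.lk) → ℝ≥0∞) :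
    expect (coins D) (fun r => g r.key) =
      expect (PMF.uniformOfFintype (Fin D.l → Fin D.lk → Bool))
        (fun f => g fun j => ofWires (f j)) := by
  rw [← expect_uniform_equiv (Equiv.curry (Fin D.l) (Fin D.lk) Bool)]
  exact expect_uniform_comp (fun b => Sum.inl b)
    (fun _ _ h => by simpa using h) (fun f => g fun j => ofWires fun b => f (j, b))

/-- A session of the reader. -/
inductive Sess (D : Dims) where
  | idle
  | waiting (c1 : BitVec D.lu)
  | rejected
  | accepted (c1 : BitVec D.lu) (α : BitVec D.lA) (i : Fin D.l) (c2 : BitVec D.lr)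

/-- The state of the attack game. Compared with `Game`, indices are not stored and the fooling of
the reader is recorded for each tag. -/
structure World (D : Dims) where
  key : Fin D.l → BitVec D.lk
  ctr : Fin D.l → BitVec D.lr
  c1 : Fin D.l → BitVec D.lu
  rT : Fin D.l → BitVec D.lv
  recCtr : Fin D.l → Option (BitVec D.lr)
  corrupted : Fin D.l → Bool
  pending : Fin D.l → Option (BitVec D.lu × BitVec D.lA)
  log : Fin D.l → List (BitVec D.lu × BitVec D.lA)
  reader : Fin D.m → Sess D
  tagFooled : Fin D.l → Bool
  readerFooled : Fin D.l → Bool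

def α11 (α : BitVec D.lA) : BitVec D.lr := α.extractLsb' (D.lv + D.lr) D.lr
def α12 (α : BitVec D.lA) : BitVec D.lv := α.extractLsb' D.lr D.lv
def α13 (α : BitVec D.lA) : BitVec D.lr := α.extractLsb' 0 D.lr

namespace World

/-- The state after `Setup`. -/
def init (key : Fin D.l → BitVec D.lk) : World D where
  key := key
  ctr _ := BitVec.ofNat D.lr 1
  c1 _ := 0
  rT _ := 0
  recCtr _ := some (BitVec.ofNat D.lr 1)
  corrupted _ := false
  pending _ := none
  log _ := []
  reader _ := .idle
  tagFooled _ := false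
  readerFooled _ := false

def begin (w : World D) (i : Fin D.l) (c1 : BitVec D.lu) (α : BitVec D.lA) : World D :=
  { w with pending := Function.update w.pending i (some (c1, α))
           log := Function.update w.log i ((c1, α) :: w.log i) }

/-- Delete the record of a tag. -/
def forget (w : World D) (c : Fin D.l) : World D :=
  { w with recCtr := Function.update w.recCtr c none }

def initReader (s : Fin D.m) (c1 : BitVec D.lu) (w : World D) : BitVec D.lu × World D :=
  match w.reader s with
  | .idle => (c1, { w with reader := Function.update w.reader s (.waiting c1) })
  | _ => (0, w)

/-- Tag `i` computes `α₁` from the index `a` and the mask `b`. -/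
def startTag (i : Fin D.l) (c1 : BitVec D.lu) (rT : BitVec D.lv) (a b : BitVec D.lr)
    (w : World D) : BitVec D.lA × World D :=
  let α : BitVec D.lA := a ++ rT ++ (b ^^^ w.ctr i)
  (α, { w.begin i c1 α with
    ctr := Function.update w.ctr i (w.ctr i + BitVec.ofNat D.lr 1)
    c1 := Function.update w.c1 i c1
    rT := Function.update w.rT i rT })

/-- The record of `j` is found by its index: `b` is the mask, `ix` the index of the record. -/
def hit1 (w : World D) (α : BitVec D.lA) (b ix : Fin D.l → BitVec D.lr) (j : Fin D.l) : Bool :=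
  match w.recCtr j with
  | none => false
  | some k => decide (ix j = α11 α) && decide (k = b j ^^^ α13 α)

/-- The record of `j` is found by the index `ix` of the received counter. -/
def hit2 (w : World D) (α : BitVec D.lA) (ix : Fin D.l → BitVec D.lr) (j : Fin D.l) : Bool :=
  (w.recCtr j).isSome && decide (ix j = α11 α)

/-- The record found by the reader, where `y 0` are the masks, `y 1` the indices of the received
counters, and `y 2` the indices of the records. -/
def found (w : World D) (α : BitVec D.lA) (y : Fin 4 → Fin D.l → BitVec D.lr) :
    Option (Fin D.l) :=
  (select (w.hit1 α (y 0) (y 2))).or (select (w.hit2 α (y 1)))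

/-- The reader's answer in session `s`, begun with `c1`, when it has identified tag `i`. -/
def accept (s : Fin D.m) (c1 : BitVec D.lu) (α : BitVec D.lA) (i : Fin D.l)
    (k c2 : BitVec D.lr) (w : World D) : World D :=
  { w with
    recCtr := Function.update w.recCtr i (some k)
    reader := Function.update w.reader s (.accepted c1 α i c2)
    tagFooled := Function.update w.tagFooled i
      (w.tagFooled i || (!w.corrupted i && decide ((c1, α) ∉ w.log i))) }

def sendReader (s : Fin D.m) (α : BitVec D.lA) (y : Fin 4 → Fin D.l → BitVec D.lr)
    (w : World D) : (BitVec D.lr × Bool) × World D :=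
  match w.reader s with
  | .waiting c1 =>
      match w.found α y with
      | none => ((0, false), { w with reader := Function.update w.reader s .rejected })
      | some i => ((y 3 i, true),
          w.accept s c1 α i ((y 0 i ^^^ α13 α) + BitVec.ofNat D.lr 1) (y 3 i))
  | _ => ((0, false), w)

def ReaderMatches (w : World D) (i : Fin D.l) (c1 : BitVec D.lu) (α : BitVec D.lA)
    (c2 : BitVec D.lr) : Prop :=
  ∃ s, w.reader s = .accepted c1 α i c2

open Classical in
def finishTag (i : Fin D.l) (c2 e : BitVec D.lr) (w : World D) : Bool × World D :=
  match w.pending i with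
  | some (c1, α) =>
      (decide (c2 = e), { w with
        pending := Function.update w.pending i none
        readerFooled := Function.update w.readerFooled i (w.readerFooled i ||
          (decide (c2 = e) && !w.corrupted i && !decide (w.ReaderMatches i c1 α c2))) })
  | none => (false, w)

/-- Sessions of `c` are replaced by random messages. -/
def startTagIdeal (c i : Fin D.l) (c1 : BitVec D.lu) (r : Coins D) (a b : BitVec D.lr)
    (w : World D) : BitVec D.lA × World D :=
  if i = c then (r.α, w.begin c c1 r.α) else w.startTag i c1 r.rT a b

def sendReaderIdeal (c : Fin D.l) (s : Fin D.m) (α : BitVec D.lA) (r : Coins D)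
    (y : Fin 4 → Fin D.l → BitVec D.lr) (w : World D) : (BitVec D.lr × Bool) × World D :=
  match w.reader s with
  | .waiting c1 =>
      if (c1, α) ∈ w.log c then
        ((r.c2, true), { w with reader := Function.update w.reader s (.accepted c1 α c r.c2) })
      else w.sendReader s α y
  | _ => ((0, false), w)

open Classical in
def finishTagIdeal (c i : Fin D.l) (c2 e : BitVec D.lr) (w : World D) : Bool × World D :=
  if i = c then
    match w.pending c with
    | some (c1, α) => (decide (w.ReaderMatches c c1 α c2),
        { w with pending := Function.update w.pending c none })
    | none => (false, w)
  else w.finishTag i c2 e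

end World

/-- Variants of the game. Messages of the tag `ideal` are replaced by random ones; the state of the
tag `hidden` is not revealed when it is corrupted; `marks` says whether an attempt to corrupt the
hidden tag is recorded. -/
structure Rules (l : ℕ) where
  ideal : Option (Fin l)
  hidden : Option (Fin l)
  marks : Bool

namespace World

/-- The two settings of `marks` serve the two stages. In the learning stage an attempt to corrupt
the hidden tag must be remembered, because it makes the outcome for this tag void; in the guessing
stage the call has no effect. -/
def corrupt (ρ : Rules D.l) (i : Fin D.l) (w : World D) :
    BitVec (D.lk + D.lr + D.lu + D.lv) × World D :=
  (if ρ.hidden = some i then 0 else w.key i ++ w.ctr i ++ w.c1 i ++ w.rT i,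
   if ρ.hidden = some i ∧ ρ.marks = false then w
   else { w with corrupted := Function.update w.corrupted i true })

def start (ρ : Rules D.l) (i : Fin D.l) (c1 : BitVec D.lu) (r : Coins D) (a b : BitVec D.lr)
    (w : World D) : BitVec D.lA × World D :=
  match ρ.ideal with
  | none => w.startTag i c1 r.rT a b
  | some c => w.startTagIdeal c i c1 r a b

def send (ρ : Rules D.l) (s : Fin D.m) (α : BitVec D.lA) (r : Coins D)
    (y : Fin 4 → Fin D.l → BitVec D.lr) (w : World D) : (BitVec D.lr × Bool) × World D :=
  match ρ.ideal with
  | none => w.sendReader s α y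
  | some c => w.sendReaderIdeal c s α r y

def finish (ρ : Rules D.l) (i : Fin D.l) (c2 e : BitVec D.lr) (w : World D) : Bool × World D :=
  match ρ.ideal with
  | none => w.finishTag i c2 e
  | some c => w.finishTagIdeal c i c2 e

/-- The reader's nonce in session `s`. -/
def readerNonce (w : World D) (s : Fin D.m) : BitVec D.lu :=
  match w.reader s with
  | .waiting c1 => c1
  | .accepted c1 _ _ _ => c1
  | _ => 0

variable {F : D.Family}

/-- The arguments at which the function of tag `j` is evaluated when `α` is sent to session `s`;
`b` is the mask. -/
def readerArgs (w : World D) (s : Fin D.m) (α : BitVec D.lA) (t : Fin 4) (b : BitVec D.lr)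
    (j : Fin D.l) : BitVec D.ld :=
  match t with
  | 0 => D.mac (w.readerNonce s) (α11 α) (α12 α)
  | 1 => D.idx (b ^^^ α13 α)
  -- The default value is harmless, since `hit1` rejects a tag without a record.
  | 2 => D.idx ((w.recCtr j).getD 0)
  | 3 => D.mac (w.readerNonce s) ((b ^^^ α13 α) + BitVec.ofNat D.lr 1) (α12 α)

/-- The argument at which the function of tag `j` is evaluated in round `t` of an oracle call,
given the results `y` of round `0`. -/
def rounds (w : World D) (p : AttackPort) (x : (D.Ifc F).In p → Bool) (r : Coins D) (t : Fin 4)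
    (y : Fin D.l → BitVec D.lr) (j : Fin D.l) : BitVec D.ld :=
  match p, x with
  | .startTag, x =>
      if t = 0 then D.idx (w.ctr j)
      -- The rounds 2 and 3 repeat round 1; only the rounds 0 and 1 are used in the answer.
      else D.mac (ofWires fun b : Fin D.lu => x (.inr b)) (y j) r.rT
  | .sendReader, x =>
      match select (fun s : Fin D.m => x (.inl s)) with
      | none => 0
      | some s => w.readerArgs s (ofWires fun b : Fin D.lA => x (.inr b)) t (y j) j
  | .finishTag, _ => D.mac (w.c1 j) (w.ctr j) (w.rT j)
  | _, _ => 0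

/-- The answer to an oracle call, given the results `y` of all rounds. -/
def answer (F : D.Family) (ρ : Rules D.l) (w : World D) (p : AttackPort)
    (x : (D.Ifc F).In p → Bool) (r : Coins D)
    (y : Fin 4 → Fin D.l → BitVec D.lr) : ((D.Ifc F).Out p → Bool) × World D :=
  match p, x with
  | .initReader, x =>
      match select (n := D.m) x with
      | some s => (fun b : Fin D.lu => (w.initReader s r.c1).1.getLsb b, (w.initReader s r.c1).2)
      | none => (fun _ => false, w)
  | .startTag, x =>
      match select (fun i : Fin D.l => x (.inl i)) with
      | some i =>
          let c1 : BitVec D.lu := ofWires fun b : Fin D.lu => x (.inr b)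
          let res := w.start ρ i c1 r (y 0 i) (y 1 i)
          (fun b : Fin D.lA => res.1.getLsb b, res.2)
      | none => (fun _ => false, w)
  | .sendReader, x =>
      match select (fun s : Fin D.m => x (.inl s)) with
      | some s =>
          let α : BitVec D.lA := ofWires fun b : Fin D.lA => x (.inr b)
          let res := w.send ρ s α r y
          (Sum.elim (fun b : Fin D.lr => res.1.1.getLsb b) (fun _ => res.1.2), res.2)
      | none => (fun _ => false, w)
  | .finishTag, x =>
      match select (fun i : Fin D.l => x (.inl i)) with
      | some i =>
          let c2 : BitVec D.lr := ofWires fun b : Fin D.lr => x (.inr b)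
          let res := w.finish ρ i c2 (y 0 i)
          (fun _ => res.1, res.2)
      | none => (fun _ => false, w)
  | .corrupt, x =>
      match select (n := D.l) x with
      | some i => (fun b : Fin (D.lk + D.lr + D.lu + D.lv) => (w.corrupt ρ i).1.getLsb b,
          (w.corrupt ρ i).2)
      | none => (fun _ => false, w)

/-- The results of all rounds for given functions of the tags. -/
def evals (fn : Fin D.l → D.Fn) (w : World D) (p : AttackPort)
    (x : (D.Ifc F).In p → Bool) (r : Coins D) (t : Fin 4) (j : Fin D.l) : BitVec D.lr :=
  fn j (w.rounds p x r t (fun i => fn i (w.rounds p x r 0 0 i)) j)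

/-- The oracles of the adversary; `ev` gives the functions of the tags with given keys. -/
def oracle (F : D.Family) (ρ : Rules D.l) (ev : (Fin D.l → BitVec D.lk) → Fin D.l → D.Fn) :
    Oracle (D.Ifc F) (World D) := fun p x w =>
  (coins D).map fun r => answer F ρ w p x r (evals (ev w.key) w p x r)

end World

end RFID

end

noncomputable section

namespace RFID

open scoped ENNReal

variable {D : Dims} {F : D.Family}

/-! ### The real system in normal form -/

theorem pmf_ext_expect {α : Type} {μ ν : PMF α} (h : ∀ Φ, expect μ Φ = expect ν Φ) : μ = ν := by
  classical
  ext a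
  have := h (fun b => if b = a then 1 else 0)
  simpa [expect] using this

theorem update_map {ι α β : Type} [DecidableEq ι] (f : α → β) (g : ι → α) (i : ι) (a : α) :
    (fun j => f (Function.update g i a j)) = Function.update (fun j => f (g j)) i (f a) := by
  funext j
  by_cases h : j = i
  · subst h; simp
  · simp [h]

theorem findSome?_eq_find?_map {α β : Type} {L : List α} {g : α → Option β} {p : α → Bool}
    {h : α → β} (H : ∀ a, g a = if p a then some (h a) else none) :
    L.findSome? g = (L.find? p).map h := by
  induction L with
  | nil => rfl
  | cons a L ih =>
    rw [List.findSome?_cons, List.find?_cons, H a]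
    cases p a <;> simp [ih]

section HandlersOracle

variable {S : RFIDSystem} {m : ℕ} (H : Handlers S m)

theorem Handlers.oracle_initReader_none (x : (attackInterface S m).In .initReader → Bool)
    (g : Game S m) (h : select x = none) :
    H.oracle .initReader x g = pure (fun _ => false, g) := by
  simp only [Handlers.oracle, h]

theorem Handlers.oracle_initReader_some (x : (attackInterface S m).In .initReader → Bool)
    (g : Game S m) {s : Fin m} (h : select x = some s) :
    H.oracle .initReader x g = (H.initReader s g >>= fun y => pure (fun j => y.1.getLsb j, y.2)) := by
  simp only [Handlers.oracle, h]
  rfl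

theorem Handlers.oracle_startTag_none (x : (attackInterface S m).In .startTag → Bool)
    (g : Game S m) (h : select (fun i => x (.inl i)) = none) :
    H.oracle .startTag x g = pure (fun _ => false, g) := by
  simp only [Handlers.oracle, h]

theorem Handlers.oracle_startTag_some (x : (attackInterface S m).In .startTag → Bool)
    (g : Game S m) {i : Fin S.numTags} (h : select (fun i => x (.inl i)) = some i) :
    H.oracle .startTag x g = (H.startTag i (ofWires (fun j => x (.inr j))) g >>= fun y => pure (fun j => y.1.getLsb j, y.2)) := by
  simp only [Handlers.oracle, h]
  rfl

theorem Handlers.oracle_sendReader_none (x : (attackInterface S m).In .sendReader → Bool)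
    (g : Game S m) (h : select (fun i => x (.inl i)) = none) :
    H.oracle .sendReader x g = pure (fun _ => false, g) := by
  simp only [Handlers.oracle, h]

theorem Handlers.oracle_sendReader_some (x : (attackInterface S m).In .sendReader → Bool)
    (g : Game S m) {s : Fin m} (h : select (fun i => x (.inl i)) = some s) :
    H.oracle .sendReader x g = (H.sendReader s (ofWires (fun j => x (.inr j))) g >>= fun y => pure (Sum.elim (fun j => y.1.1.getLsb j) (fun _ => y.1.2), y.2)) := by
  simp only [Handlers.oracle, h]
  rfl

theorem Handlers.oracle_finishTag_none (x : (attackInterface S m).In .finishTag → Bool)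
    (g : Game S m) (h : select (fun i => x (.inl i)) = none) :
    H.oracle .finishTag x g = pure (fun _ => false, g) := by
  simp only [Handlers.oracle, h]

theorem Handlers.oracle_finishTag_some (x : (attackInterface S m).In .finishTag → Bool)
    (g : Game S m) {i : Fin S.numTags} (h : select (fun i => x (.inl i)) = some i) :
    H.oracle .finishTag x g = (H.finishTag i (ofWires (fun j => x (.inr j))) g >>= fun y => pure (fun _ => y.1, y.2)) := by
  simp only [Handlers.oracle, h]

theorem Handlers.oracle_corrupt_none (x : (attackInterface S m).In .corrupt → Bool)
    (g : Game S m) (h : select x = none) :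
    H.oracle .corrupt x g = pure (fun _ => false, g) := by
  simp only [Handlers.oracle, h]

theorem Handlers.oracle_corrupt_some (x : (attackInterface S m).In .corrupt → Bool)
    (g : Game S m) {i : Fin S.numTags} (h : select x = some i) :
    H.oracle .corrupt x g = (H.corrupt i g >>= fun y => pure (fun j => y.1.getLsb j, y.2)) := by
  simp only [Handlers.oracle, h]
  rfl

end HandlersOracle

def Sess.toSession (F : D.Family) : Sess D → ReaderSession (D.sys F)
  | .idle => .idle
  | .waiting c1 => .waiting c1
  | .rejected => .rejected
  | .accepted c1 α i c2 => .accepted c1 α i c2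

/-- The record of a tag with key `k` and counter `n`. -/
def Dims.record (D : Dims) (F : D.Family) (k : BitVec D.lk) (n : BitVec D.lr) :
    MARec D.lk D.lr where
  index := F k (D.idx n)
  key := k
  ctr := n

namespace World

/-- At setup and after each update the stored index is the value of `F_k` at the stored counter, so
records can be reconstructed from keys and counters. -/
def db (F : D.Family) (w : World D) (i : Fin D.l) : Option (MARec D.lk D.lr) :=
  (w.recCtr i).map (D.record F (w.key i))

def tags (w : World D) (i : Fin D.l) : MATag D.lk D.lv D.lr D.lu where
  key := w.key i
  ctr := w.ctr i
  c1 := w.c1 i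
  rT := w.rT i

/-- The state of the attack game that is represented by `w`. -/
def toGame (F : D.Family) (w : World D) : Game (D.sys F) D.m where
  db := w.db F
  tag := w.tags
  corrupted := w.corrupted
  pending := w.pending
  tagLog := w.log
  reader s := (w.reader s).toSession F
  tagImpersonated := decide (∃ i, w.tagFooled i = true)
  readerImpersonated := decide (∃ i, w.readerFooled i = true)

theorem toGame_reader_update (w : World D) (s : Fin D.m) (t : Sess D) :
    toGame F { w with reader := Function.update w.reader s t } =
      { toGame F w with reader := Function.update (toGame F w).reader s (t.toSession F) } := by
  unfold toGame
  congr 1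
  exact update_map _ _ _ _

/-- The game flips only the coins that it needs, the normal form flips all of them. The two are
therefore compared as distributions, through arbitrary test functions. -/
theorem expect_initReader (w : World D) (s : Fin D.m) (Φ : BitVec D.lu × Game (D.sys F) D.m → ℝ≥0∞) :
    expect (Game.initReader s (w.toGame F)) Φ =
      expect (coins D) (fun r =>
        Φ ((w.initReader s r.c1).1, toGame F (w.initReader s r.c1).2)) := by
  rw [expect_coins_c1 (fun c1 => Φ ((w.initReader s c1).1, toGame F (w.initReader s c1).2))]
  unfold Game.initReader World.initReader
  have h : (w.toGame F).reader s = (w.reader s).toSession F := rfl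
  rw [h]
  cases w.reader s with
  | idle =>
    refine (expect_bind (uniformBits D.lu) _ _).trans ?_
    congr 1
    funext c1
    refine (expect_pure _ _).trans ?_
    exact congrArg (fun g => Φ (c1, g)) (toGame_reader_update w s (.waiting c1)).symm
  | _ =>
    simp only [Sess.toSession, expect_const]
    exact expect_pure _ _

theorem tags_startTag (w : World D) (i : Fin D.l) (c1 : BitVec D.lu) (rT : BitVec D.lv)
    (a b : BitVec D.lr) : (w.startTag i c1 rT a b).2.tags = Function.update w.tags i
      { key := w.key i, ctr := w.ctr i + BitVec.ofNat D.lr 1, c1 := c1, rT := rT } := by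
  funext j
  by_cases h : j = i
  · subst h
    simp [tags, startTag, World.begin]
  · simp [tags, startTag, World.begin, h]

theorem expect_startTag (w : World D) (i : Fin D.l) (c1 : BitVec D.lu)
    (Φ : BitVec D.lA × Game (D.sys F) D.m → ℝ≥0∞) :
    expect (Game.startTag i c1 (w.toGame F)) Φ =
      expect (coins D) (fun r =>
        let res := w.startTag i c1 r.rT (F (w.key i) (D.idx (w.ctr i)))
          (F (w.key i) (D.mac c1 (F (w.key i) (D.idx (w.ctr i))) r.rT))
        Φ (res.1, toGame F res.2)) := by
  rw [expect_coins_rT (fun rT =>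
        let res := w.startTag i c1 rT (F (w.key i) (D.idx (w.ctr i)))
          (F (w.key i) (D.mac c1 (F (w.key i) (D.idx (w.ctr i))) rT))
        Φ (res.1, toGame F res.2))]
  unfold Game.startTag
  refine (expect_bind _ _ _).trans ((expect_bind (uniformBits D.lv) _ _).trans ?_)
  congr 1
  funext rT
  refine (expect_pure _ _).trans ((expect_pure _ _).trans ?_)
  exact congrArg (fun t => Φ (_, { toGame F (w.startTag i c1 rT _ _).2 with tag := t }))
    (tags_startTag w i c1 rT _ _).symm

/-- The values that the reader computes when it receives `α` in a session begun with `c1`. -/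
def readerEvals (fn : Fin D.l → D.Fn) (w : World D) (c1 : BitVec D.lu) (α : BitVec D.lA)
    (t : Fin 4) (j : Fin D.l) : BitVec D.lr :=
  let b := fn j (D.mac c1 (α11 α) (α12 α))
  match t with
  | 0 => b
  | 1 => fn j (D.idx (b ^^^ α13 α))
  | 2 => fn j (D.idx ((w.recCtr j).getD 0))
  | 3 => fn j (D.mac c1 ((b ^^^ α13 α) + BitVec.ofNat D.lr 1) (α12 α))

theorem evals_sendReader (fn : Fin D.l → D.Fn) (w : World D)
    (x : (D.Ifc F).In .sendReader → Bool) (r : Coins D) {s : Fin D.m}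
    (hs : select (fun s : Fin D.m => x (.inl s)) = some s) :
    w.evals fn .sendReader x r =
      readerEvals fn w (w.readerNonce s) (ofWires fun b : Fin D.lA => x (.inr b)) := by
  have h : ∀ t y j, w.rounds .sendReader x r t y j =
      w.readerArgs s (ofWires fun b : Fin D.lA => x (.inr b)) t (y j) j := by
    intro t y j
    simp only [rounds, hs]
  funext t j
  unfold evals
  rw [h, h]
  fin_cases t <;> rfl

/-- Both searches ask for the first tag with a Boolean property, namely `hit1` or `hit2`; the record
returned with it is the stored one, because these properties require a record to exist. -/
theorem readerRespond_eq (w : World D) (c1 : BitVec D.lu) (α : BitVec D.lA) :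
    (D.sys F).readerRespond (w.db F) c1 α =
      match w.found α (readerEvals (fun j => F (w.key j)) w c1 α) with
      | none => pure (w.db F, none)
      | some i => pure (Function.update (w.db F) i
          (some (D.record F (w.key i)
            ((readerEvals (fun j => F (w.key j)) w c1 α 0 i ^^^ α13 α) + BitVec.ofNat D.lr 1))),
          some (i, readerEvals (fun j => F (w.key j)) w c1 α 3 i)) := by
  let y := readerEvals (fun j => F (w.key j)) w c1 α
  have h : ∀ p : Fin D.l → Bool, ∀ g : Fin D.l → Option (Fin D.l × MARec D.lk D.lr),
      (∀ j, g j = if p j then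
        some (j, D.record F (w.key j) ((w.recCtr j).getD 0)) else none) →
      (List.finRange D.l).findSome? g = (select p).map
        (fun j => (j, D.record F (w.key j) ((w.recCtr j).getD 0))) :=
    fun p g H => findSome?_eq_find?_map H
  let g1 (j : Fin D.l) : Option (Fin D.l × MARec D.lk D.lr) :=
    (w.db F j).bind fun rcd =>
      if rcd.index = α11 α ∧ rcd.ctr = F rcd.key (D.mac c1 (α11 α) (α12 α)) ^^^ α13 α
      then some (j, rcd) else none
  let g2 (j : Fin D.l) : Option (Fin D.l × MARec D.lk D.lr) :=
    (w.db F j).bind fun rcd =>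
      if F rcd.key (D.idx (F rcd.key (D.mac c1 (α11 α) (α12 α)) ^^^ α13 α)) = α11 α
      then some (j, rcd) else none
  have h1 : (List.finRange D.l).findSome? g1 = _ := h (w.hit1 α (y 0) (y 2)) g1 (by
    intro j
    simp only [g1, db, hit1, y, readerEvals]
    cases w.recCtr j with
    | none => rfl
    | some k => simp [Dims.record])
  have h2 : (List.finRange D.l).findSome? g2 = _ := h (w.hit2 α (y 1)) g2 (by
    intro j
    simp only [g2, db, hit2, y, readerEvals]
    cases w.recCtr j with
    | none => rfl
    | some k => simp [Dims.record])
  have h3 := congrArg₂ Option.or h1 h2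
  rw [← Option.map_or] at h3
  unfold Dims.sys MA
  dsimp only
  split
  · rename_i heq
    have h4 : w.found α (readerEvals (fun j => F (w.key j)) w c1 α) = none :=
      Option.map_eq_none_iff.1 (h3.symm.trans heq)
    rw [h4]
  · rename_i i rcd heq
    obtain ⟨i', h4, h5⟩ := Option.map_eq_some_iff.1 (h3.symm.trans heq)
    have h6 : w.found α (readerEvals (fun j => F (w.key j)) w c1 α) = some i' := h4
    obtain ⟨rfl, rfl⟩ := Prod.mk.injEq .. ▸ h5
    rw [h6]
    rfl

theorem db_update (w : World D) (i : Fin D.l) (k : BitVec D.lr) :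
    World.db F { w with recCtr := Function.update w.recCtr i (some k) } =
      Function.update (w.db F) i (some (D.record F (w.key i) k)) := by
  funext j
  by_cases h : j = i
  · subst h; simp [db]
  · simp [db, h]

/-- The game has one bit for a fraud concerning any tag, the normal form one bit for each tag. -/
theorem exists_update_or {l : ℕ} (f : Fin l → Bool) (i : Fin l) (b : Bool) :
    decide (∃ j, Function.update f i (f i || b) j = true) = (decide (∃ j, f j = true) || b) := by
  rw [Bool.eq_iff_iff]
  simp only [decide_eq_true_eq, Bool.or_eq_true]
  constructor
  · rintro ⟨j, hj⟩
    by_cases h : j = i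
    · subst h
      rw [Function.update_self, Bool.or_eq_true] at hj
      exact hj.imp (fun h => ⟨_, h⟩) id
    · rw [Function.update_of_ne h] at hj
      exact Or.inl ⟨j, hj⟩
  · rintro (⟨j, hj⟩ | h)
    · refine ⟨j, ?_⟩
      by_cases h : j = i
      · subst h; simp [hj]
      · simp [h, hj]
    · exact ⟨i, by simp [h]⟩

theorem sendReader_eq (w : World D) (s : Fin D.m) (α : BitVec D.lA) :
    Game.sendReader s α (w.toGame F) =
      let res := w.sendReader s α (readerEvals (fun j => F (w.key j)) w (w.readerNonce s) α)
      (pure (res.1, toGame F res.2) : PMF ((BitVec D.lr × Bool) × Game (D.sys F) D.m)) := by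
  unfold Game.sendReader World.sendReader readerNonce
  have h : (w.toGame F).reader s = (w.reader s).toSession F := rfl
  rw [h]
  cases hs : w.reader s with
  | waiting c1 =>
    simp only [Sess.toSession]
    have h' : (w.toGame F).db = w.db F := rfl
    rw [h', readerRespond_eq]
    cases w.found α (readerEvals (fun j => F (w.key j)) w c1 α) with
    | none =>
      refine (PMF.pure_bind _ _).trans ?_
      simp only [toGame_reader_update]
      rfl
    | some i =>
      refine (PMF.pure_bind _ _).trans ?_
      simp only
      congr 2
      unfold accept toGame
      congr 1
      · exact (db_update _ _ _).symm
      · exact (update_map (ι := Fin D.m) (Sess.toSession F) w.reader s (.accepted c1 α i _)).symm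
      · rw [exists_update_or]
        congr 1
        rw [Bool.eq_iff_iff]
        simp only [Bool.and_eq_true, Bool.not_eq_true', decide_eq_true_eq]
        rfl
  | _ => rfl

theorem toSession_accepted (F : D.Family) (t : Sess D) (c1 α i c2) :
    t.toSession F = .accepted c1 α i c2 ↔ t = .accepted c1 α i c2 := by
  cases t with
  | accepted =>
    refine ⟨fun h => ?_, fun h => ?_⟩
    · injection h with h1 h2 h3 h4
      subst h1 h2 h3 h4
      rfl
    · injection h with h1 h2 h3 h4
      subst h1 h2 h3 h4
      rfl
  | _ => exact ⟨fun h => (by injection h), fun h => (by injection h)⟩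

theorem readerMatches_iff (w : World D) (i : Fin D.l) (c1 α c2) :
    (w.toGame F).ReaderMatches i c1 α c2 ↔ w.ReaderMatches i c1 α c2 :=
  exists_congr fun _ => toSession_accepted F _ _ _ _ _

theorem finishTag_eq (w : World D) (i : Fin D.l) (c2 : BitVec D.lr) :
    Game.finishTag i c2 (w.toGame F) =
      let res := w.finishTag i c2 (F (w.key i) (D.mac (w.c1 i) (w.ctr i) (w.rT i)))
      (pure (res.1, toGame F res.2) : PMF (Bool × Game (D.sys F) D.m)) := by
  unfold Game.finishTag World.finishTag
  have h : (w.toGame F).pending i = w.pending i := rfl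
  rw [h]
  cases w.pending i with
  | none => rfl
  | some p =>
    simp only
    congr 2
    unfold toGame
    congr 1
    · funext j
      by_cases h : j = i
      · subst h; exact Function.update_self _ _ _
      · exact Function.update_of_ne h _ _
    · rw [exists_update_or]
      congr 1
      rw [Bool.eq_iff_iff]
      simp only [decide_eq_true_eq, Bool.and_eq_true, Bool.not_eq_true', decide_eq_false_iff_not,
        and_assoc]
      refine and_congr ?_ (and_congr Iff.rfl (not_congr (readerMatches_iff (F := F) _ _ _ _ _)))
      exact decide_eq_true_iff

/-- The functions of the tags in the real system. -/
abbrev realEv (F : D.Family) : (Fin D.l → BitVec D.lk) → Fin D.l → D.Fn := fun key j => F (key j)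

/-- The handlers `H` treat the represented states according to the rules `ρ`. -/
structure Simulates (F : D.Family) (H : Handlers (D.sys F) D.m) (ρ : Rules D.l) : Prop where
  init : ∀ (w : World D) (s : Fin D.m) Φ, expect (H.initReader s (w.toGame F)) Φ =
    expect (coins D) (fun r => Φ ((w.initReader s r.c1).1, toGame F (w.initReader s r.c1).2))
  start : ∀ (w : World D) (i : Fin D.l) (c1 : BitVec D.lu) Φ,
    expect (H.startTag i c1 (w.toGame F)) Φ =
      expect (coins D) (fun r =>
        let res := w.start ρ i c1 r (F (w.key i) (D.idx (w.ctr i)))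
          (F (w.key i) (D.mac c1 (F (w.key i) (D.idx (w.ctr i))) r.rT))
        Φ (res.1, toGame F res.2))
  send : ∀ (w : World D) (s : Fin D.m) (α : BitVec D.lA) Φ,
    expect (H.sendReader s α (w.toGame F)) Φ =
      expect (coins D) (fun r =>
        let res := w.send ρ s α r (readerEvals (fun j => F (w.key j)) w (w.readerNonce s) α)
        Φ (res.1, toGame F res.2))
  finish : ∀ (w : World D) (i : Fin D.l) (c2 : BitVec D.lr) Φ,
    expect (H.finishTag i c2 (w.toGame F)) Φ =
      let res := w.finish ρ i c2 (F (w.key i) (D.mac (w.c1 i) (w.ctr i) (w.rT i)))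
      Φ (res.1, toGame F res.2)
  corrupt : ∀ (w : World D) (i : Fin D.l),
    H.corrupt i (w.toGame F) =
      (pure ((w.corrupt ρ i).1, toGame F (w.corrupt ρ i).2) :
        PMF (BitVec (D.lk + D.lr + D.lu + D.lv) × Game (D.sys F) D.m))

theorem simulates_real (b : Bool) : Simulates F (realHandlers (D.sys F) D.m) ⟨none, none, b⟩ where
  init := expect_initReader
  start := expect_startTag
  send w s α Φ := by
    rw [show (realHandlers (D.sys F) D.m).sendReader s α (w.toGame F) = _ from sendReader_eq w s α]
    exact (expect_pure _ _).trans (expect_const _ _).symm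
  finish w i c2 Φ := by
    rw [show (realHandlers (D.sys F) D.m).finishTag i c2 (w.toGame F) = _ from finishTag_eq w i c2]
    exact expect_pure _ _
  corrupt w i := rfl

theorem corruptExcept_eq (ideal : Option (Fin D.l)) (c i : Fin D.l) (w : World D) :
    corruptExcept (S := D.sys F) c i (w.toGame F) =
      (pure ((w.corrupt ⟨ideal, some c, false⟩ i).1,
        toGame F (w.corrupt ⟨ideal, some c, false⟩ i).2) :
        PMF (BitVec (D.lk + D.lr + D.lu + D.lv) × Game (D.sys F) D.m)) := by
  unfold corruptExcept World.corrupt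
  by_cases h : i = c
  · subst h
    refine (if_pos rfl).trans ?_
    simp only [if_true, and_self]
    rfl
  · have h' : c ≠ i := fun e => h e.symm
    refine (if_neg h).trans ?_
    simp only [Option.some.injEq, h', if_false, false_and]
    rfl

theorem simulates_realChallenge (c : Fin D.l) :
    Simulates F (realChallenge (D.sys F) D.m c) ⟨none, some c, false⟩ where
  init := expect_initReader
  start := expect_startTag
  send := (simulates_real false).send
  finish := (simulates_real false).finish
  corrupt w i := corruptExcept_eq none c i w

theorem simulates_randomChallenge (c : Fin D.l) :
    Simulates F (randomChallenge (D.sys F) D.m c) ⟨some c, some c, false⟩ where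
  init := expect_initReader
  start w i c1 Φ := by
    change expect (if i = c then _ else _) Φ = _
    simp only [start, startTagIdeal]
    by_cases h : i = c
    · subst h
      simp only [if_true]
      rw [expect_coins_α (fun α => Φ (α, toGame F (w.begin i c1 α)))]
      refine (expect_bind (uniformBits D.lA) _ _).trans ?_
      congr 1
      funext α
      exact expect_pure _ _
    · simp only [if_neg h]
      exact expect_startTag w i c1 Φ
  send w s α Φ := by
    unfold randomChallenge
    simp only [send, sendReaderIdeal]
    have h : (w.toGame F).reader s = (w.reader s).toSession F := rfl
    rw [h]
    cases hs : w.reader s with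
    | waiting c1 =>
      simp only [Sess.toSession]
      have h' : (w.toGame F).tagLog c = w.log c := rfl
      by_cases hc : (c1, α) ∈ w.log c
      · refine (congrArg (expect · Φ) (if_pos hc)).trans ?_
        simp only [if_pos hc]
        refine Eq.trans ?_ (expect_coins_c2 (fun c2 => Φ ((c2, true), toGame F
          { w with reader := Function.update w.reader s (.accepted c1 α c c2) }))).symm
        refine (expect_bind (uniformBits D.lr) _ _).trans ?_
        congr 1
        funext c2
        refine (expect_pure _ _).trans ?_
        exact congrArg (fun g => Φ ((c2, true), g))
          (toGame_reader_update w s (.accepted c1 α c c2)).symm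
      · refine (congrArg (expect · Φ) (if_neg hc)).trans ?_
        simp only [if_neg hc]
        exact (simulates_real false).send w s α Φ
    | _ => exact (expect_pure _ _).trans (expect_const _ _).symm
  finish w i c2 Φ := by
    change expect (if i = c then _ else _) Φ = _
    simp only [finish, finishTagIdeal]
    by_cases h : i = c
    · subst h
      simp only [if_true]
      have h' : (w.toGame F).pending i = w.pending i := rfl
      rw [h']
      cases w.pending i with
      | none => exact expect_pure _ _
      | some p =>
        refine (expect_pure _ _).trans ?_
        refine congrArg (fun b => Φ (b, _)) ?_
        exact decide_eq_decide.2 (readerMatches_iff w i p.1 p.2 c2)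
    · simp only [if_neg h]
      exact (simulates_real false).finish w i c2 Φ
  corrupt w i := corruptExcept_eq (some c) c i w

theorem Simulates.oracle_eq {H : Handlers (D.sys F) D.m} {ρ : Rules D.l} (hH : Simulates F H ρ)
    (p : AttackPort) (x : (D.Ifc F).In p → Bool) (w : World D) :
    H.oracle p x (w.toGame F) =
      (World.oracle F ρ (realEv F) p x w).map (fun y => (y.1, y.2.toGame F)) := by
  apply pmf_ext_expect
  intro Φ
  rw [expect_map]
  change _ = expect ((coins D).map fun r =>
    answer F ρ w p x r (evals (realEv F w.key) w p x r)) _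
  rw [expect_map]
  cases p with
  | initReader =>
    unfold answer
    dsimp only
    cases hs : select (n := D.m) x with
    | none =>
      rw [Handlers.oracle_initReader_none H x (w.toGame F) hs]
      exact (expect_pure _ _).trans (expect_const _ _).symm
    | some s =>
      rw [Handlers.oracle_initReader_some H x (w.toGame F) hs]
      refine (expect_bind _ _ _).trans ?_
      refine (hH.init w s _).trans ?_
      congr 1
      funext r
      exact expect_pure _ _
  | startTag =>
    unfold answer
    dsimp only
    cases hs : select (fun i : Fin D.l => x (.inl i)) with
    | none =>
      rw [Handlers.oracle_startTag_none H x (w.toGame F) hs]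
      exact (expect_pure _ _).trans (expect_const _ _).symm
    | some i =>
      rw [Handlers.oracle_startTag_some H x (w.toGame F) hs]
      refine (expect_bind _ _ _).trans ?_
      refine (hH.start w i _ _).trans ?_
      congr 1
      funext r
      exact expect_pure _ _
  | sendReader =>
    unfold answer
    dsimp only
    cases hs : select (fun s : Fin D.m => x (.inl s)) with
    | none =>
      rw [Handlers.oracle_sendReader_none H x (w.toGame F) hs]
      exact (expect_pure _ _).trans (expect_const _ _).symm
    | some s =>
      rw [Handlers.oracle_sendReader_some H x (w.toGame F) hs]
      refine (expect_bind _ _ _).trans ?_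
      refine (hH.send w s _ _).trans ?_
      congr 1
      funext r
      refine (expect_pure _ _).trans ?_
      dsimp only
      rw [evals_sendReader _ _ _ _ hs]
      rfl
  | finishTag =>
    unfold answer
    dsimp only
    cases hs : select (fun i : Fin D.l => x (.inl i)) with
    | none =>
      rw [Handlers.oracle_finishTag_none H x (w.toGame F) hs]
      exact (expect_pure _ _).trans (expect_const _ _).symm
    | some i =>
      rw [Handlers.oracle_finishTag_some H x (w.toGame F) hs]
      refine (expect_bind _ _ _).trans ?_
      refine (hH.finish w i _ _).trans ?_
      exact (expect_pure _ _).trans (expect_const _ _).symm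
  | corrupt =>
    unfold answer
    dsimp only
    cases hs : select (n := D.l) x with
    | none =>
      rw [Handlers.oracle_corrupt_none H x (w.toGame F) hs]
      exact (expect_pure _ _).trans (expect_const _ _).symm
    | some i =>
      rw [Handlers.oracle_corrupt_some H x (w.toGame F) hs]
      refine (expect_bind _ _ _).trans ?_
      rw [hH.corrupt w i]
      exact (expect_pure _ _).trans ((expect_pure _ _).trans (expect_const _ _).symm)

/-- Running a circuit in the attack game or in its normal form. -/
theorem Simulates.run {H : Handlers (D.sys F) D.m} {ρ : Rules D.l} (hH : Simulates F H ρ)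
    (A : Circuit (D.Ifc F)) (mem : Memory) (w : World D) :
    Coupled (fun x y => x = (y.1, y.2.toGame F)) (A.run H.oracle (mem, w.toGame F))
      (A.run (World.oracle F ρ (realEv F)) (mem, w)) :=
  run_map hH.oracle_eq A mem w

end World

end RFID

end

noncomputable section

namespace RFID

open scoped ENNReal

variable {D : Dims} {F : D.Family}

/-! ### Experiments for a single tag -/

namespace World

/-- The functions of the tags when the function of tag `c` is `f`. -/
def tagEv (F : D.Family) (c : Fin D.l) (f : D.Fn) : (Fin D.l → BitVec D.lk) → Fin D.l → D.Fn :=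
  fun key j => if j = c then f else F (key j)

theorem start_key (ρ : Rules D.l) (i c1 r a b) (w : World D) :
    (w.start ρ i c1 r a b).2.key = w.key := by
  unfold start startTagIdeal
  cases ρ.ideal with
  | none => rfl
  | some c => dsimp only; split_ifs <;> rfl

theorem sendReader_key (s α y) (w : World D) : (w.sendReader s α y).2.key = w.key := by
  unfold sendReader
  split
  · split <;> rfl
  · rfl

theorem send_key (ρ : Rules D.l) (s α r y) (w : World D) :
    (w.send ρ s α r y).2.key = w.key := by
  unfold send sendReaderIdeal
  cases ρ.ideal with
  | none => exact sendReader_key _ _ _ _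
  | some c =>
    dsimp only
    split
    · split_ifs
      · rfl
      · exact sendReader_key _ _ _ _
    · rfl

theorem finishTag_key (i c2 e) (w : World D) : (w.finishTag i c2 e).2.key = w.key := by
  unfold finishTag
  split <;> rfl

theorem finish_key (ρ : Rules D.l) (i c2 e) (w : World D) :
    (w.finish ρ i c2 e).2.key = w.key := by
  unfold finish finishTagIdeal
  cases ρ.ideal with
  | none => exact finishTag_key _ _ _ _
  | some c =>
    dsimp only
    split_ifs
    · split <;> rfl
    · exact finishTag_key _ _ _ _

theorem corrupt_key (ρ : Rules D.l) (i) (w : World D) : (w.corrupt ρ i).2.key = w.key := by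
  unfold corrupt
  dsimp only
  split_ifs <;> rfl

theorem initReader_key (s c1) (w : World D) : (w.initReader s c1).2.key = w.key := by
  unfold initReader
  split <;> rfl

/-- Because keys never change, a function fixed at setup as that of tag `c` remains the right one
during the whole attack. -/
theorem answer_key (ρ : Rules D.l) (w : World D) (p : AttackPort) (x : (D.Ifc F).In p → Bool)
    (r : Coins D) (y) : (answer F ρ w p x r y).2.key = w.key := by
  cases p <;> unfold answer <;> dsimp only <;> split
  · exact initReader_key _ _ _
  · rfl
  · exact start_key _ _ _ _ _ _ _
  · rfl
  · exact send_key _ _ _ _ _ _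
  · rfl
  · exact finish_key _ _ _ _ _
  · rfl
  · exact corrupt_key _ _ _
  · rfl

/-- Tag `c` is corrupted in both states, and it has been involved in the same frauds. -/
def Lost (c : Fin D.l) (w w' : World D) : Prop :=
  w'.corrupted c = true ∧ w.corrupted c = true ∧
    w'.tagFooled c = w.tagFooled c ∧ w'.readerFooled c = w.readerFooled c

/-- A fraud is charged only to a tag that is uncorrupted at that moment, so the flags of a corrupted
tag are frozen, whatever values `y` the functions take. -/
theorem answer_lost {ρ : Rules D.l} (hρ : ρ.ideal = none) {w : World D} {c : Fin D.l}
    (h : w.corrupted c = true) (p : AttackPort) (x : (D.Ifc F).In p → Bool)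
    (r : Coins D) (y) : Lost c w (answer F ρ w p x r y).2 := by
  have h0 : Lost c w w := ⟨h, h, rfl, rfl⟩
  cases p with
  | initReader =>
    unfold answer
    dsimp only
    split
    · unfold initReader
      split <;> exact h0
    · exact h0
  | startTag =>
    unfold answer start
    rw [hρ]
    dsimp only
    split <;> exact h0
  | sendReader =>
    unfold answer send
    rw [hρ]
    dsimp only
    split
    · unfold sendReader
      split
      · split
        · exact h0
        · rename_i i _
          refine ⟨h, h, ?_, rfl⟩
          unfold accept
          by_cases hi : c = i
          · subst hi; simp [h]
          · simp [hi]
      · exact h0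
    · exact h0
  | finishTag =>
    unfold answer finish
    rw [hρ]
    dsimp only
    split
    · rename_i i _
      unfold finishTag
      split
      · refine ⟨h, h, rfl, ?_⟩
        by_cases hi : c = i
        · subst hi; simp [h]
        · simp [hi]
      · exact h0
    · exact h0
  | corrupt =>
    unfold answer
    dsimp only
    split
    · rename_i i _
      unfold corrupt
      dsimp only
      split_ifs
      · exact h0
      · refine ⟨?_, h, rfl, rfl⟩
        by_cases hi : c = i
        · subst hi; simp
        · simp [hi, h]
    · exact h0

/-- The relation between the real game and the game in which the corruption of `c` reveals
nothing. -/
def Hides (c : Fin D.l) (key : Fin D.l → BitVec D.lk) (x y : Memory × World D) : Prop :=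
  (x = y ∧ x.2.key = key) ∨ Lost c x.2 y.2

theorem tagEv_key {key : Fin D.l → BitVec D.lk} {c : Fin D.l} :
    tagEv F c (F (key c)) key = realEv F key := by
  funext j
  unfold tagEv
  split_ifs with h
  · rw [h]
  · rfl

/-- The two sets of rules differ only in the call that corrupts `c`, and this call leaves `c`
corrupted on both sides. -/
theorem answer_hidden (c : Fin D.l) (w : World D) (p : AttackPort) (x : (D.Ifc F).In p → Bool)
    (r : Coins D) (y) :
    answer F ⟨none, none, true⟩ w p x r y = answer F ⟨none, some c, true⟩ w p x r y ∨
      Lost c (answer F ⟨none, none, true⟩ w p x r y).2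
        (answer F ⟨none, some c, true⟩ w p x r y).2 := by
  cases p with
  | corrupt =>
    unfold answer
    dsimp only
    cases select (n := D.l) x with
    | none => exact Or.inl rfl
    | some i =>
      by_cases h : c = i
      · subst h
        right
        refine ⟨?_, ?_, ?_, ?_⟩ <;> simp [corrupt]
      · left
        simp [corrupt, h]
  | _ => exact Or.inl rfl

/-- The two runs agree until `c` is corrupted. Afterwards the adversary may behave differently, but
nothing that is counted for `c` can change any more. -/
theorem run_hidden (c : Fin D.l) (key : Fin D.l → BitVec D.lk) (A : Circuit (D.Ifc F))
    {x y : Memory × World D} (h : Hides c key x y) :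
    Coupled (Hides c key) (A.run (oracle F ⟨none, none, true⟩ (realEv F)) x)
      (A.run (oracle F ⟨none, some c, true⟩ (tagEv F c (F (key c)))) y) := by
  refine run_coupled A ?_ h
  rintro i - ⟨mem, w⟩ ⟨mem', w'⟩ hR
  cases i with
  | gate g =>
    refine Coupled.pure ?_
    rcases hR with ⟨h1, h2⟩ | hR
    · obtain ⟨rfl, rfl⟩ := Prod.mk.injEq .. ▸ h1
      exact Or.inl ⟨rfl, h2⟩
    · exact Or.inr hR
  | flip d =>
    refine Coupled.bind_same fun b => Coupled.pure ?_
    rcases hR with ⟨h1, h2⟩ | hR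
    · obtain ⟨rfl, rfl⟩ := Prod.mk.injEq .. ▸ h1
      exact Or.inl ⟨rfl, h2⟩
    · exact Or.inr hR
  | query p inp out =>
    refine Coupled.bind (R := fun u v => (u = v ∧ mem = mem' ∧ u.2.key = key) ∨ Lost c u.2 v.2)
      (Coupled.map (Coupled.refl (coins D)) ?_) ?_
    · rintro r _ rfl
      rcases hR with ⟨h1, h2⟩ | ⟨h1, h2, h3, h4⟩
      · obtain ⟨rfl, rfl⟩ := Prod.mk.injEq .. ▸ h1
        change w.key = key at h2
        have hev : tagEv F c (F (key c)) w.key = realEv F w.key := by rw [h2]; exact tagEv_key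
        rw [hev]
        rcases answer_hidden (F := F) c w p (fun i => mem (inp i)) r
          (evals (realEv F w.key) w p (fun i => mem (inp i)) r) with h | h
        · exact Or.inl ⟨h, rfl, (answer_key _ _ _ _ _ _).trans h2⟩
        · exact Or.inr h
      · right
        obtain ⟨h1', _, h3', h4'⟩ := answer_lost (F := F) (ρ := ⟨none, none, true⟩) rfl h2 p
          (fun i => mem (inp i)) r (evals (realEv F w.key) w p (fun i => mem (inp i)) r)
        obtain ⟨h5, h6, h7, h8⟩ := answer_lost (F := F) (ρ := ⟨none, some c, true⟩) rfl h1 p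
          (fun i => mem' (inp i)) r
          (evals (tagEv F c (F (key c)) w'.key) w' p (fun i => mem' (inp i)) r)
        exact ⟨h5, h1', h7.trans (h3.trans h3'.symm), h8.trans (h4.trans h4'.symm)⟩
    · rintro ⟨a, u⟩ ⟨b, v⟩ h
      refine Coupled.pure ?_
      rcases h with ⟨h1, rfl, h2⟩ | h
      · obtain ⟨rfl, rfl⟩ := Prod.mk.injEq .. ▸ h1
        exact Or.inl ⟨rfl, h2⟩
      · exact Or.inr h

/-- In the guessing stage the challenge tag is hidden in the experiment itself. Only the description
of its function has to be changed, which is possible as its key is constant. -/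
theorem run_tagEv (ρ : Rules D.l) (c : Fin D.l) (key : Fin D.l → BitVec D.lk)
    (A : Circuit (D.Ifc F)) (x : Memory × World D) (hx : x.2.key = key) :
    Coupled (fun x y => x = y ∧ x.2.key = key) (A.run (oracle F ρ (realEv F)) x)
      (A.run (oracle F ρ (tagEv F c (F (key c)))) x) := by
  refine run_coupled A ?_ ⟨rfl, hx⟩
  rintro i - ⟨mem, w⟩ _ ⟨rfl, hR⟩
  cases i with
  | gate g => exact Coupled.pure ⟨rfl, hR⟩
  | flip d => exact Coupled.bind_same fun b => Coupled.pure ⟨rfl, hR⟩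
  | query p inp out =>
    change w.key = key at hR
    refine Coupled.bind (R := fun u v => u = v ∧ u.2.key = key)
      (Coupled.map (Coupled.refl (coins D)) ?_) ?_
    · rintro r _ rfl
      have hev : tagEv F c (F (key c)) w.key = realEv F w.key := by rw [hR]; exact tagEv_key
      rw [hev]
      exact ⟨rfl, (answer_key _ _ _ _ _ _).trans hR⟩
    · rintro ⟨a, u⟩ _ ⟨rfl, h⟩
      exact Coupled.pure ⟨rfl, h⟩

/-- The tag `c` has been chosen and is not corrupted. -/
def chose (c : Fin D.l) (mem : Memory) (w : World D) : Bool :=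
  decide (select (fun i : Fin D.l => mem i) = some c) && !w.corrupted c

/-- The rules for the tag `c` in the second stage. -/
def stage2 (c : Fin D.l) (ideal : Bool) : Rules D.l :=
  ⟨if ideal then some c else none, some c, false⟩

/-- The state in which the second stage starts. -/
def switch (c : Fin D.l) (ideal : Bool) (w : World D) : World D :=
  if ideal then w.forget c else w

/-- The probability that `out` holds at the end of an attack in two stages, when the function of
tag `c` is `f`. -/
def tagExp (F : D.Family) (c : Fin D.l) (A₁ A₂ : Circuit (D.Ifc F)) (ideal : Bool)
    (out : Bool → Memory → World D → Bool) (f : D.Fn) (k : BitVec D.lk) : ℝ≥0∞ :=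
  expect (coins D) fun r =>
    expect (A₁.run (oracle F ⟨none, some c, true⟩ (tagEv F c f))
        (blank, init (Function.update r.key c k))) fun x =>
      expect (A₂.run (oracle F (stage2 c ideal) (tagEv F c f)) (x.1, switch c ideal x.2)) fun y =>
        ind (out (chose c x.1 x.2) y.1 y.2)

/-- The guess of the adversary counts if the tag `c` has been chosen. -/
def guess (ok : Bool) (mem : Memory) (_ : World D) : Bool := ok && mem 0

theorem expect_init (Φ : Game (D.sys F) D.m → ℝ≥0∞) :
    expect (Game.init (D.sys F) D.m) Φ = expect (coins D) (fun r => Φ ((init r.key).toGame F)) := by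
  rw [expect_coins_key (fun key => Φ ((init key).toGame F))]
  unfold Game.init
  refine (expect_bind _ _ _).trans
    ((expect_bind (PMF.uniformOfFintype (Fin D.l → Fin D.lk → Bool)) _ _).trans ?_)
  congr 1
  funext keys
  refine (expect_pure _ _).trans ((expect_pure _ _).trans ?_)
  refine congrArg Φ ?_
  unfold toGame
  congr 1
  · exact (decide_eq_false (by simp [init])).symm
  · exact (decide_eq_false (by simp [init])).symm

/-- The key of `c` is separated from the other keys, in order to become the key of the PRF
experiment. -/
theorem expect_coins_update (c : Fin D.l) (g : (Fin D.l → BitVec D.lk) → ℝ≥0∞) :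
    expect (coins D) (fun r => g r.key) =
      expect (uniformBits D.lk) (fun k =>
        expect (coins D) (fun r => g (Function.update r.key c k))) := by
  rw [expect_coins_key, expect_uniform_update c, uniformBits, expect_map]
  congr 1
  funext k
  rw [expect_coins_key (fun key => g (Function.update key c (ofWires k)))]
  congr 1
  funext f
  congr 1
  funext j
  by_cases h : j = c
  · subst h; simp
  · simp [h]

/-- The real attack seen from tag `c`. -/
theorem expect_hidden (c : Fin D.l) (A : Circuit (D.Ifc F)) (g : Memory × World D → ℝ≥0∞)
    (g' : BitVec D.lk → Memory × World D → ℝ≥0∞)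
    (hg : ∀ key x y, Hides c key x y → g x = g' (key c) y) :
    expect (coins D) (fun r => expect (A.run (oracle F ⟨none, none, true⟩ (realEv F))
        (blank, init r.key)) g) =
      expect (uniformBits D.lk) (fun k => expect (coins D) (fun r =>
        expect (A.run (oracle F ⟨none, some c, true⟩ (tagEv F c (F k)))
          (blank, init (Function.update r.key c k))) (g' k))) := by
  rw [expect_coins_update c (fun key => expect (A.run (oracle F ⟨none, none, true⟩ (realEv F))
        (blank, init key)) g)]
  congr 1
  funext k
  congr 1
  funext r
  have := run_hidden c (Function.update r.key c k) A
    (x := (blank, init (Function.update r.key c k))) (Or.inl ⟨rfl, rfl⟩)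
  rw [Function.update_self] at this
  refine this.expect_eq fun x y h => ?_
  rw [hg _ x y h, Function.update_self]

theorem expect_real (A : Circuit (D.Ifc F)) (g : Memory × Game (D.sys F) D.m → ℝ≥0∞) :
    expect (Game.init (D.sys F) D.m) (fun g₀ =>
      expect (A.run (realHandlers (D.sys F) D.m).oracle (blank, g₀)) g) =
    expect (coins D) (fun r => expect (A.run (oracle F ⟨none, none, true⟩ (realEv F))
        (blank, init r.key)) (fun x => g (x.1, x.2.toGame F))) := by
  rw [expect_init]
  congr 1
  funext r
  refine ((simulates_real true).run A blank (init r.key)).expect_eq ?_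
  rintro _ y rfl
  rfl

/-- Frauds are counted separately for each tag. -/
theorem expect_fraud_le (A : Circuit (D.Ifc F)) (π : Game (D.sys F) D.m → Bool)
    (flag : World D → Fin D.l → Bool)
    (hπ : ∀ w, π (w.toGame F) = decide (∃ i, flag w i = true))
    (hflag : ∀ c w w', Lost c w w' → flag w c = flag w' c) :
    expect (Game.init (D.sys F) D.m) (fun g₀ =>
      expect (A.run (realHandlers (D.sys F) D.m).oracle (blank, g₀)) (fun x : Memory × Game (D.sys F) D.m => ind (π x.2))) ≤
    ∑ c : Fin D.l, expect (uniformBits D.lk) (fun k =>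
        tagExp F c A [] false (fun _ _ w => flag w c) (F k) k) := by
  rw [expect_real]
  -- A union bound over the tags.
  have h2 : ∀ w : World D, ind (π (w.toGame F)) ≤ ∑ c : Fin D.l, ind (flag w c) := by
    intro w
    rw [hπ]
    by_cases h : ∃ i, flag w i = true
    · obtain ⟨i, hi⟩ := h
      calc ind _ ≤ 1 := ind_le_one _
        _ = ind (flag w i) := by rw [hi]; rfl
        _ ≤ _ := Finset.single_le_sum (f := fun c => ind (flag w c))
          (fun _ _ => zero_le) (Finset.mem_univ i)
    · simp [h]
  refine (expect_mono _ fun r => expect_mono _ fun x : Memory × World D => h2 x.2).trans ?_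
  simp only [expect_finset_sum]
  refine (Finset.sum_congr rfl fun c _ => ?_).le
  rw [expect_hidden c A (fun x => ind (flag x.2 c)) (fun _ x => ind (flag x.2 c))]
  · congr 1
    funext k
    unfold tagExp
    congr 1
    funext r
    congr 1
    funext x
    -- The second stage is the empty circuit and leaves the state as it is.
    change _ = expect (pure (x.1, switch c false x.2)) (fun y : Memory × World D => ind (flag y.2 c))
    rw [expect_pure]
    rfl
  · rintro key x y (⟨rfl, -⟩ | h)
    · rfl
    · rw [hflag _ _ _ h]

theorem authExp_fst_le (A : Circuit (D.Ifc F)) :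
    ((authExp (D.sys F) D.m A).map Prod.fst) true ≤ ∑ c : Fin D.l,
      expect (uniformBits D.lk) (fun k =>
        tagExp F c A [] false (fun _ _ w => w.tagFooled c) (F k) k) := by
  refine le_trans (le_of_eq ?_) (expect_fraud_le A (fun g => g.tagImpersonated)
    (fun w c => w.tagFooled c) (fun _ => rfl) (fun c w w' h => h.2.2.1.symm))
  rw [apply_true, expect_map]
  refine (expect_bind _ _ _).trans ?_
  congr 1
  funext g₀
  refine (expect_bind _ _ _).trans ?_
  congr 1
  funext x
  exact expect_pure _ _

theorem authExp_snd_le (A : Circuit (D.Ifc F)) :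
    ((authExp (D.sys F) D.m A).map Prod.snd) true ≤ ∑ c : Fin D.l,
      expect (uniformBits D.lk) (fun k =>
        tagExp F c A [] false (fun _ _ w => w.readerFooled c) (F k) k) := by
  refine le_trans (le_of_eq ?_) (expect_fraud_le A (fun g => g.readerImpersonated)
    (fun w c => w.readerFooled c) (fun _ => rfl) (fun c w w' h => h.2.2.2.symm))
  rw [apply_true, expect_map]
  refine (expect_bind _ _ _).trans ?_
  congr 1
  funext g₀
  refine (expect_bind _ _ _).trans ?_
  congr 1
  funext x
  exact expect_pure _ _

theorem db_forget (w : World D) (c : Fin D.l) :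
    (w.forget c).db F = Function.update (w.db F) c none := by
  funext j
  by_cases h : j = c
  · subst h; simp [db, forget]
  · simp [db, forget, h]

theorem toGame_forget (w : World D) (c : Fin D.l) :
    toGame F (w.forget c) = (toGame F w).forget c := by
  exact congrArg (fun t => { toGame F w with db := t }) (db_forget w c)

/-- The second stage of the privacy experiment with challenge tag `c`. -/
def stage (S : RFIDSystem) (m : ℕ) (A₂ : Attack S m) (b : Bool) (mem : Memory) (g : Game S m)
    (c : Fin S.numTags) : PMF (Memory × Game S m) :=
  if b then A₂.run (realChallenge S m c).oracle (mem, g)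
  else A₂.run (randomChallenge S m c).oracle (mem, g.forget c)

theorem expect_stage (A₂ : Circuit (D.Ifc F)) (b : Bool) (mem : Memory) (w : World D)
    (c : Fin D.l) (g : Memory → ℝ≥0∞) :
    expect (stage (D.sys F) D.m A₂ b mem (w.toGame F) c) (fun y => g y.1) =
      expect (A₂.run (oracle F (stage2 c !b) (realEv F)) (mem, switch c (!b) w))
        (fun y => g y.1) := by
  cases b with
  | true =>
    refine ((simulates_realChallenge c).run A₂ mem w).expect_eq ?_
    rintro _ y rfl
    rfl
  | false =>
    change expect (A₂.run (randomChallenge (D.sys F) D.m c).oracle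
      (mem, (w.toGame F).forget c)) _ = _
    rw [← toGame_forget]
    refine ((simulates_randomChallenge c).run A₂ mem (w.forget c)).expect_eq ?_
    rintro _ y rfl
    rfl

/-- For every run at most one tag is chosen, and without an uncorrupted choice the result is `0`; so
the result is the sum over `c` of the events that `c` was chosen uncorrupted and the guess is `1`.
Each summand is an experiment for a tag fixed in advance, so nothing is lost by guessing the
challenge tag. -/
theorem unpExp_eq (A₁ A₂ : Circuit (D.Ifc F)) (b : Bool) :
    unpExp (D.sys F) D.m A₁ A₂ b true = ∑ c : Fin D.l,
      expect (uniformBits D.lk) (fun k => tagExp F c A₁ A₂ (!b) guess (F k) k) := by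
  let V (c : Fin D.l) (x : Memory × World D) : ℝ≥0∞ :=
    ind (chose c x.1 x.2) * expect (A₂.run (oracle F (stage2 c !b) (realEv F))
      (x.1, switch c (!b) x.2)) (fun y => ind (y.1 0))
  have h1 : unpExp (D.sys F) D.m A₁ A₂ b true = expect (coins D) (fun r =>
      expect (A₁.run (oracle F ⟨none, none, true⟩ (realEv F)) (blank, init r.key))
        (fun x => ∑ c : Fin D.l, V c x)) := by
    rw [apply_true]
    refine (expect_bind _ _ _).trans ?_
    refine Eq.trans ?_ (expect_real A₁ (fun x => expect (match chosenTag (D.sys F) x.1 with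
      | none => pure false
      | some c => if x.2.corrupted c then pure false
          else stage (D.sys F) D.m A₂ b x.1 x.2 c >>= fun y => pure (y.1 0)) ind)) |>.trans ?_
    · congr 1
      funext g₀
      refine (expect_bind _ _ _).trans ?_
      congr 1
      funext ⟨mem, g⟩
      dsimp only
      cases chosenTag (D.sys F) mem with
      | none => rfl
      | some c =>
        dsimp only
        cases b <;> rfl
    · congr 1
      funext r
      congr 1
      funext ⟨mem, w⟩
      dsimp only
      have e : chosenTag (D.sys F) mem = select (fun i : Fin D.l => mem i) := rfl
      rw [e]
      simp only [V, chose]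
      cases hs : select (fun i : Fin D.l => mem i) with
      | none =>
        dsimp only
        rw [expect_pure]
        simp
      | some c =>
        dsimp only
        rw [Finset.sum_eq_single c]
        · have e' : (toGame F w).corrupted c = w.corrupted c := rfl
          cases hc : w.corrupted c with
          | true =>
            refine (congrArg (expect · ind) (if_pos (e'.trans hc))).trans ?_
            rw [expect_pure]
            simp
          | false =>
            refine (congrArg (expect · ind) (if_neg (by rw [e', hc]; simp))).trans ?_
            refine (expect_bind _ _ _).trans ?_
            simp only [expect_pure]
            refine (expect_stage A₂ b mem w c (fun mem => ind (mem 0))).trans ?_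
            simp
        · intro c' _ hc'
          simp [Ne.symm hc']
        · simp
  rw [h1]
  simp only [expect_finset_sum]
  refine Finset.sum_congr rfl fun c _ => ?_
  rw [expect_hidden c A₁ (V c) (fun k x => expect (A₂.run (oracle F (stage2 c !b) (tagEv F c (F k)))
      (x.1, switch c (!b) x.2)) (fun y => ind (guess (chose c x.1 x.2) y.1 y.2)))]
  · rfl
  · rintro key x y (⟨rfl, hk⟩ | h)
    · simp only [V, guess]
      cases chose c x.1 x.2 with
      | false => simp [expect_const]
      | true =>
        simp only [ind_true, one_mul, Bool.true_and]
        refine (run_tagEv (stage2 c !b) c key A₂ (x.1, switch c (!b) x.2) ?_).expect_eq ?_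
        · rw [← hk]
          unfold switch
          split_ifs <;> rfl
        · rintro u _ ⟨rfl, -⟩
          rfl
    -- Once `c` has been corrupted, its summand vanishes on both sides.
    · have h3 : chose c x.1 x.2 = false := by simp [chose, h.2.1]
      have h4 : chose c y.1 y.2 = false := by simp [chose, h.1]
      simp [V, guess, h3, h4, expect_const]

end World

end RFID

end

noncomputable section

namespace RFID

open scoped ENNReal

/-! ### Approximate equality of probabilities -/

/-- The numbers `a` and `b` differ by at most `ε`. -/
def Near (ε a b : ℝ≥0∞) : Prop := a ≤ b + ε ∧ b ≤ a + ε

namespace Near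

variable {ε ε' a b c : ℝ≥0∞}

theorem refl (ε a : ℝ≥0∞) : Near ε a a := ⟨le_self_add, le_self_add⟩

theorem symm (h : Near ε a b) : Near ε b a := ⟨h.2, h.1⟩

theorem mono (h : Near ε a b) (hε : ε ≤ ε') : Near ε' a b :=
  ⟨h.1.trans (by gcongr), h.2.trans (by gcongr)⟩

theorem trans (h : Near ε a b) (h' : Near ε' b c) : Near (ε + ε') a c := by
  constructor
  · calc a ≤ b + ε := h.1
      _ ≤ c + ε' + ε := by gcongr; exact h'.1
      _ = c + (ε + ε') := by ring
  · calc c ≤ b + ε' := h'.2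
      _ ≤ a + ε + ε' := by gcongr; exact h.2
      _ = a + (ε + ε') := by ring

theorem of_le_one (ha : a ≤ 1) (hb : b ≤ 1) (hε : 1 ≤ ε) : Near ε a b :=
  ⟨(ha.trans hε).trans le_add_self, (hb.trans hε).trans le_add_self⟩

/-- The error may depend on the sample: `δ` is the constant part, which comes from the rest of the
attack, and `B` the part that is averaged, for instance the indicator of a bad event. -/
theorem expect {α : Type} {μ : PMF α} {g h B : α → ℝ≥0∞} {δ : ℝ≥0∞}
    (H : ∀ x ∈ μ.support, Near (δ + B x) (g x) (h x)) :
    Near (δ + RFID.expect μ B) (RFID.expect μ g) (RFID.expect μ h) := by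
  constructor
  · refine (expect_mono_support μ fun x hx => (H x hx).1).trans ?_
    rw [expect_add, expect_add, expect_const]
  · refine (expect_mono_support μ fun x hx => (H x hx).2).trans ?_
    rw [expect_add, expect_add, expect_const]

theorem expect_const {α : Type} {μ : PMF α} {g h : α → ℝ≥0∞} {δ : ℝ≥0∞}
    (H : ∀ x, Near δ (g x) (h x)) :
    Near δ (RFID.expect μ g) (RFID.expect μ h) := by
  have := Near.expect (μ := μ) (g := g) (h := h) (B := fun _ => 0) (δ := δ)
    (fun x _ => by simpa using H x)
  simpa [RFID.expect_const] using this

end Near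

/-- The probability of a bit string of length `n`. -/
def atom (n : ℕ) : ℝ≥0∞ := ((2 ^ n : ℕ) : ℝ≥0∞)⁻¹

theorem expect_bits_sum (n : ℕ) (g : BitVec n → ℝ≥0∞) :
    expect (uniformBits n) g = atom n * ∑ a, g a := by
  rw [expect_uniformBits, expect_uniform, card_bitVec, atom]

theorem expect_bits_mem {n : ℕ} (s : Finset (BitVec n)) :
    expect (uniformBits n) (fun a => if a ∈ s then 1 else 0) = s.card * atom n := by
  rw [expect_bits_sum, mul_comm]
  simp

/-- Two expectations whose integrands are close outside of a small set. -/
theorem near_bits {n : ℕ} (s : Finset (BitVec n)) {g h B : BitVec n → ℝ≥0∞} {δ : ℝ≥0∞}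
    (hg : ∀ a, g a ≤ 1) (hh : ∀ a, h a ≤ 1) (H : ∀ a, a ∉ s → Near (δ + B a) (g a) (h a)) :
    Near (δ + (s.card * atom n + expect (uniformBits n) B))
      (expect (uniformBits n) g) (expect (uniformBits n) h) := by
  rw [← expect_bits_mem, ← expect_add]
  refine Near.expect fun a _ => ?_
  by_cases ha : a ∈ s
  · refine Near.of_le_one (hg a) (hh a) ?_
    simp only [ha, if_true]
    exact le_self_add.trans le_add_self
  · simpa [ha] using H a ha

theorem near_bits' {n : ℕ} (s : Finset (BitVec n)) {g h : BitVec n → ℝ≥0∞} {δ : ℝ≥0∞}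
    (hg : ∀ a, g a ≤ 1) (hh : ∀ a, h a ≤ 1) (H : ∀ a, a ∉ s → Near δ (g a) (h a)) :
    Near (δ + s.card * atom n) (expect (uniformBits n) g) (expect (uniformBits n) h) := by
  have := near_bits s (B := fun _ => 0) hg hh (by simpa using H)
  simpa [expect_const] using this

/-! ### Partially revealed random functions -/

variable {D : Dims} {F : D.Family}

/-- A uniformly random function. -/
def randFn (D : Dims) : PMF D.Fn := PMF.uniformOfFintype (BitVec D.ld → BitVec D.lr)

/-- The function `f`, overridden by the values that have been revealed. -/
def patch (Q : BitVec D.ld → Option (BitVec D.lr)) (f : D.Fn) : D.Fn := fun x => (Q x).getD (f x)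

theorem patch_of_eq {Q : BitVec D.ld → Option (BitVec D.lr)} {x y} (h : Q x = some y) (f : D.Fn) :
    patch Q f x = y := by
  simp [patch, h]

theorem patch_update (Q : BitVec D.ld → Option (BitVec D.lr)) (x y) (f : D.Fn) :
    patch (Function.update Q x (some y)) f x = y := by
  simp [patch]

/-- Reveal the value at `u`. -/
theorem expect_reveal {Q : BitVec D.ld → Option (BitVec D.lr)} {u : BitVec D.ld} (hu : Q u = none)
    (g : D.Fn → ℝ≥0∞) :
    expect (randFn D) (fun f => g (patch Q f)) =
      expect (uniformBits D.lr) (fun y =>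
        expect (randFn D) (fun f => g (patch (Function.update Q u (some y)) f))) := by
  rw [expect_uniformBits]
  refine (expect_uniform_update u _).trans ?_
  congr 1
  funext y
  congr 1
  funext f
  congr 1
  funext x
  by_cases h : x = u
  · subst h; simp [patch, hu]
  · simp [patch, h]

/-- A value that has not been revealed is still uniform, so it is guessed with probability `2 ^
(-lr)`. -/
theorem expect_reveal_eq {Q : BitVec D.ld → Option (BitVec D.lr)} {u : BitVec D.ld}
    (hu : Q u = none) (a : BitVec D.lr) :
    expect (randFn D) (fun f => ind (decide (patch Q f u = a))) = atom D.lr := by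
  rw [expect_reveal hu (fun f => ind (decide (f u = a)))]
  simp only [patch_update, expect_const]
  rw [← one_mul (atom D.lr)]
  have := expect_bits_mem ({a} : Finset (BitVec D.lr))
  simpa [ind] using this

/-! ### Parsing -/

theorem append_eq_append {n k : ℕ} {a a' : BitVec n} {b b' : BitVec k} (h : a ++ b = a' ++ b') :
    a = a' ∧ b = b' := by
  constructor
  · have := congrArg (fun z => z.extractLsb' k n) h
    simpa only [BitVec.extractLsb'_append_eq_left] using this
  · have := congrArg (fun z => z.extractLsb' 0 k) h
    simpa only [BitVec.extractLsb'_append_eq_right] using this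

theorem cast_injective {n k : ℕ} (h : n = k) {a b : BitVec n} (hab : a.cast h = b.cast h) :
    a = b := by
  subst h
  exact hab

theorem mac_injective {c1 c1' x x' r r'} (h : D.mac c1 x r = D.mac c1' x' r') :
    c1 = c1' ∧ x = x' ∧ r = r' := by
  unfold Dims.mac at h
  have h1 := append_eq_append (cast_injective _ h)
  have h2 := append_eq_append h1.1
  exact ⟨h2.1, h2.2, h1.2⟩

theorem idx_injective {k k' : BitVec D.lr} (h : D.idx k = D.idx k') : k = k' :=
  (append_eq_append (cast_injective _ h)).1

theorem α11_append (a : BitVec D.lr) (r : BitVec D.lv) (b : BitVec D.lr) :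
    α11 (a ++ r ++ b : BitVec D.lA) = a := by
  unfold α11
  ext i hi
  have h1 : ¬ D.lv + D.lr + i < D.lr := by omega
  have h2 : ¬ D.lv + D.lr + i - D.lr < D.lv := by omega
  have h3 : D.lv + D.lr + i - D.lr - D.lv = i := by omega
  simp [BitVec.getElem_extractLsb', BitVec.getLsbD_append, h1, h2, h3, hi]

theorem α12_append (a : BitVec D.lr) (r : BitVec D.lv) (b : BitVec D.lr) :
    α12 (a ++ r ++ b : BitVec D.lA) = r := by
  unfold α12
  ext i hi
  simp [BitVec.getElem_extractLsb', BitVec.getLsbD_append, hi]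

theorem α13_append (a : BitVec D.lr) (r : BitVec D.lv) (b : BitVec D.lr) :
    α13 (a ++ r ++ b : BitVec D.lA) = b := by
  unfold α13
  ext i hi
  simp [BitVec.getElem_extractLsb', BitVec.getLsbD_append, hi]

theorem append_α (α : BitVec D.lA) : (α11 α ++ α12 α ++ α13 α : BitVec D.lA) = α := by
  apply BitVec.eq_of_getLsbD_eq
  intro i hi
  unfold α11 α12 α13
  simp only [BitVec.getLsbD_append, BitVec.getLsbD_extractLsb']
  by_cases h1 : i < D.lr
  · simp [h1]
  · by_cases h2 : i - D.lr < D.lv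
    · simp only [h1, h2, decide_true, decide_false, Bool.true_and, if_true, if_false]
      congr 1; omega
    · have h3 : i - D.lr - D.lv < D.lr := by omega
      simp only [h1, h2, h3, decide_true, decide_false, Bool.true_and, if_false]
      congr 1; omega

/-- A uniform `α₁` and its components. -/
theorem expect_α (k : BitVec D.lr) (g : BitVec D.lA → ℝ≥0∞) :
    expect (uniformBits D.lA) g = expect (uniformBits D.lv) (fun r =>
      expect (uniformBits D.lr) (fun a => expect (uniformBits D.lr) (fun b =>
        g (a ++ r ++ (b ^^^ k))))) := by
  let e : BitVec D.lv × BitVec D.lr × BitVec D.lr ≃ BitVec D.lA :=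
    { toFun := fun x => x.2.1 ++ x.1 ++ (x.2.2 ^^^ k)
      invFun := fun α => (α12 α, α11 α, α13 α ^^^ k)
      left_inv := by
        rintro ⟨r, a, b⟩
        simp [α11_append, α12_append, α13_append]
      right_inv := by
        intro α
        simp [append_α] }
  simp only [expect_uniformBits]
  rw [← expect_uniform_equiv e, expect_uniform_prod]
  congr 1
  funext r
  rw [expect_uniform_prod]
  rfl

end RFID

end

/-! ### The state without the secrets of one tag -/

noncomputable section

namespace RFID

open scoped ENNReal

variable {D : Dims} {F : D.Family}

namespace World

/-- Delete everything that the sessions of tag `c` depend on. -/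
def erase (c : Fin D.l) (w : World D) : World D :=
  { w with ctr := Function.update w.ctr c 0
           c1 := Function.update w.c1 c 0
           rT := Function.update w.rT c 0
           recCtr := Function.update w.recCtr c none }

/-- The arguments at which the function of `j` is evaluated involve only the state of `j`, the
sessions of the reader and the call, none of which is touched by erasing another tag. -/
theorem evals_erase (c : Fin D.l) (w : World D) (key) (f f' : D.Fn) (p : AttackPort)
    (x : (D.Ifc F).In p → Bool) (r : Coins D) (t : Fin 4) {j : Fin D.l} (hj : j ≠ c) :
    evals (tagEv F c f key) w p x r t j = evals (tagEv F c f' key) (w.erase c) p x r t j := by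
  have h0 : ∀ t y y', y j = y' j →
      rounds (F := F) w p x r t y j = rounds (F := F) (w.erase c) p x r t y' j := by
    intro t y y' hy
    cases p with
    | startTag => simp [rounds, erase, hj, hy]
    | sendReader =>
      unfold rounds
      dsimp only
      split
      · rfl
      · simp only [hy, readerArgs, readerNonce, erase]
        simp [hj]
    | finishTag => simp [rounds, erase, hj]
    | _ => rfl
  unfold evals
  have h1 : tagEv F c f key j = tagEv F c f' key j := by simp [tagEv, hj]
  rw [h1, h0 t _ _ (by rw [h1, h0 0 _ _ rfl])]

theorem hit1_erase {c j : Fin D.l} (hj : j ≠ c) (w : World D) (α) {b b' ix ix' : Fin D.l → _}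
    (hb : b j = b' j) (hi : ix j = ix' j) :
    w.hit1 α b ix j = (w.erase c).hit1 α b' ix' j := by
  simp [hit1, erase, hj, hb, hi]

theorem hit2_erase {c j : Fin D.l} (hj : j ≠ c) (w : World D) (α) {ix ix' : Fin D.l → _}
    (hi : ix j = ix' j) : w.hit2 α ix j = (w.erase c).hit2 α ix' j := by
  simp [hit2, erase, hj, hi]

/-- If the search does not hit `c`, deleting the record of `c` does not change which record comes
first. -/
theorem found_erase {c : Fin D.l} (w : World D) (α) {y y' : Fin 4 → Fin D.l → BitVec D.lr}
    (hy : ∀ t j, j ≠ c → y t j = y' t j) (h1 : w.hit1 α (y 0) (y 2) c = false)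
    (h2 : w.hit2 α (y 1) c = false) : w.found α y = (w.erase c).found α y' := by
  unfold found
  congr 1
  · congr 1
    funext j
    by_cases hj : j = c
    · subst hj; rw [h1]; simp [hit1, erase]
    · exact hit1_erase hj w α (hy _ _ hj) (hy _ _ hj)
  · congr 1
    funext j
    by_cases hj : j = c
    · subst hj; rw [h2]; simp [hit2, erase]
    · exact hit2_erase hj w α (hy _ _ hj)

theorem select_some {n : ℕ} {f : Fin n → Bool} {i : Fin n} (h : select f = some i) : f i = true :=
  List.find?_some h

theorem select_none {n : ℕ} {f : Fin n → Bool} (h : select f = none) (i : Fin n) : f i = false := by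
  have := List.find?_eq_none.1 h i (List.mem_finRange i)
  simpa using this

theorem found_some {w : World D} {α y i} (h : w.found α y = some i) :
    w.hit1 α (y 0) (y 2) i = true ∨ w.hit2 α (y 1) i = true := by
  unfold found at h
  rw [Option.or_eq_some_iff] at h
  rcases h with h | ⟨-, h⟩
  · exact Or.inl (select_some h)
  · exact Or.inr (select_some h)

theorem found_erase_ne {c : Fin D.l} {w : World D} {α y i} (h : (w.erase c).found α y = some i) :
    i ≠ c := by
  rintro rfl
  rcases found_some h with h | h
  · simp [hit1, erase] at h
  · simp [hit2, erase] at h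

theorem sendReader_erase {c : Fin D.l} (w : World D) (s α)
    {y y' : Fin 4 → Fin D.l → BitVec D.lr} (hy : ∀ t j, j ≠ c → y t j = y' t j)
    (hf : w.found α y = (w.erase c).found α y') :
    (w.sendReader s α y).1 = ((w.erase c).sendReader s α y').1 ∧
      (w.sendReader s α y).2.erase c = ((w.erase c).sendReader s α y').2 := by
  unfold sendReader
  have hr : (w.erase c).reader s = w.reader s := rfl
  rw [hr]
  cases w.reader s with
  | waiting c1 =>
    dsimp only
    rw [hf]
    cases h : (w.erase c).found α y' with
    | none => exact ⟨rfl, rfl⟩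
    | some i =>
      have hi := found_erase_ne h
      dsimp only
      rw [hy 3 i hi, hy 0 i hi]
      refine ⟨rfl, ?_⟩
      unfold accept erase
      dsimp only
      rw [Function.update_comm hi]
  | _ => exact ⟨rfl, rfl⟩

theorem startTag_erase {c i : Fin D.l} (hi : i ≠ c) (w : World D) (c1 rT a b) :
    (w.startTag i c1 rT a b).1 = ((w.erase c).startTag i c1 rT a b).1 ∧
      (w.startTag i c1 rT a b).2.erase c = ((w.erase c).startTag i c1 rT a b).2 := by
  unfold startTag begin erase
  dsimp only
  rw [Function.update_of_ne hi]
  refine ⟨rfl, ?_⟩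
  rw [Function.update_comm hi _ 0 w.ctr, Function.update_comm hi c1 0 w.c1,
    Function.update_comm hi rT 0 w.rT]

theorem finishTag_erase {c : Fin D.l} (i : Fin D.l) (w : World D) (c2 e) :
    (w.finishTag i c2 e).1 = ((w.erase c).finishTag i c2 e).1 ∧
      (w.finishTag i c2 e).2.erase c = ((w.erase c).finishTag i c2 e).2 := by
  unfold finishTag
  have hr : (w.erase c).pending i = w.pending i := rfl
  rw [hr]
  cases w.pending i with
  | none => exact ⟨rfl, rfl⟩
  | some z => exact ⟨rfl, rfl⟩

theorem initReader_erase (c : Fin D.l) (w : World D) (s x) :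
    (w.initReader s x).1 = ((w.erase c).initReader s x).1 ∧
      (w.initReader s x).2.erase c = ((w.erase c).initReader s x).2 := by
  unfold initReader
  have hr : (w.erase c).reader s = w.reader s := rfl
  rw [hr]
  cases w.reader s <;> exact ⟨rfl, rfl⟩

theorem corrupt_erase {ρ ρ' : Rules D.l} {c : Fin D.l} (h : ρ.hidden = some c)
    (h' : ρ'.hidden = some c) (hm : ρ.marks = ρ'.marks) (w : World D) (i) :
    (w.corrupt ρ i).1 = ((w.erase c).corrupt ρ' i).1 ∧
      (w.corrupt ρ i).2.erase c = ((w.erase c).corrupt ρ' i).2 := by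
  unfold corrupt
  rw [h, h', hm]
  dsimp only
  by_cases hi : c = i
  · subst hi
    simp only [true_and, if_true]
    split_ifs <;> rfl
  · have hi' : i ≠ c := fun h => hi h.symm
    simp only [Option.some.injEq, hi, false_and, if_false]
    refine ⟨?_, rfl⟩
    simp [erase, hi']

/-! ### The ideal game does not use the secrets of the tag -/

/-- An ideal tag takes its messages from the coins, and its acceptance is read off from transcripts.
As its record is missing, no search can find it, and no update can restore the record. -/
theorem answer_ideal_erase (c : Fin D.l) (marks : Bool) (w : World D) (hw : w.recCtr c = none)
    (p : AttackPort) (x : (D.Ifc F).In p → Bool) (r : Coins D)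
    {y y' : Fin 4 → Fin D.l → BitVec D.lr} (hy : ∀ t j, j ≠ c → y t j = y' t j) :
    (answer F ⟨some c, some c, marks⟩ w p x r y).1 =
        (answer F ⟨some c, some c, marks⟩ (w.erase c) p x r y').1 ∧
      (answer F ⟨some c, some c, marks⟩ w p x r y).2.erase c =
        (answer F ⟨some c, some c, marks⟩ (w.erase c) p x r y').2 ∧
      (answer F ⟨some c, some c, marks⟩ w p x r y).2.recCtr c = none := by
  cases p <;> unfold answer <;> dsimp only <;> split
  · rename_i s _
    obtain ⟨h1, h2⟩ := initReader_erase c w s r.c1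
    refine ⟨by rw [h1], h2, ?_⟩
    unfold initReader
    split <;> exact hw
  · exact ⟨rfl, rfl, hw⟩
  · rename_i i _
    unfold start startTagIdeal
    dsimp only
    by_cases hi : i = c
    · simp only [hi, if_true]
      exact ⟨rfl, rfl, hw⟩
    · simp only [hi, if_false]
      rw [hy 0 i hi, hy 1 i hi]
      obtain ⟨h1, h2⟩ := startTag_erase hi w (ofWires fun b : Fin D.lu => x (.inr b)) r.rT
        (y' 0 i) (y' 1 i)
      refine ⟨by rw [h1], h2, hw⟩
  · exact ⟨rfl, rfl, hw⟩
  · rename_i s _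
    unfold send sendReaderIdeal
    dsimp only
    have hr : (w.erase c).reader s = w.reader s := rfl
    have hl : (w.erase c).log = w.log := rfl
    rw [hr, hl]
    cases h : w.reader s with
    | waiting c1 =>
      dsimp only
      split_ifs
      · exact ⟨rfl, rfl, hw⟩
      · have hf := found_erase w (ofWires fun b : Fin D.lA => x (.inr b)) hy
          (by simp [hit1, hw]) (by simp [hit2, hw])
        obtain ⟨h1, h2⟩ := sendReader_erase w s _ hy hf
        refine ⟨by rw [h1], h2, ?_⟩
        unfold sendReader
        rw [h]
        dsimp only
        rw [hf]
        split
        · exact hw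
        · rename_i i hi
          have := found_erase_ne hi
          simp [accept, this.symm, hw]
    | _ => exact ⟨rfl, rfl, hw⟩
  · exact ⟨rfl, rfl, hw⟩
  · rename_i i _
    unfold finish finishTagIdeal
    dsimp only
    by_cases hi : i = c
    · simp only [hi, if_true]
      have hr : (w.erase c).pending c = w.pending c := rfl
      rw [hr]
      cases w.pending c with
      | none => exact ⟨rfl, rfl, hw⟩
      | some z => exact ⟨rfl, rfl, hw⟩
    · simp only [hi, if_false]
      rw [hy 0 i hi]
      obtain ⟨h1, h2⟩ := finishTag_erase (c := c) i w (ofWires fun b : Fin D.lr => x (.inr b))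
        (y' 0 i)
      refine ⟨by rw [h1], h2, ?_⟩
      unfold finishTag
      split <;> exact hw
  · exact ⟨rfl, rfl, hw⟩
  · rename_i i _
    obtain ⟨h1, h2⟩ := corrupt_erase (ρ := ⟨some c, some c, marks⟩)
      (ρ' := ⟨some c, some c, marks⟩) rfl rfl rfl w i
    refine ⟨by rw [h1], h2, ?_⟩
    unfold corrupt
    dsimp only
    split_ifs <;> exact hw
  · exact ⟨rfl, rfl, hw⟩

theorem run_ideal_erase (c : Fin D.l) (marks : Bool) (f f' : D.Fn) (C : Circuit (D.Ifc F))
    (mem : Memory) (w : World D) (hw : w.recCtr c = none) :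
    Coupled (fun x y => y = (x.1, x.2.erase c) ∧ x.2.recCtr c = none)
      (C.run (oracle F ⟨some c, some c, marks⟩ (tagEv F c f)) (mem, w))
      (C.run (oracle F ⟨some c, some c, marks⟩ (tagEv F c f')) (mem, w.erase c)) := by
  refine run_coupled C ?_ ⟨rfl, hw⟩
  rintro i - ⟨mem, w⟩ _ ⟨rfl, hw⟩
  change w.recCtr c = none at hw
  cases i with
  | gate g => exact Coupled.pure ⟨rfl, hw⟩
  | flip d => exact Coupled.bind_same fun b => Coupled.pure ⟨rfl, hw⟩
  | query p inp out =>
    refine Coupled.bind (R := fun u v => v = (u.1, u.2.erase c) ∧ u.2.recCtr c = none)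
      (Coupled.map (Coupled.refl (coins D)) ?_) ?_
    · rintro r _ rfl
      obtain ⟨h1, h2, h3⟩ := answer_ideal_erase (F := F) c marks w hw p (fun i => mem (inp i)) r
        (y := evals (tagEv F c f w.key) w p (fun i => mem (inp i)) r)
        (y' := evals (tagEv F c f' w.key) (w.erase c) p (fun i => mem (inp i)) r)
        (fun t j hj => evals_erase c w w.key f f' p _ r t hj)
      refine ⟨Prod.ext h1.symm h2.symm, h3⟩
    · rintro ⟨a, u⟩ _ ⟨rfl, h⟩
      exact Coupled.pure ⟨rfl, h⟩

end World

end RFID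

end

/-! ### Bookkeeping of the revealed values -/

noncomputable section

namespace RFID

open scoped ENNReal

variable {D : Dims} {F : D.Family}

/-! ### The invariant of the game with a random function -/

/-- A session of the tag: its transcript and the value of the counter. -/
structure Entry (D : Dims) where
  c1 : BitVec D.lu
  α : BitVec D.lA
  k : ℕ

namespace Entry

/-- The argument that gives the mask. -/
def msg (e : Entry D) : BitVec D.ld := D.mac e.c1 (α11 e.α) (α12 e.α)

/-- The argument that gives the expected answer. -/
def conf (e : Entry D) : BitVec D.ld := D.mac e.c1 (BitVec.ofNat D.lr (e.k + 1)) (α12 e.α)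

end Entry

/-- The nonce of a session that is running or has been accepted. -/
def Sess.nonce : Sess D → Option (BitVec D.lu)
  | .waiting c1 => some c1
  | .accepted c1 _ _ _ => some c1
  | _ => none

/-- The invariant for tag `c` after `n` of `q` steps: `Q` contains the revealed values of the random
function, `E` lists the sessions of the tag, `V` contains the values in `Q`. -/
structure InvAt (F : D.Family) (c : Fin D.l) (q n : ℕ) (Q : BitVec D.ld → Option (BitVec D.lr))
    (E : List (Entry D)) (V : Finset (BitVec D.lr)) (w : World D) : Prop where
  len : E.length ≤ n
  -- A step reveals at most two values: an index and a mask when the tag starts a session, or one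
  -- answer of the reader.
  card : V.card ≤ 2 * n
  ctr : w.ctr c = BitVec.ofNat D.lr (E.length + 1)
  log : w.log c = E.map fun e => (e.c1, e.α)
  rec_some : (w.recCtr c).isSome = true
  k_le : ∀ e ∈ E, e.k ≤ E.length
  idx_eq : ∀ e ∈ E, Q (D.idx (BitVec.ofNat D.lr e.k)) = some (α11 e.α)
  msg_eq : ∀ e ∈ E, Q e.msg = some (α13 e.α ^^^ BitVec.ofNat D.lr e.k)
  -- Every revealed argument belongs to a session of the tag: it gives its index, its mask, or the
  -- answer to it. The answer is revealed only by a session of the reader that accepted, and this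
  -- makes matching transcripts equivalent to a correct `c₂`.
  dom : ∀ x y, Q x = some y → (∃ e ∈ E, x = D.idx (BitVec.ofNat D.lr e.k)) ∨
    (∃ e ∈ E, x = e.msg) ∨ ∃ e ∈ E, x = e.conf ∧ ∃ s, w.reader s = .accepted e.c1 e.α c y
  acc : ∀ s c1 α y, w.reader s = .accepted c1 α c y →
    ∃ e ∈ E, e.c1 = c1 ∧ e.α = α ∧ Q e.conf = some y
  -- Distinct arguments have distinct values, so a revealed index determines the counter it belongs
  -- to.
  inj : ∀ x x' y, Q x = some y → Q x' = some y → x = x'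
  vals : ∀ x y, Q x = some y → y ∈ V
  nonce : ∀ s s' x, (w.reader s).nonce = some x → (w.reader s').nonce = some x → s = s'
  -- The formats of `D.mac` and `D.idx` are not disjoint. This field and the next one say that the
  -- nonces in use separate them from the arguments for counters up to `q + 1`.
  nonce_idx : ∀ s x, (w.reader s).nonce = some x → ∀ k ≤ q + 1, ∀ y r,
    D.mac x y r ≠ D.idx (BitVec.ofNat D.lr k)
  fresh : ∀ e ∈ E, ∀ k ≤ q + 1, ∀ x y, D.mac x y (α12 e.α) ≠ D.idx (BitVec.ofNat D.lr k)
  -- The function of no other tag fits the message; otherwise the reader could find the record of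
  -- that tag instead.
  other : ∀ e ∈ E, ∀ j, j ≠ c →
    F (w.key j) (D.idx (F (w.key j) e.msg ^^^ α13 e.α)) ≠ α11 e.α
  -- These arguments could coincide only if the index of the session were equal to the next counter.
  msg_ne : ∀ e ∈ E, e.msg ≠ e.conf
  rT_inj : ∀ e ∈ E, ∀ e' ∈ E, α12 e.α = α12 e'.α → e = e'
  pend : ∀ c1 α, w.pending c = some (c1, α) → ∃ e ∈ E, e.c1 = c1 ∧ e.α = α ∧ w.c1 c = c1 ∧
    w.rT c = α12 α ∧ w.ctr c = BitVec.ofNat D.lr (e.k + 1)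

def Inv (F : D.Family) (c : Fin D.l) (q n : ℕ) (Q : BitVec D.ld → Option (BitVec D.lr))
    (w : World D) : Prop := ∃ E V, InvAt F c q n Q E V w

section Inv

variable {c : Fin D.l} {q n : ℕ} {Q : BitVec D.ld → Option (BitVec D.lr)}
  {E : List (Entry D)} {V : Finset (BitVec D.lr)} {w w' : World D}

theorem InvAt.congr (h : InvAt F c q n Q E V w) (hkey : w'.key = w.key)
    (hctr : w'.ctr c = w.ctr c) (hlog : w'.log c = w.log c)
    (hrec : (w'.recCtr c).isSome = (w.recCtr c).isSome) (hreader : w'.reader = w.reader)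
    (hpend : w'.pending c = none ∨ w'.pending c = w.pending c ∧ w'.c1 c = w.c1 c ∧
      w'.rT c = w.rT c) : InvAt F c q n Q E V w' where
  len := h.len
  card := h.card
  ctr := hctr.trans h.ctr
  log := hlog.trans h.log
  rec_some := hrec.trans h.rec_some
  k_le := h.k_le
  idx_eq := h.idx_eq
  msg_eq := h.msg_eq
  dom := by rw [hreader]; exact h.dom
  acc := by rw [hreader]; exact h.acc
  inj := h.inj
  vals := h.vals
  nonce := by rw [hreader]; exact h.nonce
  nonce_idx := by rw [hreader]; exact h.nonce_idx
  fresh := h.fresh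
  other := by rw [hkey]; exact h.other
  msg_ne := h.msg_ne
  rT_inj := h.rT_inj
  pend := by
    rcases hpend with hp | ⟨h1, h2, h3⟩
    · intro c1 α h'; rw [hp] at h'; cases h'
    · rw [h1, h2, h3, hctr]; exact h.pend

theorem InvAt.succ (h : InvAt F c q n Q E V w) : InvAt F c q (n + 1) Q E V w :=
  { h with len := h.len.trans (by omega), card := h.card.trans (by omega) }

theorem Inv.succ (h : Inv F c q n Q w) : Inv F c q (n + 1) Q w := by
  obtain ⟨E, V, h⟩ := h
  exact ⟨E, V, h.succ⟩

theorem InvAt.inv (h : InvAt F c q n Q E V w) : Inv F c q n Q w := ⟨E, V, h⟩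

/-- By `dom` the argument is an index, a mask or an answer. The first is excluded by `fresh`. In the
other cases equality of the tag's nonces forces the session to be `e` itself, and then `msg_ne`
excludes a mask. -/
theorem InvAt.accepted_of_conf (h : InvAt F c q n Q E V w) (hn : n ≤ q) {e : Entry D} (he : e ∈ E)
    {y} (hy : Q e.conf = some y) : ∃ s, w.reader s = .accepted e.c1 e.α c y := by
  rcases h.dom _ _ hy with ⟨e', he', h1⟩ | ⟨e', he', h1⟩ | ⟨e', he', h1, h2⟩
  · exact absurd h1 (h.fresh e he _ (by have := h.k_le e' he'; have := h.len; omega) _ _)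
  · have := h.rT_inj e he e' he' (mac_injective h1).2.2
    subst this
    exact absurd h1.symm (h.msg_ne e he)
  · have := h.rT_inj e he e' he' (mac_injective h1).2.2
    subst this
    exact h2

/-- The reader opens the session `s`. -/
theorem InvAt.wait (h : InvAt F c q n Q E V w) {s : Fin D.m} {x : BitVec D.lu}
    (hs : w.reader s = .idle) (hx : ∀ s', (w.reader s').nonce ≠ some x)
    (hi : ∀ k ≤ q + 1, ∀ y r, D.mac x y r ≠ D.idx (BitVec.ofNat D.lr k)) :
    InvAt F c q n Q E V { w with reader := Function.update w.reader s (.waiting x) } :=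
  { h with
    dom := by
      intro z y hz
      rcases h.dom z y hz with h1 | h1 | ⟨e, he, h1, s', h2⟩
      · exact Or.inl h1
      · exact Or.inr (Or.inl h1)
      · refine Or.inr (Or.inr ⟨e, he, h1, s', ?_⟩)
        have : s' ≠ s := by rintro rfl; rw [hs] at h2; cases h2
        simpa [this] using h2
    acc := by
      intro s' c1 α y h'
      by_cases hss : s' = s
      · subst hss; simp at h'
      · exact h.acc s' c1 α y (by simpa [hss] using h')
    nonce := by
      intro s' s'' z h1 h2
      dsimp only at h1 h2
      by_cases h3 : s' = s <;> by_cases h4 : s'' = s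
      · rw [h3, h4]
      · subst h3
        simp only [Function.update_self, Sess.nonce, Option.some.injEq] at h1
        rw [Function.update_of_ne h4] at h2
        exact absurd h2 (h1 ▸ hx s'')
      · subst h4
        simp only [Function.update_self, Sess.nonce, Option.some.injEq] at h2
        rw [Function.update_of_ne h3] at h1
        exact absurd h1 (h2 ▸ hx s')
      · rw [Function.update_of_ne h3] at h1
        rw [Function.update_of_ne h4] at h2
        exact h.nonce _ _ _ h1 h2
    nonce_idx := by
      intro s' z h1
      dsimp only at h1
      by_cases h3 : s' = s
      · subst h3
        simp only [Function.update_self, Sess.nonce, Option.some.injEq] at h1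
        subst h1
        exact hi
      · rw [Function.update_of_ne h3] at h1
        exact h.nonce_idx _ _ h1 }

/-- The reader closes the session `s` without accepting the tag. -/
theorem InvAt.close (h : InvAt F c q n Q E V w) {s : Fin D.m} {x : BitVec D.lu}
    (hs : w.reader s = .waiting x) {σ : Sess D} (hσ : σ.nonce = none ∨ σ.nonce = some x)
    (hc : ∀ c1 α y, σ ≠ .accepted c1 α c y) :
    InvAt F c q n Q E V { w with reader := Function.update w.reader s σ } := by
  have hn : ∀ s' z, ((Function.update w.reader s σ) s').nonce = some z →
      (w.reader s').nonce = some z := by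
    intro s' z h1
    by_cases h3 : s' = s
    · subst h3
      rw [Function.update_self] at h1
      rw [hs]
      rcases hσ with h4 | h4 <;> rw [h4] at h1
      · cases h1
      · exact h1
    · rwa [Function.update_of_ne h3] at h1
  exact { h with
    dom := by
      intro z y hz
      rcases h.dom z y hz with h1 | h1 | ⟨e, he, h1, s', h2⟩
      · exact Or.inl h1
      · exact Or.inr (Or.inl h1)
      · refine Or.inr (Or.inr ⟨e, he, h1, s', ?_⟩)
        have : s' ≠ s := by rintro rfl; rw [hs] at h2; cases h2
        simpa [this] using h2
    acc := by
      intro s' c1 α y h'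
      by_cases hss : s' = s
      · subst hss; simp only [Function.update_self] at h'; exact absurd h' (hc _ _ _)
      · exact h.acc s' c1 α y (by simpa [hss] using h')
    nonce := fun s' s'' z h1 h2 => h.nonce s' s'' z (hn _ _ h1) (hn _ _ h2)
    nonce_idx := fun s' z h1 => h.nonce_idx s' z (hn _ _ h1) }

/-- The reader accepts a session of the tag; its answer is a new value. -/
theorem InvAt.confirm (h : InvAt F c q n Q E V w) {s : Fin D.m} {e : Entry D}
    (he : e ∈ E)
    (hs : w.reader s = .waiting e.c1) {y : BitVec D.lr} (hy : y ∉ V) (hQ : Q e.conf = none) :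
    InvAt F c q (n + 1) (Function.update Q e.conf (some y)) E (insert y V)
      { w with reader := Function.update w.reader s (.accepted e.c1 e.α c y) } := by
  have hne : ∀ {z v}, Q z = some v → z ≠ e.conf := by
    rintro z v h1 rfl; rw [hQ] at h1; cases h1
  have hn' : ∀ s' z, ((Function.update w.reader s (.accepted e.c1 e.α c y)) s').nonce = some z →
      (w.reader s').nonce = some z := by
    intro s' z h1
    by_cases h3 : s' = s
    · subst h3
      rw [Function.update_self] at h1
      rw [hs]
      exact h1
    · rwa [Function.update_of_ne h3] at h1
  exact { h with
    len := h.len.trans (by omega)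
    card := (Finset.card_insert_le _ _).trans (by have := h.card; omega)
    idx_eq := by
      intro e' he'
      rw [Function.update_of_ne (hne (h.idx_eq e' he'))]
      exact h.idx_eq e' he'
    msg_eq := by
      intro e' he'
      rw [Function.update_of_ne (hne (h.msg_eq e' he'))]
      exact h.msg_eq e' he'
    dom := by
      intro z v hz
      by_cases h3 : z = e.conf
      · subst h3
        simp only [Function.update_self, Option.some.injEq] at hz
        subst hz
        exact Or.inr (Or.inr ⟨e, he, rfl, s, by simp⟩)
      · rw [Function.update_of_ne h3] at hz
        rcases h.dom z v hz with h1 | h1 | ⟨e', he', h1, s', h2⟩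
        · exact Or.inl h1
        · exact Or.inr (Or.inl h1)
        · refine Or.inr (Or.inr ⟨e', he', h1, s', ?_⟩)
          have : s' ≠ s := by rintro rfl; rw [hs] at h2; cases h2
          simpa [this] using h2
    acc := by
      intro s' c1 α v h'
      by_cases hss : s' = s
      · subst hss
        simp only [Function.update_self, Sess.accepted.injEq, true_and] at h'
        obtain ⟨rfl, rfl, rfl⟩ := h'
        exact ⟨e, he, rfl, rfl, by simp⟩
      · obtain ⟨e', he', h1, h2, h3⟩ := h.acc s' c1 α v (by simpa [hss] using h')
        refine ⟨e', he', h1, h2, ?_⟩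
        rw [Function.update_of_ne (hne h3)]
        exact h3
    inj := by
      intro x x' v h1 h2
      by_cases h3 : x = e.conf <;> by_cases h4 : x' = e.conf
      · rw [h3, h4]
      · subst h3
        simp only [Function.update_self, Option.some.injEq] at h1
        rw [Function.update_of_ne h4] at h2
        exact absurd (h.vals _ _ h2) (h1 ▸ hy)
      · subst h4
        simp only [Function.update_self, Option.some.injEq] at h2
        rw [Function.update_of_ne h3] at h1
        exact absurd (h.vals _ _ h1) (h2 ▸ hy)
      · rw [Function.update_of_ne h3] at h1
        rw [Function.update_of_ne h4] at h2
        exact h.inj _ _ _ h1 h2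
    vals := by
      intro x v h1
      by_cases h3 : x = e.conf
      · subst h3
        simp only [Function.update_self, Option.some.injEq] at h1
        simp [h1]
      · rw [Function.update_of_ne h3] at h1
        exact Finset.mem_insert_of_mem (h.vals _ _ h1)
    nonce := fun s' s'' z h1 h2 => h.nonce s' s'' z (hn' _ _ h1) (hn' _ _ h2)
    nonce_idx := fun s' z h1 => h.nonce_idx s' z (hn' _ _ h1) }

theorem ofNat_ne {n i j : ℕ} (hi : i < 2 ^ n) (hj : j < 2 ^ n) (h : i ≠ j) :
    BitVec.ofNat n i ≠ BitVec.ofNat n j := by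
  intro h'
  have := congrArg BitVec.toNat h'
  simp only [BitVec.toNat_ofNat, Nat.mod_eq_of_lt hi, Nat.mod_eq_of_lt hj] at this
  exact h this

/-- The index of the current counter has not been revealed. -/
theorem InvAt.idx_none (h : InvAt F c q n Q E V w) (hq : q + 2 < 2 ^ D.lr) (hn : n < q) :
    Q (D.idx (BitVec.ofNat D.lr (E.length + 1))) = none := by
  have hl := h.len
  cases hQ : Q (D.idx (BitVec.ofNat D.lr (E.length + 1))) with
  | none => rfl
  | some y =>
    rcases h.dom _ _ hQ with ⟨e, he, h1⟩ | ⟨e, he, h1⟩ | ⟨e, he, h1, -⟩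
    -- All counters involved lie below `2 ^ lr`, so there is no wrapping, and earlier sessions had
    -- smaller counters.
    · have hk := h.k_le e he
      exact absurd (idx_injective h1) (ofNat_ne (by omega) (by omega) (by omega))
    · exact absurd h1.symm (h.fresh e he _ (by omega) _ _)
    · exact absurd h1.symm (h.fresh e he _ (by omega) _ _)

/-- A message with a new nonce of the tag has not been revealed. -/
theorem InvAt.msg_none (h : InvAt F c q n Q E V w) (hn : n < q)
    {r : BitVec D.lv} (hr : ∀ e ∈ E, α12 e.α ≠ r)
    (hi : ∀ k ≤ q + 1, ∀ x y, D.mac x y r ≠ D.idx (BitVec.ofNat D.lr k)) (c1 a) :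
    Q (D.mac c1 a r) = none := by
  have hl := h.len
  cases hQ : Q (D.mac c1 a r) with
  | none => rfl
  | some y =>
    rcases h.dom _ _ hQ with ⟨e, he, h1⟩ | ⟨e, he, h1⟩ | ⟨e, he, h1, -⟩
    · exact absurd h1 (hi _ (by have := h.k_le e he; omega) _ _)
    · exact absurd (mac_injective h1).2.2.symm (hr e he)
    · exact absurd (mac_injective h1).2.2.symm (hr e he)

/-- The tag begins a session. -/
theorem InvAt.start (h : InvAt F c q n Q E V w) (hq : q + 2 < 2 ^ D.lr) (hn : n < q)
    {c1 : BitVec D.lu} {r : BitVec D.lv} {a b : BitVec D.lr}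
    (hr : ∀ e ∈ E, α12 e.α ≠ r)
    (hi : ∀ k ≤ q + 1, ∀ x y, D.mac x y r ≠ D.idx (BitVec.ofNat D.lr k))
    (ha : a ∉ V) (ha' : a ≠ BitVec.ofNat D.lr (E.length + 1 + 1)) (hb : b ∉ V) (hab : b ≠ a)
    (ho : ∀ j, j ≠ c → F (w.key j) (D.idx (F (w.key j) (D.mac c1 a r) ^^^
      (b ^^^ BitVec.ofNat D.lr (E.length + 1)))) ≠ a) :
    InvAt F c q (n + 1)
      (Function.update (Function.update Q (D.idx (w.ctr c)) (some a)) (D.mac c1 a r) (some b))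
      (⟨c1, a ++ r ++ (b ^^^ BitVec.ofNat D.lr (E.length + 1)), E.length + 1⟩ :: E)
      (insert b (insert a V)) (w.startTag c c1 r a b).2 := by
  have hl := h.len
  set k : BitVec D.lr := BitVec.ofNat D.lr (E.length + 1) with hk
  set e₀ : Entry D := ⟨c1, a ++ r ++ (b ^^^ k), E.length + 1⟩ with he₀
  have hm₀ : e₀.msg = D.mac c1 a r := by simp [Entry.msg, he₀, α11_append, α12_append]
  have hr₀ : α12 e₀.α = r := by simp [he₀, α12_append]
  rw [h.ctr, ← hk]
  have hQi := h.idx_none hq hn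
  rw [← hk] at hQi
  have hQm := h.msg_none hn hr hi c1 a
  have hne : D.mac c1 a r ≠ D.idx k := hi _ (by omega) _ _
  set Q' := Function.update (Function.update Q (D.idx k) (some a)) (D.mac c1 a r) (some b) with hQ'
  have q1 : Q' (D.idx k) = some a := by simp [hQ', hne.symm]
  have q2 : Q' (D.mac c1 a r) = some b := by simp [hQ']
  have q3 : ∀ {x y}, Q x = some y → Q' x = some y := by
    intro x y hx
    have e1 : x ≠ D.idx k := by rintro rfl; rw [hQi] at hx; cases hx
    have e2 : x ≠ D.mac c1 a r := by rintro rfl; rw [hQm] at hx; cases hx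
    simp [hQ', e1, e2, hx]
  have q4 : ∀ {x y}, Q' x = some y → (x = D.idx k ∧ y = a) ∨ (x = D.mac c1 a r ∧ y = b) ∨
      Q x = some y := by
    intro x y hx
    by_cases e2 : x = D.mac c1 a r
    · subst e2; rw [q2] at hx; exact Or.inr (Or.inl ⟨rfl, (Option.some.inj hx).symm⟩)
    · by_cases e1 : x = D.idx k
      · subst e1; rw [q1] at hx; exact Or.inl ⟨rfl, (Option.some.inj hx).symm⟩
      · simp only [hQ', Function.update_of_ne e2, Function.update_of_ne e1] at hx
        exact Or.inr (Or.inr hx)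
  exact
  { len := by simp only [List.length_cons]; omega
    card := by
      have := Finset.card_insert_le b (insert a V)
      have := Finset.card_insert_le a V
      have := h.card
      omega
    ctr := by
      simp only [World.startTag, Function.update_self, h.ctr, List.length_cons]
      rw [← BitVec.ofNat_add]
    log := by
      simp only [World.startTag, World.begin, Function.update_self, List.map_cons, h.log, h.ctr]
      rfl
    rec_some := h.rec_some
    k_le := by
      intro e he
      rcases List.mem_cons.1 he with rfl | he
      · simp [he₀]
      · have := h.k_le e he; simp only [List.length_cons]; omega
    idx_eq := by
      intro e he
      rcases List.mem_cons.1 he with rfl | he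
      · rw [show α11 e₀.α = a from α11_append _ _ _]; exact q1
      · exact q3 (h.idx_eq e he)
    msg_eq := by
      intro e he
      rcases List.mem_cons.1 he with rfl | he
      · rw [hm₀, q2, show α13 e₀.α = b ^^^ k from α13_append _ _ _, show BitVec.ofNat D.lr e₀.k = k from rfl]
        simp
      · exact q3 (h.msg_eq e he)
    dom := by
      intro x y hx
      rcases q4 hx with ⟨rfl, -⟩ | ⟨rfl, -⟩ | hx
      · exact Or.inl ⟨e₀, by simp, rfl⟩
      · exact Or.inr (Or.inl ⟨e₀, by simp, hm₀.symm⟩)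
      · rcases h.dom x y hx with ⟨e, he, h1⟩ | ⟨e, he, h1⟩ | ⟨e, he, h1⟩
        · exact Or.inl ⟨e, by simp [he], h1⟩
        · exact Or.inr (Or.inl ⟨e, by simp [he], h1⟩)
        · exact Or.inr (Or.inr ⟨e, by simp [he], h1⟩)
    acc := by
      intro s c1' α y h'
      obtain ⟨e, he, h1, h2, h3⟩ := h.acc s c1' α y h'
      exact ⟨e, by simp [he], h1, h2, q3 h3⟩
    inj := by
      intro x x' y h1 h2
      rcases q4 h1 with ⟨rfl, rfl⟩ | ⟨rfl, rfl⟩ | h1 <;>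
        rcases q4 h2 with ⟨rfl, h3⟩ | ⟨rfl, h3⟩ | h2
      · rfl
      · exact absurd h3.symm hab
      · exact absurd (h.vals _ _ h2) ha
      · exact absurd h3 hab
      · rfl
      · exact absurd (h.vals _ _ h2) hb
      · exact absurd (h.vals _ _ h1) (h3 ▸ ha)
      · exact absurd (h.vals _ _ h1) (h3 ▸ hb)
      · exact h.inj _ _ _ h1 h2
    vals := by
      intro x y h1
      rcases q4 h1 with ⟨rfl, rfl⟩ | ⟨rfl, rfl⟩ | h1
      · simp
      · simp
      · simp [h.vals _ _ h1]
    nonce := h.nonce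
    nonce_idx := h.nonce_idx
    fresh := by
      intro e he
      rcases List.mem_cons.1 he with rfl | he
      · rw [hr₀]; exact hi
      · exact h.fresh e he
    other := by
      intro e he j hj
      rcases List.mem_cons.1 he with rfl | he
      · rw [hm₀, show α13 e₀.α = b ^^^ k from α13_append _ _ _,
          show α11 e₀.α = a from α11_append _ _ _]
        exact ho j hj
      · exact h.other e he j hj
    msg_ne := by
      intro e he
      rcases List.mem_cons.1 he with rfl | he
      · rw [hm₀]
        intro h1
        exact ha' (mac_injective h1).2.1
      · exact h.msg_ne e he
    rT_inj := by
      intro e he e' he' h1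
      rcases List.mem_cons.1 he with rfl | he <;> rcases List.mem_cons.1 he' with rfl | he'
      · rfl
      · exact absurd (h1.symm.trans hr₀) (hr e' he')
      · exact absurd (h1.trans hr₀) (hr e he)
      · exact h.rT_inj e he e' he' h1
    pend := by
      intro c1' α h'
      simp only [World.startTag, World.begin, Function.update_self, Option.some.injEq,
        Prod.mk.injEq] at h'
      obtain ⟨rfl, rfl⟩ := h'
      refine ⟨e₀, by simp, rfl, by simp [he₀, hk, h.ctr], ?_, ?_, ?_⟩
      · simp [World.startTag]
      · simp [World.startTag, α12_append]
      · simp only [World.startTag, Function.update_self, h.ctr]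
        rw [← BitVec.ofNat_add] }

end Inv

theorem inv_init (F : D.Family) (c : Fin D.l) (q : ℕ) (key) :
    Inv F c q 0 (fun _ => none) (World.init key) := by
  refine ⟨[], ∅, ?_⟩
  constructor <;> simp [World.init, Sess.nonce]

end RFID

end

/-! ### The statistical distance caused by a single call -/

noncomputable section

namespace RFID

open scoped ENNReal

variable {D : Dims} {F : D.Family}

/-- The error in a single step. -/
def stepError (D : Dims) (q : ℕ) : ℝ≥0∞ :=
  -- This bounds the numbers of exceptional strings in all kinds of calls: `4 * n + 2 + l` strings
  -- of length `lr` and `n + q + 2` nonces when the tag starts a session, `m + q + 2` nonces when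
  -- the reader opens one, and fewer in the other calls.
  (4 * q + D.l + D.m + 10 : ℕ) * (atom D.lr + atom D.lu + atom D.lv)

theorem mul_atom_le_stepError {q : ℕ} {i j k : ℕ} (hi : i ≤ 4 * q + D.l + D.m + 10)
    (hj : j ≤ 4 * q + D.l + D.m + 10) (hk : k ≤ 4 * q + D.l + D.m + 10) :
    (i : ℝ≥0∞) * atom D.lr + j * atom D.lu + k * atom D.lv ≤ stepError D q := by
  unfold stepError
  rw [mul_add, mul_add]
  gcongr

theorem mul_atom_lr_le {q : ℕ} {i : ℕ} (hi : i ≤ 4 * q + D.l + D.m + 10) :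
    (i : ℝ≥0∞) * atom D.lr ≤ stepError D q := by
  simpa using mul_atom_le_stepError (D := D) (j := 0) (k := 0) hi (by omega) (by omega)

theorem mul_atom_lu_le {q : ℕ} {j : ℕ} (hj : j ≤ 4 * q + D.l + D.m + 10) :
    (j : ℝ≥0∞) * atom D.lu ≤ stepError D q := by
  simpa using mul_atom_le_stepError (D := D) (i := 0) (k := 0) (by omega) hj (by omega)

/-- `G` and `G'` are `δ`-close in all states that satisfy the invariant after `n` steps. -/
def Close {β : Type} (F : D.Family) (c : Fin D.l) (q n : ℕ) (δ : ℝ≥0∞)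
    (G : D.Fn → β × World D → ℝ≥0∞) (G' : β × World D → ℝ≥0∞) : Prop :=
  ∀ a Q w, Inv F c q n Q w →
    Near δ (expect (randFn D) fun f => G (patch Q f) (a, w)) (G' (a, w.erase c))

section Steps

variable {β : Type} {c : Fin D.l} {q n : ℕ} {Q : BitVec D.ld → Option (BitVec D.lr)}
  {w : World D} {δ : ℝ≥0∞} {G : D.Fn → β × World D → ℝ≥0∞} {G' : β × World D → ℝ≥0∞}

/-- A step that does not involve the random function. -/
theorem Close.same {γ : Type} {μ : PMF γ} (H : Close F c q n δ G G')
    {R : D.Fn → γ → β × World D} {I : γ → β × World D} (o : γ → β × World D)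
    (hR : ∀ f r, R f r = o r) (hI : ∀ r, I r = ((o r).1, (o r).2.erase c))
    (hinv : ∀ r, Inv F c q n Q (o r).2) :
    Near δ (expect (randFn D) fun f => expect μ fun r => G (patch Q f) (R (patch Q f) r))
      (expect μ fun r => G' (I r)) := by
  rw [expect_comm]
  refine Near.expect_const fun r => ?_
  simp only [hR, hI]
  exact H _ _ _ (hinv r)

/-- For each counter at most one nonce of the reader can produce a collision between `D.mac` and the
argument of that index, so avoiding all `q + 2` counters costs `q + 2` nonces. -/
theorem exists_prefix (x : BitVec D.ld) :
    ∃ u : BitVec D.lu, ∀ z y r, D.mac z y r = x → z = u := by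
  by_cases h : ∃ z y r, D.mac z y r = x
  · obtain ⟨u, y, r, rfl⟩ := h
    exact ⟨u, fun z y' r' h => (mac_injective h).1⟩
  · push Not at h
    exact ⟨0, fun z y r h' => absurd h' (h z y r)⟩

theorem exists_suffix (x : BitVec D.ld) :
    ∃ u : BitVec D.lv, ∀ z y r, D.mac z y r = x → r = u := by
  by_cases h : ∃ z y r, D.mac z y r = x
  · obtain ⟨z, y, u, rfl⟩ := h
    exact ⟨u, fun z y' r' h => (mac_injective h).2.2⟩
  · push Not at h
    exact ⟨0, fun z y r h' => absurd h' (h z y r)⟩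

/-- Both games draw the same nonce. The exceptional nonces are those already in use and those whose
messages could collide with the argument of an index; outside of them the invariant persists. -/
theorem near_initReader (hn : n < q) (hI : Inv F c q n Q w) {s : Fin D.m}
    (out : BitVec D.lu → β) (H : Close F c q (n + 1) δ G G') (hG : ∀ f z, G f z ≤ 1)
    (hG' : ∀ z, G' z ≤ 1) :
    Near (δ + stepError D q)
      (expect (randFn D) fun f => expect (coins D) fun r =>
        G (patch Q f) (out (w.initReader s r.c1).1, (w.initReader s r.c1).2))
      (expect (coins D) fun r =>
        G' (out ((w.erase c).initReader s r.c1).1, ((w.erase c).initReader s r.c1).2)) := by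
  classical
  rw [expect_comm]
  rw [expect_coins_c1 (fun x => expect (randFn D) fun f =>
      G (patch Q f) (out (w.initReader s x).1, (w.initReader s x).2)),
    expect_coins_c1 (fun x =>
      G' (out ((w.erase c).initReader s x).1, ((w.erase c).initReader s x).2))]
  choose u hu using fun k : ℕ => exists_prefix (D.idx (BitVec.ofNat D.lr k))
  let S : Finset (BitVec D.lu) :=
    (Finset.univ.image fun s' => (w.reader s').nonce.getD 0) ∪ (Finset.range (q + 2)).image u
  have hS : S.card ≤ D.m + (q + 2) := by
    refine (Finset.card_union_le _ _).trans (add_le_add ?_ ?_)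
    · exact Finset.card_image_le.trans (by simp)
    · exact Finset.card_image_le.trans (by simp)
  refine (near_bits' (δ := δ) S (fun x => expect_le_one _ fun f => hG _ _) (fun x => hG' _)
    fun x hx => ?_).mono ?_
  · simp only [(World.initReader_erase c w s x).1, ← (World.initReader_erase c w s x).2]
    refine H _ _ _ ?_
    obtain ⟨E, V, h⟩ := hI
    unfold World.initReader
    simp only [S, Finset.mem_union, Finset.mem_image, Finset.mem_univ, true_and, not_or,
      not_exists, Finset.mem_range, not_and] at hx
    cases hs : w.reader s with
    | idle =>
      refine (h.succ.wait hs ?_ ?_).inv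
      · intro s' h'
        exact hx.1 s' (by rw [h']; rfl)
      · intro k hk y r h'
        exact hx.2 k (by omega) (hu k _ _ _ h').symm
    | _ => exact h.succ.inv
  · gcongr
    exact mul_atom_lu_le (by omega)

/-- The fibres of a map from the strings of length `lr` to themselves partition the domain, so the
fibre of a uniform string has expected size one. -/
theorem expect_card_fiber (g : BitVec D.lr → BitVec D.lr) :
    expect (uniformBits D.lr) (fun a =>
      ((Finset.univ.filter fun x => g x = a).card : ℝ≥0∞) * atom D.lr) = atom D.lr := by
  classical
  rw [expect_bits_sum, ← Finset.sum_mul, ← Nat.cast_sum,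
    ← Finset.card_eq_sum_card_fiberwise (f := g) (s := Finset.univ) (t := Finset.univ)
      (fun _ _ => Finset.mem_univ _), Finset.card_univ, card_bitVec, ← mul_assoc, atom,
    ENNReal.inv_mul_cancel (by simp) (by simp), one_mul]

/-- The masks for which another tag is identified. -/
def confusing (F : D.Family) (c : Fin D.l) (w : World D) (c1 : BitVec D.lu) (r : BitVec D.lv)
    (k a : BitVec D.lr) : Finset (BitVec D.lr) :=
  Finset.univ.biUnion fun j : Fin D.l => Finset.univ.filter fun b => j ≠ c ∧
    F (w.key j) (D.idx (F (w.key j) (D.mac c1 a r) ^^^ (b ^^^ k))) = a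

/-- The functions of the other tags are fixed and may be degenerate: for a particular index `a` most
masks could be confusing. But the mask determines the received counter bijectively, so for a tag `j`
there are at most as many confusing masks as counters with index `a` under the function of `j`. For
uniform `a` this is one on average. -/
theorem expect_confusing (c1 : BitVec D.lu) (r : BitVec D.lv) (k : BitVec D.lr) :
    expect (uniformBits D.lr) (fun a => ((confusing F c w c1 r k a).card : ℝ≥0∞) * atom D.lr) ≤
      D.l * atom D.lr := by
  classical
  calc expect (uniformBits D.lr) (fun a => ((confusing F c w c1 r k a).card : ℝ≥0∞) * atom D.lr)
      ≤ expect (uniformBits D.lr) (fun a => ∑ j : Fin D.l,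
        ((Finset.univ.filter fun x => F (w.key j) (D.idx x) = a).card : ℝ≥0∞) * atom D.lr) := by
        refine expect_mono _ fun a => ?_
        rw [← Finset.sum_mul]
        gcongr
        rw [← Nat.cast_sum]
        refine Nat.cast_le.2 (Finset.card_biUnion_le.trans (Finset.sum_le_sum fun j _ => ?_))
        refine Finset.card_le_card_of_injOn
          (fun b => F (w.key j) (D.mac c1 a r) ^^^ (b ^^^ k)) ?_ ?_
        · intro b hb
          simp only [Finset.coe_filter, Finset.mem_univ, true_and, Set.mem_ofPred_eq] at hb ⊢
          exact hb.2
        · intro b _ b' _ h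
          simpa using h
    _ = D.l * atom D.lr := by
        rw [expect_finset_sum]
        simp only [expect_card_fiber]
        simp

theorem startTag_erase_self (w : World D) (c1 r a b) :
    (w.startTag c c1 r a b).2.erase c =
      (w.erase c).begin c c1 (a ++ r ++ (b ^^^ w.ctr c)) := by
  simp [World.startTag, World.erase, World.begin]

/-- The index and the mask are values of the random function at two new arguments, hence independent
and uniform. So the real `α₁`, whose last part is the mask xor the counter, has the distribution of
the ideal one. The exceptional nonces, indices and masks are those that would violate the invariant.
-/
theorem near_startTag (hq : q + 2 < 2 ^ D.lr) (hn : n < q) (hI : Inv F c q n Q w)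
    (c1 : BitVec D.lu)
    (out : BitVec D.lA → β) (H : Close F c q (n + 1) δ G G') (hG : ∀ f z, G f z ≤ 1)
    (hG' : ∀ z, G' z ≤ 1) :
    Near (δ + stepError D q)
      (expect (randFn D) fun f => expect (coins D) fun r =>
        (fun f a b => G f (out (w.startTag c c1 r.rT a b).1, (w.startTag c c1 r.rT a b).2))
          (patch Q f) (patch Q f (D.idx (w.ctr c)))
          (patch Q f (D.mac c1 (patch Q f (D.idx (w.ctr c))) r.rT)))
      (expect (coins D) fun r => G' (out r.α, (w.erase c).begin c c1 r.α)) := by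
  classical
  obtain ⟨E, V, h⟩ := hI
  have hlen := h.len
  have hcard := h.card
  set k : BitVec D.lr := BitVec.ofNat D.lr (E.length + 1) with hk
  have hctr : w.ctr c = k := h.ctr
  rw [expect_comm,
    expect_coins_α (fun α => G' (out α, (w.erase c).begin c c1 α)), expect_α k,
    expect_coins_rT (fun rT => expect (randFn D) fun f =>
      (fun f a b => G f (out (w.startTag c c1 rT a b).1, (w.startTag c c1 rT a b).2))
          (patch Q f) (patch Q f (D.idx (w.ctr c)))
          (patch Q f (D.mac c1 (patch Q f (D.idx (w.ctr c))) rT)))]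
  choose u hu using fun k : ℕ => exists_suffix (D.idx (BitVec.ofNat D.lr k))
  let S : Finset (BitVec D.lv) :=
    (E.map fun e => α12 e.α).toFinset ∪ (Finset.range (q + 2)).image u
  have hS : S.card ≤ n + (q + 2) := by
    refine (Finset.card_union_le _ _).trans (add_le_add ?_ ?_)
    · exact (List.toFinset_card_le _).trans (by simpa using hlen)
    · exact Finset.card_image_le.trans (by simp)
  -- The index must avoid `V` and the next counter, the mask must avoid `V` and the index: twice at
  -- most `2 * n + 1` strings. To these come on average at most `l` confusing masks.
  refine (near_bits' (δ := δ + ((4 * n + 2 + D.l : ℕ) : ℝ≥0∞) * atom D.lr) S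
    (fun x => expect_le_one _ fun f => hG _ _)
    (fun x => expect_le_one _ fun _ => expect_le_one _ fun _ => hG' _) fun r hr => ?_).mono ?_
  · simp only [S, Finset.mem_union, List.mem_toFinset, List.mem_map, not_or, not_exists, not_and,
      Finset.mem_image, Finset.mem_range] at hr
    have hr1 : ∀ e ∈ E, α12 e.α ≠ r := hr.1
    have hr2 : ∀ k ≤ q + 1, ∀ x y, D.mac x y r ≠ D.idx (BitVec.ofNat D.lr k) :=
      fun k hk x y h' => hr.2 k (by omega) (hu k _ _ _ h').symm
    have hu1 : Q (D.idx k) = none := h.idx_none hq hn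
    rw [hctr, expect_reveal hu1 (fun f => (fun f a b =>
      G f (out (w.startTag c c1 r a b).1, (w.startTag c c1 r a b).2))
          f (f (D.idx k)) (f (D.mac c1 (f (D.idx k)) r)))]
    simp only [patch_update]
    refine (near_bits (δ := δ) (insert (BitVec.ofNat D.lr (E.length + 1 + 1)) V)
      (B := fun a => ((2 * n + 1 : ℕ) : ℝ≥0∞) * atom D.lr +
        ((confusing F c w c1 r k a).card : ℝ≥0∞) * atom D.lr)
      (fun a => expect_le_one _ fun f => hG _ _)
      (fun x => expect_le_one _ fun _ => hG' _) fun a ha => ?_).mono ?_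
    · simp only [Finset.mem_insert, not_or] at ha
      have hu2 : Function.update Q (D.idx k) (some a) (D.mac c1 a r) = none := by
        rw [Function.update_of_ne (hr2 _ (by omega) _ _)]
        exact h.msg_none hn hr1 hr2 c1 a
      rw [expect_reveal hu2 (fun f => G f (out (w.startTag c c1 r a (f (D.mac c1 a r))).1,
        (w.startTag c c1 r a (f (D.mac c1 a r))).2))]
      simp only [patch_update]
      refine (near_bits' (δ := δ) (insert a V ∪ confusing F c w c1 r k a)
        (fun a => expect_le_one _ fun f => hG _ _) (fun x => hG' _) fun b hb => ?_).mono ?_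
      · simp only [Finset.mem_union, Finset.mem_insert, not_or, confusing, Finset.mem_biUnion,
          Finset.mem_univ, true_and, Finset.mem_filter, not_exists, not_and] at hb
        have := H (out (w.startTag c c1 r a b).1) _ _ (h.start hq hn (c1 := c1) hr1 hr2 ha.2 ha.1
          hb.1.2 hb.1.1 (fun j hj => hb.2 j hj)).inv
        rw [startTag_erase_self, hctr] at this
        have e1 : (w.startTag c c1 r a b).1 = a ++ r ++ (b ^^^ k) := by
          rw [← hctr]; rfl
        rw [e1] at this ⊢
        exact this
      · have h1 := (Finset.card_union_le (insert a V) (confusing F c w c1 r k a)).trans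
          (Nat.add_le_add_right (Finset.card_insert_le _ _) _)
        rw [← add_mul, ← Nat.cast_add]
        gcongr
        omega
    · rw [expect_add, expect_const]
      have h1 := Finset.card_insert_le (BitVec.ofNat D.lr (E.length + 1 + 1)) V
      calc _ ≤ δ + (((2 * n + 1 : ℕ) : ℝ≥0∞) * atom D.lr + (((2 * n + 1 : ℕ) : ℝ≥0∞) * atom D.lr +
            D.l * atom D.lr)) := by
            gcongr
            · omega
            · exact expect_confusing _ _ _
        _ = _ := by push_cast; ring
  · rw [add_assoc]
    gcongr
    have := mul_atom_le_stepError (D := D) (q := q) (i := 4 * n + 2 + D.l) (j := 0) (k := S.card)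
      (by omega) (by omega) (by omega)
    simpa using this

/-- The answer to a message of the tag. -/
theorem near_accept (hn : n < q) {s : Fin D.m} {E : List (Entry D)} {V : Finset (BitVec D.lr)}
    (h : InvAt F c q n Q E V w) {e : Entry D} (he : e ∈ E) (hs : w.reader s = .waiting e.c1)
    (k : BitVec D.lr) (out : BitVec D.lr → β) (H : Close F c q (n + 1) δ G G')
    (hG : ∀ f z, G f z ≤ 1) (hG' : ∀ z, G' z ≤ 1) :
    Near (δ + stepError D q)
      (expect (randFn D) fun f =>
        (fun f y => G f (out y, w.accept s e.c1 e.α c k y)) (patch Q f) (patch Q f e.conf))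
      (expect (coins D) fun r => G' (out r.c2, { w.erase c with
        reader := Function.update w.reader s (.accepted e.c1 e.α c r.c2) })) := by
  classical
  have hcard := h.card
  -- A revealed answer would have been sent by an accepting session with the nonce `e.c1`. As nonces
  -- are not repeated this is the session `s`, which is still waiting.
  have hQ : Q e.conf = none := by
    cases hQ : Q e.conf with
    | none => rfl
    | some y =>
      obtain ⟨s', hs'⟩ := h.accepted_of_conf (by omega) he hQ
      have := h.nonce s s' e.c1 (by rw [hs]; rfl) (by rw [hs']; rfl)
      subst this
      rw [hs] at hs'
      cases hs'
  rw [expect_coins_c2 (fun y => G' (out y, { w.erase c with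
      reader := Function.update w.reader s (.accepted e.c1 e.α c y) })),
    expect_reveal hQ (fun f => (fun f y => G f (out y, w.accept s e.c1 e.α c k y)) f (f e.conf))]
  simp only [patch_update]
  have hl : (e.c1, e.α) ∈ w.log c := by
    rw [h.log]
    exact List.mem_map.2 ⟨e, he, rfl⟩
  have hfl : Function.update w.tagFooled c (w.tagFooled c || (!w.corrupted c &&
      decide ((e.c1, e.α) ∉ w.log c))) = w.tagFooled := by
    simp [hl]
  refine (near_bits' (δ := δ) V (fun a => expect_le_one _ fun f => hG _ _) (fun x => hG' _)
    fun y hy => ?_).mono (by gcongr; exact mul_atom_lr_le (by omega))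
  have h' := h.confirm he hs hy hQ
  have h'' := h'.congr (w' := w.accept s e.c1 e.α c k y) rfl rfl rfl
    (by simp [World.accept, h.rec_some]) rfl (Or.inr ⟨rfl, rfl, rfl⟩)
  have := H (out y) _ _ h''.inv
  convert this using 3
  unfold World.accept World.erase
  simp only [hfl, Function.update_idem]

/-- The values that the reader computes from `α` in the session `s` when the functions of the tags
are `fn`. -/
def replies (fn : Fin D.l → D.Fn) (w : World D) (s : Fin D.m) (α : BitVec D.lA) (t : Fin 4)
    (j : Fin D.l) : BitVec D.lr :=
  fn j (w.readerArgs s α t (fn j (w.readerArgs s α 0 0 j)) j)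

/-- A message of the tag is attributed to the tag. -/
theorem found_self {E : List (Entry D)} {V : Finset (BitVec D.lr)}
    (h : InvAt F c q n Q E V w) {e : Entry D} (he : e ∈ E) {s : Fin D.m}
    (hs : w.reader s = .waiting e.c1) (f : D.Fn) :
    w.found e.α (replies (World.tagEv F c (patch Q f) w.key) w s e.α) = some c := by
  have hno : w.readerNonce s = e.c1 := by simp [World.readerNonce, hs]
  have h1 : ∀ j, j ≠ c → w.hit1 e.α (replies (World.tagEv F c (patch Q f) w.key) w s e.α 0)
      (replies (World.tagEv F c (patch Q f) w.key) w s e.α 2) j = false := by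
    intro j hj
    unfold World.hit1
    cases hr : w.recCtr j with
    | none => rfl
    | some k =>
      simp only [Bool.and_eq_false_iff, decide_eq_false_iff_not]
      by_contra! hcon
      obtain ⟨h2, h3⟩ := hcon
      simp only [replies, World.tagEv, hj, if_false, World.readerArgs, hr, Option.getD_some,
        hno] at h2 h3
      rw [h3] at h2
      exact h.other e he j hj h2
  have h2 : ∀ j, j ≠ c → w.hit2 e.α
      (replies (World.tagEv F c (patch Q f) w.key) w s e.α 1) j = false := by
    intro j hj
    unfold World.hit2
    simp only [Bool.and_eq_false_iff, decide_eq_false_iff_not]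
    right
    intro h2
    simp only [replies, World.tagEv, hj, if_false, World.readerArgs, hno] at h2
    exact h.other e he j hj h2
  -- The second search succeeds for `c` no matter which counter the reader has stored: the message
  -- decodes to the counter of the session, whose index is `α11`. This is why the reader can
  -- resynchronize.
  have h3 : w.hit2 e.α (replies (World.tagEv F c (patch Q f) w.key) w s e.α 1) c = true := by
    unfold World.hit2
    simp only [h.rec_some, Bool.true_and, decide_eq_true_eq]
    simp only [replies, World.tagEv, if_true, World.readerArgs, hno]
    have h4 : patch Q f (D.mac e.c1 (α11 e.α) (α12 e.α)) = α13 e.α ^^^ BitVec.ofNat D.lr e.k :=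
      patch_of_eq (h.msg_eq e he) f
    rw [h4]
    have h5 : (α13 e.α ^^^ BitVec.ofNat D.lr e.k) ^^^ α13 e.α = BitVec.ofNat D.lr e.k := by
      rw [BitVec.xor_comm, ← BitVec.xor_assoc, BitVec.xor_self, BitVec.zero_xor]
    rw [h5]
    exact patch_of_eq (h.idx_eq e he) f
  unfold World.found
  cases h4 : select (w.hit1 e.α (replies (World.tagEv F c (patch Q f) w.key) w s e.α 0)
      (replies (World.tagEv F c (patch Q f) w.key) w s e.α 2)) with
  | some j =>
    by_cases hj : j = c
    · rw [hj]; rfl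
    · have := h1 j hj
      rw [World.select_some h4] at this
      cases this
  | none =>
    rw [Option.none_or]
    cases h5 : select (w.hit2 e.α (replies (World.tagEv F c (patch Q f) w.key) w s e.α 1)) with
    | some j =>
      by_cases hj : j = c
      · rw [hj]
      · have := h2 j hj
        rw [World.select_some h5] at this
        cases this
    | none => rw [World.select_none h5 c] at h3; cases h3

/-- The message `α` in a session begun with `c1` is attributed to a tag with the function `f`. -/
def forges (c1 : BitVec D.lu) (α : BitVec D.lA) (f : D.Fn) : Bool :=
  decide (f (D.idx (f (D.mac c1 (α11 α) (α12 α)) ^^^ α13 α)) = α11 α)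

/-- If the mask for `(c1, α)` has been revealed, then `nonce_idx` and uniqueness of nonces leave
only the mask of a session `e` of the tag. If the index of the decoded counter is revealed and
equals `α11`, injectivity makes this counter the one of `e`, so `α = e.α`, contrary to the log; if
it is unrevealed, it must be guessed. If the mask has not been revealed, it is uniform, and at most
two of its values are exceptional; for the others an index must be guessed again. This gives `2 + 1`
atoms. -/
theorem expect_forges_le {E : List (Entry D)} {V : Finset (BitVec D.lr)} (hn : n < q)
    (h : InvAt F c q n Q E V w) {s : Fin D.m} {c1 : BitVec D.lu} {α : BitVec D.lA}
    (hs : w.reader s = .waiting c1) (hlog : (c1, α) ∉ w.log c) :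
    expect (randFn D) (fun f => ind (forges c1 α (patch Q f))) ≤ 3 * atom D.lr := by
  classical
  have hlen := h.len
  unfold forges
  have hle : atom D.lr ≤ 3 * atom D.lr := by
    calc atom D.lr = 1 * atom D.lr := (one_mul _).symm
      _ ≤ _ := by gcongr; norm_num
  set u := D.mac c1 (α11 α) (α12 α) with hu
  cases hQ : Q u with
  | some y =>
    simp only [patch_of_eq hQ]
    cases hQ' : Q (D.idx (y ^^^ α13 α)) with
    | none => exact (expect_reveal_eq hQ' _).le.trans hle
    | some v =>
      simp only [patch_of_eq hQ', expect_const]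
      by_cases hv : v = α11 α
      · exfalso
        rcases h.dom u y hQ with ⟨e, he, h1⟩ | ⟨e, he, h1⟩ | ⟨e, he, h1, s', h2⟩
        · exact h.nonce_idx s c1 (by rw [hs]; rfl) _ (by have := h.k_le e he; omega) _ _ h1
        · have h3 := h.msg_eq e he
          rw [← h1, hQ] at h3
          obtain rfl := Option.some.inj h3
          obtain ⟨h4, h5, h6⟩ := mac_injective h1
          have h7 := h.idx_eq e he
          rw [← h5, ← hv] at h7
          have h8 := idx_injective (h.inj _ _ _ hQ' h7)
          have h9 : α13 α = α13 e.α := by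
            have := congrArg (fun z => (α13 e.α ^^^ BitVec.ofNat D.lr e.k) ^^^ z) h8
            simp only [← BitVec.xor_assoc, BitVec.xor_self, BitVec.zero_xor] at this
            rw [this, BitVec.xor_assoc, BitVec.xor_self, BitVec.xor_zero]
          have h10 : α = e.α := by
            rw [← append_α α, ← append_α e.α, h5, h6, h9]
          apply hlog
          rw [h.log]
          exact List.mem_map.2 ⟨e, he, by rw [h4, h10]⟩
        · have h3 := h.nonce s s' c1 (by rw [hs]; rfl) (by rw [h2, (mac_injective h1).1]; rfl)
          rw [← h3, hs] at h2
          cases h2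
      · simp [hv]
  | none =>
    rw [expect_reveal hQ (fun f => ind (decide (f (D.idx (f u ^^^ α13 α)) = α11 α)))]
    simp only [patch_update]
    -- `S₁` contains the masks that decode to a counter whose revealed index fits, `S₂` those for
    -- which the argument of the index is `u` itself. Each has at most one element.
    let S₁ : Finset (BitVec D.lr) :=
      Finset.univ.filter fun y => Q (D.idx (y ^^^ α13 α)) = some (α11 α)
    let S₂ : Finset (BitVec D.lr) := Finset.univ.filter fun y => D.idx (y ^^^ α13 α) = u
    have c1 : S₁.card ≤ 1 := by
      refine Finset.card_le_one.2 fun y hy y' hy' => ?_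
      simp only [S₁, Finset.mem_filter, Finset.mem_univ, true_and] at hy hy'
      simpa using idx_injective (h.inj _ _ _ hy hy')
    have c2 : S₂.card ≤ 1 := by
      refine Finset.card_le_one.2 fun y hy y' hy' => ?_
      simp only [S₂, Finset.mem_filter, Finset.mem_univ, true_and] at hy hy'
      simpa using idx_injective (hy.trans hy'.symm)
    have hS : (S₁ ∪ S₂).card ≤ 2 := (Finset.card_union_le _ _).trans (by omega)
    calc _ ≤ expect (uniformBits D.lr) (fun y => (if y ∈ S₁ ∪ S₂ then 1 else 0) + atom D.lr) := by
          refine expect_mono _ fun y => ?_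
          by_cases hy : y ∈ S₁ ∪ S₂
          · simp only [hy, if_true]
            exact (expect_le_one _ fun f => ind_le_one _).trans le_self_add
          · simp only [hy, if_false, zero_add]
            simp only [S₁, S₂, Finset.mem_union, Finset.mem_filter, Finset.mem_univ, true_and,
              not_or] at hy
            cases hQ' : Q (D.idx (y ^^^ α13 α)) with
            | none =>
              refine (expect_reveal_eq ?_ _).le
              rw [Function.update_of_ne hy.2, hQ']
            | some v =>
              have hv : v ≠ α11 α := by
                rintro rfl; exact hy.1 hQ'
              have : ∀ f, patch (Function.update Q u (some y)) f (D.idx (y ^^^ α13 α)) = v :=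
                fun f => patch_of_eq (by rw [Function.update_of_ne hy.2, hQ']) f
              simp [this, hv, expect_const]
      _ = (S₁ ∪ S₂).card * atom D.lr + atom D.lr := by
          rw [expect_add, expect_const, expect_bits_mem]
      _ ≤ 2 * atom D.lr + atom D.lr := by gcongr; exact_mod_cast hS
      _ = 3 * atom D.lr := by ring

/-- In the first search the stored counter equals the received one, so a hit in either search shows
that the index of the received counter is `α11`, which is the relation in `forges`. -/
theorem not_forges {s : Fin D.m} {c1 : BitVec D.lu} {α : BitVec D.lA} {f : D.Fn}
    (hs : w.reader s = .waiting c1) (hf : forges c1 α f = false) {Y' : Fin 4 → Fin D.l → _}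
    (hY : ∀ t j, j ≠ c → replies (World.tagEv F c f w.key) w s α t j = Y' t j) :
    w.found α (replies (World.tagEv F c f w.key) w s α) = (w.erase c).found α Y' := by
  have hno : w.readerNonce s = c1 := by simp [World.readerNonce, hs]
  simp only [forges, decide_eq_false_iff_not] at hf
  refine World.found_erase w α hY ?_ ?_
  · unfold World.hit1
    cases hr : w.recCtr c with
    | none => rfl
    | some k =>
      simp only [Bool.and_eq_false_iff, decide_eq_false_iff_not]
      by_contra! hcon
      obtain ⟨h2, h3⟩ := hcon
      simp only [replies, World.tagEv, if_true, World.readerArgs, hr, Option.getD_some,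
        hno] at h2 h3
      rw [h3] at h2
      exact hf h2
  · unfold World.hit2
    simp only [Bool.and_eq_false_iff, decide_eq_false_iff_not]
    right
    simpa only [replies, World.tagEv, if_true, World.readerArgs, hno] using hf

theorem sendReader_congr {s : Fin D.m} {α : BitVec D.lA} {y y' : Fin 4 → Fin D.l → BitVec D.lr}
    (hf : w.found α y = w.found α y') (hy : ∀ i, w.found α y = some i → ∀ t, y t i = y' t i) :
    w.sendReader s α y = w.sendReader s α y' := by
  unfold World.sendReader
  split
  · rw [← hf]
    split
    · rfl
    · rename_i i hi
      rw [hy i hi 3, hy i hi 0]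
  · rfl

theorem InvAt.send {E : List (Entry D)} {V : Finset (BitVec D.lr)}
    (h : InvAt F c q n Q E V w) {s : Fin D.m} {α : BitVec D.lA}
    {y : Fin 4 → Fin D.l → BitVec D.lr} (hy : ∀ i, w.found α y = some i → i ≠ c) :
    InvAt F c q n Q E V (w.sendReader s α y).2 := by
  unfold World.sendReader
  cases hs : w.reader s with
  | waiting c1 =>
    dsimp only
    cases hf : w.found α y with
    | none => exact h.close hs (Or.inl rfl) (by simp)
    | some i =>
      have hi := hy i hf
      refine (h.close hs (σ := .accepted c1 α i (y 3 i)) (Or.inr rfl) ?_).congr rfl rfl rfl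
        ?_ rfl (Or.inr ⟨rfl, rfl, rfl⟩)
      · rintro _ _ _ h'
        injection h' with _ _ h''
        exact hi h''
      · simp [World.accept, hi.symm]
  | _ => exact h

/-- If `(c1, α)` is a transcript of the tag, the reader finds `c` for every random function, and its
answer is a new value. Otherwise, unless the message is a forgery, the reader behaves as if the
record of `c` did not exist. -/
theorem near_sendReader (hn : n < q) (hI : Inv F c q n Q w) (s : Fin D.m) (α : BitVec D.lA)
    (out : BitVec D.lr × Bool → β) (H : Close F c q (n + 1) δ G G') (hG : ∀ f z, G f z ≤ 1)
    (hG' : ∀ z, G' z ≤ 1) {Y' : Fin 4 → Fin D.l → BitVec D.lr}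
    (hY : ∀ f t j, j ≠ c → replies (World.tagEv F c f w.key) w s α t j = Y' t j) :
    Near (δ + stepError D q)
      (expect (randFn D) fun f =>
        (fun f x => G f (out x.1, x.2)) (patch Q f)
          (w.sendReader s α (replies (World.tagEv F c (patch Q f) w.key) w s α)))
      (expect (coins D) fun r =>
        (fun x => G' (out x.1, x.2)) (World.sendReaderIdeal c s α r Y' (w.erase c))) := by
  classical
  obtain ⟨E, V, h⟩ := hI
  have hidle : (∀ y, w.sendReader s α y = ((0, false), w)) →
      (∀ r, World.sendReaderIdeal c s α r Y' (w.erase c) = ((0, false), w.erase c)) → Near (δ + stepError D q)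
      (expect (randFn D) fun f =>
        (fun f x => G f (out x.1, x.2)) (patch Q f)
          (w.sendReader s α (replies (World.tagEv F c (patch Q f) w.key) w s α)))
      (expect (coins D) fun r =>
        (fun x => G' (out x.1, x.2)) (World.sendReaderIdeal c s α r Y' (w.erase c))) := by
    intro h1 h2
    simp only [h1, h2, expect_const]
    exact (H _ _ _ h.succ.inv).mono le_self_add
  cases hs : w.reader s with
  | waiting c1 =>
    clear hidle
    by_cases hlog : (c1, α) ∈ w.log c
    · have hlog' := hlog
      rw [h.log] at hlog
      obtain ⟨e, he, h1⟩ := List.mem_map.1 hlog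
      obtain ⟨rfl, rfl⟩ := Prod.mk.injEq .. ▸ h1
      have hno : w.readerNonce s = e.c1 := by simp [World.readerNonce, hs]
      have hmsg : ∀ f, patch Q f (D.mac e.c1 (α11 e.α) (α12 e.α)) ^^^ α13 e.α =
          BitVec.ofNat D.lr e.k := by
        intro f
        rw [show patch Q f (D.mac e.c1 (α11 e.α) (α12 e.α)) = α13 e.α ^^^ BitVec.ofNat D.lr e.k
          from patch_of_eq (h.msg_eq e he) f, BitVec.xor_comm, ← BitVec.xor_assoc,
          BitVec.xor_self, BitVec.zero_xor]
      have key : ∀ f, w.sendReader s e.α (replies (World.tagEv F c (patch Q f) w.key) w s e.α) =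
          ((patch Q f e.conf, true), w.accept s e.c1 e.α c (BitVec.ofNat D.lr (e.k + 1))
            (patch Q f e.conf)) := by
        intro f
        unfold World.sendReader
        rw [hs]
        dsimp only
        rw [found_self h he hs f]
        dsimp only
        simp only [replies, World.tagEv, if_true, World.readerArgs, hno, hmsg, ← BitVec.ofNat_add]
        rfl
      have key' : ∀ r, World.sendReaderIdeal c s e.α r Y' (w.erase c) = ((r.c2, true),
          { w.erase c with
            reader := Function.update w.reader s (.accepted e.c1 e.α c r.c2) }) := by
        intro r
        unfold World.sendReaderIdeal
        have e1 : (w.erase c).reader = w.reader := rfl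
        have e2 : (w.erase c).log = w.log := rfl
        rw [e1, e2, hs]
        simp only [hlog', if_true]
        rfl
      simp only [key, key']
      exact near_accept hn h he hs _ (fun y => out (y, true)) H hG hG'
    · have key' : ∀ r, World.sendReaderIdeal c s α r Y' (w.erase c) =
          (w.erase c).sendReader s α Y' := by
        intro r
        unfold World.sendReaderIdeal
        have e1 : (w.erase c).reader = w.reader := rfl
        have e2 : (w.erase c).log = w.log := rfl
        rw [e1, e2, hs]
        simp only [hlog, if_false]
      simp only [key', expect_const]
      have hbad := expect_forges_le hn h hs hlog
      have herr : 3 * atom D.lr ≤ stepError D q := by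
        exact_mod_cast mul_atom_lr_le (D := D) (q := q) (i := 3) (by omega)
      -- All functions for which the message is not a forgery lead to the same behaviour of the
      -- reader, represented by `f₀`. If there is no such function, the bound for forgeries is at
      -- least `1`, and nothing has to be shown.
      by_cases hex : ∃ f₀, forges c1 α (patch Q f₀) = false
      · obtain ⟨f₀, hf₀⟩ := hex
        have hfound := not_forges hs hf₀ (hY (patch Q f₀))
        set o := w.sendReader s α (replies (World.tagEv F c (patch Q f₀) w.key) w s α) with ho
        have h1 : Near (0 + expect (randFn D) (fun f => ind (forges c1 α (patch Q f))))
            (expect (randFn D) fun f => (fun f x => G f (out x.1, x.2)) (patch Q f)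
              (w.sendReader s α (replies (World.tagEv F c (patch Q f) w.key) w s α)))
            (expect (randFn D) fun f => G (patch Q f) (out o.1, o.2)) := by
          refine Near.expect fun f _ => ?_
          cases hf : forges c1 α (patch Q f) with
          | true => exact Near.of_le_one (hG _ _) (hG _ _) (by simp)
          | false =>
            have e1 : w.sendReader s α (replies (World.tagEv F c (patch Q f) w.key) w s α) = o := by
              have hfd := not_forges hs hf (hY (patch Q f))
              refine sendReader_congr (hfd.trans hfound.symm) fun i hi t => ?_
              have hi' : i ≠ c := by
                rw [hfd] at hi
                exact World.found_erase_ne hi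
              rw [hY _ t i hi', hY _ t i hi']
            rw [e1]
            exact Near.refl _ _
        have h2 := H (out o.1) Q o.2 (h.succ.send fun i hi => by
          rw [hfound] at hi
          exact World.found_erase_ne hi).inv
        obtain ⟨h3, h4⟩ := World.sendReader_erase w s α (hY (patch Q f₀)) hfound
        rw [← h3, ← h4]
        refine (h1.trans h2).mono ?_
        rw [zero_add, add_comm]
        gcongr
        exact hbad.trans herr
      · push Not at hex
        have : (1 : ℝ≥0∞) ≤ stepError D q := by
          refine le_trans ?_ (hbad.trans herr)
          simp [hex, expect_const]
        exact Near.of_le_one (expect_le_one _ fun f => hG _ _) (hG' _) (this.trans le_add_self)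
  | _ =>
    refine hidle (fun y => ?_) (fun r => ?_)
    · unfold World.sendReader
      rw [hs]
    · unfold World.sendReaderIdeal
      have e1 : (w.erase c).reader = w.reader := rfl
      rw [e1, hs]

/-- The tag compares `c2` with the value at `e.conf`. If this value is revealed, then it was sent by
the accepting session of the reader, and acceptance is equivalent to matching. Otherwise no session
matches, and `c2` is a guess of an unrevealed value. -/
theorem near_finishTag (hn : n < q) (hI : Inv F c q n Q w) (c2 e' : BitVec D.lr)
    (out : Bool → β) (H : Close F c q (n + 1) δ G G') (hG : ∀ f z, G f z ≤ 1) :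
    Near (δ + stepError D q)
      (expect (randFn D) fun f =>
        (fun f x => G f (out x.1, x.2)) (patch Q f)
          (w.finishTag c c2 (patch Q f (D.mac (w.c1 c) (w.ctr c) (w.rT c)))))
      ((fun x => G' (out x.1, x.2)) (World.finishTagIdeal c c c2 e' (w.erase c))) := by
  classical
  obtain ⟨E, V, h⟩ := hI
  have e1 : (w.erase c).pending = w.pending := rfl
  unfold World.finishTag World.finishTagIdeal
  rw [e1]
  cases hp : w.pending c with
  | none =>
    simp only [if_true]
    exact (H _ _ _ h.succ.inv).mono le_self_add
  | some z =>
    obtain ⟨c1, α⟩ := z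
    obtain ⟨e, he, rfl, rfl, h1, h2, h3⟩ := h.pend c1 α hp
    have hconf : D.mac (w.c1 c) (w.ctr c) (w.rT c) = e.conf := by rw [h1, h2, h3]; rfl
    simp only [if_true, hconf]
    set M : Prop := w.ReaderMatches c e.c1 e.α c2 with hM
    have hMe : (w.erase c).ReaderMatches c e.c1 e.α c2 ↔ M := Iff.rfl
    have hmatch : M → Q e.conf = some c2 := by
      rintro ⟨s, hs⟩
      obtain ⟨e', he', h4, h5, h6⟩ := h.acc _ _ _ _ hs
      have : e' = e := h.rT_inj e' he' e he (by rw [h5])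
      rwa [this] at h6
    have hbad : expect (randFn D) (fun f => ind (decide (¬ (c2 = patch Q f e.conf ↔ M)))) ≤
        1 * atom D.lr := by
      cases hQ : Q e.conf with
      | some y =>
        have : ∀ f, (c2 = patch Q f e.conf ↔ M) := by
          intro f
          rw [patch_of_eq hQ]
          constructor
          · rintro rfl
            exact h.accepted_of_conf (by omega) he hQ
          · intro hm
            have := hmatch hm
            rw [hQ] at this
            exact (Option.some.inj this).symm
        simp [this, expect_const]
      | none =>
        have hM0 : ¬ M := fun hm => by rw [hmatch hm] at hQ; cases hQ
        have := expect_reveal_eq hQ c2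
        rw [one_mul, ← this]
        refine expect_mono _ fun f => ?_
        simp [hM0, eq_comm]
    have hfin := H (out (decide M)) Q { w with pending := Function.update w.pending c none }
      (h.succ.congr (w' := { w with pending := Function.update w.pending c none }) rfl rfl rfl rfl
        rfl (Or.inl (by simp))).inv
    refine ((Near.expect (δ := 0) (B := fun f => ind (decide (¬ (c2 = patch Q f e.conf ↔ M))))
      (h := fun f => G (patch Q f)
        (out (decide M), { w with pending := Function.update w.pending c none }))
      fun f _ => ?_).trans hfin).mono ?_
    · by_cases hf : c2 = patch Q f e.conf ↔ M
      · simp only [hf]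
        -- When acceptance coincides with matching, the flag for a fooled tag does not change.
        have : Function.update w.readerFooled c (w.readerFooled c ||
            (decide M && !w.corrupted c && !decide M)) = w.readerFooled := by
          by_cases hm : M <;> simp [hm]
        rw [this]
        exact Near.refl _ _
      · exact Near.of_le_one (hG _ _) (hG _ _) (by simp [hf])
    · rw [zero_add, add_comm]
      gcongr
      refine hbad.trans ?_
      exact_mod_cast mul_atom_lr_le (D := D) (q := q) (i := 1) (by omega)

end Steps

end RFID

end

/-! ### Whole attacks on the real and on the ideal tag -/

noncomputable section

namespace RFID

open scoped ENNReal

variable {D : Dims} {F : D.Family}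

open World

section

variable {c : Fin D.l} {q n : ℕ} {Q : BitVec D.ld → Option (BitVec D.lr)}
  {w : World D} {δ : ℝ≥0∞}

theorem near_startTag_other {β : Type} {G : D.Fn → β × World D → ℝ≥0∞} {G' : β × World D → ℝ≥0∞}
    (hI : Inv F c q n Q w) {i : Fin D.l} (hi : i ≠ c) (c1 : BitVec D.lu)
    (out : BitVec D.lA → β) (H : Close F c q (n + 1) δ G G') {a' : Coins D → BitVec D.lr}
    {b : D.Fn → Coins D → BitVec D.lr} {b'' : Coins D → BitVec D.lr}
    {a : D.Fn → Coins D → BitVec D.lr} (ha : ∀ f r, a f r = a' r) (hb : ∀ f r, b f r = b'' r) :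
    Near (δ + stepError D q)
      (expect (randFn D) fun f => expect (coins D) fun r =>
        G (patch Q f) (out (w.startTag i c1 r.rT (a (patch Q f) r) (b (patch Q f) r)).1,
          (w.startTag i c1 r.rT (a (patch Q f) r) (b (patch Q f) r)).2))
      (expect (coins D) fun r => G' (out ((w.erase c).startTag i c1 r.rT (a' r) (b'' r)).1,
        ((w.erase c).startTag i c1 r.rT (a' r) (b'' r)).2)) := by
  simp only [ha, hb]
  rw [expect_comm]
  refine Near.mono (Near.expect_const fun r => ?_) le_self_add
  obtain ⟨h1, h2⟩ := startTag_erase hi w c1 r.rT (a' r) (b'' r)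
  rw [← h1, ← h2]
  refine H _ _ _ ?_
  obtain ⟨E, V, h⟩ := hI
  have hi' : c ≠ i := fun h => hi h.symm
  refine (h.succ.congr ?_ ?_ ?_ ?_ ?_ (Or.inr ⟨?_, ?_, ?_⟩)).inv <;>
    simp [World.startTag, World.begin, hi']

theorem near_finishTag_other {β : Type} {G : D.Fn → β × World D → ℝ≥0∞}
    {G' : β × World D → ℝ≥0∞} (hI : Inv F c q n Q w) {i : Fin D.l} (hi : i ≠ c)
    (c2 : BitVec D.lr) (out : Bool → β) (H : Close F c q (n + 1) δ G G')
    {a : D.Fn → Coins D → BitVec D.lr} {a' : Coins D → BitVec D.lr} (ha : ∀ f r, a f r = a' r) :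
    Near (δ + stepError D q)
      (expect (randFn D) fun f => expect (coins D) fun r =>
        G (patch Q f) (out (w.finishTag i c2 (a (patch Q f) r)).1,
          (w.finishTag i c2 (a (patch Q f) r)).2))
      (expect (coins D) fun r => G' (out ((w.erase c).finishTag i c2 (a' r)).1,
        ((w.erase c).finishTag i c2 (a' r)).2)) := by
  simp only [ha]
  refine (H.same (R := fun _ r => (out (w.finishTag i c2 (a' r)).1,
    (w.finishTag i c2 (a' r)).2)) (o := fun r =>
      (out (w.finishTag i c2 (a' r)).1, (w.finishTag i c2 (a' r)).2))
    (fun _ _ => rfl) (fun r => ?_) (fun r => ?_)).mono le_self_add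
  · obtain ⟨h1, h2⟩ := finishTag_erase (c := c) i w c2 (a' r)
    rw [h1, h2]
  · obtain ⟨E, V, h⟩ := hI
    have hi' : c ≠ i := fun h => hi h.symm
    dsimp only
    unfold World.finishTag
    split
    · refine (h.succ.congr ?_ ?_ ?_ ?_ ?_ (Or.inr ⟨?_, ?_, ?_⟩)).inv <;> simp [hi']
    · exact h.succ.inv

theorem near_corrupt {β : Type} {G : D.Fn → β × World D → ℝ≥0∞}
    {G' : β × World D → ℝ≥0∞} (hI : Inv F c q n Q w) (i : Fin D.l) (marks : Bool)
    (out : BitVec (D.lk + D.lr + D.lu + D.lv) → β) (H : Close F c q (n + 1) δ G G') :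
    Near (δ + stepError D q)
      (expect (randFn D) fun f => expect (coins D) fun _ =>
        G (patch Q f) (out (w.corrupt ⟨none, some c, marks⟩ i).1,
          (w.corrupt ⟨none, some c, marks⟩ i).2))
      (expect (coins D) fun _ => G' (out ((w.erase c).corrupt ⟨some c, some c, marks⟩ i).1,
        ((w.erase c).corrupt ⟨some c, some c, marks⟩ i).2)) := by
  obtain ⟨h1, h2⟩ := corrupt_erase (ρ := ⟨none, some c, marks⟩)
    (ρ' := ⟨some c, some c, marks⟩) rfl rfl rfl w i
  refine (H.same (R := fun _ _ => (out (w.corrupt ⟨none, some c, marks⟩ i).1,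
      (w.corrupt ⟨none, some c, marks⟩ i).2))
    (o := fun _ => (out (w.corrupt ⟨none, some c, marks⟩ i).1,
      (w.corrupt ⟨none, some c, marks⟩ i).2))
    (fun f r => rfl) (fun r => ?_) (fun r => ?_)).mono le_self_add
  · rw [h1, h2]
  · obtain ⟨E, V, h⟩ := hI
    refine (h.succ.congr ?_ ?_ ?_ ?_ ?_ (Or.inr ⟨?_, ?_, ?_⟩)).inv <;>
      (unfold World.corrupt; dsimp only; split_ifs <;> rfl)

/-- Only calls to `c` and messages to the reader involve the random function in an essential way;
the calls for other tags and the hidden corruption of `c` behave alike in both games, since their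
results do not depend on what is erased. -/
theorem near_answer (hq : q + 2 < 2 ^ D.lr) (hn : n < q) (hI : Inv F c q n Q w) (marks : Bool)
    (p : AttackPort) (x : (D.Ifc F).In p → Bool)
    {G : D.Fn → ((D.Ifc F).Out p → Bool) × World D → ℝ≥0∞}
    {G' : ((D.Ifc F).Out p → Bool) × World D → ℝ≥0∞}
    (H : Close F c q (n + 1) δ G G') (hG : ∀ f z, G f z ≤ 1) (hG' : ∀ z, G' z ≤ 1) :
    Near (δ + stepError D q)
      (expect (randFn D) fun f => expect (coins D) fun r =>
        (fun f r => G f (answer F ⟨none, some c, marks⟩ w p x r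
          (evals (tagEv F c f w.key) w p x r))) (patch Q f) r)
      (expect (coins D) fun r => G' (answer F ⟨some c, some c, marks⟩ (w.erase c) p x r
        (evals (tagEv F c (fun _ => 0) w.key) (w.erase c) p x r))) := by
  have hY : ∀ f r t j, j ≠ c → evals (tagEv F c f w.key) w p x r t j =
      evals (tagEv F c (fun _ => 0) w.key) (w.erase c) p x r t j :=
    fun f r t j hj => evals_erase c w w.key f _ p x r t hj
  have skip : (∀ r y, answer F ⟨none, some c, marks⟩ w p x r y = (fun _ => false, w)) →
      (∀ r y, answer F ⟨some c, some c, marks⟩ (w.erase c) p x r y =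
        (fun _ => false, w.erase c)) →
      Near (δ + stepError D q)
      (expect (randFn D) fun f => expect (coins D) fun r =>
        (fun f r => G f (answer F ⟨none, some c, marks⟩ w p x r
          (evals (tagEv F c f w.key) w p x r))) (patch Q f) r)
      (expect (coins D) fun r => G' (answer F ⟨some c, some c, marks⟩ (w.erase c) p x r
        (evals (tagEv F c (fun _ => 0) w.key) (w.erase c) p x r))) := by
    intro h1 h2
    simp only [h1, h2]
    exact (H.same (R := fun _ _ => (fun _ => false, w)) (o := fun _ => (fun _ => false, w))
      (fun _ _ => rfl) (fun _ => rfl) (fun _ => hI.succ)).mono le_self_add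
  cases p with
  | initReader =>
    cases hs : select (n := D.m) x with
    | none => exact skip (fun r y => by simp only [answer, hs]) (fun r y => by simp only [answer, hs])
    | some s =>
      simp only [answer, hs]
      exact near_initReader hn hI (s := s) (fun y => fun b : Fin D.lu => y.getLsb b) H hG hG'
  | startTag =>
    cases hs : select (fun i : Fin D.l => x (.inl i)) with
    | none => exact skip (fun r y => by simp only [answer, hs]) (fun r y => by simp only [answer, hs])
    | some i =>
      simp only [answer, hs, start]
      by_cases hi : i = c
      · subst hi
        simp only [startTagIdeal, if_true]
        have h0 : ∀ (f : D.Fn) (r : Coins D), evals (F := F) (tagEv F i f w.key) w .startTag x r 0 i =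
            f (D.idx (w.ctr i)) := by
          intro f r; simp [evals, rounds, tagEv]
        have h1 : ∀ (f : D.Fn) (r : Coins D), evals (F := F) (tagEv F i f w.key) w .startTag x r 1 i =
            f (D.mac (ofWires fun b : Fin D.lu => x (.inr b)) (f (D.idx (w.ctr i))) r.rT) := by
          intro f r; simp [evals, rounds, tagEv]
        simp only [h0, h1]
        exact near_startTag hq hn hI (ofWires fun b : Fin D.lu => x (.inr b))
          (fun y => fun b : Fin D.lA => y.getLsb b) H hG hG'
      · simp only [startTagIdeal, hi, if_false]
        exact near_startTag_other hI hi (ofWires fun b : Fin D.lu => x (.inr b))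
          (fun y => fun b : Fin D.lA => y.getLsb b) H
          (a := fun f r => evals (F := F) (tagEv F c f w.key) w .startTag x r 0 i)
          (b := fun f r => evals (F := F) (tagEv F c f w.key) w .startTag x r 1 i)
          (fun f r => hY f r 0 i hi) (fun f r => hY f r 1 i hi)
  | sendReader =>
    cases hs : select (fun s : Fin D.m => x (.inl s)) with
    | none => exact skip (fun r y => by simp only [answer, hs]) (fun r y => by simp only [answer, hs])
    | some s =>
      simp only [answer, hs, send]
      have h0 : ∀ (fn : Fin D.l → D.Fn) (w : World D) (r : Coins D),
          evals (F := F) fn w .sendReader x r =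
            replies fn w s (ofWires fun b : Fin D.lA => x (.inr b)) := by
        intro fn w r
        funext t j
        simp only [evals, rounds, hs, replies]
        rfl
      simp only [h0] at hY ⊢
      simp only [expect_const]
      exact near_sendReader hn hI s (ofWires fun b : Fin D.lA => x (.inr b))
        (fun y => Sum.elim (fun b : Fin D.lr => y.1.getLsb b) (fun _ => y.2)) H hG hG'
        (fun f => hY f (fun _ => false))
  | finishTag =>
    cases hs : select (fun i : Fin D.l => x (.inl i)) with
    | none => exact skip (fun r y => by simp only [answer, hs]) (fun r y => by simp only [answer, hs])
    | some i =>
      simp only [answer, hs, finish]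
      by_cases hi : i = c
      · subst hi
        have h0 : ∀ (f : D.Fn) (r : Coins D), evals (F := F) (tagEv F i f w.key) w .finishTag x r 0 i =
            f (D.mac (w.c1 i) (w.ctr i) (w.rT i)) := by
          intro f r; simp [evals, rounds, tagEv]
        simp only [h0, expect_const]
        have : ∀ e, (World.finishTagIdeal i i (ofWires fun b : Fin D.lr => x (.inr b)) e (w.erase i)) =
            (World.finishTagIdeal i i (ofWires fun b : Fin D.lr => x (.inr b)) 0 (w.erase i)) := by
          intro e; simp [World.finishTagIdeal]
        simp only [this, expect_const]
        exact near_finishTag hn hI (ofWires fun b : Fin D.lr => x (.inr b)) 0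
          (fun y => fun _ => y) H hG
      · simp only [finishTagIdeal, hi, if_false]
        exact near_finishTag_other hI hi (ofWires fun b : Fin D.lr => x (.inr b))
          (fun y => fun _ => y) H
          (a := fun f r => evals (F := F) (tagEv F c f w.key) w .finishTag x r 0 i)
          (fun f r => hY f r 0 i hi)
  | corrupt =>
    cases hs : select (n := D.l) x with
    | none => exact skip (fun r y => by simp only [answer, hs]) (fun r y => by simp only [answer, hs])
    | some i =>
      simp only [answer, hs]
      exact near_corrupt hI i marks
        (fun y => fun b : Fin (D.lk + D.lr + D.lu + D.lv) => y.getLsb b) H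

/-- A circuit that attacks the real tag with a random function and the ideal tag. -/
theorem near_run (hq : q + 2 < 2 ^ D.lr) (marks : Bool) (C : Circuit (D.Ifc F))
    {T : D.Fn → Memory × World D → ℝ≥0∞} {T' : Memory × World D → ℝ≥0∞}
    (hT : ∀ f z, T f z ≤ 1) (hT' : ∀ z, T' z ≤ 1) (mem : Memory)
    (hn : n + C.length ≤ q) (hI : Inv F c q n Q w)
    (H : ∀ k, k ≤ n + C.length → Close F c q k δ T T') :
    Near (δ + C.length * stepError D q)
      (expect (randFn D) fun f => (fun f => expect
        (Circuit.run (oracle F ⟨none, some c, marks⟩ (tagEv F c f)) C (mem, w)) (T f)) (patch Q f))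
      (expect (Circuit.run (oracle F ⟨some c, some c, marks⟩ (tagEv F c fun _ => 0)) C (mem, w.erase c))
        T') := by
  induction C generalizing n Q w mem with
  | nil =>
    have h1 : ∀ (O : Oracle (D.Ifc F) (World D)) w, Circuit.run O [] (mem, w) = pure (mem, w) :=
      fun _ _ => rfl
    simp only [h1, expect_pure]
    -- The end of the circuit can be reached after any number of calls up to its length, since only
    -- calls increase `n`; therefore `H` is assumed for all these numbers.
    exact (H n (by simp) mem Q w hI).mono le_self_add
  | cons i C ih =>
    have h1 : ∀ (O : Oracle (D.Ifc F) (World D)) w, Circuit.run O (i :: C) (mem, w) =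
      (i.exec O (mem, w) >>= Circuit.run O C) := fun _ _ => rfl
    simp only [h1, expect_bind]
    simp only [List.length_cons] at hn H ⊢
    have hlen : δ + ((C.length + 1 : ℕ) : ℝ≥0∞) * stepError D q =
        (δ + C.length * stepError D q) + stepError D q := by
      push_cast; ring
    rw [hlen]
    cases i with
    | gate g =>
      have h2 : ∀ (O : Oracle (D.Ifc F) (World D)) w, Instr.exec O (.gate g) (mem, w) =
        pure (g.eval mem, w) := fun _ _ => rfl
      simp only [h2, expect_pure]
      exact (ih _ (n := n) (by omega) hI (fun k hk => H k (by omega))).mono le_self_add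
    | flip d =>
      have h2 : ∀ (O : Oracle (D.Ifc F) (World D)) w, Instr.exec O (.flip d) (mem, w) =
        (PMF.uniformOfFintype Bool >>= fun b => pure (Function.update mem d b, w)) :=
        fun _ _ => rfl
      simp only [h2, expect_bind, expect_pure]
      rw [expect_comm]
      refine (Near.expect_const fun b => ?_).mono le_self_add
      exact ih _ (n := n) (by omega) hI (fun k hk => H k (by omega))
    | query p inp out =>
      have h2 : ∀ (O : Oracle (D.Ifc F) (World D)) w,
          Instr.exec O (.query p inp out) (mem, w) =
        (O p (fun i => mem (inp i)) w >>= fun y => pure (Function.extend out y.1 mem, y.2)) :=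
        fun _ _ => rfl
      simp only [h2, expect_bind, expect_pure]
      unfold oracle
      simp only [expect_map]
      refine near_answer hq (by omega) hI marks p (fun i => mem (inp i))
        (G := fun f z => expect (Circuit.run (oracle F ⟨none, some c, marks⟩ (tagEv F c f)) C
          (Function.extend out z.1 mem, z.2)) (T f))
        (G' := fun z => expect (Circuit.run (oracle F ⟨some c, some c, marks⟩ (tagEv F c fun _ => 0)) C
          (Function.extend out z.1 mem, z.2)) T') ?_ (fun f z => expect_le_one _ (hT _))
        (fun z => expect_le_one _ hT')
      -- The call may have enlarged the table of revealed values, so the induction needs the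
      -- statement for all tables.
      intro a Q' w' hI'
      exact ih _ (n := n + 1) (by omega) hI' (fun k hk => H k (by omega))

end

end RFID

end

/-! ### Frauds and guesses in the ideal game -/

noncomputable section

namespace RFID

open scoped ENNReal

variable {D : Dims} {F : D.Family}

open World

/-- No fraud involves tag `c`, and its record has been deleted. -/
def Clean (c : Fin D.l) (w : World D) : Prop :=
  w.tagFooled c = false ∧ w.readerFooled c = false ∧ w.recCtr c = none

/-- The replacements for sessions of `c` never set a flag of `c`, and without its record the reader
cannot identify `c` by a search either. -/
theorem answer_ideal_clean {c : Fin D.l} {marks : Bool} {w : World D} (hw : Clean c w)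
    (p : AttackPort) (x : (D.Ifc F).In p → Bool) (r : Coins D) (y) :
    Clean c (answer F ⟨some c, some c, marks⟩ w p x r y).2 := by
  obtain ⟨h1, h2, h3⟩ := hw
  cases p <;> unfold answer <;> dsimp only <;> split
  · unfold World.initReader
    split <;> exact ⟨h1, h2, h3⟩
  · exact ⟨h1, h2, h3⟩
  · unfold start startTagIdeal
    dsimp only
    split_ifs <;> exact ⟨h1, h2, h3⟩
  · exact ⟨h1, h2, h3⟩
  · rename_i s _
    unfold send sendReaderIdeal
    dsimp only
    split
    · split_ifs
      · exact ⟨h1, h2, h3⟩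
      · rename_i c1 hs _
        unfold World.sendReader
        rw [hs]
        dsimp only
        split
        · exact ⟨h1, h2, h3⟩
        · rename_i i hi
          have hic : c ≠ i := by
            rintro rfl
            rcases found_some hi with h | h
            · simp [hit1, h3] at h
            · simp [hit2, h3] at h
          refine ⟨?_, h2, ?_⟩ <;> simp [accept, hic, h1, h3]
    · exact ⟨h1, h2, h3⟩
  · exact ⟨h1, h2, h3⟩
  · rename_i i _
    unfold finish finishTagIdeal
    dsimp only
    split_ifs with hi
    · split <;> exact ⟨h1, h2, h3⟩
    · unfold World.finishTag
      have hi' : c ≠ i := fun h => hi h.symm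
      split
      · refine ⟨h1, ?_, h3⟩
        simp [hi', h2]
      · exact ⟨h1, h2, h3⟩
  · exact ⟨h1, h2, h3⟩
  · unfold World.corrupt
    dsimp only
    split_ifs <;> exact ⟨h1, h2, h3⟩
  · exact ⟨h1, h2, h3⟩

theorem run_ideal_clean {c : Fin D.l} (marks : Bool) (ev) (C : Circuit (D.Ifc F)) (mem : Memory)
    {w : World D} (hw : Clean c w) :
    Coupled (fun x y => x = y ∧ Clean c x.2)
      (C.run (oracle F ⟨some c, some c, marks⟩ ev) (mem, w))
      (C.run (oracle F ⟨some c, some c, marks⟩ ev) (mem, w)) := by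
  refine run_coupled C ?_ ⟨rfl, hw⟩
  rintro i - ⟨mem, w⟩ _ ⟨rfl, hw⟩
  cases i with
  | gate g => exact Coupled.pure ⟨rfl, hw⟩
  | flip d => exact Coupled.bind_same fun b => Coupled.pure ⟨rfl, hw⟩
  | query p inp out =>
    refine Coupled.bind (R := fun u v => u = v ∧ Clean c u.2)
      (Coupled.map (Coupled.refl (coins D)) ?_) ?_
    · rintro r _ rfl
      exact ⟨rfl, answer_ideal_clean hw _ _ _ _⟩
    · rintro ⟨a, u⟩ _ ⟨rfl, h⟩
      exact Coupled.pure ⟨rfl, h⟩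

/-- The value of the experiment in which the tag is ideal in both stages. -/
def idealExp (F : D.Family) (c : Fin D.l) (A₁ A₂ : Circuit (D.Ifc F)) (k : BitVec D.lk) : ℝ≥0∞ :=
  expect (coins D) fun r =>
    expect (A₁.run (oracle F ⟨some c, some c, true⟩ (tagEv F c fun _ => 0))
        (blank, (init (Function.update r.key c k)).erase c)) fun x =>
      expect (A₂.run (oracle F ⟨some c, some c, false⟩ (tagEv F c fun _ => 0)) x) fun y =>
        ind (guess (chose c x.1 x.2) y.1 y.2)

/-- Both values of `ideal` are compared with the same reference `idealExp`. The second stage is used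
as the test function for the first one. If it is real, it is close to the ideal stage by `near_run`,
started from a table that already contains values; if it is ideal, it does not depend on the random
function at all, by `run_ideal_erase`. -/
theorem near_tagExp (c : Fin D.l) (A₁ A₂ : Circuit (D.Ifc F))
    (hq : A₁.length + A₂.length + 2 < 2 ^ D.lr) (ideal : Bool) (k : BitVec D.lk) :
    Near ((A₁.length + A₂.length : ℕ) * stepError D (A₁.length + A₂.length))
      (expect (randFn D) fun f => tagExp F c A₁ A₂ ideal guess f k) (idealExp F c A₁ A₂ k) := by
  set q := A₁.length + A₂.length with hqdef
  unfold tagExp idealExp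
  rw [expect_comm]
  refine Near.expect_const fun r => ?_
  have hI := inv_init F c q (Function.update r.key c k)
  refine (near_run (δ := A₂.length * stepError D q) hq true A₁
    (T := fun f x => expect (A₂.run (oracle F (stage2 c ideal) (tagEv F c f))
      (x.1, switch c ideal x.2)) fun y => ind (guess (chose c x.1 x.2) y.1 y.2))
    (T' := fun x => expect (A₂.run (oracle F ⟨some c, some c, false⟩ (tagEv F c fun _ => 0)) x)
      fun y => ind (guess (chose c x.1 x.2) y.1 y.2))
    (fun f z => expect_le_one _ fun _ => ind_le_one _)
    (fun z => expect_le_one _ fun _ => ind_le_one _) blank (by omega) hI ?_).mono ?_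
  · intro n hn mem Q w hI'
    cases ideal with
    | false =>
      have := near_run (δ := 0) (n := n) hq false A₂
        (T := fun _ y => ind (guess (chose c mem w) y.1 y.2))
        (T' := fun y => ind (guess (chose c mem w) y.1 y.2))
        (fun f z => ind_le_one _) (fun z => ind_le_one _) mem (by omega) hI' ?_
      · rw [zero_add] at this
        exact this
      · intro j hj mem' Q' w' hI''
        simp only [expect_const]
        exact Near.refl _ _
    | true =>
      have key : ∀ f, expect (A₂.run (oracle F ⟨some c, some c, false⟩ (tagEv F c f))
          (mem, w.forget c)) (fun y => ind (guess (chose c mem w) y.1 y.2)) =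
          expect (A₂.run (oracle F ⟨some c, some c, false⟩ (tagEv F c fun _ => 0))
          (mem, w.erase c)) (fun y => ind (guess (chose c mem w) y.1 y.2)) := by
        intro f
        have := run_ideal_erase (F := F) c false f (fun _ => 0) A₂ mem (w.forget c)
          (by simp [World.forget])
        have he : (w.forget c).erase c = w.erase c := by
          simp [World.forget, World.erase]
        rw [he] at this
        refine this.expect_eq ?_
        rintro x y ⟨rfl, -⟩
        rfl
      have : Near (A₂.length * stepError D q)
          (expect (randFn D) fun f => expect (A₂.run (oracle F ⟨some c, some c, false⟩
            (tagEv F c (patch Q f))) (mem, w.forget c))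
              (fun y => ind (guess (chose c mem w) y.1 y.2)))
          (expect (A₂.run (oracle F ⟨some c, some c, false⟩ (tagEv F c fun _ => 0))
          (mem, w.erase c)) (fun y => ind (guess (chose c mem w) y.1 y.2))) := by
        simp only [key, expect_const]
        exact Near.refl _ _
      exact this
  · rw [hqdef, Nat.cast_add, add_mul, add_comm]

theorem near_guess (c : Fin D.l) (A₁ A₂ : Circuit (D.Ifc F))
    (hq : A₁.length + A₂.length + 2 < 2 ^ D.lr) (k : BitVec D.lk) :
    Near (2 * ((A₁.length + A₂.length : ℕ) * stepError D (A₁.length + A₂.length)))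
      (expect (randFn D) fun f => tagExp F c A₁ A₂ false guess f k)
      (expect (randFn D) fun f => tagExp F c A₁ A₂ true guess f k) := by
  rw [two_mul]
  exact (near_tagExp c A₁ A₂ hq false k).trans (near_tagExp c A₁ A₂ hq true k).symm

/-- In the ideal game the flag is never set, so its probability in the game with a random function
is at most the distance of the two games. -/
theorem fraud_le (c : Fin D.l) (A : Circuit (D.Ifc F)) (hq : A.length + 2 < 2 ^ D.lr)
    (flag : World D → Bool) (hflag : ∀ w, Clean c w → flag w = false)
    (herase : ∀ w, flag (w.erase c) = flag w) (k : BitVec D.lk) :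
    expect (randFn D) (fun f => tagExp F c A [] false (fun _ _ w => flag w) f k) ≤
      A.length * stepError D A.length := by
  unfold tagExp
  rw [expect_comm]
  refine (expect_mono _ fun r => ?_).trans (expect_const (coins D) _).le
  have hI := inv_init F c A.length (Function.update r.key c k)
  have h := near_run (δ := 0) hq true A (T := fun _ x => ind (flag x.2))
    (T' := fun x => ind (flag x.2)) (fun f z => ind_le_one _) (fun z => ind_le_one _) blank
    (by omega) hI (by
      intro n hn mem Q w hI'
      simp only [expect_const, herase]
      exact Near.refl _ _)
  have h0 : expect (Circuit.run (oracle F ⟨some c, some c, true⟩ (tagEv F c fun _ => 0)) A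
      (blank, (init (Function.update r.key c k)).erase c)) (fun x => ind (flag x.2)) = 0 := by
    refine ((run_ideal_clean true (tagEv F c fun _ => 0) A blank ⟨rfl, rfl, ?_⟩).expect_eq
      (Ψ := fun _ => 0) ?_).trans (expect_const _ 0)
    · simp [World.erase]
    · rintro x y ⟨rfl, hx⟩
      simp [hflag _ hx]
  rw [h0] at h
  have h1 := h.1
  simp only [zero_add] at h1
  refine le_trans (le_of_eq ?_) h1
  congr 1
  funext f
  congr 1
  funext x
  have h1 : ∀ (O : Oracle (D.Ifc F) (World D)) z, Circuit.run O [] z = pure z :=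
    fun _ _ => rfl
  rw [h1, expect_pure]
  rfl

end RFID

end

noncomputable section

namespace RFID

open scoped ENNReal

/-! ### Boolean formulas as circuits -/

/-- Formulas over the registers. -/
inductive Formula where
  | tt
  | var (r : ℕ)
  | nand (a b : Formula)

namespace Formula

def eval (mem : Memory) : Formula → Bool
  | tt => true
  | var r => mem r
  | nand a b => !(a.eval mem && b.eval mem)

def size : Formula → ℕ
  | tt => 1
  | var _ => 1
  | nand a b => a.size + b.size + 1

/-- No temporary register is read. -/
def Safe : Formula → Prop
  | tt => True
  -- The registers of the distinguisher are divided by residues modulo 4: residue 0 for the memory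
  -- of the adversary, 1 for the state of the simulated game, 2 for the circuit of `F`, 3 for
  -- temporary values.
  | var r => r % 4 ≠ 3
  | nand a b => a.Safe ∧ b.Safe

theorem size_pos (φ : Formula) : 1 ≤ φ.size := by cases φ <;> simp [size]

theorem eval_congr {φ : Formula} (h : φ.Safe) {mem mem' : Memory}
    (hm : ∀ r, r % 4 ≠ 3 → mem r = mem' r) : φ.eval mem = φ.eval mem' := by
  induction φ with
  | tt => rfl
  | var r => exact hm r h
  | nand a b iha ihb => simp only [eval, iha h.1, ihb h.2]

/-- The temporary registers. -/
def tmp (t : ℕ) : ℕ := 4 * t + 3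

theorem tmp_mod (t : ℕ) : tmp t % 4 = 3 := by unfold tmp; omega

theorem tmp_inj {t t' : ℕ} : tmp t = tmp t' ↔ t = t' := by unfold tmp; omega

theorem ne_tmp {r : ℕ} (h : r % 4 ≠ 3) (t : ℕ) : r ≠ tmp t := by
  rintro rfl; exact h (tmp_mod t)

/-- Gates that write the value of a formula to the temporary register `t`. -/
def compile : Formula → ℕ → List Gate
  -- There is no constant register; NAND of a bit and its negation is true.
  | tt, t => [⟨tmp (t + 1), tmp t, tmp t⟩, ⟨tmp t, tmp t, tmp (t + 1)⟩]
  | var r, t => [⟨tmp (t + 1), r, r⟩, ⟨tmp t, tmp (t + 1), tmp (t + 1)⟩]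
  | nand a b, t => a.compile t ++ b.compile (t + 1) ++ [⟨tmp t, tmp t, tmp (t + 1)⟩]

/-- The effect of gates on the memory. -/
def exec (gs : List Gate) (mem : Memory) : Memory := gs.foldl (fun mem g => g.eval mem) mem

theorem exec_append (gs gs' : List Gate) (mem : Memory) :
    exec (gs ++ gs') mem = exec gs' (exec gs mem) := by
  simp [exec]

theorem exec_cons (g : Gate) (gs : List Gate) (mem : Memory) :
    exec (g :: gs) mem = exec gs (g.eval mem) := rfl

theorem exec_nil (mem : Memory) : exec [] mem = mem := rfl

/-- The temporary registers form a stack: a formula compiled at level `t` writes only to levels from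
`t` upwards, so the value of the left subformula survives at `t` while the right one is computed at
`t + 1`. -/
theorem exec_compile {φ : Formula} (h : φ.Safe) (t : ℕ) (mem : Memory) :
    exec (φ.compile t) mem (tmp t) = φ.eval mem ∧
      ∀ r, (∀ t', t ≤ t' → r ≠ tmp t') → exec (φ.compile t) mem r = mem r := by
  induction φ generalizing t mem with
  | tt =>
    have h1 : t ≠ t + 1 := by omega
    refine ⟨by simp [compile, exec, Gate.eval, eval, tmp_inj], fun r hr => ?_⟩
    simp [compile, exec, Gate.eval, hr t le_rfl, hr (t + 1) (by omega)]
  | var r =>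
    have h1 : t ≠ t + 1 := by omega
    refine ⟨by simp [compile, exec, Gate.eval, eval], fun r hr => ?_⟩
    simp [compile, exec, Gate.eval, hr t le_rfl, hr (t + 1) (by omega)]
  | nand a b iha ihb =>
    obtain ⟨a1, a2⟩ := iha h.1 t mem
    obtain ⟨b1, b2⟩ := ihb h.2 (t + 1) (exec (a.compile t) mem)
    have h1 : exec (b.compile (t + 1)) (exec (a.compile t) mem) (tmp t) = a.eval mem := by
      rw [b2 _ fun t' ht' => by rw [ne_eq, tmp_inj]; omega, a1]
    have h2 : b.eval (exec (a.compile t) mem) = b.eval mem :=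
      eval_congr h.2 fun r hr => a2 r fun t' _ => ne_tmp hr t'
    constructor
    · simp only [compile, exec_append, exec_cons, exec_nil, Gate.eval, Function.update_self, h1, b1,
        h2, eval]
    · intro r hr
      simp only [compile, exec_append, exec_cons, exec_nil, Gate.eval]
      rw [Function.update_of_ne (hr t le_rfl), b2 r fun t' ht' => hr t' (by omega), a2 r hr]

theorem length_compile (φ : Formula) (t : ℕ) : (φ.compile t).length ≤ 2 * φ.size := by
  induction φ generalizing t with
  | tt => simp [compile, size]
  | var r => simp [compile, size]
  | nand a b iha ihb =>
    have := iha t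
    have := ihb (t + 1)
    simp only [compile, size, List.length_append, List.length_cons, List.length_nil]
    omega

/-- Gates that write the negations of formulas to temporary registers. -/
def evalList (G : ℕ → Formula) : List ℕ → ℕ → List Gate
  | [], _ => []
  | r :: L, t => (nand (G r) tt).compile t ++ evalList G L (t + 1)

/-- Gates that copy the negations of temporary registers. -/
def copyList : List ℕ → ℕ → List Gate
  | [], _ => []
  | r :: L, t => ⟨r, tmp t, tmp t⟩ :: copyList L (t + 1)

/-- Gates that assign to all registers `r` in a list simultaneously the values of the formulas
`G r`. -/
def assign (L : List ℕ) (G : ℕ → Formula) : List Gate := evalList G L 0 ++ copyList L 0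

theorem exec_evalList {G : ℕ → Formula} {L : List ℕ} (h : ∀ r ∈ L, (G r).Safe) (t : ℕ)
    (mem : Memory) :
    (∀ i (hi : i < L.length), exec (evalList G L t) mem (tmp (t + i)) = !(G L[i]).eval mem) ∧
      ∀ r, (∀ t', t ≤ t' → r ≠ tmp t') → exec (evalList G L t) mem r = mem r := by
  induction L generalizing t mem with
  | nil => exact ⟨fun i hi => by simp at hi, fun r _ => rfl⟩
  | cons r L ih =>
    have hr : (nand (G r) tt).Safe := ⟨h r (by simp), trivial⟩
    obtain ⟨a1, a2⟩ := exec_compile hr t mem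
    obtain ⟨b1, b2⟩ := ih (fun r hr => h r (by simp [hr])) (t + 1)
      (exec ((nand (G r) tt).compile t) mem)
    refine ⟨fun i hi => ?_, fun r' hr' => ?_⟩
    · simp only [evalList, exec_append]
      cases i with
      | zero =>
        rw [Nat.add_zero t, b2 _ fun t' ht' => by rw [ne_eq, tmp_inj]; omega, a1]
        simp [eval]
      | succ i =>
        have hi' : i < L.length := by simpa using hi
        have := b1 i hi'
        rw [show t + 1 + i = t + (i + 1) by omega] at this
        rw [this, List.getElem_cons_succ, eval_congr (h L[i] (by simp)) fun r hr =>
          a2 r fun t' _ => ne_tmp hr t']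
    · simp only [evalList, exec_append]
      rw [b2 r' fun t' ht' => hr' t' (by omega), a2 r' hr']

theorem exec_copyList {L : List ℕ} (hL : ∀ r ∈ L, r % 4 ≠ 3) (v : ℕ → Bool) (t : ℕ) (mem : Memory)
    (h : ∀ i (hi : i < L.length), mem (tmp (t + i)) = !v L[i]) (r : ℕ) :
    exec (copyList L t) mem r = if r ∈ L then v r else mem r := by
  induction L generalizing t mem with
  | nil => rfl
  | cons r' L ih =>
    simp only [copyList, exec_cons]
    have h0 : mem (tmp t) = !v r' := h 0 (by simp)
    rw [ih (fun r hr => hL r (by simp [hr])) (t + 1)]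
    · by_cases h1 : r ∈ L
      · simp [h1]
      · by_cases h2 : r = r'
        · subst h2; simp [h1, Gate.eval, h0]
        · simp [h1, h2, Gate.eval]
    · intro i hi
      have := h (i + 1) (by simpa using hi)
      rw [show t + 1 + i = t + (i + 1) by omega]
      rw [Gate.eval, Function.update_of_ne (ne_tmp (hL r' (by simp)) _).symm, this]
      simp

/-- All formulas are evaluated before the first register of the list is overwritten, so they read
the old values. The values are stored negated, because the single NAND gate that copies them negates
once more. -/
theorem exec_assign {L : List ℕ} {G : ℕ → Formula} (hL : ∀ r ∈ L, r % 4 ≠ 3)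
    (h : ∀ r ∈ L, (G r).Safe) (mem : Memory) (r : ℕ) (hr : r % 4 ≠ 3) :
    exec (assign L G) mem r = if r ∈ L then (G r).eval mem else mem r := by
  obtain ⟨a1, a2⟩ := exec_evalList h 0 mem
  rw [assign, exec_append, exec_copyList hL (fun r => (G r).eval mem) 0 _ a1 r,
    a2 r fun t' _ => ne_tmp hr t']

theorem length_assign {L : List ℕ} {G : ℕ → Formula} {B : ℕ} (h : ∀ r ∈ L, (G r).size ≤ B) :
    (assign L G).length ≤ L.length * (2 * B + 5) := by
  have h1 : ∀ t, (evalList G L t).length ≤ L.length * (2 * B + 4) := by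
    induction L with
    | nil => intro t; simp [evalList]
    | cons r L ih =>
      intro t
      have h2 := length_compile (nand (G r) tt) t
      have h3 := h r (by simp)
      have h4 := ih (fun r hr => h r (by simp [hr])) (t + 1)
      simp only [size] at h2
      simp only [evalList, List.length_append, List.length_cons, add_mul, one_mul]
      omega
  have h2 : ∀ t, (copyList L t).length = L.length := by
    clear h h1
    induction L with
    | nil => intro t; rfl
    | cons r L ih => intro t; simp [copyList, ih]
  have := h1 0
  rw [assign, List.length_append, h2]
  calc _ ≤ L.length * (2 * B + 4) + L.length := by omega
    _ = _ := by ring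

end Formula

end RFID

end

noncomputable section

namespace RFID

open scoped ENNReal

/-! ### The simulated game in memory -/

/-- A tag, circuits for the other tags, a bound `T` for the number of sessions and a bound `N` for
all dimensions. -/
structure Setting (D : Dims) (F : D.Family) where
  c : Fin D.l
  T : ℕ
  N : ℕ
  gates : List Gate
  out : Fin D.lr → ℕ
  computes : ∀ k x, ofWires (fun j => Formula.exec gates (loadArgs k x) (out j)) = F k x
  bound : 10 * (D.l + D.lk + D.ld + D.lv + D.lr + D.lu + D.m + T + gates.length + D.l * D.lk + 10)
    ≤ N

/-- The simulated game together with auxiliary variables: the result of the first stage, the coins,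
the arguments and the results of the functions of the tags. -/
structure Ctx (D : Dims) where
  mem : Memory
  w : World D
  ok : Bool
  rnd : Coins D
  x : Fin D.l → BitVec D.ld
  y : Fin 4 → Fin D.l → BitVec D.lr

namespace Sess

variable {D : Dims}

def isIdle : Sess D → Bool
  | idle => true
  | _ => false

def isWaiting : Sess D → Bool
  | waiting _ => true
  | _ => false

def isAccepted : Sess D → Bool
  | accepted _ _ _ _ => true
  | _ => false

def c1 : Sess D → BitVec D.lu
  | waiting c1 => c1
  | accepted c1 _ _ _ => c1
  | _ => 0

def α : Sess D → BitVec D.lA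
  | accepted _ α _ _ => α
  | _ => 0

def isTag (i : Fin D.l) : Sess D → Bool
  | accepted _ _ j _ => decide (j = i)
  | _ => false

def c2 : Sess D → BitVec D.lr
  | accepted _ _ _ c2 => c2
  | _ => 0

end Sess

/-- The bits of the state of the game; the key of one tag is not included. -/
inductive WVar (D : Dims) (T : ℕ) where
  | key (j : Fin D.l) (b : Fin D.lk)
  | ctr (j : Fin D.l) (b : Fin D.lr)
  | c1 (j : Fin D.l) (b : Fin D.lu)
  | rT (j : Fin D.l) (b : Fin D.lv)
  | recHas (j : Fin D.l)
  | recCtr (j : Fin D.l) (b : Fin D.lr)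
  | corrupted (j : Fin D.l)
  | pendHas (j : Fin D.l)
  | pendC1 (j : Fin D.l) (b : Fin D.lu)
  | pendA (j : Fin D.l) (b : Fin D.lA)
  | logHas (j : Fin D.l) (k : Fin T)
  | logC1 (j : Fin D.l) (k : Fin T) (b : Fin D.lu)
  | logA (j : Fin D.l) (k : Fin T) (b : Fin D.lA)
  | idle (s : Fin D.m)
  | waiting (s : Fin D.m)
  | accepted (s : Fin D.m)
  | sC1 (s : Fin D.m) (b : Fin D.lu)
  | sA (s : Fin D.m) (b : Fin D.lA)
  | sTag (s : Fin D.m) (i : Fin D.l)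
  | sC2 (s : Fin D.m) (b : Fin D.lr)
  | tagFooled (j : Fin D.l)
  | readerFooled (j : Fin D.l)

inductive Var (D : Dims) (T : ℕ) where
  | world (v : WVar D T)
  | ok
  | rnd (i : D.Coin)
  | x (j : Fin D.l) (b : Fin D.ld)
  | y (t : Fin 4) (j : Fin D.l) (b : Fin D.lr)

section

variable {D : Dims} {T : ℕ}

/-- The first component of an optional pair. -/
def fst0 (z : Option (BitVec D.lu × BitVec D.lA)) : BitVec D.lu := z.elim 0 Prod.fst

def snd0 (z : Option (BitVec D.lu × BitVec D.lA)) : BitVec D.lA := z.elim 0 Prod.snd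

def WVar.bit (c : Fin D.l) (w : World D) : WVar D T → Bool
  | key j b => if j = c then false else (w.key j).getLsb b
  | ctr j b => (w.ctr j).getLsb b
  | c1 j b => (w.c1 j).getLsb b
  | rT j b => (w.rT j).getLsb b
  | recHas j => (w.recCtr j).isSome
  | recCtr j b => ((w.recCtr j).getD 0).getLsb b
  | corrupted j => w.corrupted j
  | pendHas j => (w.pending j).isSome
  | pendC1 j b => (fst0 (w.pending j)).getLsb b
  | pendA j b => (snd0 (w.pending j)).getLsb b
  | logHas j k => (w.log j)[k.1]?.isSome
  | logC1 j k b => (fst0 (w.log j)[k.1]?).getLsb b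
  | logA j k b => (snd0 (w.log j)[k.1]?).getLsb b
  | idle s => (w.reader s).isIdle
  | waiting s => (w.reader s).isWaiting
  | accepted s => (w.reader s).isAccepted
  | sC1 s b => (w.reader s).c1.getLsb b
  | sA s b => (w.reader s).α.getLsb b
  | sTag s i => (w.reader s).isTag i
  | sC2 s b => (w.reader s).c2.getLsb b
  | tagFooled j => w.tagFooled j
  | readerFooled j => w.readerFooled j

def Var.bit (c : Fin D.l) (γ : Ctx D) : Var D T → Bool
  | world v => v.bit c γ.w
  | ok => γ.ok
  | rnd i => γ.rnd i
  | x j b => (γ.x j).getLsb b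
  | y t j b => (γ.y t j).getLsb b

/-- Variables are named by four numbers. -/
def Var.name : Var D T → ℕ × ℕ × ℕ × ℕ
  | world (.key j b) => (0, j, b, 0)
  | world (.ctr j b) => (1, j, b, 0)
  | world (.c1 j b) => (2, j, b, 0)
  | world (.rT j b) => (3, j, b, 0)
  | world (.recHas j) => (4, j, 0, 0)
  | world (.recCtr j b) => (5, j, b, 0)
  | world (.corrupted j) => (6, j, 0, 0)
  | world (.pendHas j) => (7, j, 0, 0)
  | world (.pendC1 j b) => (8, j, b, 0)
  | world (.pendA j b) => (9, j, b, 0)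
  | world (.logHas j k) => (10, j, k, 0)
  | world (.logC1 j k b) => (11, j, k, b)
  | world (.logA j k b) => (12, j, k, b)
  | world (.idle s) => (13, s, 0, 0)
  | world (.waiting s) => (14, s, 0, 0)
  | world (.accepted s) => (15, s, 0, 0)
  | world (.sC1 s b) => (16, s, b, 0)
  | world (.sA s b) => (17, s, b, 0)
  | world (.sTag s i) => (18, s, i, 0)
  | world (.sC2 s b) => (19, s, b, 0)
  | world (.tagFooled j) => (20, j, 0, 0)
  | world (.readerFooled j) => (21, j, 0, 0)
  | ok => (22, 0, 0, 0)
  | rnd i => (23, Fintype.equivFin D.Coin i, 0, 0)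
  | x j b => (24, j, b, 0)
  | y t j b => (25, t, j, b)

theorem Var.name_injective : Function.Injective (Var.name (D := D) (T := T)) := by
  intro v v' h
  rcases v with (_ | _ | _ | _ | _ | _ | _ | _ | _ | _ | _ | _ | _ | _ | _ | _ | _ | _ | _ | _ | _ |
    _) | _ | _ | _ | _ <;>
  rcases v' with (_ | _ | _ | _ | _ | _ | _ | _ | _ | _ | _ | _ | _ | _ | _ | _ | _ | _ | _ | _ | _ |
    _) | _ | _ | _ | _ <;>
  first
  | (exfalso; have h0 := congrArg Prod.fst h; simp [Var.name] at h0; done)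
  | (simp only [Var.name, Prod.mk.injEq, Fin.val_inj, EmbeddingLike.apply_eq_iff_eq, true_and,
      and_true] at h; simp only [h])

def Var.code (v : Var D T) : ℕ :=
  Nat.pair v.name.1 (Nat.pair v.name.2.1 (Nat.pair v.name.2.2.1 v.name.2.2.2))

/-- The register of a variable. -/
def Var.addr (v : Var D T) : ℕ := 4 * v.code + 1

theorem Var.addr_injective : Function.Injective (Var.addr (D := D) (T := T)) := by
  intro v v' h
  have h1 : v.code = v'.code := by unfold Var.addr at h; omega
  unfold Var.code at h1
  simp only [Nat.pair_eq_pair] at h1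
  exact Var.name_injective (Prod.ext h1.1 (Prod.ext h1.2.1 (Prod.ext h1.2.2.1 h1.2.2.2)))

theorem Var.addr_mod (v : Var D T) : v.addr % 4 = 1 := by unfold Var.addr; omega

theorem pair_lt {a b n : ℕ} (ha : a < n) (hb : b < n) : Nat.pair a b < n ^ 2 := by
  refine (Nat.pair_lt_max_add_one_sq a b).trans_le ?_
  exact Nat.pow_le_pow_left (by omega) 2

end

variable {D : Dims} {F : D.Family} {S : Setting D F}

theorem Setting.le_N (S : Setting D F) : 100 ≤ S.N := by have := S.bound; omega

/-- Each component of the name is below `N`, and each of the three nested pairings squares the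
bound. -/
theorem Var.code_lt (v : Var D S.T) : v.code < S.N ^ 8 := by
  have hb := S.bound
  have hA : D.lA = D.lr + D.lv + D.lr := rfl
  have h : v.name.1 < S.N ∧ v.name.2.1 < S.N ∧ v.name.2.2.1 < S.N ∧ v.name.2.2.2 < S.N := by
    rcases v with (_ | _ | _ | _ | _ | _ | _ | _ | _ | _ | _ | _ | _ | _ | _ | _ | _ | _ | _ | _ | _ |
      _) | _ | i | _ | _ <;> simp only [Var.name] <;> try omega
    have := (Fintype.equivFin D.Coin i).2
    simp only [Fintype.card_sum, Fintype.card_prod, Fintype.card_fin] at this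
    omega
  obtain ⟨h1, h2, h3, h4⟩ := h
  have hN := S.le_N
  have h5 := pair_lt h3 h4
  have h6 : v.name.2.1 < S.N ^ 2 := h2.trans_le (Nat.le_self_pow (by norm_num) _)
  have h7 := pair_lt h6 h5
  have h8 : v.name.1 < (S.N ^ 2) ^ 2 := h1.trans_le (by
    rw [← pow_mul]; exact Nat.le_self_pow (by norm_num) _)
  have h9 := pair_lt h8 h7
  rw [← pow_mul, ← pow_mul] at h9
  exact h9

/-- The registers `reg` contain the simulated game. -/
structure Enc (S : Setting D F) (γ : Ctx D) (reg : Memory) : Prop where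
  mem : ∀ r, reg (4 * r) = γ.mem r
  bit : ∀ v : Var D S.T, reg v.addr = v.bit S.c γ
  short : ∀ j, (γ.w.log j).length ≤ S.T

/-- The bit `e` of the simulated game is computed by a formula of size at most `N ^ k`. -/
def Cheap (S : Setting D F) (k : ℕ) (e : Ctx D → Bool) : Prop :=
  ∃ φ : Formula, φ.Safe ∧ φ.size ≤ S.N ^ k ∧ ∀ γ reg, Enc S γ reg → φ.eval reg = e γ

namespace Cheap

open Formula

variable {k k' k'' : ℕ} {e e' e'' : Ctx D → Bool}

theorem mono (h : Cheap S k e) (hk : k ≤ k') : Cheap S k' e := by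
  obtain ⟨φ, h1, h2, h3⟩ := h
  have := S.le_N
  exact ⟨φ, h1, h2.trans (Nat.pow_le_pow_right (by omega) hk), h3⟩

theorem congr (h : Cheap S k e) (H : ∀ γ, (∀ j, (γ.w.log j).length ≤ S.T) → e γ = e' γ) :
    Cheap S k e' := by
  obtain ⟨φ, h1, h2, h3⟩ := h
  exact ⟨φ, h1, h2, fun γ reg hE => (h3 γ reg hE).trans (H γ hE.short)⟩

theorem congr' (h : Cheap S k e) (H : ∀ γ, e γ = e' γ) : Cheap S k e' := h.congr fun γ _ => H γ

/-- As `100 ≤ N`, constant factors are absorbed into the exponent of `N`. Sizes are therefore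
tracked by exponents only, which stay below an absolute constant. -/
theorem pow_le (S : Setting D F) (a n k : ℕ) (ha : a ≤ 100 * n) (hn : n ≤ S.N ^ k) :
    a ≤ S.N ^ (k + 1) := by
  have := S.le_N
  calc a ≤ 100 * n := ha
    _ ≤ S.N * S.N ^ k := Nat.mul_le_mul this hn
    _ = _ := by ring

theorem tt : Cheap S 1 fun _ => true :=
  ⟨Formula.tt, trivial, by have := S.le_N; simp [size]; omega, fun _ _ _ => rfl⟩

theorem var (v : Var D S.T) : Cheap S 1 fun γ => v.bit S.c γ :=
  ⟨Formula.var v.addr, by have := v.addr_mod; simp [Safe, this],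
    by have := S.le_N; simp [size]; omega, fun _ _ h => h.bit v⟩

theorem mem (r : ℕ) : Cheap S 1 fun γ => γ.mem r :=
  ⟨Formula.var (4 * r), by simp [Safe],
    by have := S.le_N; simp [size]; omega, fun _ _ h => h.mem r⟩

theorem nand (h : Cheap S k e) (h' : Cheap S k' e') :
    Cheap S (max k k' + 1) fun γ => !(e γ && e' γ) := by
  obtain ⟨φ, h1, h2, h3⟩ := h.mono (le_max_left k k')
  obtain ⟨φ', h1', h2', h3'⟩ := h'.mono (le_max_right k k')
  refine ⟨φ.nand φ', ⟨h1, h1'⟩, ?_, fun γ reg hE => ?_⟩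
  · refine pow_le S _ _ _ ?_ le_rfl
    have := φ.size_pos
    simp only [size]
    omega
  · simp only [Formula.eval, h3 γ reg hE, h3' γ reg hE]

theorem not (h : Cheap S k e) : Cheap S (k + 2) fun γ => !e γ :=
  ((h.nand tt).mono (by omega)).congr' fun γ => by simp

theorem const (b : Bool) : Cheap S 3 fun _ => b := by
  cases b
  · exact tt.not
  · exact tt.mono (by omega)

theorem and (h : Cheap S k e) (h' : Cheap S k' e') :
    Cheap S (max k k' + 3) fun γ => e γ && e' γ :=
  (h.nand h').not.congr' fun γ => by simp

theorem or (h : Cheap S k e) (h' : Cheap S k' e') :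
    Cheap S (max k k' + 3) fun γ => e γ || e' γ :=
  ((h.not.nand h'.not).mono (by omega)).congr' fun γ => by simp

theorem cond (h : Cheap S k e) (h' : Cheap S k' e') (h'' : Cheap S k'' e'') :
    Cheap S (max (max k k') k'' + 8) fun γ => if e γ = true then e' γ else e'' γ :=
  (((h.and h').or (h.not.and h'')).mono (by omega)).congr' fun γ => by
    cases e γ <;> simp

theorem beq (h : Cheap S k e) (h' : Cheap S k' e') :
    Cheap S (max k k' + 10) fun γ => e γ == e' γ :=
  ((h.cond h' h'.not).mono (by omega)).congr' fun γ => by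
    cases e γ <;> cases e' γ <;> rfl

theorem xor (h : Cheap S k e) (h' : Cheap S k' e') :
    Cheap S (max k k' + 10) fun γ => e γ ^^ e' γ :=
  ((h.cond h'.not h').mono (by omega)).congr' fun γ => by
    cases e γ <;> cases e' γ <;> rfl

/-- A disjunction over at most `N` cases multiplies the size by at most `10 * (n + 1)`, which three
further powers of `N` cover. -/
theorem any {n : ℕ} (hn : n ≤ S.N) {e : Fin n → Ctx D → Bool} (h : ∀ i, Cheap S k (e i)) :
    Cheap S (k + 3) fun γ => decide (∃ i, e i γ = true) := by
  choose φ h1 h2 h3 using h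
  have key : ∀ L : List (Fin n), ∃ ψ : Formula, ψ.Safe ∧ ψ.size ≤ (L.length + 1) * (10 * S.N ^ k) ∧
      ∀ γ reg, Enc S γ reg → ψ.eval reg = decide (∃ i ∈ L, e i γ = true) := by
    have hpos : 1 ≤ S.N ^ k := Nat.one_le_pow _ _ (by have := S.le_N; omega)
    intro L
    induction L with
    | nil =>
      refine ⟨Formula.tt.nand Formula.tt, ⟨trivial, trivial⟩, ?_, fun γ reg _ => ?_⟩
      · simp only [size, List.length_nil]; omega
      · simp [Formula.eval]
    | cons i L ih =>
      obtain ⟨ψ, g1, g2, g3⟩ := ih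
      refine ⟨((φ i).nand Formula.tt).nand (ψ.nand Formula.tt), ⟨⟨h1 i, trivial⟩, ⟨g1, trivial⟩⟩,
        ?_, fun γ reg hE => ?_⟩
      · have := h2 i
        simp only [size, List.length_cons]
        rw [add_mul (L.length + 1) 1]
        omega
      · simp only [Formula.eval, h3 i γ reg hE, g3 γ reg hE]
        cases h : e i γ <;> simp [h]
  obtain ⟨ψ, g1, g2, g3⟩ := key (List.finRange n)
  refine ⟨ψ, g1, ?_, fun γ reg hE => (g3 γ reg hE).trans (by simp)⟩
  have := S.le_N
  rw [List.length_finRange] at g2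
  calc ψ.size ≤ (n + 1) * (10 * S.N ^ k) := g2
    _ ≤ (S.N * S.N) * (S.N * S.N ^ k) := by
      gcongr
      · nlinarith
      · omega
    _ = _ := by ring

theorem all {n : ℕ} (hn : n ≤ S.N) {e : Fin n → Ctx D → Bool} (h : ∀ i, Cheap S k (e i)) :
    Cheap S (k + 7) fun γ => decide (∀ i, e i γ = true) :=
  ((any hn fun i => (h i).not).not.mono (by omega)).congr' fun γ => by
    simp only [Bool.not_eq_true']
    rw [← decide_not]
    simp

end Cheap

end RFID

end

/-! ### Formulas for selection, comparison and incrementation of bit strings -/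

noncomputable section

namespace RFID

open scoped ENNReal

variable {D : Dims} {F : D.Family} {S : Setting D F}

theorem getLsb_eq_getLsbD {n : ℕ} (x : BitVec n) (i : Fin n) : x.getLsb i = x.getLsbD i := rfl

/-- All bits of `e` are cheap. -/
def CheapBits (S : Setting D F) (k : ℕ) {n : ℕ} (e : Ctx D → BitVec n) : Prop :=
  ∀ i : Fin n, Cheap S k fun γ => (e γ).getLsb i

/-- The index `o` is cheap. -/
def CheapOpt (S : Setting D F) (k : ℕ) {n : ℕ} (o : Ctx D → Option (Fin n)) : Prop :=
  ∀ i, Cheap S k fun γ => decide (o γ = some i)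

variable {k k' k'' n n' : ℕ}

/-- Selection by an index in one-hot form: the disjunction over all `i` of "`i` is selected and `e
i`", with the default if nothing is selected. -/
theorem Cheap.mux (hn : n ≤ S.N) {o : Ctx D → Option (Fin n)} (ho : CheapOpt S k o)
    {e : Fin n → Ctx D → Bool} (he : ∀ i, Cheap S k' (e i)) {e₀ : Ctx D → Bool}
    (h₀ : Cheap S k'' e₀) :
    Cheap S (max (max k k') k'' + 20) fun γ => (o γ).elim (e₀ γ) fun i => e i γ := by
  refine (((Cheap.any hn fun i => (ho i).and (he i)).or
    ((Cheap.any hn ho).not.and h₀)).mono (by omega)).congr' fun γ => ?_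
  cases h : o γ with
  | none => simp
  | some i =>
    simp only [Option.elim_some, Option.some.injEq]
    rw [Bool.eq_iff_iff]
    simp

theorem select_eq_some {f : Fin n → Bool} {i : Fin n} :
    select f = some i ↔ f i = true ∧ ∀ j, j < i → f j = false := by
  unfold select
  rw [List.find?_eq_some_iff_getElem]
  constructor
  · rintro ⟨h1, m, hm, h2, h3⟩
    refine ⟨h1, fun j hj => ?_⟩
    have hm' : m < n := by simpa using hm
    have : i = ⟨m, hm'⟩ := by rw [← h2]; simp
    subst this
    have := h3 j hj
    simpa using this
  · rintro ⟨h1, h2⟩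
    refine ⟨h1, i, by simp, by simp, fun j hj => ?_⟩
    have := h2 ⟨j, hj.trans i.2⟩ hj
    simpa using this

theorem CheapOpt.select (hn : n ≤ S.N) {f : Fin n → Ctx D → Bool} (hf : ∀ i, Cheap S k (f i)) :
    CheapOpt S (k + 20) fun γ => RFID.select fun i => f i γ := by
  intro i
  refine (((hf i).and (Cheap.all hn fun j => ((Cheap.const (decide (i ≤ j))).or
    (hf j).not))).mono (k' := k + 20) (by omega)).congr' fun γ => ?_
  rw [Bool.eq_iff_iff, decide_eq_true_iff, select_eq_some]
  simp only [Bool.and_eq_true, Bool.or_eq_true, decide_eq_true_eq, Bool.not_eq_true']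
  refine and_congr_right fun _ => forall_congr' fun j => ?_
  rw [← not_lt, imp_iff_not_or]

theorem CheapOpt.or (hn : n ≤ S.N) {o o' : Ctx D → Option (Fin n)} (h : CheapOpt S k o)
    (h' : CheapOpt S k' o') : CheapOpt S (max k k' + 20) fun γ => (o γ).or (o' γ) := by
  intro i
  refine (((h i).or ((Cheap.any hn h).not.and (h' i))).mono (by omega)).congr' fun γ => ?_
  cases h : o γ with
  | none => simp [h]
  | some j => simp [h]

namespace CheapBits

variable {e : Ctx D → BitVec n} {e' : Ctx D → BitVec n}

theorem mono (h : CheapBits S k e) (hk : k ≤ k') : CheapBits S k' e := fun i => (h i).mono hk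

theorem congr (h : CheapBits S k e) (H : ∀ γ, e γ = e' γ) : CheapBits S k e' :=
  fun i => (h i).congr' fun γ => by rw [H]

theorem const (a : BitVec n) : CheapBits S 3 fun _ => a := fun _ => Cheap.const _

theorem eq (hn : n ≤ S.N) (h : CheapBits S k e) (h' : CheapBits S k' e') :
    Cheap S (max k k' + 20) fun γ => decide (e γ = e' γ) := by
  refine ((Cheap.all hn fun i => (h i).beq (h' i)).mono (by omega)).congr' fun γ => ?_
  rw [Bool.eq_iff_iff]
  simp only [beq_iff_eq, decide_eq_true_eq]
  constructor
  · intro H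
    exact BitVec.eq_of_getLsbD_eq fun i hi => H ⟨i, hi⟩
  · rintro H i
    rw [H]

theorem append {e : Ctx D → BitVec n} {e' : Ctx D → BitVec n'} (h : CheapBits S k e)
    (h' : CheapBits S k' e') : CheapBits S (max k k') fun γ => e γ ++ e' γ := by
  intro i
  by_cases hi : i.1 < n'
  · refine ((h' ⟨i, hi⟩).mono (le_max_right _ _)).congr' fun γ => ?_
    rw [getLsb_eq_getLsbD, getLsb_eq_getLsbD, BitVec.getLsbD_append, if_pos hi]
  · refine ((h ⟨i - n', by omega⟩).mono (le_max_left _ _)).congr' fun γ => ?_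
    rw [getLsb_eq_getLsbD, getLsb_eq_getLsbD, BitVec.getLsbD_append, if_neg hi]

theorem cast (h : CheapBits S k e) (hn : n = n') : CheapBits S k fun γ => (e γ).cast hn := by
  subst hn
  exact h

theorem xor (h : CheapBits S k e) (h' : CheapBits S k' e') :
    CheapBits S (max k k' + 10) fun γ => e γ ^^^ e' γ :=
  fun i => ((h i).xor (h' i)).congr' fun γ => by simp

theorem cond {p : Ctx D → Bool} (hp : Cheap S k p) (h : CheapBits S k' e)
    (h' : CheapBits S k'' e') :
    CheapBits S (max (max k k') k'' + 8) fun γ => if p γ = true then e γ else e' γ :=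
  fun i => (hp.cond (h i) (h' i)).congr' fun γ => by dsimp only; split_ifs <;> rfl

theorem mux (hn : n' ≤ S.N) {o : Ctx D → Option (Fin n')} (ho : CheapOpt S k o)
    {e : Fin n' → Ctx D → BitVec n} (he : ∀ i, CheapBits S k' (e i)) {e₀ : Ctx D → BitVec n}
    (h₀ : CheapBits S k'' e₀) :
    CheapBits S (max (max k k') k'' + 20) fun γ => (o γ).elim (e₀ γ) fun i => e i γ :=
  fun i => (Cheap.mux hn ho (fun j => he j i) (h₀ i)).congr' fun γ => by dsimp only; cases o γ <;> rfl

theorem ofWires {f : Fin n → Ctx D → Bool} (hf : ∀ i, Cheap S k (f i)) :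
    CheapBits S k fun γ => RFID.ofWires fun i => f i γ :=
  fun i => (hf i).congr' fun γ => (getLsb_ofWires (fun i => f i γ) i).symm

theorem getLsbD_one_succ (i : ℕ) : (BitVec.ofNat n 1).getLsbD (i + 1) = false := by
  rw [BitVec.getLsbD_ofNat]
  simp [Nat.testBit_succ]

/-- When `1` is added, a carry passes a position exactly if all bits up to there are set. So each
bit of the incremented counter is a bit xor a conjunction, which is cheap. -/
theorem carry_one (x : BitVec n) (i : ℕ) :
    BitVec.carry (i + 1) x (BitVec.ofNat n 1) false = decide (∀ j ≤ i, x.getLsbD j = true) := by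
  induction i with
  | zero =>
    rw [BitVec.carry_succ, BitVec.carry_zero]
    by_cases hn : 0 < n
    · simp [hn, Bool.atLeastTwo]
    · have : n = 0 := by omega
      subst this
      simp [Bool.atLeastTwo]
  | succ i ih =>
    rw [BitVec.carry_succ, ih]
    rw [getLsbD_one_succ, Bool.eq_iff_iff]
    simp only [Bool.atLeastTwo, Bool.and_false, Bool.false_and, Bool.or_false, Bool.false_or,
      Bool.and_eq_true, decide_eq_true_eq]
    constructor
    · rintro ⟨h2, h3⟩ j hj
      rcases Nat.lt_or_ge i j with h4 | h4
      · rwa [show j = i + 1 by omega]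
      · exact h3 j h4
    · intro h
      exact ⟨h _ le_rfl, fun j hj => h j (by omega)⟩

theorem getLsb_succ (x : BitVec n) (i : Fin n) :
    (x + BitVec.ofNat n 1).getLsb i =
      (x.getLsb i ^^ decide (∀ j : Fin n, (decide (i ≤ j) || x.getLsb j) = true)) := by
  simp only [getLsb_eq_getLsbD]
  rw [BitVec.getLsbD_add i.2]
  congr 1
  obtain ⟨i, hi⟩ := i
  cases i with
  | zero => simp [hi, Fin.le_def]
  | succ i =>
    dsimp only
    rw [carry_one, getLsbD_one_succ, Bool.false_xor]
    refine decide_eq_decide.2 ⟨fun H j => ?_, fun H j hj => ?_⟩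
    · simp only [Bool.or_eq_true, decide_eq_true_eq]
      by_cases hj : j.1 ≤ i
      · exact Or.inr (H j hj)
      · left
        simp only [Fin.le_def]
        omega
    · have := H ⟨j, by omega⟩
      simp only [Bool.or_eq_true, decide_eq_true_eq, Fin.le_def] at this
      rcases this with h3 | h3
      · omega
      · exact h3

theorem succ (hn : n ≤ S.N) (h : CheapBits S k e) :
    CheapBits S (k + 30) fun γ => e γ + BitVec.ofNat n 1 :=
  fun i => (((h i).xor (Cheap.all hn fun j => (Cheap.const (decide (i ≤ j))).or (h j))).mono
    (by omega)).congr' fun γ => (getLsb_succ _ i).symm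

end CheapBits

theorem cheap_α11 {e : Ctx D → BitVec D.lA} (h : CheapBits S k e) :
    CheapBits S k fun γ => α11 (e γ) :=
  fun i => (h ⟨D.lv + D.lr + i, by have := i.2; show _ < D.lr + D.lv + D.lr; omega⟩).congr'
    fun γ => by
      change (e γ).getLsbD _ = ((e γ).extractLsb' (D.lv + D.lr) D.lr).getLsbD i
      rw [BitVec.getLsbD_extractLsb']
      simp only [i.2, decide_true, Bool.true_and]

theorem cheap_α12 {e : Ctx D → BitVec D.lA} (h : CheapBits S k e) :
    CheapBits S k fun γ => α12 (e γ) :=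
  fun i => (h ⟨D.lr + i, by have := i.2; show _ < D.lr + D.lv + D.lr; omega⟩).congr'
    fun γ => by
      change (e γ).getLsbD _ = ((e γ).extractLsb' D.lr D.lv).getLsbD i
      rw [BitVec.getLsbD_extractLsb']
      simp only [i.2, decide_true, Bool.true_and]

theorem cheap_α13 {e : Ctx D → BitVec D.lA} (h : CheapBits S k e) :
    CheapBits S k fun γ => α13 (e γ) :=
  fun i => (h ⟨i, by have := i.2; show _ < D.lr + D.lv + D.lr; omega⟩).congr'
    fun γ => by
      change (e γ).getLsbD _ = ((e γ).extractLsb' 0 D.lr).getLsbD i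
      rw [BitVec.getLsbD_extractLsb']
      simp only [i.2, decide_true, Bool.true_and, Nat.zero_add]

theorem cheap_idx {e : Ctx D → BitVec D.lr} (h : CheapBits S k e) :
    CheapBits S (max k 3) fun γ => D.idx (e γ) :=
  (h.append (CheapBits.const D.pad)).cast D.hp

theorem cheap_mac {a : Ctx D → BitVec D.lu} {b : Ctx D → BitVec D.lr} {r : Ctx D → BitVec D.lv}
    (ha : CheapBits S k a) (hb : CheapBits S k' b) (hr : CheapBits S k'' r) :
    CheapBits S (max (max k k') k'') fun γ => D.mac (a γ) (b γ) (r γ) :=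
  ((ha.append hb).append hr).cast D.hm

end RFID

end

noncomputable section

namespace RFID

open scoped ENNReal

variable {D : Dims} {F : D.Family} {S : Setting D F} {k k' k'' n : ℕ}

/-! ### The oracles are computed by small formulas -/

section

variable (S)

theorem cheap_ctr (j : Fin D.l) : CheapBits S 1 fun γ => γ.w.ctr j :=
  fun b => Cheap.var (.world (.ctr j b))

theorem cheap_c1 (j : Fin D.l) : CheapBits S 1 fun γ => γ.w.c1 j :=
  fun b => Cheap.var (.world (.c1 j b))

theorem cheap_rT (j : Fin D.l) : CheapBits S 1 fun γ => γ.w.rT j :=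
  fun b => Cheap.var (.world (.rT j b))

theorem cheap_key {j : Fin D.l} (hj : j ≠ S.c) : CheapBits S 1 fun γ => γ.w.key j :=
  fun b => (Cheap.var (.world (.key j b))).congr' fun γ => by simp [Var.bit, WVar.bit, hj]

theorem cheap_recHas (j : Fin D.l) : Cheap S 1 fun γ => (γ.w.recCtr j).isSome :=
  Cheap.var (.world (.recHas j))

theorem cheap_recCtr (j : Fin D.l) : CheapBits S 1 fun γ => (γ.w.recCtr j).getD 0 :=
  fun b => Cheap.var (.world (.recCtr j b))

theorem cheap_corrupted (j : Fin D.l) : Cheap S 1 fun γ => γ.w.corrupted j :=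
  Cheap.var (.world (.corrupted j))

theorem cheap_pendHas (j : Fin D.l) : Cheap S 1 fun γ => (γ.w.pending j).isSome :=
  Cheap.var (.world (.pendHas j))

theorem cheap_pendC1 (j : Fin D.l) : CheapBits S 1 fun γ => fst0 (γ.w.pending j) :=
  fun b => Cheap.var (.world (.pendC1 j b))

theorem cheap_pendA (j : Fin D.l) : CheapBits S 1 fun γ => snd0 (γ.w.pending j) :=
  fun b => Cheap.var (.world (.pendA j b))

theorem cheap_isIdle (s : Fin D.m) : Cheap S 1 fun γ => (γ.w.reader s).isIdle :=
  Cheap.var (.world (.idle s))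

theorem cheap_isWaiting (s : Fin D.m) : Cheap S 1 fun γ => (γ.w.reader s).isWaiting :=
  Cheap.var (.world (.waiting s))

theorem cheap_readerNonce (s : Fin D.m) : CheapBits S 1 fun γ => γ.w.readerNonce s :=
  fun b => (Cheap.var (.world (.sC1 s b))).congr' fun γ => by
    simp only [Var.bit, WVar.bit, World.readerNonce]
    cases γ.w.reader s <;> rfl

theorem cheap_tagFooled (j : Fin D.l) : Cheap S 1 fun γ => γ.w.tagFooled j :=
  Cheap.var (.world (.tagFooled j))

theorem cheap_readerFooled (j : Fin D.l) : Cheap S 1 fun γ => γ.w.readerFooled j :=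
  Cheap.var (.world (.readerFooled j))

theorem cheap_rnd (i : D.Coin) : Cheap S 1 fun γ => γ.rnd i := Cheap.var (.rnd i)

theorem cheap_rnd_key (j : Fin D.l) : CheapBits S 1 fun γ => γ.rnd.key j :=
  CheapBits.ofWires fun _ => cheap_rnd S _

theorem cheap_rnd_c1 : CheapBits S 1 fun γ => γ.rnd.c1 := CheapBits.ofWires fun _ => cheap_rnd S _

theorem cheap_rnd_rT : CheapBits S 1 fun γ => γ.rnd.rT := CheapBits.ofWires fun _ => cheap_rnd S _

theorem cheap_rnd_α : CheapBits S 1 fun γ => γ.rnd.α := CheapBits.ofWires fun _ => cheap_rnd S _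

theorem cheap_rnd_c2 : CheapBits S 1 fun γ => γ.rnd.c2 := CheapBits.ofWires fun _ => cheap_rnd S _

theorem cheap_y (t : Fin 4) (j : Fin D.l) : CheapBits S 1 fun γ => γ.y t j :=
  fun b => Cheap.var (.y t j b)

theorem Setting.le (S : Setting D F) : D.l ≤ S.N ∧ D.lr ≤ S.N ∧ D.lv ≤ S.N ∧ D.lu ≤ S.N ∧
    D.lA ≤ S.N ∧ D.m ≤ S.N ∧ S.T ≤ S.N ∧ D.lk ≤ S.N ∧ D.ld ≤ S.N := by
  have := S.bound
  have hA : D.lA = D.lr + D.lv + D.lr := rfl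
  refine ⟨?_, ?_, ?_, ?_, ?_, ?_, ?_, ?_, ?_⟩ <;> omega

end

/-- Membership is a search through the `T` encoded entries. Here the bound on the length of logs is
needed, as longer logs would not be encoded completely. -/
theorem Cheap.log_mem (j : Fin D.l) {c1 : Ctx D → BitVec D.lu} {α : Ctx D → BitVec D.lA}
    (h1 : CheapBits S k c1) (hα : CheapBits S k α) :
    Cheap S (max 1 k + 30) fun γ => decide ((c1 γ, α γ) ∈ γ.w.log j) := by
  obtain ⟨-, -, -, hlu, hlA, -, hT, -⟩ := S.le
  have h := Cheap.any hT fun i : Fin S.T =>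
    (Cheap.var (.world (.logHas j i))).and <|
    (CheapBits.eq hlu (fun b => Cheap.var (.world (.logC1 j i b)) :
      CheapBits S 1 fun γ => fst0 (γ.w.log j)[i.1]?) h1).and <|
    CheapBits.eq hlA (fun b => Cheap.var (.world (.logA j i b)) :
      CheapBits S 1 fun γ => snd0 (γ.w.log j)[i.1]?) hα
  refine (h.mono (by omega)).congr fun γ hs => ?_
  rw [Bool.eq_iff_iff]
  simp only [Var.bit, WVar.bit, Bool.and_eq_true, decide_eq_true_eq]
  constructor
  · rintro ⟨i, hi, h2, h3⟩
    obtain ⟨z, hz⟩ := Option.isSome_iff_exists.1 hi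
    rw [hz] at h2 h3
    rw [← h2, ← h3]
    exact List.mem_of_getElem? hz
  · intro hm
    obtain ⟨i, hi, he⟩ := List.mem_iff_getElem.1 hm
    refine ⟨⟨i, hi.trans_le (hs j)⟩, ?_⟩
    simp [List.getElem?_eq_getElem hi, he, fst0, snd0]

open Classical in
theorem Cheap.readerMatches (i : Fin D.l) {c1 : Ctx D → BitVec D.lu} {α : Ctx D → BitVec D.lA}
    {c2 : Ctx D → BitVec D.lr} (h1 : CheapBits S k c1) (hα : CheapBits S k α)
    (h2 : CheapBits S k c2) :
    Cheap S (max 1 k + 40) fun γ => decide (γ.w.ReaderMatches i (c1 γ) (α γ) (c2 γ)) := by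
  obtain ⟨-, hlr, -, hlu, hlA, hm, -⟩ := S.le
  have h := Cheap.any hm fun s : Fin D.m =>
    (Cheap.var (.world (.accepted s))).and <|
    (CheapBits.eq hlu (fun b => Cheap.var (.world (.sC1 s b)) :
      CheapBits S 1 fun γ => (γ.w.reader s).c1) h1).and <|
    (CheapBits.eq hlA (fun b => Cheap.var (.world (.sA s b)) :
      CheapBits S 1 fun γ => (γ.w.reader s).α) hα).and <|
    (Cheap.var (.world (.sTag s i))).and <|
    CheapBits.eq hlr (fun b => Cheap.var (.world (.sC2 s b)) :
      CheapBits S 1 fun γ => (γ.w.reader s).c2) h2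
  refine (h.mono (by omega)).congr' fun γ => ?_
  unfold World.ReaderMatches
  rw [decide_eq_decide]
  refine exists_congr fun s => ?_
  simp only [Var.bit, WVar.bit, Bool.and_eq_true, decide_eq_true_eq]
  cases γ.w.reader s <;> simp [Sess.isAccepted, Sess.c1, Sess.α, Sess.isTag, Sess.c2]

/-- All bits of the world `W` are cheap. -/
def CheapWorld (S : Setting D F) (k : ℕ) (W : Ctx D → World D) : Prop :=
  ∀ v : WVar D S.T, Cheap S k fun γ => v.bit S.c (W γ)

theorem cheapWorld_w : CheapWorld S 1 fun γ => γ.w := fun v => Cheap.var (.world v)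

namespace CheapWorld

variable {W W' : Ctx D → World D}

theorem mono (h : CheapWorld S k W) (hk : k ≤ k') : CheapWorld S k' W := fun v => (h v).mono hk

theorem congr (h : CheapWorld S k W) (H : ∀ γ, W γ = W' γ) : CheapWorld S k W' :=
  fun v => (h v).congr' fun γ => by rw [H]

theorem cond {p : Ctx D → Bool} (hp : Cheap S k p) (h : CheapWorld S k' W)
    (h' : CheapWorld S k'' W') :
    CheapWorld S (max (max k k') k'' + 8) fun γ => if p γ = true then W γ else W' γ :=
  fun v => (hp.cond (h v) (h' v)).congr' fun γ => by dsimp only; split_ifs <;> rfl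

theorem mux (hn : n ≤ S.N) {o : Ctx D → Option (Fin n)} (ho : CheapOpt S k o)
    {e : Fin n → Ctx D → World D} (he : ∀ i, CheapWorld S k' (e i)) (h₀ : CheapWorld S k'' W) :
    CheapWorld S (max (max k k') k'' + 20) fun γ => (o γ).elim (W γ) fun i => e i γ :=
  fun v => (Cheap.mux hn ho (fun j => he j v) (h₀ v)).congr' fun γ => by
    dsimp only; cases o γ <;> rfl

theorem setCtr (h : CheapWorld S k W) (j : Fin D.l) {e : Ctx D → BitVec D.lr}
    (he : CheapBits S k e) :
    CheapWorld S k fun γ => { W γ with ctr := Function.update (W γ).ctr j (e γ) } := by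
  intro v
  have h0 := h v
  cases v
  case ctr j' b =>
    by_cases hj : j' = j
    · subst hj; simpa [WVar.bit] using he b
    · simpa [WVar.bit, hj] using h0
  all_goals exact h0

theorem setC1 (h : CheapWorld S k W) (j : Fin D.l) {e : Ctx D → BitVec D.lu}
    (he : CheapBits S k e) :
    CheapWorld S k fun γ => { W γ with c1 := Function.update (W γ).c1 j (e γ) } := by
  intro v
  have h0 := h v
  cases v
  case c1 j' b =>
    by_cases hj : j' = j
    · subst hj; simpa [WVar.bit] using he b
    · simpa [WVar.bit, hj] using h0
  all_goals exact h0

theorem setRT (h : CheapWorld S k W) (j : Fin D.l) {e : Ctx D → BitVec D.lv}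
    (he : CheapBits S k e) :
    CheapWorld S k fun γ => { W γ with rT := Function.update (W γ).rT j (e γ) } := by
  intro v
  have h0 := h v
  cases v
  case rT j' b =>
    by_cases hj : j' = j
    · subst hj; simpa [WVar.bit] using he b
    · simpa [WVar.bit, hj] using h0
  all_goals exact h0

theorem setRecCtr (h : CheapWorld S k W) (hk : 3 ≤ k) (j : Fin D.l) {e : Ctx D → BitVec D.lr}
    (he : CheapBits S k e) :
    CheapWorld S k fun γ => { W γ with recCtr := Function.update (W γ).recCtr j (some (e γ)) } := by
  intro v
  have h0 := h v
  cases v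
  case recHas j' =>
    by_cases hj : j' = j
    · subst hj; simpa [WVar.bit] using (Cheap.const true).mono hk
    · simpa [WVar.bit, hj] using h0
  case recCtr j' b =>
    by_cases hj : j' = j
    · subst hj; simpa [WVar.bit] using he b
    · simpa [WVar.bit, hj] using h0
  all_goals exact h0

theorem forget (h : CheapWorld S k W) (hk : 3 ≤ k) (j : Fin D.l) :
    CheapWorld S k fun γ => (W γ).forget j := by
  intro v
  have h0 := h v
  cases v
  case recHas j' =>
    by_cases hj : j' = j
    · subst hj; simpa [WVar.bit, World.forget] using (Cheap.const false).mono hk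
    · simpa [WVar.bit, hj, World.forget] using h0
  case recCtr j' b =>
    by_cases hj : j' = j
    · subst hj; simpa [WVar.bit, World.forget] using (CheapBits.const 0 b).mono hk
    · simpa [WVar.bit, hj, World.forget] using h0
  all_goals exact h0

theorem setCorrupted (h : CheapWorld S k W) (hk : 3 ≤ k) (j : Fin D.l) :
    CheapWorld S k fun γ => { W γ with corrupted := Function.update (W γ).corrupted j true } := by
  intro v
  have h0 := h v
  cases v
  case corrupted j' =>
    by_cases hj : j' = j
    · subst hj; simpa [WVar.bit] using (Cheap.const true).mono hk
    · simpa [WVar.bit, hj] using h0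
  all_goals exact h0

theorem setPending (h : CheapWorld S k W) (hk : 3 ≤ k) (j : Fin D.l) :
    CheapWorld S k fun γ => { W γ with pending := Function.update (W γ).pending j none } := by
  intro v
  have h0 := h v
  cases v
  case pendHas j' =>
    by_cases hj : j' = j
    · subst hj; simpa [WVar.bit] using (Cheap.const false).mono hk
    · simpa [WVar.bit, hj] using h0
  case pendC1 j' b =>
    by_cases hj : j' = j
    · subst hj; simpa [WVar.bit, fst0] using (CheapBits.const 0 b).mono hk
    · simpa [WVar.bit, hj] using h0
  case pendA j' b =>
    by_cases hj : j' = j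
    · subst hj; simpa [WVar.bit, snd0] using (CheapBits.const 0 b).mono hk
    · simpa [WVar.bit, hj] using h0
  all_goals exact h0

theorem begin (h : CheapWorld S k W) (hk : 3 ≤ k) (j : Fin D.l) {c1 : Ctx D → BitVec D.lu}
    {α : Ctx D → BitVec D.lA} (h1 : CheapBits S k c1) (hα : CheapBits S k α) :
    CheapWorld S k fun γ => (W γ).begin j (c1 γ) (α γ) := by
  intro v
  have h0 := h v
  cases v
  case pendHas j' =>
    by_cases hj : j' = j
    · subst hj; simpa [WVar.bit, World.begin] using (Cheap.const true).mono hk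
    · simpa [WVar.bit, hj, World.begin] using h0
  case pendC1 j' b =>
    by_cases hj : j' = j
    · subst hj; simpa [WVar.bit, fst0, World.begin] using h1 b
    · simpa [WVar.bit, hj, World.begin] using h0
  case pendA j' b =>
    by_cases hj : j' = j
    · subst hj; simpa [WVar.bit, snd0, World.begin] using hα b
    · simpa [WVar.bit, hj, World.begin] using h0
  case logHas j' i =>
    by_cases hj : j' = j
    · subst hj
      -- A new transcript is put in front, so entry `i + 1` becomes the former entry `i`.
      obtain ⟨_ | i, hi⟩ := i
      · simpa [WVar.bit, World.begin] using (Cheap.const true).mono hk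
      · simpa [WVar.bit, World.begin] using h (.logHas j' ⟨i, by omega⟩)
    · simpa [WVar.bit, hj, World.begin] using h0
  case logC1 j' i b =>
    by_cases hj : j' = j
    · subst hj
      obtain ⟨_ | i, hi⟩ := i
      · simpa [WVar.bit, fst0, World.begin] using h1 b
      · simpa [WVar.bit, World.begin] using h (.logC1 j' ⟨i, by omega⟩ b)
    · simpa [WVar.bit, hj, World.begin] using h0
  case logA j' i b =>
    by_cases hj : j' = j
    · subst hj
      obtain ⟨_ | i, hi⟩ := i
      · simpa [WVar.bit, snd0, World.begin] using hα b
      · simpa [WVar.bit, World.begin] using h (.logA j' ⟨i, by omega⟩ b)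
    · simpa [WVar.bit, hj, World.begin] using h0
  all_goals exact h0

theorem setReader (h : CheapWorld S k W) (s : Fin D.m) {z : Ctx D → Sess D}
    (hi : Cheap S k fun γ => (z γ).isIdle) (hw : Cheap S k fun γ => (z γ).isWaiting)
    (ha : Cheap S k fun γ => (z γ).isAccepted) (h1 : CheapBits S k fun γ => (z γ).c1)
    (hα : CheapBits S k fun γ => (z γ).α) (ht : ∀ i, Cheap S k fun γ => (z γ).isTag i)
    (h2 : CheapBits S k fun γ => (z γ).c2) :
    CheapWorld S k fun γ => { W γ with reader := Function.update (W γ).reader s (z γ) } := by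
  intro v
  have h0 := h v
  cases v
  case idle s' =>
    by_cases hs : s' = s
    · subst hs; simpa [WVar.bit] using hi
    · simpa [WVar.bit, hs] using h0
  case waiting s' =>
    by_cases hs : s' = s
    · subst hs; simpa [WVar.bit] using hw
    · simpa [WVar.bit, hs] using h0
  case accepted s' =>
    by_cases hs : s' = s
    · subst hs; simpa [WVar.bit] using ha
    · simpa [WVar.bit, hs] using h0
  case sC1 s' b =>
    by_cases hs : s' = s
    · subst hs; simpa [WVar.bit] using h1 b
    · simpa [WVar.bit, hs] using h0
  case sA s' b =>
    by_cases hs : s' = s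
    · subst hs; simpa [WVar.bit] using hα b
    · simpa [WVar.bit, hs] using h0
  case sTag s' i =>
    by_cases hs : s' = s
    · subst hs; simpa [WVar.bit] using ht i
    · simpa [WVar.bit, hs] using h0
  case sC2 s' b =>
    by_cases hs : s' = s
    · subst hs; simpa [WVar.bit] using h2 b
    · simpa [WVar.bit, hs] using h0
  all_goals exact h0

theorem setWaiting (h : CheapWorld S k W) (hk : 3 ≤ k) (s : Fin D.m) {c1 : Ctx D → BitVec D.lu}
    (h1 : CheapBits S k c1) :
    CheapWorld S k fun γ =>
      { W γ with reader := Function.update (W γ).reader s (.waiting (c1 γ)) } :=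
  h.setReader s ((Cheap.const false).mono hk) ((Cheap.const true).mono hk)
    ((Cheap.const false).mono hk) h1 ((CheapBits.const 0).mono hk)
    (fun _ => (Cheap.const false).mono hk) ((CheapBits.const 0).mono hk)

theorem setRejected (h : CheapWorld S k W) (hk : 3 ≤ k) (s : Fin D.m) :
    CheapWorld S k fun γ => { W γ with reader := Function.update (W γ).reader s .rejected } :=
  h.setReader s ((Cheap.const false).mono hk) ((Cheap.const false).mono hk)
    ((Cheap.const false).mono hk) ((CheapBits.const 0).mono hk) ((CheapBits.const 0).mono hk)
    (fun _ => (Cheap.const false).mono hk) ((CheapBits.const 0).mono hk)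

theorem setAccepted (h : CheapWorld S k W) (hk : 3 ≤ k) (s : Fin D.m) {c1 : Ctx D → BitVec D.lu}
    {α : Ctx D → BitVec D.lA} (i : Fin D.l) {c2 : Ctx D → BitVec D.lr} (h1 : CheapBits S k c1)
    (hα : CheapBits S k α) (h2 : CheapBits S k c2) :
    CheapWorld S k fun γ => { W γ with
      reader := Function.update (W γ).reader s (.accepted (c1 γ) (α γ) i (c2 γ)) } :=
  h.setReader s ((Cheap.const false).mono hk) ((Cheap.const false).mono hk)
    ((Cheap.const true).mono hk) h1 hα (fun j => (Cheap.const (decide (i = j))).mono hk) h2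

theorem setTagFooled (h : CheapWorld S k W) (j : Fin D.l) {e : Ctx D → Bool}
    (he : Cheap S k e) :
    CheapWorld S k fun γ => { W γ with tagFooled := Function.update (W γ).tagFooled j (e γ) } := by
  intro v
  have h0 := h v
  cases v
  case tagFooled j' =>
    by_cases hj : j' = j
    · subst hj; simpa [WVar.bit] using he
    · simpa [WVar.bit, hj] using h0
  all_goals exact h0

theorem setReaderFooled (h : CheapWorld S k W) (j : Fin D.l) {e : Ctx D → Bool}
    (he : Cheap S k e) :
    CheapWorld S k fun γ =>
      { W γ with readerFooled := Function.update (W γ).readerFooled j (e γ) } := by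
  intro v
  have h0 := h v
  cases v
  case readerFooled j' =>
    by_cases hj : j' = j
    · subst hj; simpa [WVar.bit] using he
    · simpa [WVar.bit, hj] using h0
  all_goals exact h0

theorem init : CheapWorld S 3 fun γ => World.init γ.rnd.key := by
  intro v
  have h := Cheap.const (S := S) (v.bit S.c (World.init fun _ => 0))
  cases v
  case key j b =>
    by_cases hj : j = S.c
    · simpa [WVar.bit, hj] using Cheap.const false
    · simpa [WVar.bit, hj, World.init] using ((cheap_rnd_key S j) b).mono (by norm_num)
  all_goals exact h

end CheapWorld

end RFID

end

/-! ### Formulas for complete oracle calls -/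

noncomputable section

namespace RFID

open scoped ENNReal

variable {D : Dims} {F : D.Family} {S : Setting D F}

namespace World

variable (w : World D)

/-- Here and in the next lemmas case distinctions on data are rewritten as conditionals on encoded
bits, for which the closure properties of `Cheap` apply. -/
theorem initReader_eq_ite (s : Fin D.m) (c1 : BitVec D.lu) :
    w.initReader s c1 = (if (w.reader s).isIdle = true then c1 else 0,
      if (w.reader s).isIdle = true then
        { w with reader := Function.update w.reader s (.waiting c1) } else w) := by
  unfold initReader
  cases w.reader s <;> rfl

theorem hit1_eq_ite (α : BitVec D.lA) (b ix : Fin D.l → BitVec D.lr) (j : Fin D.l) :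
    w.hit1 α b ix j = ((w.recCtr j).isSome && (decide (ix j = α11 α) &&
      decide ((w.recCtr j).getD 0 = b j ^^^ α13 α))) := by
  unfold hit1
  cases w.recCtr j <;> rfl

theorem sendReader_eq_ite (s : Fin D.m) (α : BitVec D.lA) (y : Fin 4 → Fin D.l → BitVec D.lr) :
    w.sendReader s α y = ((
      if (w.reader s).isWaiting = true then (w.found α y).elim 0 (y 3) else 0,
      if (w.reader s).isWaiting = true then (w.found α y).elim false fun _ => true else false),
      if (w.reader s).isWaiting = true then
        (w.found α y).elim { w with reader := Function.update w.reader s .rejected } fun i =>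
          w.accept s (w.readerNonce s) α i ((y 0 i ^^^ α13 α) + BitVec.ofNat D.lr 1) (y 3 i)
      else w) := by
  unfold sendReader readerNonce
  cases w.reader s <;> try rfl
  cases w.found α y <;> rfl

theorem finishTag_eq_ite (i : Fin D.l) (c2 e : BitVec D.lr) :
    w.finishTag i c2 e = (
      if (w.pending i).isSome = true then decide (c2 = e) else false,
      if (w.pending i).isSome = true then { w with
        pending := Function.update w.pending i none
        readerFooled := Function.update w.readerFooled i (w.readerFooled i ||
          (decide (c2 = e) && !w.corrupted i &&
            !@decide _ (Classical.propDecidable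
              (w.ReaderMatches i (fst0 (w.pending i)) (snd0 (w.pending i)) c2)))) }
      else w) := by
  unfold finishTag
  cases w.pending i <;> rfl

theorem sendReaderIdeal_eq_ite (c : Fin D.l) (s : Fin D.m) (α : BitVec D.lA) (r : Coins D)
    (y : Fin 4 → Fin D.l → BitVec D.lr) :
    w.sendReaderIdeal c s α r y = ((
      if (w.reader s).isWaiting = true then
        if decide ((w.readerNonce s, α) ∈ w.log c) = true then r.c2 else (w.sendReader s α y).1.1
      else 0,
      if (w.reader s).isWaiting = true then
        if decide ((w.readerNonce s, α) ∈ w.log c) = true then true else (w.sendReader s α y).1.2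
      else false),
      if (w.reader s).isWaiting = true then
        if decide ((w.readerNonce s, α) ∈ w.log c) = true then
          { w with reader :=
              Function.update w.reader s (.accepted (w.readerNonce s) α c r.c2) }
        else (w.sendReader s α y).2
      else w) := by
  unfold sendReaderIdeal readerNonce
  cases h : w.reader s <;> try rfl
  simp only [Sess.isWaiting, if_true, decide_eq_true_eq]
  split_ifs <;> rfl

theorem finishTagIdeal_self (c : Fin D.l) (c2 e : BitVec D.lr) :
    w.finishTagIdeal c c c2 e = (
      if (w.pending c).isSome = true then
        @decide _ (Classical.propDecidable
          (w.ReaderMatches c (fst0 (w.pending c)) (snd0 (w.pending c)) c2)) else false,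
      if (w.pending c).isSome = true then
        { w with pending := Function.update w.pending c none } else w) := by
  unfold finishTagIdeal
  rw [if_pos rfl]
  cases w.pending c <;> rfl

end World

theorem cheap_found {α : Ctx D → BitVec D.lA} (hα : CheapBits S 10 α) :
    CheapOpt S 200 fun γ => γ.w.found (α γ) γ.y := by
  obtain ⟨hl, hlr, -⟩ := S.le
  have h1 : ∀ j, Cheap S 100 fun γ => γ.w.hit1 (α γ) (γ.y 0) (γ.y 2) j := fun j =>
    (((cheap_recHas S j).and (((cheap_y S 2 j).eq hlr (cheap_α11 hα)).and
      ((cheap_recCtr S j).eq hlr ((cheap_y S 0 j).xor (cheap_α13 hα))))).mono (by omega)).congr'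
      fun γ => (γ.w.hit1_eq_ite _ _ _ _).symm
  have h2 : ∀ j, Cheap S 100 fun γ => γ.w.hit2 (α γ) (γ.y 1) j := fun j =>
    (((cheap_recHas S j).and ((cheap_y S 1 j).eq hlr (cheap_α11 hα))).mono (by omega)).congr'
      fun γ => rfl
  intro i
  exact (((CheapOpt.select hl h1).or hl (CheapOpt.select hl h2)) i).mono (by omega)

theorem cheap_initReader (s : Fin D.m) :
    CheapBits S 100 (fun γ => (γ.w.initReader s γ.rnd.c1).1) ∧
      CheapWorld S 100 fun γ => (γ.w.initReader s γ.rnd.c1).2 := by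
  constructor
  · exact (((CheapBits.cond (cheap_isIdle S s) (cheap_rnd_c1 S) (CheapBits.const 0))).mono
      (by omega)).congr fun γ => by rw [World.initReader_eq_ite]
  · exact ((CheapWorld.cond (cheap_isIdle S s)
      ((cheapWorld_w.mono (by omega)).setWaiting le_rfl s ((cheap_rnd_c1 S).mono (by omega)))
      cheapWorld_w).mono (by omega)).congr fun γ => by rw [World.initReader_eq_ite]

theorem cheap_startTag (i : Fin D.l) {c1 : Ctx D → BitVec D.lu} (h1 : CheapBits S 10 c1) :
    CheapBits S 100 (fun γ => (γ.w.startTag i (c1 γ) γ.rnd.rT (γ.y 0 i) (γ.y 1 i)).1) ∧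
      CheapWorld S 100 fun γ => (γ.w.startTag i (c1 γ) γ.rnd.rT (γ.y 0 i) (γ.y 1 i)).2 := by
  have hα := ((cheap_y S 0 i).append (cheap_rnd_rT S)).append
    ((cheap_y S 1 i).xor (cheap_ctr S i))
  refine ⟨hα.mono (by omega), ?_⟩
  obtain ⟨-, hlr, -⟩ := S.le
  have := ((((cheapWorld_w (S := S)).mono (show 1 ≤ 100 by omega)).begin (by omega) i
    (h1.mono (by omega)) (hα.mono (by omega))).setCtr i (((cheap_ctr S i).succ hlr).mono
    (by omega))).setC1 i (h1.mono (by omega)) |>.setRT i ((cheap_rnd_rT S).mono (by omega))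
  exact this

theorem cheap_start (ρ : Rules D.l) (i : Fin D.l) {c1 : Ctx D → BitVec D.lu}
    (h1 : CheapBits S 10 c1) :
    CheapBits S 100 (fun γ => (γ.w.start ρ i (c1 γ) γ.rnd (γ.y 0 i) (γ.y 1 i)).1) ∧
      CheapWorld S 100 fun γ => (γ.w.start ρ i (c1 γ) γ.rnd (γ.y 0 i) (γ.y 1 i)).2 := by
  unfold World.start
  cases ρ.ideal with
  | none => exact cheap_startTag i h1
  | some c =>
    simp only [World.startTagIdeal]
    split_ifs with h
    · exact ⟨(cheap_rnd_α S).mono (by omega), (cheapWorld_w.mono (by omega)).begin (by omega) c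
        (h1.mono (by omega)) ((cheap_rnd_α S).mono (by omega))⟩
    · exact cheap_startTag i h1

theorem cheap_accept (s : Fin D.m) {α : Ctx D → BitVec D.lA} (hα : CheapBits S 10 α)
    (i : Fin D.l) : CheapWorld S 200 fun γ => γ.w.accept s (γ.w.readerNonce s) (α γ) i
      ((γ.y 0 i ^^^ α13 (α γ)) + BitVec.ofNat D.lr 1) (γ.y 3 i) := by
  obtain ⟨-, hlr, -⟩ := S.le
  have hf := (cheap_tagFooled S i).or
    ((cheap_corrupted S i).not.and (Cheap.log_mem i ((cheap_readerNonce S s).mono (show 1 ≤ 10 by omega)) hα).not)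
  have := ((((cheapWorld_w (S := S)).mono (show 1 ≤ 200 by omega)).setRecCtr (by omega) i
    ((((cheap_y S 0 i).xor (cheap_α13 hα)).succ hlr).mono (by omega))).setAccepted (by omega) s i
    ((cheap_readerNonce S s).mono (by omega)) (hα.mono (by omega))
    ((cheap_y S 3 i).mono (by omega))).setTagFooled i (hf.mono (k' := 200) (by omega))
  refine this.congr fun γ => ?_
  simp only [World.accept, decide_not]

theorem cheap_sendReader (s : Fin D.m) {α : Ctx D → BitVec D.lA} (hα : CheapBits S 10 α) :
    CheapBits S 300 (fun γ => (γ.w.sendReader s (α γ) γ.y).1.1) ∧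
      Cheap S 300 (fun γ => (γ.w.sendReader s (α γ) γ.y).1.2) ∧
      CheapWorld S 300 fun γ => (γ.w.sendReader s (α γ) γ.y).2 := by
  obtain ⟨hl, -⟩ := S.le
  have hw := cheap_isWaiting S s
  have hf := cheap_found hα
  refine ⟨?_, ?_, ?_⟩
  · exact ((CheapBits.cond hw (CheapBits.mux hl hf (fun i => cheap_y S 3 i) (CheapBits.const 0))
      (CheapBits.const 0)).mono (by omega)).congr fun γ => by rw [World.sendReader_eq_ite]
  · exact ((Cheap.cond hw (Cheap.mux hl hf (fun _ => Cheap.const true) (Cheap.const false))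
      (Cheap.const false)).mono (by omega)).congr' fun γ => by rw [World.sendReader_eq_ite]
  · exact ((CheapWorld.cond hw (CheapWorld.mux hl hf (fun i => cheap_accept s hα i)
      ((cheapWorld_w.mono (by omega)).setRejected le_rfl s)) cheapWorld_w).mono (by omega)).congr
      fun γ => by rw [World.sendReader_eq_ite]

theorem cheap_send (ρ : Rules D.l) (s : Fin D.m) {α : Ctx D → BitVec D.lA}
    (hα : CheapBits S 10 α) :
    CheapBits S 400 (fun γ => (γ.w.send ρ s (α γ) γ.rnd γ.y).1.1) ∧
      Cheap S 400 (fun γ => (γ.w.send ρ s (α γ) γ.rnd γ.y).1.2) ∧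
      CheapWorld S 400 fun γ => (γ.w.send ρ s (α γ) γ.rnd γ.y).2 := by
  obtain ⟨h1, h2, h3⟩ := cheap_sendReader s hα
  unfold World.send
  cases ρ.ideal with
  | none => exact ⟨h1.mono (by omega), h2.mono (by omega), h3.mono (by omega)⟩
  | some c =>
    have hw := cheap_isWaiting S s
    have hn := cheap_readerNonce S s
    have hm := Cheap.log_mem c (hn.mono (show 1 ≤ 10 by omega)) hα
    refine ⟨?_, ?_, ?_⟩
    · exact ((CheapBits.cond hw (CheapBits.cond hm (cheap_rnd_c2 S) h1) (CheapBits.const 0)).mono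
        (by omega)).congr fun γ => by simp only [World.sendReaderIdeal_eq_ite]
    · exact ((Cheap.cond hw (Cheap.cond hm (Cheap.const true) h2) (Cheap.const false)).mono
        (by omega)).congr' fun γ => by simp only [World.sendReaderIdeal_eq_ite]
    · exact ((CheapWorld.cond hw (CheapWorld.cond hm ((cheapWorld_w.mono (by omega)).setAccepted
        (k := 10) (by omega) s c (hn.mono (by omega)) hα ((cheap_rnd_c2 S).mono (by omega))) h3)
        cheapWorld_w).mono (by omega)).congr fun γ => by simp only [World.sendReaderIdeal_eq_ite]

theorem cheap_finishTag (i : Fin D.l) {c2 : Ctx D → BitVec D.lr} (h2 : CheapBits S 10 c2) :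
    Cheap S 100 (fun γ => (γ.w.finishTag i (c2 γ) (γ.y 0 i)).1) ∧
      CheapWorld S 100 fun γ => (γ.w.finishTag i (c2 γ) (γ.y 0 i)).2 := by
  obtain ⟨-, hlr, -⟩ := S.le
  have hp := cheap_pendHas S i
  have he := CheapBits.eq hlr h2 (cheap_y S 0 i)
  have hf := (cheap_readerFooled S i).or ((he.and (cheap_corrupted S i).not).and
    (Cheap.readerMatches i (k := 10) ((cheap_pendC1 S i).mono (by omega))
      ((cheap_pendA S i).mono (by omega)) h2).not)
  constructor
  · exact ((hp.cond he (Cheap.const false)).mono (by omega)).congr' fun γ => by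
      rw [World.finishTag_eq_ite]
  · have := ((cheapWorld_w (S := S)).mono (show 1 ≤ 90 by omega)).setPending (by omega) i
      |>.setReaderFooled i (hf.mono (k' := 90) (by omega))
    exact ((CheapWorld.cond hp this cheapWorld_w).mono (by omega)).congr fun γ => by
      rw [World.finishTag_eq_ite]

theorem cheap_finish (ρ : Rules D.l) (i : Fin D.l) {c2 : Ctx D → BitVec D.lr}
    (h2 : CheapBits S 10 c2) :
    Cheap S 100 (fun γ => (γ.w.finish ρ i (c2 γ) (γ.y 0 i)).1) ∧
      CheapWorld S 100 fun γ => (γ.w.finish ρ i (c2 γ) (γ.y 0 i)).2 := by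
  unfold World.finish
  cases ρ.ideal with
  | none => exact cheap_finishTag i h2
  | some c =>
    by_cases h : i = c
    · subst h
      have hp := cheap_pendHas S i
      constructor
      · exact ((hp.cond (Cheap.readerMatches i (k := 10) ((cheap_pendC1 S i).mono (by omega))
          ((cheap_pendA S i).mono (by omega)) h2) (Cheap.const false)).mono (by omega)).congr'
          fun γ => by simp only [World.finishTagIdeal_self]
      · exact ((CheapWorld.cond hp ((cheapWorld_w.mono (by omega)).setPending le_rfl i)
          cheapWorld_w).mono (by omega)).congr fun γ => by simp only [World.finishTagIdeal_self]
    · simp only [World.finishTagIdeal, if_neg h]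
      exact cheap_finishTag i h2

/-- Corruption is the only call that outputs a key. The assumption on `ρ` excludes the key of `c`,
which is not encoded. -/
theorem cheap_corrupt {ρ : Rules D.l} (hρ : ρ.hidden = some S.c) (i : Fin D.l) :
    CheapBits S 10 (fun γ => (γ.w.corrupt ρ i).1) ∧
      CheapWorld S 10 fun γ => (γ.w.corrupt ρ i).2 := by
  simp only [World.corrupt, hρ]
  constructor
  · by_cases h : some S.c = some i
    · simp only [if_pos h]
      exact (CheapBits.const 0).mono (by omega)
    · simp only [if_neg h]
      exact ((((cheap_key S fun hi => h (by rw [hi])).append (cheap_ctr S i)).append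
        (cheap_c1 S i)).append (cheap_rT S i)).mono (by omega)
  · split_ifs
    · exact cheapWorld_w.mono (by omega)
    · exact (cheapWorld_w.mono (by omega)).setCorrupted (by omega) i

theorem elim_of_some {ι β : Type*} {o : Option ι} {i : ι} (h : o = some i) {b z : β} {f : ι → β}
    (hz : f i = z) : o.elim b f = z := by
  rw [h]
  exact hz

theorem elim_of_none {ι β : Type*} {o : Option ι} (h : o = none) {b z : β} {f : ι → β}
    (hz : b = z) : o.elim b f = z := by
  rw [h]
  exact hz

theorem cheap_select {n : ℕ} (hn : n ≤ S.N) (inp : Fin n → ℕ) :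
    CheapOpt S 21 fun γ => select fun i => γ.mem (inp i) :=
  CheapOpt.select hn fun i => Cheap.mem (inp i)

theorem cheap_answer {ρ : Rules D.l} (hρ : ρ.hidden = some S.c) (p : AttackPort)
    (inp : (D.Ifc F).In p → ℕ) :
    (∀ o, Cheap S 500 fun γ =>
      (World.answer F ρ γ.w p (fun i => γ.mem (inp i)) γ.rnd γ.y).1 o) ∧
    CheapWorld S 500 fun γ =>
      (World.answer F ρ γ.w p (fun i => γ.mem (inp i)) γ.rnd γ.y).2 := by
  obtain ⟨hl, hlr, hlv, hlu, hlA, hm, -⟩ := S.le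
  cases p
  case initReader =>
    have hs := cheap_select hm inp
    constructor
    · intro o
      refine ((Cheap.mux hm hs (fun s => (cheap_initReader s).1 o) (Cheap.const false)).mono
        (by omega)).congr' fun γ => ?_
      simp only [World.answer]
      split <;> rename_i h
      exacts [elim_of_some h rfl, elim_of_none h rfl]
    · refine ((CheapWorld.mux hm hs (fun s => (cheap_initReader s).2) cheapWorld_w).mono
        (by omega)).congr fun γ => ?_
      simp only [World.answer]
      split <;> rename_i h
      exacts [elim_of_some h rfl, elim_of_none h rfl]
  case startTag =>
    have hs := cheap_select hl fun i => inp (.inl i)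
    have h1 : CheapBits S 10 fun γ => ofWires fun b : Fin D.lu => γ.mem (inp (.inr b)) :=
      CheapBits.ofWires fun b => (Cheap.mem _).mono (by omega)
    constructor
    · intro o
      refine ((Cheap.mux hl hs (fun s => (cheap_start ρ s h1).1 o) (Cheap.const false)).mono
        (by omega)).congr' fun γ => ?_
      simp only [World.answer]
      split <;> rename_i h
      exacts [elim_of_some h rfl, elim_of_none h rfl]
    · refine ((CheapWorld.mux hl hs (fun s => (cheap_start ρ s h1).2) cheapWorld_w).mono
        (by omega)).congr fun γ => ?_
      simp only [World.answer]
      split <;> rename_i h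
      exacts [elim_of_some h rfl, elim_of_none h rfl]
  case sendReader =>
    have hs := cheap_select hm fun i => inp (.inl i)
    have h1 : CheapBits S 10 fun γ => ofWires fun b : Fin D.lA => γ.mem (inp (.inr b)) :=
      CheapBits.ofWires fun b => (Cheap.mem _).mono (by omega)
    constructor
    · rintro (o | o)
      · refine ((Cheap.mux hm hs (fun s => (cheap_send ρ s h1).1 o) (Cheap.const false)).mono
          (by omega)).congr' fun γ => ?_
        simp only [World.answer]
        split <;> rename_i h
        exacts [elim_of_some h rfl, elim_of_none h rfl]
      · refine ((Cheap.mux hm hs (fun s => (cheap_send ρ s h1).2.1) (Cheap.const false)).mono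
          (by omega)).congr' fun γ => ?_
        simp only [World.answer]
        split <;> rename_i h
        exacts [elim_of_some h rfl, elim_of_none h rfl]
    · refine ((CheapWorld.mux hm hs (fun s => (cheap_send ρ s h1).2.2) cheapWorld_w).mono
        (by omega)).congr fun γ => ?_
      simp only [World.answer]
      split <;> rename_i h
      exacts [elim_of_some h rfl, elim_of_none h rfl]
  case finishTag =>
    have hs := cheap_select hl fun i => inp (.inl i)
    have h1 : CheapBits S 10 fun γ => ofWires fun b : Fin D.lr => γ.mem (inp (.inr b)) :=
      CheapBits.ofWires fun b => (Cheap.mem _).mono (by omega)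
    constructor
    · intro o
      refine ((Cheap.mux hl hs (fun s => (cheap_finish ρ s h1).1) (Cheap.const false)).mono
        (by omega)).congr' fun γ => ?_
      simp only [World.answer]
      split <;> rename_i h
      exacts [elim_of_some h rfl, elim_of_none h rfl]
    · refine ((CheapWorld.mux hl hs (fun s => (cheap_finish ρ s h1).2) cheapWorld_w).mono
        (by omega)).congr fun γ => ?_
      simp only [World.answer]
      split <;> rename_i h
      exacts [elim_of_some h rfl, elim_of_none h rfl]
  case corrupt =>
    have hs := cheap_select hl inp
    constructor
    · intro o
      refine ((Cheap.mux hl hs (fun s => (cheap_corrupt hρ s).1 o) (Cheap.const false)).mono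
        (by omega)).congr' fun γ => ?_
      simp only [World.answer]
      split <;> rename_i h
      exacts [elim_of_some h rfl, elim_of_none h rfl]
    · refine ((CheapWorld.mux hl hs (fun s => (cheap_corrupt hρ s).2) cheapWorld_w).mono
        (by omega)).congr fun γ => ?_
      simp only [World.answer]
      split <;> rename_i h
      exacts [elim_of_some h rfl, elim_of_none h rfl]

theorem cheap_rounds (p : AttackPort) (inp : (D.Ifc F).In p → ℕ) (t : Fin 4) (j : Fin D.l) :
    CheapBits S 500 fun γ =>
      World.rounds (F := F) γ.w p (fun i => γ.mem (inp i)) γ.rnd t (γ.y 0) j := by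
  obtain ⟨hl, hlr, hlv, hlu, hlA, hm, -⟩ := S.le
  cases p
  case startTag =>
    simp only [World.rounds]
    split_ifs
    · exact (cheap_idx (cheap_ctr S j)).mono (by omega)
    · exact (cheap_mac (CheapBits.ofWires (k := 1) fun b => Cheap.mem (inp (.inr b)))
        (cheap_y S 0 j) (cheap_rnd_rT S)).mono (by omega)
  case sendReader =>
    have hs := cheap_select hm fun i => inp (.inl i)
    have h1 : CheapBits S 10 fun γ => ofWires fun b : Fin D.lA => γ.mem (inp (.inr b)) :=
      CheapBits.ofWires fun b => (Cheap.mem _).mono (by omega)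
    have h2 := (cheap_y S 0 j).xor (cheap_α13 h1)
    have h3 : ∀ s, CheapBits S 100 fun γ => γ.w.readerArgs s
        (ofWires fun b : Fin D.lA => γ.mem (inp (.inr b))) t (γ.y 0 j) j := by
      intro s
      have hn := cheap_readerNonce S s
      unfold World.readerArgs
      split
      · exact (cheap_mac hn (cheap_α11 h1) (cheap_α12 h1)).mono (by omega)
      · exact (cheap_idx h2).mono (by omega)
      · exact (cheap_idx (cheap_recCtr S j)).mono (by omega)
      · exact (cheap_mac hn (h2.succ hlr) (cheap_α12 h1)).mono (by omega)
    refine ((CheapBits.mux hm hs h3 (CheapBits.const 0)).mono (by omega)).congr fun γ => ?_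
    simp only [World.rounds]
    split <;> rename_i h
    exacts [elim_of_none h rfl, elim_of_some h rfl]
  case finishTag =>
    exact (cheap_mac (cheap_c1 S j) (cheap_ctr S j) (cheap_rT S j)).mono (by omega)
  all_goals exact (CheapBits.const 0).mono (by omega)

/-- Hence values left over in `y 0` from an earlier call do no harm in round 0. -/
theorem World.rounds_zero (w : World D) (p : AttackPort) (x : (D.Ifc F).In p → Bool) (r : Coins D)
    (y y' : Fin D.l → BitVec D.lr) (j : Fin D.l) :
    World.rounds (F := F) w p x r 0 y j = World.rounds (F := F) w p x r 0 y' j := by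
  cases p <;> rfl

/-- A call adds at most one transcript to a log; so an attack with at most `T` instructions never
exceeds the space reserved for the logs. -/
theorem World.answer_log_le (ρ : Rules D.l) (w : World D) (p : AttackPort)
    (x : (D.Ifc F).In p → Bool) (r : Coins D) (y : Fin 4 → Fin D.l → BitVec D.lr) {n : ℕ}
    (h : ∀ j, (w.log j).length ≤ n) (j : Fin D.l) :
    ((World.answer F ρ w p x r y).2.log j).length ≤ n + 1 := by
  have hj := h j
  have hb : ∀ i c1 (α : BitVec D.lA), ((w.begin i c1 α).log j).length ≤ n + 1 := by
    intro i c1 α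
    have hi := h i
    by_cases hij : j = i
    · subst hij; simp only [World.begin, Function.update_self, List.length_cons]; omega
    · simp only [World.begin, Function.update_of_ne hij]; omega
  have hs : ∀ s α, (w.sendReader s α y).2.log = w.log := by
    intro s α
    rw [World.sendReader_eq_ite]
    dsimp only
    split_ifs
    · cases w.found α y <;> rfl
    · rfl
  have hf : ∀ i c2 e, (w.finishTag i c2 e).2.log = w.log := by
    intro i c2 e
    rw [World.finishTag_eq_ite]
    dsimp only
    split_ifs <;> rfl
  cases p <;> simp only [World.answer]
  · split
    · rw [World.initReader_eq_ite]
      dsimp only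
      split_ifs <;> first | omega | (dsimp only; omega)
    · dsimp only; omega
  · split
    · simp only [World.start]
      split
      · exact hb _ _ _
      · simp only [World.startTagIdeal]
        split_ifs
        · exact hb _ _ _
        · exact hb _ _ _
    · dsimp only; omega
  · split
    · simp only [World.send]
      split
      · rw [hs]; omega
      · rw [World.sendReaderIdeal_eq_ite]
        dsimp only
        split_ifs
        · dsimp only; omega
        · rw [hs]; omega
        · omega
    · dsimp only; omega
  · split
    · simp only [World.finish]
      split
      · rw [hf]; omega
      · simp only [World.finishTagIdeal]
        split_ifs
        · split <;> (dsimp only; omega)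
        · rw [hf]; omega
    · dsimp only; omega
  · split
    · simp only [World.corrupt]
      split_ifs <;> first | omega | (dsimp only; omega)
    · dsimp only; omega

end RFID

end

noncomputable section

namespace RFID

open scoped ENNReal

variable {D : Dims} {F : D.Family} {S : Setting D F}

/-! ### Simulation by a distinguisher -/

/-- Circuits with access to a function of one tag. -/
abbrev SimCircuit (D : Dims) : Type := Circuit (funInterface D.ld D.lr)

theorem size_append {I : Interface} (C C' : Circuit I) : (C ++ C').size = C.size + C'.size := by
  simp [Circuit.size]

theorem size_gates {I : Interface} (gs : List Gate) :
    Circuit.size (gs.map (Instr.gate (I := I))) = gs.length := by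
  induction gs with
  | nil => rfl
  | cons g gs ih =>
    simp only [Circuit.size, List.map_cons, List.sum_cons, List.length_cons] at ih ⊢
    rw [ih]
    simp [Instr.cost, add_comm]

theorem length_le_size {I : Interface} (C : Circuit I) : C.length ≤ C.size := by
  induction C with
  | nil => exact le_rfl
  | cons i C ih =>
    have h : 1 ≤ i.cost := by cases i <;> simp [Instr.cost]; omega
    simp only [Circuit.size, List.map_cons, List.sum_cons, List.length_cons] at ih ⊢
    omega

/-- With access to `f`, the circuit `C` changes the simulated game by `g f`. -/
def Steps (S : Setting D F) (C : SimCircuit D) (g : D.Fn → Ctx D → Ctx D) : Prop :=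
  ∀ f γ reg, Enc S γ reg → (∀ j, ((g f γ).w.log j).length ≤ S.T) →
    ∃ reg', C.run (funOracle f) (reg, ()) = pure (reg', ()) ∧ Enc S (g f γ) reg'

/-- As the first circuit leaves the world unchanged, the bound for the logs, which is assumed only
for the final state, holds in between as well. -/
theorem Steps.append {C C' : SimCircuit D} {g g' : D.Fn → Ctx D → Ctx D} (h : Steps S C g)
    (h' : Steps S C' g') (hg : ∀ f γ, (g f γ).w = γ.w) :
    Steps S (C ++ C') fun f γ => g' f (g f γ) := by
  intro f γ reg hE hs
  obtain ⟨reg', h1, h2⟩ := h f γ reg hE (by rw [hg]; exact hE.short)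
  obtain ⟨reg'', h3, h4⟩ := h' f _ reg' h2 hs
  refine ⟨reg'', ?_, h4⟩
  rw [run_append, h1]
  exact (PMF.pure_bind _ _).trans h3

theorem Steps.gates {gs : List Gate} {g : D.Fn → Ctx D → Ctx D}
    (h : ∀ f γ reg, Enc S γ reg → (∀ j, ((g f γ).w.log j).length ≤ S.T) →
      Enc S (g f γ) (Formula.exec gs reg)) :
    Steps S (gs.map Instr.gate) g :=
  fun f γ reg hE hs => ⟨_, run_gates _ _ _ _, h f γ reg hE hs⟩

theorem Setting.pow_pos (S : Setting D F) (k : ℕ) : 1 ≤ S.N ^ k :=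
  Nat.one_le_pow _ _ (by have := S.le_N; omega)

/-- Simultaneous assignment of cheap bits. -/
theorem exists_assign {k : ℕ} (g : Ctx D → Ctx D)
    (hv : ∀ v : Var D S.T, Cheap S k fun γ => v.bit S.c (g γ)) {ι : Type} [Fintype ι]
    (hι : Fintype.card ι ≤ S.N) (out : ι ↪ ℕ) (ans : ι → Ctx D → Bool)
    (ha : ∀ o, Cheap S k (ans o))
    (hmem : ∀ γ, (g γ).mem = Function.extend out (fun o => ans o γ) γ.mem) :
    ∃ C : SimCircuit D, C.size ≤ S.N ^ (k + 12) ∧ Steps S C fun _ => g := by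
  classical
  choose φ hφ1 hφ2 hφ3 using hv
  choose ψ hψ1 hψ2 hψ3 using ha
  -- Registers that encode a bit receive the formula of the bit, registers of the answer the formula
  -- of the answer, and all others keep their value.
  set G : ℕ → Formula := Function.extend Var.addr φ
    (Function.extend (fun o => 4 * out o) ψ Formula.var) with hG
  -- The list runs through all possible codes of variables, including unused ones, which are
  -- assigned to themselves. This gives its length without counting the variables.
  set L : List ℕ := (List.range (S.N ^ 8)).map (fun i => 4 * i + 1) ++
    (Finset.univ : Finset ι).toList.map (fun o => 4 * out o) with hLdef
  have hinj : Function.Injective fun o => 4 * out o := fun o o' h =>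
    out.injective (by dsimp only at h; omega)
  have hGv : ∀ v, G (Var.addr v) = φ v := fun v => Var.addr_injective.extend_apply _ _ v
  have hnot : ∀ r, r % 4 ≠ 1 → G r = Function.extend (fun o => 4 * out o) ψ Formula.var r := by
    intro r hr
    exact Function.extend_apply' _ _ _ fun ⟨v, hv⟩ => hr (hv ▸ v.addr_mod)
  have hGo : ∀ o, G (4 * out o) = ψ o := fun o => by
    rw [hnot _ (by omega)]
    exact hinj.extend_apply _ _ o
  have hLmod : ∀ r ∈ L, r % 4 ≠ 3 := by
    intro r hr
    rw [hLdef, List.mem_append, List.mem_map, List.mem_map] at hr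
    rcases hr with ⟨i, -, rfl⟩ | ⟨o, -, rfl⟩ <;> omega
  have hpos := S.pow_pos k
  have hGL : ∀ r, r % 4 ≠ 3 → (G r).Safe ∧ (G r).size ≤ S.N ^ k := by
    intro r hr
    by_cases h1 : ∃ v : Var D S.T, v.addr = r
    · obtain ⟨v, rfl⟩ := h1
      rw [hGv]
      exact ⟨hφ1 v, hφ2 v⟩
    · rw [hG, Function.extend_apply' _ _ _ h1]
      by_cases h2 : ∃ o, 4 * out o = r
      · obtain ⟨o, rfl⟩ := h2
        rw [hinj.extend_apply]
        exact ⟨hψ1 o, hψ2 o⟩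
      · rw [Function.extend_apply' _ _ _ h2]
        exact ⟨hr, hpos⟩
  refine ⟨(Formula.assign L G).map Instr.gate, ?_, Steps.gates fun f γ reg hE hs => ?_⟩
  · rw [size_gates]
    refine (Formula.length_assign fun r hr => (hGL r (hLmod r hr)).2).trans ?_
    have hlen : L.length ≤ S.N ^ 8 + S.N := by
      simp only [hLdef, List.length_append, List.length_map, List.length_range,
        Finset.length_toList, Finset.card_univ]
      omega
    have hN := S.le_N
    have h8 : S.N ≤ S.N ^ 8 := Nat.le_self_pow (by norm_num) _
    calc L.length * (2 * S.N ^ k + 5) ≤ (S.N * S.N ^ 8) * (S.N * S.N ^ k) := by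
          gcongr
          · nlinarith
          · nlinarith
      _ = S.N ^ (k + 10) := by ring
      _ ≤ _ := Nat.pow_le_pow_right (by omega) (by omega)
  · have hex := fun r hr => Formula.exec_assign hLmod (fun r hr => (hGL r (hLmod r hr)).1) reg r hr
    refine ⟨fun r => ?_, fun v => ?_, hs⟩
    · rw [hex _ (by omega), hmem]
      by_cases h2 : ∃ o, out o = r
      · obtain ⟨o, rfl⟩ := h2
        rw [if_pos (by simp [hLdef]), hGo, hψ3 o γ reg hE, out.injective.extend_apply]
      · rw [if_neg, Function.extend_apply' _ _ _ h2, hE.mem]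
        intro hr
        rw [hLdef, List.mem_append, List.mem_map, List.mem_map] at hr
        rcases hr with ⟨i, -, h⟩ | ⟨o, -, h⟩
        · omega
        · exact h2 ⟨o, by omega⟩
    · rw [hex _ (by rw [v.addr_mod]; omega), if_pos, hGv, hφ3 v γ reg hE]
      rw [hLdef, List.mem_append, List.mem_map]
      exact Or.inl ⟨v.code, List.mem_range.2 v.code_lt, rfl⟩

/-! Evaluation of the functions of the tags -/

/-- A gate moved to the scratch registers. -/
def Gate.scratch (g : Gate) : Gate := ⟨4 * g.dst + 2, 4 * g.a + 2, 4 * g.b + 2⟩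

/-- The circuit of `F` expects its whole memory to be initialized. It suffices to prepare the
finitely many registers in `R`, which includes all that are read. -/
theorem exec_scratch (R : Finset ℕ) (gs : List Gate) (hR : ∀ g ∈ gs, g.a ∈ R ∧ g.b ∈ R)
    (mem reg : Memory) (h : ∀ r ∈ R, reg (4 * r + 2) = mem r) :
    (∀ r ∈ R, Formula.exec (gs.map Gate.scratch) reg (4 * r + 2) = Formula.exec gs mem r) ∧
      ∀ r, r % 4 ≠ 2 → Formula.exec (gs.map Gate.scratch) reg r = reg r := by
  induction gs generalizing mem reg with
  | nil => exact ⟨h, fun _ _ => rfl⟩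
  | cons g gs ih =>
    obtain ⟨ha, hb⟩ := hR g (by simp)
    have h' : ∀ r ∈ R, g.scratch.eval reg (4 * r + 2) = g.eval mem r := by
      intro r hr
      unfold Gate.eval Gate.scratch
      by_cases hd : r = g.dst
      · subst hd
        simp [h _ ha, h _ hb]
      · rw [Function.update_of_ne (by dsimp only; omega), Function.update_of_ne hd, h r hr]
    obtain ⟨h1, h2⟩ := ih (fun g' hg' => hR g' (by simp [hg'])) _ _ h'
    refine ⟨h1, fun r hr => (h2 r hr).trans ?_⟩
    unfold Gate.eval Gate.scratch
    rw [Function.update_of_ne (by dsimp only; omega)]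

/-- The function of tag `j` is evaluated at its argument. -/
def evalStep (S : Setting D F) (t : Fin 4) (j : Fin D.l) (f : D.Fn) (γ : Ctx D) : Ctx D :=
  { γ with
    y := Function.update γ.y t
      (Function.update (γ.y t) j (World.tagEv F S.c f γ.w.key j (γ.x j))) }

theorem evalStep_bit (t : Fin 4) (j : Fin D.l) (f : D.Fn) (γ : Ctx D) (v : Var D S.T)
    (hv : ∀ b, v ≠ .y t j b) : v.bit S.c (evalStep S t j f γ) = v.bit S.c γ := by
  cases v
  case y t' j' b =>
    by_cases ht : t' = t
    · subst ht
      have hj : j' ≠ j := fun hj => hv b (by rw [hj])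
      simp [Var.bit, evalStep, hj]
    · simp [Var.bit, evalStep, ht]
  all_goals rfl

theorem evalStep_self (t : Fin 4) (j : Fin D.l) (f : D.Fn) (γ : Ctx D) (b : Fin D.lr) :
    (Var.y t j b : Var D S.T).bit S.c (evalStep S t j f γ) =
      (World.tagEv F S.c f γ.w.key j (γ.x j)).getLsb b := by
  simp [Var.bit, evalStep]

theorem Enc.evalStep {γ : Ctx D} {reg reg' : Memory} (h : Enc S γ reg) (t : Fin 4) (j : Fin D.l)
    (f : D.Fn) (h1 : ∀ r, r % 4 ≤ 1 → (∀ b, r ≠ (Var.y t j b : Var D S.T).addr) → reg' r = reg r)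
    (h2 : ∀ b, reg' (Var.y t j b : Var D S.T).addr =
      (World.tagEv F S.c f γ.w.key j (γ.x j)).getLsb b) :
    Enc S (evalStep S t j f γ) reg' where
  mem r := by
    rw [h1 _ (by omega) fun b hb => ?_, h.mem]
    · rfl
    · have := (Var.y t j b : Var D S.T).addr_mod
      omega
  bit v := by
    by_cases hv : ∃ b, v = .y t j b
    · obtain ⟨b, rfl⟩ := hv
      rw [h2, evalStep_self]
    · push Not at hv
      rw [h1 _ (by rw [v.addr_mod]) fun b hb => hv b (Var.addr_injective hb), h.bit,
        evalStep_bit _ _ _ _ _ hv]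
  short := h.short

/-- For the tag `c` one call of the given oracle replaces the computation, so the key of `c` is not
needed. -/
theorem exists_eval_oracle (t : Fin 4) :
    ∃ C : SimCircuit D, C.size ≤ S.N ^ 20 ∧ Steps S C (evalStep S t S.c) := by
  let out : Fin D.lr ↪ ℕ := ⟨fun b => (Var.y t S.c b : Var D S.T).addr, fun b b' h => by
    simpa using Var.addr_injective h⟩
  refine ⟨[Instr.query () (fun b : Fin D.ld => (Var.x S.c b : Var D S.T).addr) out], ?_, ?_⟩
  · have h : Circuit.size [Instr.query (I := funInterface D.ld D.lr) ()
        (fun b : Fin D.ld => (Var.x S.c b : Var D S.T).addr) out] = 1 + D.ld + D.lr := by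
      simp only [Circuit.size, List.map_cons, List.map_nil, List.sum_cons, List.sum_nil, Instr.cost,
        add_zero]
      congr 1
      · congr 1
        exact Fintype.card_fin _
      · exact Fintype.card_fin _
    rw [h]
    have := S.bound
    exact (show _ ≤ S.N by omega).trans (Nat.le_self_pow (by norm_num) _)
  · intro f γ reg hE hs
    have hx : ofWires (fun b : Fin D.ld => reg (Var.x S.c b : Var D S.T).addr) = γ.x S.c := by
      rw [← ofWires_getLsb (γ.x S.c)]
      congr 1
      funext b
      exact hE.bit _
    refine ⟨Function.extend out (fun b => (f (γ.x S.c)).getLsb b) reg, ?_, ?_⟩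
    · change (Instr.exec (funOracle f) _ _ >>= fun y => pure y) = _
      refine (bind_pure _).trans ((pure_bind _ _).trans ?_)
      rw [← hx]
      rfl
    · refine hE.evalStep t S.c f (fun r _ hr => ?_) fun b => ?_
      · exact Function.extend_apply' _ _ _ fun ⟨b, hb⟩ => hr b hb.symm
      · have := out.injective.extend_apply (fun b => (f (γ.x S.c)).getLsb b) reg b
        refine this.trans ?_
        simp [World.tagEv]

/-- For another tag the key is known: key and argument are loaded into the scratch registers, the
circuit of `F` is executed there, and its outputs are copied back. -/
theorem exists_eval_gates (t : Fin 4) {j : Fin D.l} (hj : j ≠ S.c) :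
    ∃ C : SimCircuit D, C.size ≤ S.N ^ 20 ∧ Steps S C (evalStep S t j) := by
  classical
  have hN := S.le_N
  have hb := S.bound
  set R : Finset ℕ := (S.gates.map Gate.a).toFinset ∪ (S.gates.map Gate.b).toFinset ∪
    Finset.univ.image S.out with hR
  have hRcard : R.card ≤ S.N := by
    have h1 := List.toFinset_card_le (S.gates.map Gate.a)
    have h2 := List.toFinset_card_le (S.gates.map Gate.b)
    have h3 := Finset.card_image_le (s := Finset.univ) (f := S.out)
    have h4 := Finset.card_union_le (S.gates.map Gate.a).toFinset (S.gates.map Gate.b).toFinset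
    have h5 := Finset.card_union_le ((S.gates.map Gate.a).toFinset ∪
      (S.gates.map Gate.b).toFinset) (Finset.univ.image S.out)
    rw [List.length_map] at h1 h2
    rw [Finset.card_univ, Fintype.card_fin] at h3
    rw [← hR] at h5
    omega
  let load : ℕ → Formula := fun r' =>
    let r := r' / 4
    if h : r < D.lk then .var (Var.world (.key j ⟨r, h⟩) : Var D S.T).addr
    else if h : r - D.lk < D.ld then .var (Var.x j ⟨r - D.lk, h⟩ : Var D S.T).addr
    -- Beyond key and argument the initial memory of the circuit of `F` contains zeros.
    else .nand .tt .tt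
  have hload : ∀ r', (load r').Safe ∧ (load r').size ≤ 3 := by
    intro r'
    dsimp only [load]
    split_ifs
    · exact ⟨by simp [Formula.Safe, Var.addr_mod], by simp [Formula.size]⟩
    · exact ⟨by simp [Formula.Safe, Var.addr_mod], by simp [Formula.size]⟩
    · exact ⟨⟨trivial, trivial⟩, by simp [Formula.size]⟩
  set L : List ℕ := R.toList.map fun r => 4 * r + 2 with hL
  set store : ℕ → Formula := Function.extend (fun b => (Var.y t j b : Var D S.T).addr)
    (fun b => Formula.var (4 * S.out b + 2)) Formula.var with hstore
  have hyinj : Function.Injective fun b => (Var.y t j b : Var D S.T).addr := fun b b' h => by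
    simpa using Var.addr_injective h
  set L' : List ℕ := (List.finRange D.lr).map fun b => (Var.y t j b : Var D S.T).addr with hL'
  have hLmod : ∀ r ∈ L, r % 4 ≠ 3 := by
    intro r hr
    obtain ⟨r, -, rfl⟩ := List.mem_map.1 hr
    omega
  have hL'mod : ∀ r ∈ L', r % 4 ≠ 3 := by
    intro r hr
    obtain ⟨b, -, rfl⟩ := List.mem_map.1 hr
    rw [Var.addr_mod]
    omega
  have hst : ∀ r ∈ L', (store r).Safe ∧ (store r).size ≤ 3 := by
    intro r hr
    obtain ⟨b, -, rfl⟩ := List.mem_map.1 hr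
    rw [hstore, hyinj.extend_apply]
    exact ⟨by simp [Formula.Safe], by simp [Formula.size]⟩
  refine ⟨(Formula.assign L load ++ S.gates.map Gate.scratch ++
    Formula.assign L' store).map Instr.gate, ?_, Steps.gates fun f γ reg hE hs => ?_⟩
  · rw [size_gates, List.length_append, List.length_append, List.length_map]
    have h1 := Formula.length_assign fun r (_ : r ∈ L) => (hload r).2
    have h2 := Formula.length_assign fun r hr => (hst r hr).2
    have hl1 : L.length ≤ S.N := by simpa [hL] using hRcard
    have hl2 : L'.length ≤ S.N := by simp only [hL', List.length_map, List.length_finRange]; omega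
    have h20 : S.N * S.N ≤ S.N ^ 20 := by
      rw [← sq]; exact Nat.pow_le_pow_right (by omega) (by omega)
    nlinarith
  · simp only [Formula.exec_append]
    have e1 := fun r hr => Formula.exec_assign hLmod (fun r _ => (hload r).1) reg r hr
    obtain ⟨e2, e3⟩ := exec_scratch R S.gates (fun g hg =>
        ⟨Finset.mem_union_left _ (Finset.mem_union_left _ (List.mem_toFinset.2
          (List.mem_map_of_mem hg))), Finset.mem_union_left _ (Finset.mem_union_right _
          (List.mem_toFinset.2 (List.mem_map_of_mem hg)))⟩)
      (loadArgs (γ.w.key j) (γ.x j)) (Formula.exec (Formula.assign L load) reg) fun r hr => by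
        rw [e1 _ (by omega), if_pos (List.mem_map.2 ⟨r, Finset.mem_toList.2 hr, rfl⟩)]
        have hdiv : (4 * r + 2) / 4 = r := by omega
        simp only [load, hdiv]
        unfold loadArgs
        split_ifs with h1 h2
        · refine (hE.bit _).trans ?_
          simp only [Var.bit, WVar.bit, if_neg hj]
          rfl
        · exact hE.bit _
        · rw [BitVec.getLsbD_of_ge _ _ (by omega)]
          rfl
    have e4 := fun r hr => Formula.exec_assign hL'mod (fun r hr => (hst r hr).1)
      (Formula.exec (S.gates.map Gate.scratch) (Formula.exec (Formula.assign L load) reg)) r hr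
    refine hE.evalStep t j f (fun r hr hy => ?_) fun b => ?_
    · rw [e4 r (by omega), if_neg, e3 r (by omega), e1 r (by omega), if_neg]
      · intro hr'
        obtain ⟨r, -, rfl⟩ := List.mem_map.1 hr'
        omega
      · intro hr'
        obtain ⟨b, -, rfl⟩ := List.mem_map.1 hr'
        exact hy b rfl
    · rw [e4 _ (by rw [Var.addr_mod]; omega), if_pos (List.mem_map.2 ⟨b, List.mem_finRange b, rfl⟩),
        hstore, hyinj.extend_apply]
      change Formula.exec (S.gates.map Gate.scratch) _ (4 * S.out b + 2) = _
      rw [e2 _ (by simp [hR])]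
      have := S.computes (γ.w.key j) (γ.x j)
      simp only [World.tagEv, if_neg hj]
      rw [← this, getLsb_ofWires]

theorem exists_eval (t : Fin 4) (j : Fin D.l) :
    ∃ C : SimCircuit D, C.size ≤ S.N ^ 20 ∧ Steps S C (evalStep S t j) := by
  by_cases hj : j = S.c
  · subst hj
    exact exists_eval_oracle t
  · exact exists_eval_gates t hj

end RFID

end

/-! ### Simulation of a single oracle call -/

noncomputable section

namespace RFID

open scoped ENNReal

variable {D : Dims} {F : D.Family} {S : Setting D F}

theorem Steps.congr {C : SimCircuit D} {g g' : D.Fn → Ctx D → Ctx D} (h : Steps S C g)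
    (H : ∀ f γ, g f γ = g' f γ) : Steps S C g' := by
  have : g = g' := funext fun f => funext fun γ => H f γ
  rwa [← this]

theorem exists_evalList (t : Fin 4) (L : List (Fin D.l)) :
    ∃ C : SimCircuit D, C.size ≤ L.length * S.N ^ 20 ∧ Steps S C fun f γ =>
      { γ with y := Function.update γ.y t fun j =>
                  if j ∈ L then World.tagEv F S.c f γ.w.key j (γ.x j) else γ.y t j } := by
  induction L with
  | nil =>
    refine ⟨[], by simp [Circuit.size], fun f γ reg hE _ => ⟨reg, rfl, ?_⟩⟩
    simpa using hE
  | cons i L ih =>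
    obtain ⟨C, h1, h2⟩ := exists_eval (S := S) t i
    obtain ⟨C', h3, h4⟩ := ih
    refine ⟨C ++ C', ?_, (h2.append h4 fun _ _ => rfl).congr fun f γ => ?_⟩
    · rw [size_append, List.length_cons, add_mul]
      omega
    · unfold evalStep
      dsimp only
      congr 1
      funext t' j
      by_cases ht : t' = t
      · subst ht
        simp only [Function.update_self, List.mem_cons]
        by_cases h5 : j ∈ L
        · simp [h5]
        · by_cases h6 : j = i
          · subst h6; simp [h5]
          · simp [h5, h6]
      · simp [ht]

theorem extend_empty (ans : Empty → Bool) (mem : Memory) :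
    mem = Function.extend (Function.Embedding.ofIsEmpty : Empty ↪ ℕ) ans mem :=
  funext fun _ => (Function.extend_apply' _ _ _ fun ⟨o, _⟩ => o.elim).symm

/-- One round of an oracle call. -/
def roundStep (S : Setting D F) (p : AttackPort) (inp : (D.Ifc F).In p → ℕ) (t : Fin 4)
    (f : D.Fn) (γ : Ctx D) : Ctx D :=
  let x := World.rounds (F := F) γ.w p (fun i => γ.mem (inp i)) γ.rnd t (γ.y 0)
  { γ with
    x := x
    y := Function.update γ.y t fun j => World.tagEv F S.c f γ.w.key j (x j) }

theorem exists_round (p : AttackPort) (inp : (D.Ifc F).In p → ℕ) (t : Fin 4) :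
    ∃ C : SimCircuit D, C.size ≤ S.N ^ 513 ∧ Steps S C (roundStep S p inp t) := by
  have hN := S.le_N
  obtain ⟨C, h1, h2⟩ := exists_assign (S := S) (k := 500)
    (fun γ => { γ with x := World.rounds (F := F) γ.w p (fun i => γ.mem (inp i)) γ.rnd t (γ.y 0) })
    (fun v => by
      cases v
      case x j b => exact cheap_rounds p inp t j b
      case world v => exact (Cheap.var (.world v)).mono (by norm_num)
      case ok => exact (Cheap.var .ok).mono (by norm_num)
      case rnd i => exact (Cheap.var (.rnd i)).mono (by norm_num)
      case y t j b => exact (Cheap.var (.y t j b)).mono (by norm_num))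
    (ι := Empty) (by simp) Function.Embedding.ofIsEmpty (fun o => o.elim) (fun o => o.elim)
    (fun γ => extend_empty _ _)
  obtain ⟨C', h3, h4⟩ := exists_evalList (S := S) t (List.finRange D.l)
  refine ⟨C ++ C', ?_, (h2.append h4 fun _ _ => rfl).congr fun f γ => ?_⟩
  · rw [size_append]
    rw [List.length_finRange] at h3
    obtain ⟨hl, -⟩ := S.le
    have h5 : D.l * S.N ^ 20 ≤ S.N ^ 512 := by
      calc D.l * S.N ^ 20 ≤ S.N * S.N ^ 20 := by gcongr
        _ = S.N ^ 21 := by rw [pow_succ' S.N 20]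
        _ ≤ _ := Nat.pow_le_pow_right (by omega) (by omega)
    have h6 : S.N ^ 513 = S.N * S.N ^ 512 := by rw [pow_succ' S.N 512]
    have h7 := Nat.mul_le_mul_right (S.N ^ 512) (show 2 ≤ S.N by omega)
    rw [h6]
    have h8 : C.size ≤ S.N ^ 512 := h1
    omega
  · unfold roundStep
    simp only [List.mem_finRange, if_true]

open Classical in
/-- The registers receive fresh coins. -/
theorem run_flips (f : D.Fn) (L : List D.Coin) {γ : Ctx D} {reg : Memory} (h : Enc S γ reg) :
    Coupled (fun x r => Enc S { γ with rnd := fun i => if i ∈ L then r i else γ.rnd i } x.1)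
      (Circuit.run (funOracle f) (L.map fun i => Instr.flip (Var.rnd i : Var D S.T).addr) (reg, ()))
      (coins D) := by
  induction L generalizing γ reg with
  | nil =>
    have : Coupled (fun (x : Memory × Unit) (r : Coins D) => x = (reg, ())) (pure (reg, ()))
        (coins D) := Coupled.of_support fun x hx r _ => by
          rw [PMF.mem_support_iff] at hx
          by_contra hne
          exact hx (PMF.pure_apply_of_ne _ _ hne)
    exact this.mono fun x r hx => by subst hx; simpa using h
  | cons i L ih =>
    have hflip : ∀ b, Enc S { γ with rnd := Function.update γ.rnd i b }
        (Function.update reg (Var.rnd i : Var D S.T).addr b) := fun b =>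
      { mem := fun r => by
          have := (Var.rnd i : Var D S.T).addr_mod
          rw [Function.update_of_ne (by omega)]
          exact h.mem r
        bit := fun v => by
          by_cases hv : v = .rnd i
          · subst hv; simp [Var.bit]
          · rw [Function.update_of_ne fun hh => hv (Var.addr_injective hh), h.bit]
            cases v
            case rnd i' =>
              have hi : i' ≠ i := fun hi => hv (by rw [hi])
              simp [Var.bit, hi]
            all_goals rfl
        short := h.short }
    -- If `i` occurs in `L` again, its first flip is overwritten; otherwise the flip `b` resamples
    -- the coin `i` of an otherwise uniform string of coins.
    have key : Coupled (fun x r => Enc S { γ with rnd := fun k => if k ∈ i :: L then r k else γ.rnd k }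
        x.1) (PMF.uniformOfFintype Bool >>= fun b => Circuit.run (funOracle f)
          (L.map fun i => Instr.flip (Var.rnd i : Var D S.T).addr)
          (Function.update reg (Var.rnd i : Var D S.T).addr b, ()))
        (PMF.uniformOfFintype Bool >>= fun b => (coins D).map fun r =>
          if i ∈ L then r else Function.update r i b) := by
      refine Coupled.bind_same fun b => ?_
      have := (ih (hflip b)).map (f := id) (f' := fun r => if i ∈ L then r else Function.update r i b)
        (R' := fun x r => Enc S { γ with rnd := fun k => if k ∈ i :: L then r k else γ.rnd k } x.1)
        fun x r hx => by
          refine cast (congrArg (fun ω => Enc S { γ with rnd := ω } x.1) (funext fun k => ?_)) hx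
          by_cases h1 : i ∈ L
          · by_cases h2 : k ∈ L
            · simp [h1, h2]
            · have h3 : k ≠ i := fun h3 => h2 (h3 ▸ h1)
              simp [h2, h3]
          · by_cases h3 : k = i
            · subst h3; simp [h1]
            · simp [h1, h3]
      rwa [PMF.map_id] at this
    intro Φ Ψ
    have h1 : expect (coins D) Ψ = expect (PMF.uniformOfFintype Bool >>= fun b =>
        (coins D).map fun r => if i ∈ L then r else Function.update r i b) Ψ := by
      rw [expect_bind]
      simp only [expect_map]
      by_cases hi : i ∈ L
      · simp only [if_pos hi, expect_const]
      · simp only [if_neg hi]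
        exact expect_uniform_update i Ψ
    have h2 : Circuit.run (funOracle f) ((i :: L).map fun i =>
        Instr.flip (Var.rnd i : Var D S.T).addr) (reg, ()) =
        (PMF.uniformOfFintype Bool >>= fun b => Circuit.run (funOracle f)
          (L.map fun i => Instr.flip (Var.rnd i : Var D S.T).addr)
          (Function.update reg (Var.rnd i : Var D S.T).addr b, ())) := by
      change ((PMF.uniformOfFintype Bool >>= fun b => pure _) >>= _) = _
      rw [bind_assoc]
      refine congrArg _ (funext fun b => ?_)
      exact pure_bind _ _
    rw [h1, h2]
    exact key Φ Ψ

theorem exists_flips (S : Setting D F) : ∃ C : SimCircuit D, C.size ≤ S.N ∧ ∀ f γ reg, Enc S γ reg →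
    Coupled (fun x r => Enc S { γ with rnd := r } x.1) (C.run (funOracle f) (reg, ()))
      (coins D) := by
  refine ⟨(Finset.univ : Finset D.Coin).toList.map
    fun i => Instr.flip (Var.rnd i : Var D S.T).addr, ?_, fun f γ reg hE => ?_⟩
  · have : ∀ L : List D.Coin, Circuit.size (L.map fun i => Instr.flip (I := funInterface D.ld D.lr)
        (Var.rnd i : Var D S.T).addr) = L.length := by
      intro L
      simp [Circuit.size, Instr.cost, Function.comp_def]
    rw [this, Finset.length_toList, Finset.card_univ]
    have hb := S.bound
    simp only [Fintype.card_sum, Fintype.card_prod, Fintype.card_fin, Dims.lA]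
    omega
  · exact (run_flips f _ hE).mono fun x r hx => by simpa using hx

/-- All rounds of an oracle call and its answer. -/
def queryStep (S : Setting D F) (ρ : Rules D.l) (p : AttackPort) (inp : (D.Ifc F).In p → ℕ)
    (out : (D.Ifc F).Out p ↪ ℕ) (γ : Ctx D) : Ctx D :=
  { γ with
    mem := Function.extend out
      (World.answer F ρ γ.w p (fun i => γ.mem (inp i)) γ.rnd γ.y).1 γ.mem
    w := (World.answer F ρ γ.w p (fun i => γ.mem (inp i)) γ.rnd γ.y).2 }

theorem Setting.card_out_le (S : Setting D F) (p : (D.Ifc F).Port) :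
    Fintype.card ((D.Ifc F).Out p) ≤ S.N := by
  have hb := S.bound
  have hA : D.lA = D.lr + D.lv + D.lr := rfl
  change AttackPort at p
  cases p
  case initReader => exact (Fintype.card_fin D.lu).le.trans (show D.lu ≤ S.N by omega)
  case startTag => exact (Fintype.card_fin D.lA).le.trans (show D.lA ≤ S.N by omega)
  case sendReader =>
    have : Fintype.card (Fin D.lr ⊕ Unit) ≤ S.N := by
      rw [Fintype.card_sum, Fintype.card_fin, Fintype.card_unit]; omega
    exact this
  case finishTag => exact Fintype.card_unit.le.trans (show 1 ≤ S.N by omega)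
  case corrupt =>
    exact (Fintype.card_fin (D.lk + D.lr + D.lu + D.lv)).le.trans
      (show D.lk + D.lr + D.lu + D.lv ≤ S.N by omega)

theorem exists_queryStep {ρ : Rules D.l} (hρ : ρ.hidden = some S.c) (p : (D.Ifc F).Port)
    (inp : (D.Ifc F).In p → ℕ) (out : (D.Ifc F).Out p ↪ ℕ) :
    ∃ C : SimCircuit D, C.size ≤ S.N ^ 512 ∧ Steps S C fun _ => queryStep S ρ p inp out := by
  obtain ⟨h1, h2⟩ := cheap_answer hρ p inp
  refine exists_assign (k := 500) _ (fun v => ?_) (S.card_out_le p) out _ h1 fun γ => rfl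
  cases v
  case world v => exact h2 v
  case ok => exact (Cheap.var .ok).mono (by norm_num)
  case rnd i => exact (Cheap.var (.rnd i)).mono (by norm_num)
  case x j b => exact (Cheap.var (.x j b)).mono (by norm_num)
  case y t j b => exact (Cheap.var (.y t j b)).mono (by norm_num)

/-- Round 0 depends on no earlier results, and the other rounds depend only on those of round 0,
which they do not change; so four consecutive rounds produce all values that the oracle needs. -/
theorem rounds_eq (p : AttackPort) (inp : (D.Ifc F).In p → ℕ) (f : D.Fn) (γ : Ctx D) :
    (roundStep S p inp 3 f (roundStep S p inp 2 f (roundStep S p inp 1 f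
      (roundStep S p inp 0 f γ)))).y = World.evals (World.tagEv F S.c f γ.w.key) γ.w p
        (fun i => γ.mem (inp i)) γ.rnd := by
  funext t j
  have h0 := fun i => World.rounds_zero (F := F) γ.w p (fun i => γ.mem (inp i)) γ.rnd (γ.y 0) 0 i
  have h0' := fun y i => World.rounds_zero (F := F) γ.w p (fun i => γ.mem (inp i)) γ.rnd y 0 i
  unfold World.evals
  fin_cases t
  · simp [roundStep, h0, h0']
  · simp [roundStep, h0]
  · simp [roundStep, h0]
  · simp [roundStep, h0]

end RFID

end

/-! ### The distinguisher obtained from an attack -/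

noncomputable section

namespace RFID

open scoped ENNReal

variable {D : Dims} {F : D.Family} {S : Setting D F}

open World

/-- The registers contain the state `y`, and the tags had at most `n` sessions. -/
def Sim (S : Setting D F) (ok : Bool) (n : ℕ) (x : Memory × Unit) (y : Memory × World D) : Prop :=
  (∀ j, (y.2.log j).length ≤ n) ∧
    ∃ γ : Ctx D, γ.mem = y.1 ∧ γ.w = y.2 ∧ γ.ok = ok ∧ Enc S γ x.1

theorem Steps.coupled {C : SimCircuit D} {g : D.Fn → Ctx D → Ctx D} (h : Steps S C g) (f : D.Fn)
    {γ : Ctx D} {reg : Memory} (hE : Enc S γ reg) (hs : ∀ j, ((g f γ).w.log j).length ≤ S.T)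
    {β : Type} {R : Memory × Unit → β → Prop} {y : β} (hR : ∀ reg', Enc S (g f γ) reg' → R (reg', ()) y) :
    Coupled R (C.run (funOracle f) (reg, ())) (pure y) := by
  obtain ⟨reg', h1, h2⟩ := h f γ reg hE hs
  rw [h1]
  exact Coupled.pure (hR _ h2)

/-- The circuit flips the coins, runs the four rounds of evaluations and then updates state and
memory. After the flips everything is deterministic, so it is enough to couple its coins with those
of the oracle. -/
theorem sim_query {ρ : Rules D.l} (hρ : ρ.hidden = some S.c) (p : (D.Ifc F).Port)
    (inp : (D.Ifc F).In p → ℕ) (out : (D.Ifc F).Out p ↪ ℕ) :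
    ∃ C : SimCircuit D, C.size ≤ S.N ^ 520 ∧ ∀ f ok n x y, n + 1 ≤ S.T → Sim S ok n x y →
      Coupled (Sim S ok (n + 1)) (C.run (funOracle f) x)
        (Instr.exec (oracle F ρ (tagEv F S.c f)) (.query p inp out) y) := by
  obtain ⟨C, h1, h2⟩ := exists_flips S
  choose R h3 h4 using exists_round (S := S) p inp
  obtain ⟨Q, h5, h6⟩ := exists_queryStep hρ p inp out
  have hchain := (((((h4 0).append (h4 1) fun _ _ => rfl).append (h4 2) fun _ _ => rfl).append
    (h4 3) fun _ _ => rfl).append h6 fun _ _ => rfl)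
  refine ⟨C ++ (R 0 ++ R 1 ++ R 2 ++ R 3 ++ Q), ?_, ?_⟩
  · simp only [size_append]
    have := h3 0
    have := h3 1
    have := h3 2
    have := h3 3
    have hN := S.le_N
    have a1 : S.N ^ 512 ≤ S.N ^ 513 := Nat.pow_le_pow_right (by omega) (by omega)
    have a2 : S.N ≤ S.N ^ 513 := Nat.le_self_pow (by omega) _
    have a3 : 100 * S.N ^ 513 ≤ S.N ^ 520 := by
      calc 100 * S.N ^ 513 ≤ S.N * S.N ^ 513 := by gcongr
        _ = S.N ^ 514 := by rw [pow_succ' S.N 513]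
        _ ≤ _ := Nat.pow_le_pow_right (by omega) (by omega)
    omega
  · rintro f ok n ⟨reg, ⟨⟩⟩ ⟨mem, w⟩ hn ⟨hlog, γ, rfl, rfl, rfl, hE⟩
    rw [run_append]
    change Coupled _ _ ((oracle F ρ (tagEv F S.c f) p (fun i => γ.mem (inp i)) γ.w) >>= fun z =>
      (pure (Function.extend out z.1 γ.mem, z.2) : PMF _))
    have horacle : (oracle F ρ (tagEv F S.c f) p (fun i => γ.mem (inp i)) γ.w >>= fun z =>
        (pure (Function.extend out z.1 γ.mem, z.2) : PMF _)) = (coins D >>= fun r => pure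
          (Function.extend out (answer F ρ γ.w p (fun i => γ.mem (inp i)) r
            (evals (tagEv F S.c f γ.w.key) γ.w p (fun i => γ.mem (inp i)) r)).1 γ.mem,
          (answer F ρ γ.w p (fun i => γ.mem (inp i)) r
            (evals (tagEv F S.c f γ.w.key) γ.w p (fun i => γ.mem (inp i)) r)).2)) := by
      refine (PMF.bind_map _ _ _).trans ?_
      rfl
    rw [horacle]
    refine (h2 f γ reg hE).bind ?_
    rintro ⟨reg', ⟨⟩⟩ r hr
    have hy := rounds_eq (S := S) p inp f { γ with rnd := r }
    set γ₁ := roundStep S p inp 3 f (roundStep S p inp 2 f (roundStep S p inp 1 f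
      (roundStep S p inp 0 f { γ with rnd := r }))) with hγ₁
    have hw : (queryStep S ρ p inp out γ₁).w = (answer F ρ γ.w p (fun i => γ.mem (inp i)) r
            (evals (tagEv F S.c f γ.w.key) γ.w p (fun i => γ.mem (inp i)) r)).2 := by
      rw [← hy]; rfl
    have hm : (queryStep S ρ p inp out γ₁).mem = Function.extend out
        (answer F ρ γ.w p (fun i => γ.mem (inp i)) r
            (evals (tagEv F S.c f γ.w.key) γ.w p (fun i => γ.mem (inp i)) r)).1 γ.mem := by
      rw [← hy]; rfl
    have hl : ∀ j, ((queryStep S ρ p inp out γ₁).w.log j).length ≤ n + 1 := by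
      rw [hw]
      exact answer_log_le ρ γ.w p _ r _ hlog
    refine hchain.coupled f hr (fun j => (hl j).trans hn) fun reg'' hE' => ?_
    exact ⟨by rw [← hw]; exact hl, _, hm, hw, rfl, hE'⟩

theorem sim_instr {ρ : Rules D.l} (hρ : ρ.hidden = some S.c) (i : Instr (D.Ifc F)) :
    ∃ C : SimCircuit D, C.size ≤ S.N ^ 520 ∧ ∀ f ok n x y, n + 1 ≤ S.T → Sim S ok n x y →
      Coupled (Sim S ok (n + 1)) (C.run (funOracle f) x)
        (i.exec (oracle F ρ (tagEv F S.c f)) y) := by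
  have hmem : ∀ {γ : Ctx D} {reg : Memory} (r : ℕ) (b : Bool), Enc S γ reg →
      Enc S { γ with mem := Function.update γ.mem r b } (Function.update reg (4 * r) b) := by
    intro γ reg r b hE
    refine ⟨fun r' => ?_, fun v => ?_, hE.short⟩
    · by_cases h : r' = r
      · subst h; simp
      · rw [Function.update_of_ne (by omega), hE.mem]
        simp [h]
    · rw [Function.update_of_ne (by have := v.addr_mod; omega), hE.bit]
      cases v <;> rfl
  cases i with
  | gate g =>
    refine ⟨[.gate ⟨4 * g.dst, 4 * g.a, 4 * g.b⟩], S.pow_pos _, ?_⟩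
    rintro f ok n ⟨reg, ⟨⟩⟩ ⟨mem, w⟩ hn ⟨hlog, γ, rfl, rfl, rfl, hE⟩
    have h1 : Circuit.run (funOracle f) [.gate ⟨4 * g.dst, 4 * g.a, 4 * g.b⟩] (reg, ()) =
        pure (Function.update reg (4 * g.dst) (!(γ.mem g.a && γ.mem g.b)), ()) := by
      refine (pure_bind _ _).trans ?_
      rw [← hE.mem, ← hE.mem]
      rfl
    rw [h1]
    exact Coupled.pure ⟨fun j => (hlog j).trans (by omega), 
      { γ with mem := Function.update γ.mem g.dst _ }, rfl, rfl, rfl, hmem g.dst _ hE⟩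
  | flip dst =>
    refine ⟨[.flip (4 * dst)], S.pow_pos _, ?_⟩
    rintro f ok n ⟨reg, ⟨⟩⟩ ⟨mem, w⟩ hn ⟨hlog, γ, rfl, rfl, rfl, hE⟩
    have h1 : Circuit.run (funOracle f) [.flip (4 * dst)] (reg, ()) =
        (PMF.uniformOfFintype Bool >>= fun b => pure (Function.update reg (4 * dst) b, ())) :=
      bind_pure _
    rw [h1]
    exact Coupled.bind_same fun b => Coupled.pure
      ⟨fun j => (hlog j).trans (by omega), 
        { γ with mem := Function.update γ.mem dst b }, rfl, rfl, rfl, hmem dst _ hE⟩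
  | query p inp out => exact sim_query hρ p inp out

theorem sim_circuit {ρ : Rules D.l} (hρ : ρ.hidden = some S.c) (A : Circuit (D.Ifc F)) :
    ∃ C : SimCircuit D, C.size ≤ A.length * S.N ^ 520 ∧ ∀ f ok n x y, n + A.length ≤ S.T →
      Sim S ok n x y → Coupled (Sim S ok (n + A.length)) (C.run (funOracle f) x)
        (A.run (oracle F ρ (tagEv F S.c f)) y) := by
  induction A with
  | nil => exact ⟨[], by simp [Circuit.size], fun f ok n x y _ h => Coupled.pure h⟩
  | cons i A ih =>
    obtain ⟨C, h1, h2⟩ := sim_instr hρ i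
    obtain ⟨C', h3, h4⟩ := ih
    refine ⟨C ++ C', ?_, fun f ok n x y hn h => ?_⟩
    · rw [size_append, List.length_cons, add_mul]
      omega
    · rw [List.length_cons] at hn ⊢
      rw [run_append]
      refine (h2 f ok n x y (by omega) h).bind fun x' y' h' => ?_
      rw [show n + (A.length + 1) = n + 1 + A.length by omega]
      exact h4 f ok (n + 1) x' y' (by omega) h'

/-- The state before setup, in which all bits are zero. -/
def zeroCtx (D : Dims) : Ctx D where
  mem := blank
  w :=
    { key := fun _ => 0
      ctr := fun _ => 0
      c1 := fun _ => 0
      rT := fun _ => 0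
      recCtr := fun _ => none
      corrupted := fun _ => false
      pending := fun _ => none
      log := fun _ => []
      -- The state `idle` would be encoded by a bit that is set.
      reader := fun _ => .rejected
      tagFooled := fun _ => false
      readerFooled := fun _ => false }
  ok := false
  rnd := fun _ => false
  x := fun _ => 0
  y := fun _ _ => 0

theorem getLsb_zero {n : ℕ} (i : Fin n) : (0 : BitVec n).getLsb i = false := by
  simp

theorem enc_zero (S : Setting D F) : Enc S (zeroCtx D) blank where
  mem _ := rfl
  bit v := by
    symm
    cases v
    case world v =>
      cases v <;> first
      | rfl
      | exact getLsb_zero _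
      | (simp only [Var.bit, WVar.bit, zeroCtx]; split_ifs <;> first | rfl | exact getLsb_zero _)
    all_goals first | rfl | exact getLsb_zero _
  short _ := Nat.zero_le _

/-- The encoding omits the key of `c`, so the same registers represent the initial state for every
key `k`. Thus the distinguisher simulates the experiment without knowing the key of its oracle. -/
theorem Enc.init_update {γ : Ctx D} {reg : Memory} {key : Fin D.l → BitVec D.lk}
    (h : Enc S { γ with w := init key } reg) (k : BitVec D.lk) :
    Enc S { γ with w := init (Function.update key S.c k) } reg where
  mem := h.mem
  bit v := by
    rw [h.bit]
    cases v
    case world v =>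
      cases v
      case key j b =>
        simp only [Var.bit, WVar.bit, init]
        split_ifs with hj
        · rfl
        · rw [Function.update_of_ne hj]
      all_goals rfl
    all_goals rfl
  short := h.short

theorem cheap_chose : Cheap S 100 fun γ => chose S.c γ.mem γ.w := by
  obtain ⟨hl, -⟩ := S.le
  exact ((cheap_select hl (fun i => i.1) S.c).and (cheap_corrupted S S.c).not).mono (by omega)

theorem cheap_switch (ideal : Bool) : CheapWorld S 100 fun γ => switch S.c ideal γ.w := by
  unfold switch
  split_ifs
  · exact (cheapWorld_w.mono (by omega)).forget (by omega) _
  · exact cheapWorld_w.mono (by omega)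

theorem switch_log (c : Fin D.l) (ideal : Bool) (w : World D) : (switch c ideal w).log = w.log := by
  unfold switch
  split_ifs <;> rfl

/-- The experiment for a single tag is run by a small circuit with access to the function of this
tag. -/
theorem exists_distinguisher (A₁ A₂ : Circuit (D.Ifc F)) (hT : A₁.length + A₂.length ≤ S.T)
    (ideal : Bool) (out : Bool → Memory → World D → Bool)
    (hout : Cheap S 500 fun γ => out γ.ok γ.mem γ.w) :
    ∃ C : SimCircuit D, C.size ≤ (A₁.length + A₂.length + 1) * S.N ^ 521 ∧
      ∀ f k, distinguish C f true = tagExp F S.c A₁ A₂ ideal out f k := by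
  obtain ⟨C₁, a1, a2⟩ := exists_flips S
  obtain ⟨C₂, b1, b2⟩ := exists_assign (S := S) (k := 500)
    (fun γ => { γ with w := init γ.rnd.key }) (fun v => by
      cases v
      case x j b => exact (Cheap.var (.x j b)).mono (by norm_num)
      case world v => exact (CheapWorld.init v).mono (by norm_num)
      case ok => exact (Cheap.var .ok).mono (by norm_num)
      case rnd i => exact (Cheap.var (.rnd i)).mono (by norm_num)
      case y t j b => exact (Cheap.var (.y t j b)).mono (by norm_num))
    (ι := Empty) (by simp) Function.Embedding.ofIsEmpty (fun o => o.elim) (fun o => o.elim)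
    fun γ => extend_empty _ _
  obtain ⟨C₃, c1, c2⟩ := sim_circuit (S := S) (ρ := ⟨none, some S.c, true⟩) rfl A₁
  obtain ⟨C₄, d1, d2⟩ := exists_assign (S := S) (k := 500)
    (fun γ => { γ with ok := chose S.c γ.mem γ.w, w := switch S.c ideal γ.w }) (fun v => by
      cases v
      case x j b => exact (Cheap.var (.x j b)).mono (by norm_num)
      case world v => exact (cheap_switch ideal v).mono (by norm_num)
      case ok => exact cheap_chose.mono (by norm_num)
      case rnd i => exact (Cheap.var (.rnd i)).mono (by norm_num)
      case y t j b => exact (Cheap.var (.y t j b)).mono (by norm_num))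
    (ι := Empty) (by simp) Function.Embedding.ofIsEmpty (fun o => o.elim) (fun o => o.elim)
    fun γ => extend_empty _ _
  obtain ⟨C₅, e1, e2⟩ := sim_circuit (S := S) (ρ := stage2 S.c ideal) rfl A₂
  obtain ⟨C₆, f1, f2⟩ := exists_assign (S := S) (k := 500)
    (fun γ => { γ with mem := Function.update γ.mem 0 (out γ.ok γ.mem γ.w) }) (fun v => by
      cases v
      case x j b => exact (Cheap.var (.x j b)).mono (by norm_num)
      case world v => exact (Cheap.var (.world v)).mono (by norm_num)
      case ok => exact (Cheap.var .ok).mono (by norm_num)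
      case rnd i => exact (Cheap.var (.rnd i)).mono (by norm_num)
      case y t j b => exact (Cheap.var (.y t j b)).mono (by norm_num))
    (ι := Unit) (by have := S.le_N; simp; omega) ⟨fun _ => 0, fun _ _ _ => rfl⟩
    (fun _ γ => out γ.ok γ.mem γ.w) (fun _ => hout) (fun γ => funext fun r => by
      by_cases hr : r = 0
      · subst hr
        exact (Function.update_self 0 (out γ.ok γ.mem γ.w) γ.mem).trans
          ((⟨fun _ => 0, fun _ _ _ => rfl⟩ : Unit ↪ ℕ).injective.extend_apply
            (fun _ => out γ.ok γ.mem γ.w) γ.mem ()).symm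
      · rw [Function.extend_apply' _ _ _ fun ⟨_, h⟩ => hr h.symm]
        exact Function.update_of_ne hr _ _)
  refine ⟨C₁ ++ (C₂ ++ (C₃ ++ (C₄ ++ (C₅ ++ C₆)))), ?_, fun f k => ?_⟩
  · simp only [size_append]
    have hN := S.le_N
    have g1 : S.N ≤ S.N ^ 520 := Nat.le_self_pow (by omega) _
    have g2 : S.N ^ (500 + 12) ≤ S.N ^ 520 := Nat.pow_le_pow_right (by omega) (by omega)
    have g3 : (A₁.length + A₂.length + 1) * S.N ^ 521 =
        S.N * ((A₁.length + A₂.length + 1) * S.N ^ 520) := by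
      rw [pow_succ' S.N 520]; ring
    have g4 : 100 * ((A₁.length + A₂.length + 1) * S.N ^ 520) ≤
        S.N * ((A₁.length + A₂.length + 1) * S.N ^ 520) := by gcongr
    rw [g3]
    refine le_trans ?_ g4
    rw [add_mul, add_mul]
    omega
  · have key : Coupled (fun x b => x.1 0 = b)
        (Circuit.run (funOracle f) (C₁ ++ (C₂ ++ (C₃ ++ (C₄ ++ (C₅ ++ C₆))))) (blank, ()))
        (coins D >>= fun r => A₁.run (oracle F ⟨none, some S.c, true⟩ (tagEv F S.c f))
          (blank, init (Function.update r.key S.c k)) >>= fun x =>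
          A₂.run (oracle F (stage2 S.c ideal) (tagEv F S.c f)) (x.1, switch S.c ideal x.2) >>=
            fun y => (pure (out (chose S.c x.1 x.2) y.1 y.2) : PMF Bool)) := by
      rw [run_append]
      refine (a2 f _ _ (enc_zero S)).bind ?_
      rintro ⟨reg₁, ⟨⟩⟩ r hr
      rw [run_append]
      obtain ⟨reg₂, p1, p2⟩ := b2 f _ reg₁ hr fun _ => Nat.zero_le _
      rw [p1, pure_bind, run_append]
      refine (c2 f false 0 (reg₂, ()) (blank, init (Function.update r.key S.c k)) (by omega)
        ⟨fun _ => le_rfl, _, rfl, rfl, rfl, p2.init_update k⟩).bind ?_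
      rintro ⟨reg₃, ⟨⟩⟩ ⟨mem, w⟩ ⟨hlog, γ, rfl, rfl, -, hE⟩
      rw [run_append]
      obtain ⟨reg₄, q1, q2⟩ := d2 f γ reg₃ hE fun j => by
        dsimp only
        rw [switch_log]
        exact hE.short j
      rw [q1, pure_bind, run_append]
      refine (e2 f (chose S.c γ.mem γ.w) (0 + A₁.length) (reg₄, ()) (γ.mem, switch S.c ideal γ.w)
        (by omega) ⟨by dsimp only; rw [switch_log]; exact hlog, { γ with
          ok := chose S.c γ.mem γ.w
          w := switch S.c ideal γ.w }, rfl, rfl, rfl, q2⟩).bind ?_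
      rintro ⟨reg₅, ⟨⟩⟩ ⟨mem', w'⟩ ⟨hlog', γ', rfl, rfl, hok, hE'⟩
      refine f2.coupled f hE' hE'.short fun reg' hE'' => ?_
      have := hE''.mem 0
      rw [← hok]
      exact this.trans (Function.update_self 0 (out γ'.ok γ'.mem γ'.w) γ'.mem)
    unfold tagExp
    rw [apply_true]
    refine (expect_bind _ _ _).trans ?_
    refine (key.expect_eq (Ψ := ind) fun x b hb => ?_).trans ?_
    · refine (expect_pure _ _).trans ?_
      exact congrArg ind hb
    · simp only [expect_bind, expect_pure]

end RFID

end

noncomputable section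

namespace RFID

open scoped ENNReal

/-! ### Asymptotics -/

namespace PolyBounded

variable {f g : ℕ → ℕ}

theorem mono (h : PolyBounded g) (H : ∀ κ, f κ ≤ g κ) : PolyBounded f := by
  obtain ⟨p, hp⟩ := h
  exact ⟨p, fun κ => (H κ).trans (hp κ)⟩

theorem const (n : ℕ) : PolyBounded fun _ => n := ⟨Polynomial.C n, fun κ => by simp⟩

theorem add (hf : PolyBounded f) (hg : PolyBounded g) : PolyBounded fun κ => f κ + g κ := by
  obtain ⟨p, hp⟩ := hf
  obtain ⟨q, hq⟩ := hg
  exact ⟨p + q, fun κ => by rw [Polynomial.eval_add]; exact add_le_add (hp κ) (hq κ)⟩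

theorem mul (hf : PolyBounded f) (hg : PolyBounded g) : PolyBounded fun κ => f κ * g κ := by
  obtain ⟨p, hp⟩ := hf
  obtain ⟨q, hq⟩ := hg
  exact ⟨p * q, fun κ => by rw [Polynomial.eval_mul]; exact Nat.mul_le_mul (hp κ) (hq κ)⟩

theorem pow (hf : PolyBounded f) (n : ℕ) : PolyBounded fun κ => f κ ^ n := by
  obtain ⟨p, hp⟩ := hf
  exact ⟨p ^ n, fun κ => by rw [Polynomial.eval_pow]; exact Nat.pow_le_pow_left (hp κ) n⟩

end PolyBounded

namespace Negligible

variable {ε δ : ℕ → ℝ}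

theorem of_le (h : Negligible δ) (h0 : ∀ κ, 0 ≤ ε κ) (H : ∀ κ, ε κ ≤ δ κ) : Negligible ε :=
  Asymptotics.SuperpolynomialDecay.trans_abs_le h fun κ => by
    rw [abs_of_nonneg (h0 κ)]
    exact (H κ).trans (le_abs_self _)

theorem add (h : Negligible ε) (h' : Negligible δ) : Negligible fun κ => ε κ + δ κ :=
  Asymptotics.SuperpolynomialDecay.add h h'

theorem poly_mul (h : Negligible ε) (h0 : ∀ κ, 0 ≤ ε κ) {f : ℕ → ℕ} (hf : PolyBounded f) :
    Negligible fun κ => f κ * ε κ := by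
  obtain ⟨p, hp⟩ := hf
  have h1 := Asymptotics.SuperpolynomialDecay.polynomial_mul h (p.map (Nat.castRingHom ℝ))
  refine of_le h1 (fun κ => mul_nonneg (Nat.cast_nonneg _) (h0 κ)) fun κ => ?_
  refine mul_le_mul_of_nonneg_right ?_ (h0 κ)
  have h2 : Polynomial.eval (κ : ℝ) (p.map (Nat.castRingHom ℝ)) = (p.eval κ : ℕ) := by
    rw [Polynomial.eval_natCast_map]
    rfl
  rw [h2]
  exact_mod_cast hp κ

end Negligible

/-- The advantage of a distinguisher. -/
def advantage {lk ld lr : ℕ} (F : BitVec lk → BitVec ld → BitVec lr)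
    (C : Circuit (funInterface ld lr)) : ℝ :=
  |(prfReal F C true).toReal - (prfIdeal C true).toReal|

/-- The advantages of polynomially many distinguishers add up to a negligible amount. -/
theorem IsPRF.sum_advantage {lk ld lr l : ℕ → ℕ}
    {F : ∀ κ, BitVec (lk κ) → BitVec (ld κ) → BitVec (lr κ)} (hF : IsPRF lk ld lr F)
    (hl : PolyBounded l) (C : ∀ κ, Fin (l κ) → Circuit (funInterface (ld κ) (lr κ)))
    {B : ℕ → ℕ} (hB : PolyBounded B) (hC : ∀ κ c, (C κ c).size ≤ B κ) :
    Negligible fun κ => ∑ c, advantage (F κ) (C κ c) := by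
  -- The PRF property speaks of one circuit for each `κ`. By non-uniformity this can be the
  -- distinguisher for the tag with the largest advantage.
  have h : ∀ κ, ∃ C' : Circuit (funInterface (ld κ) (lr κ)), C'.size ≤ B κ ∧
      ∑ c, advantage (F κ) (C κ c) ≤ l κ * advantage (F κ) C' := by
    intro κ
    by_cases h0 : Nonempty (Fin (l κ))
    · obtain ⟨c, -, hc⟩ := Finset.exists_max_image Finset.univ
        (fun c => advantage (F κ) (C κ c)) Finset.univ_nonempty
      refine ⟨C κ c, hC κ c, ?_⟩
      refine (Finset.sum_le_card_nsmul _ _ _ fun c' _ => hc c' (Finset.mem_univ _)).trans ?_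
      simp
    · refine ⟨[], Nat.zero_le _, ?_⟩
      have : IsEmpty (Fin (l κ)) := not_nonempty_iff.1 h0
      rw [Finset.univ_eq_empty, Finset.sum_empty]
      exact mul_nonneg (Nat.cast_nonneg _) (abs_nonneg _)
  choose C' h1 h2 using h
  have h3 : Negligible fun κ => advantage (F κ) (C' κ) := hF.2 C' (hB.mono h1)
  exact (h3.poly_mul (fun κ => abs_nonneg _) hl).of_le
    (fun κ => Finset.sum_nonneg fun c _ => abs_nonneg _) h2

theorem prfReal_eq {lk ld lr : ℕ} (F : BitVec lk → BitVec ld → BitVec lr)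
    (C : Circuit (funInterface ld lr)) :
    prfReal F C true = expect (uniformBits lk) fun k => distinguish C (F k) true := by
  rw [apply_true]
  refine (expect_bind _ _ _).trans ?_
  simp only [apply_true]

theorem prfIdeal_eq (D : Dims) (C : SimCircuit D) :
    prfIdeal C true = expect (randFn D) fun f => distinguish C f true := by
  rw [apply_true]
  refine (expect_bind _ _ _).trans ?_
  simp only [← apply_true]
  exact expect_uniform_equiv
    (Equiv.arrowCongr (wiresEquiv D.ld) (wiresEquiv D.lr)) (fun f => distinguish C f true)

theorem tagExp_le_one {D : Dims} {F : D.Family} (c : Fin D.l) (A₁ A₂ : Circuit (D.Ifc F))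
    (ideal : Bool) (out : Bool → Memory → World D → Bool) (f : D.Fn) (k : BitVec D.lk) :
    World.tagExp F c A₁ A₂ ideal out f k ≤ 1 :=
  expect_le_one _ fun _ => expect_le_one _ fun _ => expect_le_one _ fun _ => ind_le_one _

/-- The experiment for tag `c` with a pseudorandom function. -/
def realProb {D : Dims} (F : D.Family) (c : Fin D.l) (A₁ A₂ : Circuit (D.Ifc F)) (ideal : Bool)
    (out : Bool → Memory → World D → Bool) : ℝ≥0∞ :=
  expect (uniformBits D.lk) fun k => World.tagExp F c A₁ A₂ ideal out (F k) k

/-- The experiment for tag `c` with a random function. -/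
def randProb {D : Dims} (F : D.Family) (c : Fin D.l) (A₁ A₂ : Circuit (D.Ifc F)) (ideal : Bool)
    (out : Bool → Memory → World D → Bool) : ℝ≥0∞ :=
  -- Any key could be written instead of `0`: with the function of `c` replaced by `f`, the key of
  -- `c` has no influence.
  expect (randFn D) fun f => World.tagExp F c A₁ A₂ ideal out f 0

theorem realProb_le_one {D : Dims} (F : D.Family) (c : Fin D.l) (A₁ A₂ : Circuit (D.Ifc F))
    (ideal : Bool) (out : Bool → Memory → World D → Bool) : realProb F c A₁ A₂ ideal out ≤ 1 :=
  expect_le_one _ fun _ => tagExp_le_one _ _ _ _ _ _ _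

theorem randProb_le_one {D : Dims} (F : D.Family) (c : Fin D.l) (A₁ A₂ : Circuit (D.Ifc F))
    (ideal : Bool) (out : Bool → Memory → World D → Bool) : randProb F c A₁ A₂ ideal out ≤ 1 :=
  expect_le_one _ fun _ => tagExp_le_one _ _ _ _ _ _ _

/-- Replacing the function of one tag by a random function changes the results of the experiments
for single tags by a negligible amount. -/
theorem negligible_tagExp {D : ℕ → Dims} {F : ∀ κ, (D κ).Family}
    (hF : IsPRF (fun κ => (D κ).lk) (fun κ => (D κ).ld) (fun κ => (D κ).lr) F)
    (hl : PolyBounded fun κ => (D κ).l) (hlk : PolyBounded fun κ => (D κ).lk)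
    (hld : PolyBounded fun κ => (D κ).ld) (hm : PolyBounded fun κ => (D κ).m)
    (A₁ A₂ : ∀ κ, Circuit ((D κ).Ifc (F κ))) (h₁ : PolyBounded fun κ => (A₁ κ).size)
    (h₂ : PolyBounded fun κ => (A₂ κ).size) (ideal : Bool)
    (out : ∀ κ, Fin (D κ).l → Bool → Memory → World (D κ) → Bool)
    (hout : ∀ κ (S : Setting (D κ) (F κ)),
      Cheap S 500 fun γ => out κ S.c γ.ok γ.mem γ.w) :
    Negligible fun κ => ∑ c, |(realProb (F κ) c (A₁ κ) (A₂ κ) ideal (out κ c)).toReal -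
      (randProb (F κ) c (A₁ κ) (A₂ κ) ideal (out κ c)).toReal| := by
  obtain ⟨gates, w, hg, hw⟩ := hF.1
  have hlr : PolyBounded fun κ => (D κ).lr := hld.mono fun κ => by have := (D κ).hm; omega
  have hlu : PolyBounded fun κ => (D κ).lu := hld.mono fun κ => by have := (D κ).hm; omega
  have hlv : PolyBounded fun κ => (D κ).lv := hld.mono fun κ => by have := (D κ).hm; omega
  have hA₁ := h₁.mono fun κ => length_le_size (A₁ κ)
  have hA₂ := h₂.mono fun κ => length_le_size (A₂ κ)
  let N : ℕ → ℕ := fun κ => 10 * ((D κ).l + (D κ).lk + (D κ).ld + (D κ).lv + (D κ).lr + (D κ).lu +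
    (D κ).m + ((A₁ κ).length + (A₂ κ).length) + (gates κ).length + (D κ).l * (D κ).lk + 10)
  have hN : PolyBounded N := (PolyBounded.const 10).mul
    ((((((((((hl.add hlk).add hld).add hlv).add hlr).add hlu).add hm).add (hA₁.add hA₂)).add hg).add
      (hl.mul hlk)).add (PolyBounded.const 10))
  let S : ∀ κ, Fin (D κ).l → Setting (D κ) (F κ) := fun κ c =>
    ⟨c, (A₁ κ).length + (A₂ κ).length, N κ, gates κ, w κ, hw κ, le_rfl⟩
  choose C hC1 hC2 using fun κ c => exists_distinguisher (S := S κ c) (A₁ κ) (A₂ κ) le_rfl ideal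
    (out κ c) (hout κ (S κ c))
  refine (hF.sum_advantage hl C (((hA₁.add hA₂).add (PolyBounded.const 1)).mul (hN.pow 521))
    hC1).of_le (fun κ => Finset.sum_nonneg fun c _ => abs_nonneg _) fun κ => ?_
  refine Finset.sum_le_sum fun c _ => le_of_eq ?_
  unfold advantage
  rw [prfReal_eq, prfIdeal_eq]
  simp only [realProb, randProb]
  congr 3
  · congr 1
    funext k
    exact (hC2 κ c _ k).symm
  · congr 1
    funext f
    exact (hC2 κ c f 0).symm

/-- A bound for the statistical distance in an attack with `q` calls. -/
def slack (D : Dims) (q : ℕ) : ℝ≥0∞ := 2 * ((q + 1 : ℕ) * stepError D q)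

/-- The analysis requires that the counter does not wrap during the attack. If it might, the error
bound exceeds `1`, and the claims hold trivially. The factor `q + 1` instead of `q` is needed for `q
= 0`. -/
theorem one_le_slack {D : Dims} {q : ℕ} (h : 2 ^ D.lr ≤ q + 2) :
    1 ≤ ((q + 1 : ℕ) : ℝ≥0∞) * stepError D q := by
  have h2 : (((2 ^ D.lr : ℕ)) : ℝ≥0∞) * atom D.lr = 1 :=
    ENNReal.mul_inv_cancel (by simp) (ENNReal.natCast_ne_top _)
  calc (1 : ℝ≥0∞) = ((2 ^ D.lr : ℕ) : ℝ≥0∞) * atom D.lr := h2.symm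
    _ ≤ (((q + 1) * (4 * q + D.l + D.m + 10) : ℕ) : ℝ≥0∞) * atom D.lr := by
      gcongr
      nlinarith
    _ = ((q + 1 : ℕ) : ℝ≥0∞) * (((4 * q + D.l + D.m + 10 : ℕ) : ℝ≥0∞) * atom D.lr) := by
      rw [Nat.cast_mul, mul_assoc]
    _ ≤ _ := by
      unfold stepError
      gcongr
      rw [add_assoc]
      exact le_self_add

theorem toReal_atom (n : ℕ) : (atom n).toReal = (1 / 2 : ℝ) ^ n := by
  simp [atom]

theorem stepError_ne_top (D : Dims) (q : ℕ) : stepError D q ≠ ⊤ := by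
  unfold stepError atom
  refine ENNReal.mul_ne_top (ENNReal.natCast_ne_top _) ?_
  simp

theorem slack_ne_top (D : Dims) (q : ℕ) : slack D q ≠ ⊤ :=
  ENNReal.mul_ne_top (by simp) (ENNReal.mul_ne_top (ENNReal.natCast_ne_top _)
    (stepError_ne_top D q))

theorem toReal_slack (D : Dims) (q : ℕ) : (slack D q).toReal =
    ((2 * ((q + 1) * (4 * q + D.l + D.m + 10)) : ℕ) : ℝ) *
      ((1 / 2 : ℝ) ^ D.lr + (1 / 2 : ℝ) ^ D.lu + (1 / 2 : ℝ) ^ D.lv) := by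
  have h : ∀ n, atom n ≠ ⊤ := fun n => by simp [atom]
  unfold slack stepError
  rw [ENNReal.toReal_mul, ENNReal.toReal_mul, ENNReal.toReal_mul,
    ENNReal.toReal_add (ENNReal.add_ne_top.2 ⟨h _, h _⟩) (h _), ENNReal.toReal_add (h _) (h _),
    toReal_atom, toReal_atom, toReal_atom, ENNReal.toReal_natCast, ENNReal.toReal_natCast]
  push_cast
  rw [show (2 : ℝ≥0∞).toReal = 2 by rfl]
  ring

theorem negligible_slack {D : ℕ → Dims} (hl : PolyBounded fun κ => (D κ).l)
    (hm : PolyBounded fun κ => (D κ).m) {q : ℕ → ℕ} (hq : PolyBounded q)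
    (hlr : Negligible fun κ => (1 / 2 : ℝ) ^ (D κ).lr)
    (hlu : Negligible fun κ => (1 / 2 : ℝ) ^ (D κ).lu)
    (hlv : Negligible fun κ => (1 / 2 : ℝ) ^ (D κ).lv) :
    Negligible fun κ => (D κ).l * (slack (D κ) (q κ)).toReal := by
  refine Negligible.poly_mul ?_ (fun κ => ENNReal.toReal_nonneg) hl
  simp only [toReal_slack]
  refine Negligible.poly_mul ((hlr.add hlu).add hlv) (fun κ => by positivity) ?_
  exact (PolyBounded.const 2).mul ((hq.add (PolyBounded.const 1)).mul
    (((((PolyBounded.const 4).mul hq).add hl).add hm).add (PolyBounded.const 10)))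

theorem Near.abs_le {ε a b : ℝ≥0∞} (h : Near ε a b) (hε : ε ≠ ⊤) (ha : a ≤ 1) (hb : b ≤ 1) :
    |a.toReal - b.toReal| ≤ ε.toReal := by
  have ha' : a ≠ ⊤ := ne_top_of_le_ne_top ENNReal.one_ne_top ha
  have hb' : b ≠ ⊤ := ne_top_of_le_ne_top ENNReal.one_ne_top hb
  have h1 := ENNReal.toReal_mono (ENNReal.add_ne_top.2 ⟨hb', hε⟩) h.1
  have h2 := ENNReal.toReal_mono (ENNReal.add_ne_top.2 ⟨ha', hε⟩) h.2
  rw [ENNReal.toReal_add hb' hε] at h1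
  rw [ENNReal.toReal_add ha' hε] at h2
  rw [_root_.abs_le]
  constructor <;> linarith

theorem randProb_guess {D : Dims} (F : D.Family) (c : Fin D.l) (A₁ A₂ : Circuit (D.Ifc F)) :
    |(randProb F c A₁ A₂ false World.guess).toReal -
      (randProb F c A₁ A₂ true World.guess).toReal| ≤
      (slack D (A₁.length + A₂.length)).toReal := by
  refine Near.abs_le ?_ (slack_ne_top _ _) (randProb_le_one _ _ _ _ _ _)
    (randProb_le_one _ _ _ _ _ _)
  by_cases hq : A₁.length + A₂.length + 2 < 2 ^ D.lr
  · refine (near_guess c A₁ A₂ hq 0).mono ?_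
    unfold slack
    gcongr 2 * (?_ * _)
    exact_mod_cast Nat.le_succ _
  · refine Near.of_le_one (randProb_le_one _ _ _ _ _ _) (randProb_le_one _ _ _ _ _ _) ?_
    refine (one_le_slack (not_lt.1 hq)).trans ?_
    unfold slack
    rw [two_mul]
    exact le_self_add

theorem randProb_fraud {D : Dims} (F : D.Family) (c : Fin D.l) (A : Circuit (D.Ifc F))
    (flag : World D → Bool) (hflag : ∀ w, Clean c w → flag w = false)
    (herase : ∀ w, flag (w.erase c) = flag w) :
    (randProb F c A [] false fun _ _ w => flag w).toReal ≤ (slack D A.length).toReal := by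
  refine ENNReal.toReal_mono (slack_ne_top _ _) ?_
  have h2 : ((A.length + 1 : ℕ) : ℝ≥0∞) * stepError D A.length ≤ slack D A.length := by
    unfold slack
    rw [two_mul]
    exact le_self_add
  by_cases hq : A.length + 2 < 2 ^ D.lr
  · refine (fraud_le c A hq flag hflag herase 0).trans (le_trans ?_ h2)
    gcongr
    omega
  · exact (randProb_le_one _ _ _ _ _ _).trans ((one_le_slack (not_lt.1 hq)).trans h2)

theorem toReal_sum_le {ι : Type} [Fintype ι] {a : ℝ≥0∞} {b : ι → ℝ≥0∞} (h : a ≤ ∑ i, b i)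
    (hb : ∀ i, b i ≤ 1) : a.toReal ≤ ∑ i, (b i).toReal := by
  have hb' : ∀ i, b i ≠ ⊤ := fun i => ne_top_of_le_ne_top ENNReal.one_ne_top (hb i)
  rw [← ENNReal.toReal_sum fun i _ => hb' i]
  exact ENNReal.toReal_mono (ENNReal.sum_ne_top.2 fun i _ => hb' i) h

section

variable {D : ℕ → Dims} {F : ∀ κ, (D κ).Family}
  (hF : IsPRF (fun κ => (D κ).lk) (fun κ => (D κ).ld) (fun κ => (D κ).lr) F)
  (hl : PolyBounded fun κ => (D κ).l) (hlk : PolyBounded fun κ => (D κ).lk)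
  (hld : PolyBounded fun κ => (D κ).ld) (hm : PolyBounded fun κ => (D κ).m)
  (hlr : Negligible fun κ => (1 / 2 : ℝ) ^ (D κ).lr)
  (hlu : Negligible fun κ => (1 / 2 : ℝ) ^ (D κ).lu)
  (hlv : Negligible fun κ => (1 / 2 : ℝ) ^ (D κ).lv)

include hF hl hlk hld hm hlr hlu hlv

/-- For each tag the triangle inequality is applied along: real world with `F`, real world with a
random function, random world with a random function, random world with `F`. The outer steps are PRF
advantages, the middle one is the statistical bound; the sum over the tags has polynomially many
terms. -/
theorem negligible_unp (A₁ A₂ : ∀ κ, Circuit ((D κ).Ifc (F κ)))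
    (h₁ : PolyBounded fun κ => (A₁ κ).size) (h₂ : PolyBounded fun κ => (A₂ κ).size) :
    Negligible fun κ =>
      |(unpExp ((D κ).sys (F κ)) (D κ).m (A₁ κ) (A₂ κ) true true).toReal -
        (unpExp ((D κ).sys (F κ)) (D κ).m (A₁ κ) (A₂ κ) false true).toReal| := by
  have hout : ∀ κ (S : Setting (D κ) (F κ)), Cheap S 500 fun γ => World.guess γ.ok γ.mem γ.w :=
    fun κ S => ((Cheap.var .ok).and (Cheap.mem 0)).mono (by norm_num)
  have hA := (h₁.mono fun κ => length_le_size (A₁ κ)).add (h₂.mono fun κ => length_le_size (A₂ κ))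
  have n1 := negligible_tagExp hF hl hlk hld hm A₁ A₂ h₁ h₂ false (fun _ _ => World.guess) hout
  have n2 := negligible_tagExp hF hl hlk hld hm A₁ A₂ h₁ h₂ true (fun _ _ => World.guess) hout
  have n3 := negligible_slack hl hm hA hlr hlu hlv
  refine ((n1.add n2).add n3).of_le (fun κ => abs_nonneg _) fun κ => ?_
  have hsum : ∀ b, (unpExp ((D κ).sys (F κ)) (D κ).m (A₁ κ) (A₂ κ) b true).toReal =
      ∑ c, (realProb (F κ) c (A₁ κ) (A₂ κ) (!b) World.guess).toReal := by
    intro b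
    rw [World.unpExp_eq, ENNReal.toReal_sum]
    · rfl
    · exact fun c _ => ne_top_of_le_ne_top ENNReal.one_ne_top (realProb_le_one _ _ _ _ _ _)
  rw [hsum, hsum, ← Finset.sum_sub_distrib]
  refine (Finset.abs_sum_le_sum_abs _ _).trans ?_
  have hcard : ((D κ).l : ℝ) * (slack (D κ) ((A₁ κ).length + (A₂ κ).length)).toReal =
      ∑ _c : Fin (D κ).l, (slack (D κ) ((A₁ κ).length + (A₂ κ).length)).toReal := by simp
  rw [hcard, ← Finset.sum_add_distrib, ← Finset.sum_add_distrib]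
  refine Finset.sum_le_sum fun c _ => ?_
  have h4 := _root_.abs_le.1 (randProb_guess (F κ) c (A₁ κ) (A₂ κ))
  have h5 := neg_abs_le ((realProb (F κ) c (A₁ κ) (A₂ κ) false World.guess).toReal -
    (randProb (F κ) c (A₁ κ) (A₂ κ) false World.guess).toReal)
  have h6 := le_abs_self ((realProb (F κ) c (A₁ κ) (A₂ κ) false World.guess).toReal -
    (randProb (F κ) c (A₁ κ) (A₂ κ) false World.guess).toReal)
  have h7 := neg_abs_le ((realProb (F κ) c (A₁ κ) (A₂ κ) true World.guess).toReal -
    (randProb (F κ) c (A₁ κ) (A₂ κ) true World.guess).toReal)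
  have h8 := le_abs_self ((realProb (F κ) c (A₁ κ) (A₂ κ) true World.guess).toReal -
    (randProb (F κ) c (A₁ κ) (A₂ κ) true World.guess).toReal)
  simp only [Bool.not_true, Bool.not_false]
  rw [_root_.abs_le]
  constructor <;> linarith [h4.1, h4.2]

/-- With a random function frauds have probability at most `slack`, and returning to `F` costs a PRF
advantage for each tag. -/
theorem negligible_fraud (A : ∀ κ, Circuit ((D κ).Ifc (F κ)))
    (h : PolyBounded fun κ => (A κ).size) (flag : ∀ κ, Fin (D κ).l → World (D κ) → Bool)
    (hflag : ∀ κ c w, Clean c w → flag κ c w = false)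
    (herase : ∀ κ c w, flag κ c (w.erase c) = flag κ c w)
    (hout : ∀ κ (S : Setting (D κ) (F κ)), Cheap S 500 fun γ => flag κ S.c γ.w) :
    Negligible fun κ =>
      ∑ c, (realProb (F κ) c (A κ) [] false fun _ _ w => flag κ c w).toReal := by
  have n1 := negligible_tagExp hF hl hlk hld hm A (fun _ => []) h (PolyBounded.const 0) false
    (fun κ c _ _ w => flag κ c w) hout
  have n2 := negligible_slack hl hm (h.mono fun κ => length_le_size (A κ)) hlr hlu hlv
  refine (n1.add n2).of_le (fun κ => Finset.sum_nonneg fun c _ => ENNReal.toReal_nonneg) fun κ => ?_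
  have hcard : ((D κ).l : ℝ) * (slack (D κ) (A κ).length).toReal =
      ∑ _c : Fin (D κ).l, (slack (D κ) (A κ).length).toReal := by simp
  rw [hcard, ← Finset.sum_add_distrib]
  refine Finset.sum_le_sum fun c _ => ?_
  have h4 := randProb_fraud (F κ) c (A κ) (flag κ c) (hflag κ c) (herase κ c)
  have h5 := le_abs_self ((realProb (F κ) c (A κ) [] false fun _ _ w => flag κ c w).toReal -
    (randProb (F κ) c (A κ) [] false fun _ _ w => flag κ c w).toReal)
  linarith

theorem negligible_auth (A : ∀ κ, Circuit ((D κ).Ifc (F κ)))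
    (h : PolyBounded fun κ => (A κ).size) :
    Negligible (fun κ =>
      (((authExp ((D κ).sys (F κ)) (D κ).m (A κ)).map Prod.fst) true).toReal) ∧
    Negligible (fun κ =>
      (((authExp ((D κ).sys (F κ)) (D κ).m (A κ)).map Prod.snd) true).toReal) := by
  constructor
  · exact (negligible_fraud hF hl hlk hld hm hlr hlu hlv A h (fun κ c w => w.tagFooled c)
      (fun κ c w hw => hw.1) (fun κ c w => rfl)
      (fun κ S => (cheap_tagFooled S S.c).mono (by norm_num))).of_le
      (fun κ => ENNReal.toReal_nonneg) fun κ => toReal_sum_le (World.authExp_fst_le (A κ))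
        fun c => realProb_le_one _ _ _ _ _ _
  · exact (negligible_fraud hF hl hlk hld hm hlr hlu hlv A h (fun κ c w => w.readerFooled c)
      (fun κ c w hw => hw.2.1) (fun κ c w => rfl)
      (fun κ S => (cheap_readerFooled S S.c).mono (by norm_num))).of_le
      (fun κ => ENNReal.toReal_nonneg) fun κ => toReal_sum_le (World.authExp_snd_le (A κ))
        fun c => realProb_le_one _ _ _ _ _ _

end

end RFID

end

noncomputable section

namespace RFID

open scoped ENNReal

/-! ### Adaptive completeness follows from privacy -/

theorem Coupled.of_expect {α β : Type} {μ : PMF α} {ν : PMF β} {f : β → α} {R : α → β → Prop}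
    (h : ∀ Φ : α → ℝ≥0∞, expect μ Φ = expect ν fun y => Φ (f y)) (H : ∀ y, R (f y) y) :
    Coupled R μ ν := by
  intro Φ Ψ
  rw [h]
  exact ⟨fun G => expect_mono ν fun y => G _ _ (H y), fun G => expect_mono ν fun y => G _ _ (H y)⟩

/-- The instruction does not write to the register `z`. -/
def Instr.Avoids {I : Interface} (z : ℕ) : Instr I → Prop
  | .gate g => g.dst ≠ z
  | .flip dst => dst ≠ z
  | .query _ _ out => ∀ o, out o ≠ z

/-- The attack may use up all `m` sessions, so the honest session needs an additional one. In the
calls of the attack its selector is wired to a register that is never written and hence remains `0`.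
The lower bound keeps this register apart from those that name the challenge tag. -/
theorem exists_avoids {I : Interface} (C : Circuit I) (n : ℕ) : ∃ z, n ≤ z ∧ ∀ i ∈ C, i.Avoids z := by
  have h : ∃ z₀, ∀ z, z₀ ≤ z → ∀ i ∈ C, i.Avoids z := by
    induction C with
    | nil => exact ⟨0, by simp⟩
    | cons i C ih =>
      obtain ⟨z₀, hz⟩ := ih
      have : ∃ z₁, ∀ z, z₁ ≤ z → i.Avoids z := by
        cases i with
        | gate g => exact ⟨g.dst + 1, fun z hz => by simp only [Instr.Avoids]; omega⟩
        | flip d => exact ⟨d + 1, fun z hz => by simp only [Instr.Avoids]; omega⟩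
        | query p inp out =>
          refine ⟨Finset.univ.sup out + 1, fun z hz o => ?_⟩
          have := Finset.le_sup (f := out) (Finset.mem_univ o)
          omega
      obtain ⟨z₁, hz₁⟩ := this
      refine ⟨max z₀ z₁, fun z hz' j hj => ?_⟩
      rcases List.mem_cons.1 hj with rfl | hj
      · exact hz₁ z (le_of_max_le_right hz')
      · exact hz z (le_of_max_le_left hz') j hj
  obtain ⟨z₀, hz⟩ := h
  exact ⟨max n z₀, le_max_left _ _, hz _ (le_max_right _ _)⟩

variable {S : RFIDSystem} {m : ℕ}

/-- Extend a family by one element. -/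
def extendFin {α : Type} (f : Fin m → α) (a : α) (s : Fin (m + 1)) : α :=
  if h : s.1 < m then f ⟨s, h⟩ else a

theorem extendFin_castSucc {α : Type} (f : Fin m → α) (a : α) (s : Fin m) :
    extendFin f a s.castSucc = f s := by
  simp [extendFin]

theorem extendFin_last {α : Type} (f : Fin m → α) (a : α) : extendFin f a (Fin.last m) = a := by
  simp [extendFin]

theorem extendFin_update {α : Type} (f : Fin m → α) (a b : α) (s : Fin m) :
    Function.update (extendFin f a) s.castSucc b = extendFin (Function.update f s b) a := by
  funext t
  refine Fin.lastCases ?_ (fun t => ?_) t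
  · rw [Function.update_of_ne (Fin.castSucc_ne_last s).symm, extendFin_last, extendFin_last]
  · rw [extendFin_castSucc]
    by_cases h : t = s
    · subst h; simp
    · rw [Function.update_of_ne fun e => h (Fin.castSucc_injective _ e), extendFin_castSucc,
        Function.update_of_ne h]

theorem select_extendFin (f : Fin m → Bool) :
    select (extendFin f false) = (select f).map Fin.castSucc := by
  unfold select
  rw [List.finRange_succ_last, List.find?_append, List.find?_map]
  have h1 : (extendFin f false ∘ Fin.castSucc) = f := funext fun s => extendFin_castSucc _ _ _
  rw [h1]
  simp [extendFin_last]

/-- The same state with an additional session of the reader. -/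
def Game.lift (g : Game S m) : Game S (m + 1) where
  db := g.db
  tag := g.tag
  corrupted := g.corrupted
  pending := g.pending
  tagLog := g.tagLog
  reader := extendFin g.reader .idle
  tagImpersonated := g.tagImpersonated
  readerImpersonated := g.readerImpersonated

theorem Game.lift_readerMatches (g : Game S m) (i : Fin S.numTags) (c1 : BitVec S.lenC1)
    (α : BitVec S.lenA) (c2 : BitVec S.lenC2) :
    g.lift.ReaderMatches i c1 α c2 = g.ReaderMatches i c1 α c2 := by
  refine propext ⟨?_, ?_⟩
  · rintro ⟨s, hs⟩
    revert hs
    refine Fin.lastCases ?_ (fun s => ?_) s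
    · intro hs
      have h : extendFin g.reader .idle (Fin.last m) = .accepted c1 α i c2 := hs
      rw [extendFin_last] at h
      cases h
    · intro hs
      exact ⟨s, (extendFin_castSucc g.reader .idle s).symm.trans hs⟩
  · rintro ⟨s, hs⟩
    exact ⟨s.castSucc, (extendFin_castSucc g.reader .idle s).trans hs⟩

theorem Game.lift_setReader (g : Game S m) (s : Fin m) (v : ReaderSession S) :
    ({ g.lift with reader := Function.update g.lift.reader s.castSucc v } : Game S (m + 1)) =
      Game.lift { g with reader := Function.update g.reader s v } :=
  congrArg (fun r => ({ g.lift with reader := r } : Game S (m + 1)))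
    (extendFin_update g.reader .idle v s)

theorem expect_initReader_lift (s : Fin m) (g : Game S m) (Φ) :
    expect (Game.initReader s.castSucc g.lift) Φ =
      expect (Game.initReader s g) fun y => Φ (y.1, y.2.lift) := by
  have hr : g.lift.reader s.castSucc = g.reader s := extendFin_castSucc _ _ _
  unfold Game.initReader
  rw [hr]
  cases g.reader s <;> simp only [expect_bind, expect_pure, Game.lift_setReader]

theorem expect_startTag_lift (i : Fin S.numTags) (c1 : BitVec S.lenC1) (g : Game S m) (Φ) :
    expect (Game.startTag i c1 g.lift) Φ =
      expect (Game.startTag i c1 g) fun y => Φ (y.1, y.2.lift) := by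
  unfold Game.startTag
  rw [expect_bind, expect_bind]
  congr 1
  funext x
  rw [expect_pure, expect_pure]
  rfl

theorem expect_sendReader_lift (s : Fin m) (α : BitVec S.lenA) (g : Game S m) (Φ) :
    expect (Game.sendReader s.castSucc α g.lift) Φ =
      expect (Game.sendReader s α g) fun y => Φ (y.1, y.2.lift) := by
  have hr : g.lift.reader s.castSucc = g.reader s := extendFin_castSucc _ _ _
  unfold Game.sendReader
  rw [hr]
  cases g.reader s with
  | waiting c1 =>
    dsimp only
    rw [expect_bind, expect_bind]
    congr 1
    funext ⟨db, res⟩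
    cases res with
    | none =>
      dsimp only
      rw [expect_pure, expect_pure]
      exact congrArg (fun r => Φ ((0, false), ({ g.lift with db := db, reader := r } : Game S (m + 1))))
        (extendFin_update g.reader .idle _ s)
    | some z =>
      dsimp only
      rw [expect_pure, expect_pure]
      refine congrArg Φ (Prod.ext rfl ?_)
      unfold Game.lift
      dsimp only
      congr 1
      exact extendFin_update g.reader .idle _ s
  | _ => simp only [expect_pure]

theorem expect_finishTag_lift (i : Fin S.numTags) (c2 : BitVec S.lenC2) (g : Game S m) (Φ) :
    expect (Game.finishTag i c2 g.lift) Φ =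
      expect (Game.finishTag i c2 g) fun y => Φ (y.1, y.2.lift) := by
  have hp : g.lift.pending i = g.pending i := rfl
  unfold Game.finishTag
  rw [hp]
  cases g.pending i with
  | none => simp only [expect_pure]
  | some z =>
    dsimp only
    rw [expect_pure, expect_pure]
    refine congrArg Φ (Prod.ext rfl ?_)
    have h := Game.lift_readerMatches g i z.1 z.2 c2
    unfold Game.lift at h ⊢
    dsimp only
    congr 2
    exact decide_eq_decide.2 (by rw [h])

theorem expect_corrupt_lift (i : Fin S.numTags) (g : Game S m) (Φ) :
    expect (Game.corrupt i g.lift) Φ = expect (Game.corrupt i g) fun y => Φ (y.1, y.2.lift) := by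
  unfold Game.corrupt
  rw [expect_pure, expect_pure]
  rfl

/-- The same instruction in an attack with an additional session, which is addressed by the register
`z`. -/
def Instr.lift (z : ℕ) : Instr (attackInterface S m) → Instr (attackInterface S (m + 1))
  | .gate g => .gate g
  | .flip dst => .flip dst
  | .query .initReader inp out => .query .initReader (extendFin (m := m) inp z) out
  | .query .startTag inp out => .query .startTag inp out
  | .query .sendReader inp out => .query .sendReader
      (Sum.elim (extendFin (fun s : Fin m => inp (.inl s)) z) fun b : Fin S.lenA => inp (.inr b)) out
  | .query .finishTag inp out => .query .finishTag inp out
  | .query .corrupt inp out => .query .corrupt inp out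

end RFID

end

/-! ### An honest session as a guessing stage -/

noncomputable section

namespace RFID

open scoped ENNReal

theorem expect_query_pure {I : Interface} {σ : Type} {O : Oracle I σ} {p : I.Port}
    {inp : I.In p → ℕ} (out : I.Out p ↪ ℕ) {mem : Memory} {s s' : σ} {a : I.Out p → Bool}
    (h : O p (fun i => mem (inp i)) s = pure (a, s')) (Φ : Memory × σ → ℝ≥0∞) :
    expect (Instr.exec O (.query p inp out) (mem, s)) Φ = Φ (Function.extend out a mem, s') := by
  refine (expect_bind _ _ _).trans ?_
  rw [h, expect_pure]
  exact expect_pure _ _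

theorem expect_query_bind {I : Interface} {σ τ : Type} {O : Oracle I σ} {p : I.Port}
    {inp : I.In p → ℕ} (out : I.Out p ↪ ℕ) {mem : Memory} {s : σ} {μ : PMF τ}
    {a : τ → I.Out p → Bool} {b : τ → σ}
    (h : O p (fun i => mem (inp i)) s = (μ >>= fun y => pure (a y, b y)))
    (Φ : Memory × σ → ℝ≥0∞) :
    expect (Instr.exec O (.query p inp out) (mem, s)) Φ =
      expect μ fun y => Φ (Function.extend out (a y) mem, b y) := by
  refine (expect_bind _ _ _).trans ?_
  rw [h, expect_bind]
  congr 1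
  funext y
  rw [expect_pure]
  exact expect_pure _ _

variable {S : RFIDSystem} {m : ℕ}

/-- As the register `z` is `0`, the lifted call addresses an old session or none. -/
theorem select_lift {mem : Memory} {z : ℕ} (hz : mem z = false) (w : Fin m → ℕ) :
    select (fun s => mem (extendFin w z s)) =
      (select fun s : Fin m => mem (w s)).map Fin.castSucc := by
  rw [← select_extendFin]
  congr 1
  funext s
  unfold extendFin
  split_ifs
  · rfl
  · exact hz

theorem expect_query_lift {z : ℕ} {mem : Memory} (hz : mem z = false) (p : AttackPort)
    (inp : (attackInterface S m).In p → ℕ) (out : (attackInterface S m).Out p ↪ ℕ) (g : Game S m)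
    (Φ : Memory × Game S (m + 1) → ℝ≥0∞) :
    expect (Instr.exec (realHandlers S (m + 1)).oracle (Instr.lift z (.query p inp out))
      (mem, g.lift)) Φ =
    expect (Instr.exec (realHandlers S m).oracle (.query p inp out) (mem, g))
      fun y => Φ (y.1, y.2.lift) := by
  cases p
  case initReader =>
    have h := select_lift (m := m) hz inp
    cases hs : select fun s : Fin m => mem (inp s) with
    | none =>
      rw [hs] at h
      have e1 := expect_query_pure (O := (realHandlers S (m + 1)).oracle) (p := .initReader)
        (mem := mem) (s := g.lift)
        (inp := (extendFin (m := m) inp z)) out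
        (Handlers.oracle_initReader_none (realHandlers S (m + 1)) (fun i => mem ((extendFin (m := m) inp z) i)) g.lift h) Φ
      have e2 := expect_query_pure (O := (realHandlers S m).oracle) (p := .initReader)
        (mem := mem) (s := g)
        (inp := inp) out
        (Handlers.oracle_initReader_none (realHandlers S m) (fun i => mem (inp i)) g hs)
        fun y => Φ (y.1, y.2.lift)
      exact e1.trans e2.symm
    | some s =>
      rw [hs] at h
      have e1 := expect_query_bind (O := (realHandlers S (m + 1)).oracle) (p := .initReader)
        (mem := mem) (s := g.lift)
        (inp := (extendFin (m := m) inp z)) out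
        (Handlers.oracle_initReader_some (realHandlers S (m + 1)) (fun i => mem ((extendFin (m := m) inp z) i)) g.lift h) Φ
      have e2 := expect_query_bind (O := (realHandlers S m).oracle) (p := .initReader)
        (mem := mem) (s := g)
        (inp := inp) out
        (Handlers.oracle_initReader_some (realHandlers S m) (fun i => mem (inp i)) g hs)
        fun y => Φ (y.1, y.2.lift)
      exact e1.trans ((expect_initReader_lift s  g fun y => Φ (Function.extend out (fun j : Fin S.lenC1 => y.1.getLsb j) mem, y.2)).trans
        e2.symm)
  case startTag =>
    cases hs : select fun i : Fin S.numTags => mem (inp (.inl i)) with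
    | none =>
      have e1 := expect_query_pure (O := (realHandlers S (m + 1)).oracle) (p := .startTag)
        (mem := mem) (s := g.lift)
        (inp := inp) out
        (Handlers.oracle_startTag_none (realHandlers S (m + 1)) (fun i => mem (inp i)) g.lift hs) Φ
      have e2 := expect_query_pure (O := (realHandlers S m).oracle) (p := .startTag)
        (mem := mem) (s := g)
        (inp := inp) out
        (Handlers.oracle_startTag_none (realHandlers S m) (fun i => mem (inp i)) g hs)
        fun y => Φ (y.1, y.2.lift)
      exact e1.trans e2.symm
    | some s =>
      have e1 := expect_query_bind (O := (realHandlers S (m + 1)).oracle) (p := .startTag)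
        (mem := mem) (s := g.lift)
        (inp := inp) out
        (Handlers.oracle_startTag_some (realHandlers S (m + 1)) (fun i => mem (inp i)) g.lift hs) Φ
      have e2 := expect_query_bind (O := (realHandlers S m).oracle) (p := .startTag)
        (mem := mem) (s := g)
        (inp := inp) out
        (Handlers.oracle_startTag_some (realHandlers S m) (fun i => mem (inp i)) g hs)
        fun y => Φ (y.1, y.2.lift)
      exact e1.trans ((expect_startTag_lift s (ofWires fun j : Fin S.lenC1 => mem (inp (.inr j))) g fun y => Φ (Function.extend out (fun j : Fin S.lenA => y.1.getLsb j) mem, y.2)).trans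
        e2.symm)
  case sendReader =>
    have h := select_lift (m := m) hz fun s => inp (.inl s)
    cases hs : select fun s : Fin m => mem (inp (.inl s)) with
    | none =>
      rw [hs] at h
      have e1 := expect_query_pure (O := (realHandlers S (m + 1)).oracle) (p := .sendReader)
        (mem := mem) (s := g.lift)
        (inp := (Sum.elim (extendFin (fun s : Fin m => inp (.inl s)) z) fun b : Fin S.lenA => inp (.inr b))) out
        (Handlers.oracle_sendReader_none (realHandlers S (m + 1)) (fun i => mem ((Sum.elim (extendFin (fun s : Fin m => inp (.inl s)) z) fun b : Fin S.lenA => inp (.inr b)) i)) g.lift h) Φ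
      have e2 := expect_query_pure (O := (realHandlers S m).oracle) (p := .sendReader)
        (mem := mem) (s := g)
        (inp := inp) out
        (Handlers.oracle_sendReader_none (realHandlers S m) (fun i => mem (inp i)) g hs)
        fun y => Φ (y.1, y.2.lift)
      exact e1.trans e2.symm
    | some s =>
      rw [hs] at h
      have e1 := expect_query_bind (O := (realHandlers S (m + 1)).oracle) (p := .sendReader)
        (mem := mem) (s := g.lift)
        (inp := (Sum.elim (extendFin (fun s : Fin m => inp (.inl s)) z) fun b : Fin S.lenA => inp (.inr b))) out
        (Handlers.oracle_sendReader_some (realHandlers S (m + 1)) (fun i => mem ((Sum.elim (extendFin (fun s : Fin m => inp (.inl s)) z) fun b : Fin S.lenA => inp (.inr b)) i)) g.lift h) Φ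
      have e2 := expect_query_bind (O := (realHandlers S m).oracle) (p := .sendReader)
        (mem := mem) (s := g)
        (inp := inp) out
        (Handlers.oracle_sendReader_some (realHandlers S m) (fun i => mem (inp i)) g hs)
        fun y => Φ (y.1, y.2.lift)
      exact e1.trans ((expect_sendReader_lift s (ofWires fun j : Fin S.lenA => mem (inp (.inr j))) g fun y => Φ (Function.extend out (Sum.elim (fun j : Fin S.lenC2 => y.1.1.getLsb j) fun _ : Unit => y.1.2) mem, y.2)).trans
        e2.symm)
  case finishTag =>
    cases hs : select fun i : Fin S.numTags => mem (inp (.inl i)) with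
    | none =>
      have e1 := expect_query_pure (O := (realHandlers S (m + 1)).oracle) (p := .finishTag)
        (mem := mem) (s := g.lift)
        (inp := inp) out
        (Handlers.oracle_finishTag_none (realHandlers S (m + 1)) (fun i => mem (inp i)) g.lift hs) Φ
      have e2 := expect_query_pure (O := (realHandlers S m).oracle) (p := .finishTag)
        (mem := mem) (s := g)
        (inp := inp) out
        (Handlers.oracle_finishTag_none (realHandlers S m) (fun i => mem (inp i)) g hs)
        fun y => Φ (y.1, y.2.lift)
      exact e1.trans e2.symm
    | some s =>
      have e1 := expect_query_bind (O := (realHandlers S (m + 1)).oracle) (p := .finishTag)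
        (mem := mem) (s := g.lift)
        (inp := inp) out
        (Handlers.oracle_finishTag_some (realHandlers S (m + 1)) (fun i => mem (inp i)) g.lift hs) Φ
      have e2 := expect_query_bind (O := (realHandlers S m).oracle) (p := .finishTag)
        (mem := mem) (s := g)
        (inp := inp) out
        (Handlers.oracle_finishTag_some (realHandlers S m) (fun i => mem (inp i)) g hs)
        fun y => Φ (y.1, y.2.lift)
      exact e1.trans ((expect_finishTag_lift s (ofWires fun j : Fin S.lenC2 => mem (inp (.inr j))) g fun y => Φ (Function.extend out (fun _ : Unit => y.1) mem, y.2)).trans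
        e2.symm)
  case corrupt =>
    cases hs : select fun i : Fin S.numTags => mem (inp i) with
    | none =>
      have e1 := expect_query_pure (O := (realHandlers S (m + 1)).oracle) (p := .corrupt)
        (mem := mem) (s := g.lift)
        (inp := inp) out
        (Handlers.oracle_corrupt_none (realHandlers S (m + 1)) (fun i => mem (inp i)) g.lift hs) Φ
      have e2 := expect_query_pure (O := (realHandlers S m).oracle) (p := .corrupt)
        (mem := mem) (s := g)
        (inp := inp) out
        (Handlers.oracle_corrupt_none (realHandlers S m) (fun i => mem (inp i)) g hs)
        fun y => Φ (y.1, y.2.lift)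
      exact e1.trans e2.symm
    | some s =>
      have e1 := expect_query_bind (O := (realHandlers S (m + 1)).oracle) (p := .corrupt)
        (mem := mem) (s := g.lift)
        (inp := inp) out
        (Handlers.oracle_corrupt_some (realHandlers S (m + 1)) (fun i => mem (inp i)) g.lift hs) Φ
      have e2 := expect_query_bind (O := (realHandlers S m).oracle) (p := .corrupt)
        (mem := mem) (s := g)
        (inp := inp) out
        (Handlers.oracle_corrupt_some (realHandlers S m) (fun i => mem (inp i)) g hs)
        fun y => Φ (y.1, y.2.lift)
      exact e1.trans ((expect_corrupt_lift s  g fun y => Φ (Function.extend out (fun j : Fin S.lenState => y.1.getLsb j) mem, y.2)).trans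
        e2.symm)

/-- An attack that does not write to the register `z` behaves in the same way if there is an
additional session. -/
theorem run_lift {z : ℕ} (A : Attack S m) (hA : ∀ i ∈ A, i.Avoids z) {mem : Memory}
    (hz : mem z = false) (g : Game S m) :
    Coupled (fun x y => x = (y.1, y.2.lift) ∧ y.1 z = false)
      (Circuit.run (realHandlers S (m + 1)).oracle (A.map (Instr.lift z)) (mem, g.lift))
      (Circuit.run (realHandlers S m).oracle A (mem, g)) := by
  induction A generalizing mem g with
  | nil => exact Coupled.pure ⟨rfl, hz⟩
  | cons i A ih =>
    have hi := hA i (by simp)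
    have step : Coupled (fun x y => x = (y.1, y.2.lift) ∧ y.1 z = false)
        (Instr.exec (realHandlers S (m + 1)).oracle (i.lift z) (mem, g.lift))
        (Instr.exec (realHandlers S m).oracle i (mem, g)) := by
      cases i with
      | gate g' =>
        exact Coupled.pure ⟨rfl, (Function.update_of_ne (Ne.symm hi) _ _).trans hz⟩
      | flip d =>
        exact Coupled.bind_same fun b =>
          Coupled.pure ⟨rfl, (Function.update_of_ne (Ne.symm hi) _ _).trans hz⟩
      | query p inp out =>
        have h1 : Coupled (fun x y => x = (y.1, y.2.lift))
            (Instr.exec (realHandlers S (m + 1)).oracle (Instr.lift z (.query p inp out))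
              (mem, g.lift))
            (Instr.exec (realHandlers S m).oracle (.query p inp out) (mem, g)) :=
          Coupled.of_expect (f := fun y => (y.1, y.2.lift))
            (expect_query_lift hz p inp out g) fun _ => rfl
        have h2 : ∀ Φ : Memory × Game S m → ℝ≥0∞,
            expect (Instr.exec (realHandlers S m).oracle (.query p inp out) (mem, g)) Φ =
            expect ((realHandlers S m).oracle p (fun i => mem (inp i)) g)
              fun y => Φ (Function.extend out y.1 mem, y.2) := by
          intro Φ
          refine (expect_bind _ _ _).trans ?_
          congr 1
          funext y
          exact expect_pure _ _
        have h3 : ∀ a, Function.extend out a mem z = false := fun a =>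
          (Function.extend_apply' _ _ _ fun ⟨o, ho⟩ => hi o ho).trans hz
        intro Φ Ψ
        constructor
        · intro H
          rw [expect_query_lift hz p inp out g Φ, h2, h2]
          exact expect_mono _ fun y => H _ _ ⟨rfl, h3 _⟩
        · intro H
          rw [expect_query_lift hz p inp out g Φ, h2, h2]
          exact expect_mono _ fun y => H _ _ ⟨rfl, h3 _⟩
    refine step.bind ?_
    rintro _ ⟨mem', g'⟩ ⟨rfl, hz'⟩
    exact ih (fun j hj => hA j (by simp [hj])) hz' g'

/-- Consecutive registers. -/
def wires (z n : ℕ) : Fin n ↪ ℕ := ⟨fun j => z + j, fun i j h => Fin.ext (by simpa using h)⟩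

/-- Registers for an answer of the reader. -/
def replyWires (z n : ℕ) : Fin n ⊕ Unit ↪ ℕ :=
  ⟨Sum.elim (fun j => z + 1 + j) fun _ => z, by
    rintro (i | i) (j | j) h
    · exact congrArg Sum.inl (Fin.ext (by simpa using h))
    · simp only [Sum.elim_inl, Sum.elim_inr] at h; omega
    · simp only [Sum.elim_inl, Sum.elim_inr] at h; omega
    · rfl⟩

/-- An undisturbed session between the tag named by the registers `0, …, numTags - 1` and the reader
in its last session. The register `z` contains `0`, and register `0` is set if the session fails. -/
def honestCircuit (S : RFIDSystem) (m z : ℕ) : Attack S (m + 1) :=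
  -- Since `z` contains `0`, this sets `z + 1` to `1`. Selectors wired to `z` except for the last,
  -- which is wired to `z + 1`, address the last session.
  [.gate ⟨z + 1, z, z⟩,
    .query .initReader (extendFin (fun _ : Fin m => z) (z + 1)) (wires (z + 3) S.lenC1),
    .query .startTag (Sum.elim (fun i : Fin S.numTags => i.1) (wires (z + 3) S.lenC1))
      (wires (z + 3) S.lenA),
    .query .sendReader (Sum.elim (extendFin (fun _ : Fin m => z) (z + 1)) (wires (z + 3) S.lenA))
      (replyWires (z + 2) S.lenC2),
    .query .finishTag (Sum.elim (fun i : Fin S.numTags => i.1) (wires (z + 3) S.lenC2))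
      ⟨fun _ => 0, fun _ _ _ => rfl⟩,
    -- Register `0` holds the output of the tag and `z + 2` that of the reader; their NAND is the
    -- failure of the session. The selector bit formerly in register `0` is no longer needed.
    .gate ⟨0, 0, z + 2⟩]

theorem select_last {mem : Memory} {z : ℕ} (hz : mem z = false) (hz' : mem (z + 1) = true) :
    select (fun s : Fin (m + 1) => mem (extendFin (fun _ : Fin m => z) (z + 1) s)) =
      some (Fin.last m) := by
  rw [select_eq_some]
  refine ⟨by rw [extendFin_last, hz'], fun j hj => ?_⟩
  have h : j.1 < m := hj
  simp [extendFin, h, hz]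

theorem extend_wires {z n : ℕ} (f : Fin n → Bool) (mem : Memory) (j : Fin n) :
    Function.extend (wires z n) f mem (wires z n j) = f j :=
  (wires z n).injective.extend_apply _ _ _

theorem extend_wires_of_lt {z n r : ℕ} (f : Fin n → Bool) (mem : Memory) (h : r < z) :
    Function.extend (wires z n) f mem r = mem r :=
  Function.extend_apply' _ _ _ fun ⟨j, hj⟩ => by
    change z + j.1 = r at hj
    omega

theorem extend_replyWires_inl {z n : ℕ} (f : Fin n ⊕ Unit → Bool) (mem : Memory) (j : Fin n) :
    Function.extend (replyWires z n) f mem (wires (z + 1) n j) = f (.inl j) :=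
  (replyWires z n).injective.extend_apply f mem (.inl j)

theorem extend_replyWires_inr {z n : ℕ} (f : Fin n ⊕ Unit → Bool) (mem : Memory) :
    Function.extend (replyWires z n) f mem z = f (.inr ()) :=
  (replyWires z n).injective.extend_apply f mem (.inr ())

theorem extend_replyWires_of_lt {z n r : ℕ} (f : Fin n ⊕ Unit → Bool) (mem : Memory) (h : r < z) :
    Function.extend (replyWires z n) f mem r = mem r :=
  Function.extend_apply' _ _ _ fun ⟨j, hj⟩ => by
    rcases j with j | j
    · change z + 1 + j.1 = r at hj
      omega
    · change z = r at hj
      omega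

theorem expect_run_cons {I : Interface} {σ : Type} {O : Oracle I σ} (i : Instr I) (C : Circuit I)
    (x : Memory × σ) (Φ : Memory × σ → ℝ≥0∞) :
    expect (Circuit.run O (i :: C) x) Φ =
      expect (Instr.exec O i x) fun y => expect (Circuit.run O C y) Φ :=
  expect_bind _ _ _

/-- The honest session under arbitrary handlers. -/
theorem expect_honestCircuit (H : Handlers S (m + 1)) {z : ℕ} (hz : S.numTags ≤ z) {mem : Memory}
    (hmem : mem z = false) {c : Fin S.numTags} (hc : select (fun i : Fin S.numTags => mem i) = some c)
    (g : Game S (m + 1)) :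
    expect (Circuit.run H.oracle (honestCircuit S m z) (mem, g)) (fun y => ind (y.1 0)) =
      expect (H.initReader (Fin.last m) g) fun u =>
      expect (H.startTag c u.1 u.2) fun v =>
      expect (H.sendReader (Fin.last m) v.1 v.2) fun w =>
      expect (H.finishTag c w.1.1 w.2) fun x => ind (!(x.1 && w.1.2)) := by
  refine (expect_run_cons _ _ _ _).trans ((expect_pure _ _).trans ?_)
  have a1 : ∀ r < z + 1, Gate.eval ⟨z + 1, z, z⟩ mem r = mem r := fun r hr =>
    Function.update_of_ne (by simp only; omega) _ _
  have a2 : Gate.eval ⟨z + 1, z, z⟩ mem (z + 1) = true :=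
    (Function.update_self _ _ _).trans (by simp [hmem])
  -- Here and after each call the memory is generalized, keeping only the facts that later calls
  -- rely on.
  suffices H1 : ∀ mem₁ : Memory, (∀ r < z + 1, mem₁ r = mem r) →
      mem₁ (z + 1) = true →
      expect (Circuit.run H.oracle ((honestCircuit S m z).drop 1) (mem₁, g)) (fun y => ind (y.1 0)) =
      expect (H.initReader (Fin.last m) g) fun u =>
      expect (H.startTag c u.1 u.2) fun v =>
      expect (H.sendReader (Fin.last m) v.1 v.2) fun w =>
      expect (H.finishTag c w.1.1 w.2) fun x => ind (!(x.1 && w.1.2)) from H1 _ a1 a2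
  clear a1 a2
  intro mem₁ a1 a2
  have b1 := select_last (m := m) ((a1 z (by omega)).trans hmem) a2
  have sel : ∀ mem' : Memory, (∀ r < z + 1, mem' r = mem r) →
      select (fun i : Fin S.numTags => mem' i) = some c := fun mem' h => by
    rw [← hc]
    congr 1
    funext i
    exact h _ (by omega)
  refine (expect_run_cons _ _ _ _).trans ?_
  refine (expect_query_bind (I := attackInterface S (m + 1)) (O := H.oracle)
    (p := AttackPort.initReader) (mem := mem₁) (s := g)
    (inp := extendFin (fun _ : Fin m => z) (z + 1)) (wires (z + 3) S.lenC1)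
    (Handlers.oracle_initReader_some H _ g b1) _).trans ?_
  congr 1
  funext u
  have c1 : ∀ r < z + 2, Function.extend (wires (z + 3) S.lenC1) (fun j => u.1.getLsb j) mem₁ r =
      mem₁ r := fun r hr => extend_wires_of_lt _ _ (by omega)
  have c2 : (ofWires fun j => Function.extend (wires (z + 3) S.lenC1) (fun j => u.1.getLsb j) mem₁
      (wires (z + 3) S.lenC1 j)) = u.1 :=
    (congrArg ofWires (funext fun j => extend_wires _ _ j)).trans (ofWires_getLsb _)
  suffices H2 : ∀ mem₂ : Memory, (∀ r < z + 2, mem₂ r = mem₁ r) →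
      (ofWires fun j => mem₂ (wires (z + 3) S.lenC1 j)) = u.1 →
      expect (Circuit.run H.oracle ((honestCircuit S m z).drop 2) (mem₂, u.2)) (fun y => ind (y.1 0)) =
      expect (H.startTag c u.1 u.2) fun v =>
      expect (H.sendReader (Fin.last m) v.1 v.2) fun w =>
      expect (H.finishTag c w.1.1 w.2) fun x => ind (!(x.1 && w.1.2)) from H2 _ c1 c2
  clear c1 c2
  intro mem₂ c1 c2
  refine (expect_run_cons _ _ _ _).trans ?_
  refine (expect_query_bind (I := attackInterface S (m + 1)) (O := H.oracle)
    (p := AttackPort.startTag) (mem := mem₂) (s := u.2)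
    (inp := Sum.elim (fun i : Fin S.numTags => i.1) (wires (z + 3) S.lenC1))
    (wires (z + 3) S.lenA) (Handlers.oracle_startTag_some H _ u.2
      (sel mem₂ fun r hr => (c1 r (by omega)).trans (a1 r hr))) _).trans ?_
  change expect (H.startTag c (ofWires fun j => mem₂ (wires (z + 3) S.lenC1 j)) u.2) _ = _
  rw [c2]
  congr 1
  funext v
  have d1 : ∀ r < z + 2, Function.extend (wires (z + 3) S.lenA) (fun j => v.1.getLsb j) mem₂ r =
      mem₁ r := fun r hr => (extend_wires_of_lt _ _ (by omega)).trans (c1 r hr)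
  have d2 : (ofWires fun j => Function.extend (wires (z + 3) S.lenA) (fun j => v.1.getLsb j) mem₂
      (wires (z + 3) S.lenA j)) = v.1 :=
    (congrArg ofWires (funext fun j => extend_wires _ _ j)).trans (ofWires_getLsb _)
  suffices H3 : ∀ mem₃ : Memory, (∀ r < z + 2, mem₃ r = mem₁ r) →
      (ofWires fun j => mem₃ (wires (z + 3) S.lenA j)) = v.1 →
      expect (Circuit.run H.oracle ((honestCircuit S m z).drop 3) (mem₃, v.2)) (fun y => ind (y.1 0)) =
      expect (H.sendReader (Fin.last m) v.1 v.2) fun w =>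
      expect (H.finishTag c w.1.1 w.2) fun x => ind (!(x.1 && w.1.2)) from H3 _ d1 d2
  clear d1 d2
  intro mem₃ d1 d2
  refine (expect_run_cons _ _ _ _).trans ?_
  refine (expect_query_bind (I := attackInterface S (m + 1)) (O := H.oracle)
    (p := AttackPort.sendReader) (mem := mem₃) (s := v.2)
    (inp := Sum.elim (extendFin (fun _ : Fin m => z) (z + 1)) (wires (z + 3) S.lenA))
    (replyWires (z + 2) S.lenC2) (Handlers.oracle_sendReader_some H _ v.2
      (select_last (m := m) (((d1 z (by omega)).trans (a1 z (by omega))).trans hmem)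
        ((d1 (z + 1) (by omega)).trans a2))) _).trans ?_
  change expect (H.sendReader (Fin.last m)
    (ofWires fun j => mem₃ (wires (z + 3) S.lenA j)) v.2) _ = _
  rw [d2]
  congr 1
  funext w
  have e1 : ∀ r < z + 2, Function.extend (replyWires (z + 2) S.lenC2)
      (Sum.elim (fun j => w.1.1.getLsb j) fun _ => w.1.2) mem₃ r = mem₁ r :=
    fun r hr => (extend_replyWires_of_lt _ _ hr).trans (d1 r hr)
  have e2 : (ofWires fun j => Function.extend (replyWires (z + 2) S.lenC2)
      (Sum.elim (fun j => w.1.1.getLsb j) fun _ => w.1.2) mem₃ (wires (z + 3) S.lenC2 j)) = w.1.1 :=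
    (congrArg ofWires (funext fun j => extend_replyWires_inl _ _ j)).trans (ofWires_getLsb _)
  have e3 := extend_replyWires_inr (z := z + 2) (n := S.lenC2)
    (Sum.elim (fun j => w.1.1.getLsb j) fun _ => w.1.2) mem₃
  suffices H4 : ∀ mem₄ : Memory, (∀ r < z + 2, mem₄ r = mem₁ r) →
      (ofWires fun j => mem₄ (wires (z + 3) S.lenC2 j)) = w.1.1 →  mem₄ (z + 2) = w.1.2 →
     
      expect (Circuit.run H.oracle ((honestCircuit S m z).drop 4) (mem₄, w.2)) (fun y => ind (y.1 0)) =
      expect (H.finishTag c w.1.1 w.2) fun x => ind (!(x.1 && w.1.2)) from H4 _ e1 e2 e3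
  clear e1 e2 e3
  intro mem₄ e1 e2 e3
  refine (expect_run_cons _ _ _ _).trans ?_
  refine (expect_query_bind (I := attackInterface S (m + 1)) (O := H.oracle)
    (p := AttackPort.finishTag) (mem := mem₄) (s := w.2)
    (inp := Sum.elim (fun i : Fin S.numTags => i.1) (wires (z + 3) S.lenC2))
    ⟨fun _ => 0, fun _ _ _ => rfl⟩ (Handlers.oracle_finishTag_some H _ w.2
      (sel mem₄ fun r hr => (e1 r (by omega)).trans (a1 r hr))) _).trans ?_
  change expect (H.finishTag c (ofWires fun j => mem₄ (wires (z + 3) S.lenC2 j)) w.2) _ = _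
  rw [e2]
  congr 1
  funext x
  refine (expect_run_cons _ _ _ _).trans ?_
  refine (expect_pure _ _).trans ((expect_pure _ _).trans (congrArg ind ?_))
  have key : ∀ mem' : Memory, Gate.eval ⟨0, 0, z + 2⟩ mem' 0 = !(mem' 0 && mem' (z + 2)) :=
    fun mem' => Function.update_self _ _ _
  refine (key _).trans ?_
  congr 2
  · exact Function.Injective.extend_apply (f := fun _ : Unit => 0) (fun _ _ _ => rfl) _ _ ()
  · exact (Function.extend_apply' _ _ _ (by rintro ⟨_, h⟩; cases h)).trans e3

end RFID

end

/-! ### The honest session in the real and in the random world -/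

noncomputable section

namespace RFID

open scoped ENNReal

variable {S : RFIDSystem} {m : ℕ}

theorem Game.initReader_of_idle {s : Fin m} {g : Game S m} (h : g.reader s = .idle) :
    Game.initReader s g = (S.readerStart >>= fun c1 =>
      pure (c1, { g with reader := Function.update g.reader s (.waiting c1) })) := by
  unfold Game.initReader
  rw [h]

theorem Game.lift_reader_last (g : Game S m) : g.lift.reader (Fin.last m) = .idle :=
  extendFin_last _ _

/-- The additional session is unused, so the four calls carry out an undisturbed session, with
failure as the output. -/
theorem expect_honest_real (c : Fin S.numTags) (g : Game S m) :
    (expect ((realChallenge S (m + 1) c).initReader (Fin.last m) g.lift) fun u =>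
      expect ((realChallenge S (m + 1) c).startTag c u.1 u.2) fun v =>
      expect ((realChallenge S (m + 1) c).sendReader (Fin.last m) v.1 v.2) fun w =>
      expect ((realChallenge S (m + 1) c).finishTag c w.1.1 w.2) fun x => ind (!(x.1 && w.1.2))) =
    expect (g.honestRun c) fun ok => ind (!ok) := by
  change (expect (Game.initReader (Fin.last m) g.lift) fun u =>
      expect (Game.startTag c u.1 u.2) fun v =>
      expect (Game.sendReader (Fin.last m) v.1 v.2) fun w =>
      expect (Game.finishTag c w.1.1 w.2) fun x => ind (!(x.1 && w.1.2))) = _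
  unfold Game.honestRun
  rw [Game.initReader_of_idle g.lift_reader_last, expect_bind, expect_bind]
  congr 1
  funext c1
  rw [expect_pure]
  unfold Game.startTag
  rw [expect_bind, expect_bind]
  refine congrArg (expect (S.tagRespond (g.tag c) c1)) (funext fun y => ?_)
  rw [expect_pure]
  have hr : (Function.update g.lift.reader (Fin.last m) (.waiting c1)) (Fin.last m) = .waiting c1 :=
    Function.update_self _ _ _
  unfold Game.sendReader
  dsimp only [Game.beginTag]
  rw [hr]
  dsimp only
  rw [expect_bind, expect_bind]
  refine congrArg (expect (S.readerRespond g.db c1 y.1)) (funext fun w => ?_)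
  obtain ⟨db, res⟩ := w
  cases res with
  | none =>
    dsimp only
    rw [expect_pure, expect_pure]
    -- If the reader rejects, the tag is still given the answer `0`, but the output is failure
    -- whatever it replies.
    simp only [Bool.and_false]
    exact expect_const _ _
  | some w =>
    dsimp only
    rw [expect_pure, expect_pure]
    unfold Game.finishTag
    dsimp only
    rw [Function.update_self]
    dsimp only
    rw [expect_pure, Function.update_self, Bool.and_true]

-- In the random world an undisturbed session cannot fail: the transcript has just entered the log
-- of the tag, so the reader accepts, and then its session matches, so the tag accepts.
open Classical in
theorem expect_honest_random (c : Fin S.numTags) (g : Game S m) :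
    (expect ((randomChallenge S (m + 1) c).initReader (Fin.last m) (g.lift.forget c)) fun u =>
      expect ((randomChallenge S (m + 1) c).startTag c u.1 u.2) fun v =>
      expect ((randomChallenge S (m + 1) c).sendReader (Fin.last m) v.1 v.2) fun w =>
      expect ((randomChallenge S (m + 1) c).finishTag c w.1.1 w.2) fun x =>
        ind (!(x.1 && w.1.2))) = 0 := by
  have hi : (g.lift.forget c).reader (Fin.last m) = .idle := g.lift_reader_last
  change (expect (Game.initReader (Fin.last m) (g.lift.forget c)) fun u => _) = _
  rw [Game.initReader_of_idle hi, expect_bind]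
  refine (expect_congr _ fun c1 _ => ?_).trans (expect_const _ 0)
  rw [expect_pure]
  simp only [randomChallenge, if_true]
  rw [expect_bind]
  refine (expect_congr _ fun α _ => ?_).trans (expect_const _ 0)
  rw [expect_pure]
  have hr : (Function.update (g.lift.forget c).reader (Fin.last m) (.waiting c1)) (Fin.last m) =
    .waiting c1 := Function.update_self _ _ _
  dsimp only [Game.beginTag]
  rw [hr]
  dsimp only
  have hmem : (c1, α) ∈ Function.update (g.lift.forget c).tagLog c
      ((c1, α) :: (g.lift.forget c).tagLog c) c := by
    rw [Function.update_self]
    exact List.mem_cons_self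
  refine (congrArg (fun μ => expect μ _) (if_pos hmem)).trans ?_
  rw [expect_bind]
  refine (expect_congr _ fun c2 _ => ?_).trans (expect_const _ 0)
  rw [expect_pure]
  dsimp only
  rw [Function.update_self]
  dsimp only
  exact (expect_pure _ _).trans (congrArg (fun b => ind (!(b && true)))
    (decide_eq_true ⟨Fin.last m, Function.update_self _ _ _⟩))

theorem expect_init_lift (Φ : Game S (m + 1) → ℝ≥0∞) :
    expect (Game.init S (m + 1)) Φ = expect (Game.init S m) fun g => Φ g.lift := by
  unfold Game.init
  rw [expect_bind, expect_bind]
  congr 1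
  funext x
  rw [expect_pure, expect_pure]
  refine congrArg (fun r => Φ (Game.mk _ _ _ _ _ r _ _)) (funext fun s => ?_)
  refine Fin.lastCases ?_ (fun s => ?_) s
  · exact (extendFin_last _ _).symm
  · exact (extendFin_castSucc (fun _ : Fin m => ReaderSession.idle) _ s).symm

/-- The output of the honest session after an attack. -/
theorem expect_honestCircuit_real {z : ℕ} (hz : S.numTags ≤ z) {mem : Memory}
    (hmem : mem z = false) {c : Fin S.numTags} (hc : chosenTag S mem = some c) (g : Game S m) :
    expect (Circuit.run (realChallenge S (m + 1) c).oracle (honestCircuit S m z) (mem, g.lift))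
      (fun y => ind (y.1 0)) = expect (g.honestRun c) fun ok => ind (!ok) :=
  (expect_honestCircuit _ hz hmem hc _).trans (expect_honest_real c g)

theorem expect_honestCircuit_random {z : ℕ} (hz : S.numTags ≤ z) {mem : Memory}
    (hmem : mem z = false) {c : Fin S.numTags} (hc : chosenTag S mem = some c) (g : Game S m) :
    expect (Circuit.run (randomChallenge S (m + 1) c).oracle (honestCircuit S m z)
      (mem, g.lift.forget c)) (fun y => ind (y.1 0)) = 0 :=
  (expect_honestCircuit _ hz hmem hc _).trans (expect_honest_random c g)

/-- For `b = 1` the guess is the failure of an honest session with the named uncorrupted tag, which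
is the event of the completeness experiment; for `b = 0` this failure is impossible. -/
theorem expect_unpExp_lift {z : ℕ} (hz : S.numTags ≤ z) (A : Attack S m)
    (hA : ∀ i ∈ A, i.Avoids z) (b : Bool) :
    expect (unpExp S (m + 1) (A.map (Instr.lift z)) (honestCircuit S m z) b) ind =
      if b then expect (completenessExp S m A) ind else 0 := by
  have key : ∀ g₀ : Game S m,
      expect (Circuit.run (realHandlers S (m + 1)).oracle (A.map (Instr.lift z)) (blank, g₀.lift))
        (fun x => expect (match chosenTag S x.1 with
          | none => pure false
          | some c =>
              if x.2.corrupted c then pure false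
              else do
                let (mem', _) ← if b
                  then (honestCircuit S m z).run (realChallenge S (m + 1) c).oracle (x.1, x.2)
                  else (honestCircuit S m z).run
                          (randomChallenge S (m + 1) c).oracle (x.1, x.2.forget c)
                pure (mem' 0)) ind) =
      expect (Circuit.run (realHandlers S m).oracle A (blank, g₀))
        (fun x => if b then expect (match chosenTag S x.1 with
          | none => pure false
          | some i => do
              let ok ← x.2.honestRun i
              pure (!x.2.corrupted i && !ok)) ind else 0) := by
    intro g₀
    refine (run_lift A hA rfl g₀).expect_eq ?_
    rintro _ ⟨mem, g⟩ ⟨rfl, hm⟩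
    dsimp only
    cases hc : chosenTag S mem with
    | none =>
      cases b <;> simp only [expect_pure, ind_false, ite_self]
    | some c =>
      dsimp only
      have hcor : g.lift.corrupted c = g.corrupted c := rfl
      rw [hcor]
      cases hg : g.corrupted c with
      | true =>
        simp only [if_true, expect_pure, ind_false, Bool.not_true, Bool.false_and, expect_bind]
        cases b <;> simp [expect_const]
      | false =>
        cases b with
        | true =>
          simp only [if_true, Bool.false_eq_true, if_false, expect_bind, expect_pure, Bool.not_false,
            Bool.true_and]
          exact expect_honestCircuit_real hz hm hc g
        | false =>
          simp only [Bool.false_eq_true, if_false, expect_bind, expect_pure]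
          exact expect_honestCircuit_random hz hm hc g
  unfold unpExp
  rw [expect_bind, expect_init_lift]
  cases b with
  | true =>
    unfold completenessExp
    rw [if_pos rfl, expect_bind]
    congr 1
    funext g₀
    rw [expect_bind, expect_bind]
    exact key g₀
  | false =>
    simp only [Bool.false_eq_true, if_false]
    refine (expect_congr _ fun g₀ _ => ?_).trans (expect_const _ 0)
    rw [expect_bind]
    exact (key g₀).trans (expect_const _ 0)

end RFID

end

/-! ### Sizes of the circuits in the reduction to privacy -/

noncomputable section

namespace RFID

open scoped ENNReal

section

variable {S : RFIDSystem} {m : ℕ}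

theorem cost_initReader (inp : (attackInterface S m).In .initReader → ℕ)
    (out : (attackInterface S m).Out .initReader ↪ ℕ) :
    Instr.cost (.query (I := attackInterface S m) .initReader inp out) = 1 + m + S.lenC1 :=
  congrArg₂ (fun a b => 1 + a + b) (Fintype.card_fin m) (Fintype.card_fin S.lenC1)

theorem card_fin_sum (a b : ℕ) : Fintype.card (Fin a ⊕ Fin b) = a + b := by simp

theorem cost_startTag (inp : (attackInterface S m).In .startTag → ℕ)
    (out : (attackInterface S m).Out .startTag ↪ ℕ) :
    Instr.cost (.query (I := attackInterface S m) .startTag inp out) =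
      1 + (S.numTags + S.lenC1) + S.lenA :=
  congrArg₂ (fun a b => 1 + a + b) (card_fin_sum S.numTags S.lenC1) (Fintype.card_fin S.lenA)

theorem cost_sendReader (inp : (attackInterface S m).In .sendReader → ℕ)
    (out : (attackInterface S m).Out .sendReader ↪ ℕ) :
    Instr.cost (.query (I := attackInterface S m) .sendReader inp out) =
      1 + (m + S.lenA) + (S.lenC2 + 1) :=
  congrArg₂ (fun a b => 1 + a + b) (card_fin_sum m S.lenA)
    ((Fintype.card_sum (α := Fin S.lenC2) (β := Unit)).trans (by simp))

theorem cost_finishTag (inp : (attackInterface S m).In .finishTag → ℕ)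
    (out : (attackInterface S m).Out .finishTag ↪ ℕ) :
    Instr.cost (.query (I := attackInterface S m) .finishTag inp out) =
      1 + (S.numTags + S.lenC2) + 1 :=
  congrArg₂ (fun a b => 1 + a + b) (card_fin_sum S.numTags S.lenC2) Fintype.card_unit

/-- A lifted call sends at most one bit more, and every instruction costs at least `1`. -/
theorem cost_lift_le (z : ℕ) (i : Instr (attackInterface S m)) : (i.lift z).cost ≤ 2 * i.cost := by
  cases i with
  | gate g => exact (by norm_num : (1 : ℕ) ≤ 2 * 1)
  | flip d => exact (by norm_num : (1 : ℕ) ≤ 2 * 1)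
  | query p inp out =>
    cases p
    case initReader =>
      refine (cost_initReader (m := m + 1) (extendFin (m := m) inp z) out).le.trans ?_
      rw [cost_initReader]
      omega
    case sendReader =>
      refine (cost_sendReader (m := m + 1) (Sum.elim (extendFin (fun s : Fin m => inp (.inl s)) z)
        fun b : Fin S.lenA => inp (.inr b)) out).le.trans ?_
      rw [cost_sendReader]
      omega
    all_goals exact Nat.le_mul_of_pos_left _ two_pos

theorem size_map_lift_le (z : ℕ) (A : Attack S m) :
    Circuit.size (A.map (Instr.lift z)) ≤ 2 * Circuit.size A := by
  induction A with
  | nil => exact le_rfl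
  | cons i A ih =>
    change (i.lift z).cost + Circuit.size (A.map (Instr.lift z)) ≤ 2 * (i.cost + Circuit.size A)
    have := cost_lift_le z i
    omega

theorem size_honestCircuit (S : RFIDSystem) (m z : ℕ) : (honestCircuit S m z).size =
    1 + ((1 + (m + 1) + S.lenC1) + ((1 + (S.numTags + S.lenC1) + S.lenA) +
      ((1 + (m + 1 + S.lenA) + (S.lenC2 + 1)) + ((1 + (S.numTags + S.lenC2) + 1) + (1 + 0))))) := by
  rw [← cost_finishTag (m := m + 1)
      (Sum.elim (fun i : Fin S.numTags => i.1) (wires (z + 3) S.lenC2)) ⟨fun _ => 0, fun _ _ _ => rfl⟩,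
    ← cost_sendReader (Sum.elim (extendFin (fun _ : Fin m => z) (z + 1)) (wires (z + 3) S.lenA))
      (replyWires (z + 2) S.lenC2),
    ← cost_startTag (m := m + 1) (Sum.elim (fun i : Fin S.numTags => i.1) (wires (z + 3) S.lenC1))
      (wires (z + 3) S.lenA),
    ← cost_initReader (extendFin (fun _ : Fin m => z) (z + 1)) (wires (z + 3) S.lenC1)]
  rfl

end

/-- The probability that an attack violates completeness is the advantage of an attack on privacy
whose guessing stage is an honest session. -/
theorem exists_unpExp (S : RFIDSystem) (m : ℕ) (A : Attack S m) :
    ∃ A₁ A₂ : Attack S (m + 1), A₁.size ≤ 2 * A.size ∧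
      (∃ z, A₂ = honestCircuit S m z) ∧
      (completenessExp S m A true).toReal =
        |(unpExp S (m + 1) A₁ A₂ true true).toReal - (unpExp S (m + 1) A₁ A₂ false true).toReal| := by
  obtain ⟨z, hz, hA⟩ := exists_avoids A S.numTags
  refine ⟨_, _, size_map_lift_le z A, ⟨z, rfl⟩, ?_⟩
  rw [apply_true, apply_true, apply_true, expect_unpExp_lift hz A hA, expect_unpExp_lift hz A hA,
    if_pos rfl, if_neg Bool.false_ne_true, ENNReal.toReal_zero, sub_zero,
    abs_of_nonneg ENNReal.toReal_nonneg]

end RFID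

end

theorem mainTheorem2
    (l lk ld lp lv lr lu : ℕ → ℕ)
    (hl : RFID.PolyBounded l) (hlk : RFID.PolyBounded lk) (hld : RFID.PolyBounded ld)
    (hp : ∀ κ, lr κ + lp κ = ld κ) (hm : ∀ κ, lu κ + lr κ + lv κ = ld κ)
    (hlr : RFID.Negligible (fun κ => (1 / 2 : ℝ) ^ lr κ))
    (hlu : RFID.Negligible (fun κ => (1 / 2 : ℝ) ^ lu κ))
    (hlv : RFID.Negligible (fun κ => (1 / 2 : ℝ) ^ lv κ))
    (pad : ∀ κ, BitVec (lp κ))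
    (F : ∀ κ, BitVec (lk κ) → BitVec (ld κ) → BitVec (lr κ))
    (hF : RFID.IsPRF lk ld lr F) :
    RFID.AdaptivelyComplete (RFID.MAFamily l lk ld lp lv lr lu hp hm pad F) ∧
    RFID.MutuallyAuthenticating (RFID.MAFamily l lk ld lp lv lr lu hp hm pad F) ∧
    RFID.UnpSharpPrivate (RFID.MAFamily l lk ld lp lv lr lu hp hm pad F) := by
  let D (m : ℕ → ℕ) (κ : ℕ) : RFID.Dims :=
    ⟨l κ, lk κ, ld κ, lp κ, lv κ, lr κ, lu κ, m κ, hp κ, hm κ, pad κ⟩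
  have unp : RFID.UnpSharpPrivate (RFID.MAFamily l lk ld lp lv lr lu hp hm pad F) :=
    fun m A₁ A₂ h h₁ h₂ =>
      RFID.negligible_unp (D := D m) (F := F) hF hl hlk hld h hlr hlu hlv A₁ A₂ h₁ h₂
  refine ⟨fun m A h hA => ?_, fun m A h hA =>
    RFID.negligible_auth (D := D m) (F := F) hF hl hlk hld h hlr hlu hlv A hA, unp⟩
  choose A₁ A₂ hA₁ hA₂ heq using fun κ =>
    RFID.exists_unpExp (RFID.MAFamily l lk ld lp lv lr lu hp hm pad F κ) (m κ) (A κ)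
  simp only [heq]
  -- The privacy attack has one more session than the given attack. Its guessing stage has linear
  -- size in `m`, `l` and the message lengths, which are bounded by `ld`; the factor `12` suffices.
  refine unp (fun κ => m κ + 1) A₁ A₂ (h.add (.const 1)) (((RFID.PolyBounded.const 2).mul hA).mono hA₁)
    (((RFID.PolyBounded.const 12).mul (((h.add hl).add hld).add (.const 1))).mono fun κ => ?_)
  obtain ⟨z, hz⟩ := hA₂ κ
  rw [hz, RFID.size_honestCircuit]
  have h1 := hp κ
  have h2 := hm κ
  change 1 + ((1 + (m κ + 1) + lu κ) + ((1 + (l κ + lu κ) + (lr κ + lv κ + lr κ)) +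
    ((1 + (m κ + 1 + (lr κ + lv κ + lr κ)) + (lr κ + 1)) + ((1 + (l κ + lr κ) + 1) + (1 + 0))))) ≤
      12 * (m κ + l κ + ld κ + 1)
  omega
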